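/- Let $\mathbf k$ be a field of characteristic zero. Let $\mathcal A,\mathcal B$ be cohomologically unital $\mathbb Z$-graded $A_\infty$-categories over $\mathbf k$ (reduced degrees $\|a\|=|a|-1$), equipped with pure nc-vector fields: Hochschild cocycles $b_{\mathcal A}\in CC^1(\mathcal A,\mathcal A)$, $b_{\mathcal B}\in CC^1(\mathcal B,\mathcal B)$, together with equivariant structures $c_X\in \mathrm{hom}^0(X,X)$, $\mu^1(c_X)=-b^0_X$, on all objects, such that the chain map $a\mapsto b^1(a)-c_Y\cdot a+a\cdot c_X$ on each $\mathrm{hom}(X,Y)$ acts on cohomology in degree $i$ as multiplication by $i$. (If $b^0=0$ and $c=0$: $b^1$ induces the Euler vector field on cohomology.) Here $y\cdot x=(-1)^{|x|}\mu^2(y,x)$. *Pure bimodules.* For a (cohomologically unital) $(\mathcal A,\mathcal B)$-bimodule $P$, with spaces $P(Y,X)$ for $X\in\mathcal A$, $Y\in\mathcal B$, let $\nu_{\mathcal A}(b_{\mathcal A})$, $\nu_{\mathcal B}(b_{\mathcal B})$ be the pre-endomorphisms of $P$ obtained by letting $b_{\mathcal A}$ (respectively $b_{\mathcal B}$) eat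 consecutive, possibly no, $\mathcal A$-inputs (respectively $\mathcal B$-inputs) and then applying $\mu_P$, the first with sign $-1$. A pure equivariant structure on $P$ is a pre-endomorphism $c_P$ of degree $0$ with $d c_P=\nu_{\mathcal A}(b_{\mathcal A})-\nu_{\mathcal B}(b_{\mathcal B})$, where $d c=\mu_P\circ c-c\circ(\mu_{\mathcal A},\mu_P,\mu_{\mathcal B})$, such that the chain map $\phi\mapsto c_P^{0|1|0}(\phi)-c_X\cdot\phi+\phi\cdot c_Y$ on each $P(Y,X)$ acts on cohomology in degree $i$ as multiplication by $i$ (with $c_X\cdot\phi=-(-1)^{|\phi|}\mu_P^{1|1|0}(c_X,\phi)$ and $\phi\cdot c_Y=\mu_P^{0|1|1}(\phi,c_Y)$). $P$ is pure if it carries one. *Functors.* Let $F:\mathcal A\to\mathcal B$ be a cohomologically unital $A_\infty$-functor. Let $\Delta^{\mathcal B}$ be the diagonal bimodule of $\mathcal B$, with structure maps $\mu^{r|1|s}(x_r,\dots,x_1,m,y_1,\dots,y_s)=(-1)^{1+\sum_j\|y_j\|}\mu_{\mathcal B}^{r+1+s}(x_r,\dots,m,\dots,y_s)$. Let $_F\Delta^{\mathcal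 B}$, $\Delta^{\mathcal B}_F$ and $_F\Delta^{\mathcal B}_F$ be its left, right and two-sided pullbacks under $F$: an $(\mathcal A,\mathcal B)$-, a $(\mathcal B,\mathcal A)$- and an $(\mathcal A,\mathcal A)$-bimodule. $F$ is pure if $_F\Delta^{\mathcal B}$ or $\Delta^{\mathcal B}_F$ is pure. *Formality.* An equivalence induced by the pure structure of $\mathcal A$ is a pair of $A_\infty$-functors $\psi_{\mathcal A}:H\mathcal A\to\mathcal A$ and $\psi_{\mathcal A}^{-1}:\mathcal A\to H\mathcal A$, both the identity on objects, such that $\psi_{\mathcal A}$ induces the identity on cohomology, $\psi_{\mathcal A}^{-1}\circ\psi_{\mathcal A}$ is equivalent to the identity functor, and the pullback of $b_{\mathcal A}$ agrees with the Euler vector field $e$ of $H\mathcal A$ (i.e. $\psi_{\mathcal A}\circ e$ and $b_{\mathcal A}\circ\psi_{\mathcal A}$ are cohomologous in $CC^1(H\mathcal A,\mathcal A)$); similarly for $\mathcal B$. Functors are called equivalent if they are isomorphic in the degree zero cohomology of the $A_\infty$-category of functors. $F$ is formal if, for such equivalences, $HF$ is equivalent to the composition $$H\mathcal A\xrightarrow{\psi_{\mathcal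 A}}\mathcal A\xrightarrow{F}\mathcal B\xrightarrow{\psi_{\mathcal B}^{-1}}H\mathcal B .$$ Then: 1. $F$ is pure if and only if it is formal. Here "formal" may be read with some choice of $\psi_{\mathcal A}^{\pm1},\psi_{\mathcal B}^{\pm1}$ (the existence of such a choice being part of formality), and also with any given choice: for all such equivalences, $F$ is pure if and only if $HF$ is equivalent to $\psi_{\mathcal B}^{-1}\circ F\circ\psi_{\mathcal A}$. 2. If $_F\Delta^{\mathcal B}$ is pure, then so are $\Delta^{\mathcal B}_F$ and $_F\Delta^{\mathcal B}_F$. If $\Delta^{\mathcal B}_F$ is pure, then so are $_F\Delta^{\mathcal B}$ and $_F\Delta^{\mathcal B}_F$. -/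

import Mathlib

universe u v w v' w' v'' w'' x x' z z'

namespace AInf

/-! ### Graded quivers, composable strings and multilinear cochains -/

/-- A set of objects with a `ℤ`-graded `k`-vector space of morphisms between any two of them. -/
structure GrQuiver (k : Type u) [Field k] where
  Ob : Type v
  Hom : Ob → Ob → ℤ → Type w
  [addCommGroup : ∀ X Y n, AddCommGroup (Hom X Y n)]
  [module : ∀ X Y n, Module k (Hom X Y n)]

attribute [instance] GrQuiver.addCommGroup GrQuiver.module

section Basic

variable {k : Type u} [Field k]

/-- The arrows `X ⟶ Y` are the homogeneous morphisms, paired with their degree; a path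
`X₀ ⟶ X₁ ⟶ ⋯ ⟶ X_r` is a composable string `(x_r, …, x_1)` of homogeneous morphisms, the
first arrow being `x_1`. -/
instance (A : GrQuiver.{u, v, w} k) : Quiver A.Ob := ⟨fun X Y => Σ n : ℤ, A.Hom X Y n⟩

variable {A : GrQuiver.{u, v, w} k} {B : GrQuiver.{u, v', w'} k} {C : GrQuiver.{u, v'', w''} k}

/-- The string consisting of one morphism. -/
abbrev str₁ {X Y : A.Ob} {n : ℤ} (a : A.Hom X Y n) : Quiver.Path X Y :=
  (Quiver.Path.nil : Quiver.Path X X).cons (⟨n, a⟩ : X ⟶ Y)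

/-- The string `(b, a)`, in which `a` is applied first. -/
abbrev str₂ {X Y Z : A.Ob} {n m : ℤ} (b : A.Hom Y Z m) (a : A.Hom X Y n) : Quiver.Path X Z :=
  (str₁ a).cons (⟨m, b⟩ : Y ⟶ Z)

/-- The total reduced degree `∑ (|x_i| - 1)` of a composable string. -/
def red {X : A.Ob} : ∀ {Y : A.Ob}, Quiver.Path X Y → ℤ
  | _, .nil => 0
  | _, .cons p e => red p + (e.1 - 1)

/-- A decomposition of a string into two consecutive pieces (`fst` consists of the arrows
applied first). -/
structure Cut2 (X Y : A.Ob) where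
  Z : A.Ob
  fst : Quiver.Path X Z
  snd : Quiver.Path Z Y

/-- A decomposition of a string into three consecutive pieces. -/
structure Cut3 (X Y : A.Ob) where
  Z : A.Ob
  W : A.Ob
  fst : Quiver.Path X Z
  mid : Quiver.Path Z W
  last : Quiver.Path W Y

/-- All decompositions of a string into two consecutive (possibly empty) pieces. -/
def cuts2 {X : A.Ob} : ∀ {Y : A.Ob}, Quiver.Path X Y → List (Cut2 X Y)
  | _, .nil => [⟨X, .nil, .nil⟩]
  | _, .cons p e =>
      (cuts2 p).map (fun c => ⟨c.Z, c.fst, c.snd.cons e⟩) ++ [⟨_, p.cons e, .nil⟩]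

/-- All decompositions of a string into three consecutive (possibly empty) pieces. -/
def cuts3 {X Y : A.Ob} (p : Quiver.Path X Y) : List (Cut3 X Y) :=
  (cuts2 p).flatMap fun c => (cuts2 c.snd).map fun c' => ⟨c.Z, c'.Z, c.fst, c'.fst, c'.snd⟩

/-- The sum of the values of a function over a list. -/
def lsum {α : Type*} {M : Type*} [AddCommGroup M] (l : List α) (φ : α → M) : M := (l.map φ).sum

/-- A family of multilinear maps
`A(X_{d-1},X_d) ⊗ ⋯ ⊗ A(X_0,X_1) → B(f X_0, g X_d)`, `d ≥ 0`, which is homogeneous of degree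
`deg` for the shifted gradings `A[1]` on the inputs: an element of `CC^deg(A, B)`.
`T.val p n` is the component in degree `n` of the value on the string `p`; it vanishes unless
`n = red p + deg`. -/
structure Cochain (A : GrQuiver.{u, v, w} k) (B : GrQuiver.{u, v', w'} k)
    (f g : A.Ob → B.Ob) (deg : ℤ) where
  val : ∀ {X Y : A.Ob}, Quiver.Path X Y → ∀ n : ℤ, B.Hom (f X) (g Y) n
  val_eq_zero : ∀ {X Y : A.Ob} (p : Quiver.Path X Y) (n : ℤ), n ≠ red p + deg → val p n = 0
  val_add : ∀ {X Y Z W : A.Ob} (p : Quiver.Path X Y) (i : ℤ) (a b : A.Hom Y Z i) (q : Quiver.Path Z W) (n : ℤ),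
    val ((p.cons ⟨i, a + b⟩).comp q) n
      = val ((p.cons ⟨i, a⟩).comp q) n + val ((p.cons ⟨i, b⟩).comp q) n
  val_smul : ∀ {X Y Z W : A.Ob} (p : Quiver.Path X Y) (i : ℤ) (r : k) (a : A.Hom Y Z i) (q : Quiver.Path Z W)
    (n : ℤ), val ((p.cons ⟨i, r • a⟩).comp q) n = r • val ((p.cons ⟨i, a⟩).comp q) n

namespace Cochain

variable {f g : A.Ob → B.Ob} {d : ℤ}

/-- The value on a string, as a homogeneous morphism. -/
def arrow (T : Cochain A B f g d) {X Y : A.Ob} (p : Quiver.Path X Y) : f X ⟶ g Y :=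
  ⟨red p + d, T.val p (red p + d)⟩

/-- The order-one part of a cochain. -/
def lin (T : Cochain A B f g d) {X Y : A.Ob} (n m : ℤ) : A.Hom X Y n →ₗ[k] B.Hom (f X) (g Y) m where
  toFun a := T.val (str₁ a) m
  map_add' a b := T.val_add Quiver.Path.nil n a b Quiver.Path.nil m
  map_smul' r a := T.val_smul Quiver.Path.nil n r a Quiver.Path.nil m

/-- The order-two part of a cochain; the first argument is the morphism that is applied first. -/
def bilin (T : Cochain A B f g d) {X Y Z : A.Ob} (n₁ n₂ m : ℤ) :
    A.Hom X Y n₁ →ₗ[k] A.Hom Y Z n₂ →ₗ[k] B.Hom (f X) (g Z) m :=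
  LinearMap.mk₂ k (fun a b => T.val (str₂ b a) m)
    (fun a a' b => T.val_add Quiver.Path.nil n₁ a a' (str₁ b) m)
    (fun r a b => T.val_smul Quiver.Path.nil n₁ r a (str₁ b) m)
    (fun a b b' => T.val_add (str₁ a) n₂ b b' Quiver.Path.nil m)
    (fun r a b => T.val_smul (str₁ a) n₂ r b Quiver.Path.nil m)

/-- Auxiliary to `blocks`: decompose `p` followed by `s`, where the last block ends with `s`. -/
def blocksAux (T : Cochain A B f f d) {X : A.Ob} :
    ∀ {Z : A.Ob}, Quiver.Path X Z → ∀ {Y : A.Ob}, Quiver.Path Z Y → List (Quiver.Path (f X) (f Y))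
  | _, .nil, _, s => [Quiver.Path.nil.cons (T.arrow s)]
  | _, .cons p e, _, s =>
      blocksAux T p (e.toPath.comp s) ++ (blocksAux T p e.toPath).map (fun r => r.cons (T.arrow s))

/-- For every decomposition of a string into consecutive nonempty blocks, the string
`(T(block_r), …, T(block_1))` of the values of `T` on the blocks. -/
def blocks (T : Cochain A B f f d) {X : A.Ob} :
    ∀ {Y : A.Ob}, Quiver.Path X Y → List (Quiver.Path (f X) (f Y))
  | _, .nil => [Quiver.Path.nil]
  | _, .cons p e => blocksAux T p e.toPath

end Cochain

end Basic


/-! ### `A∞`-categories -/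

section Cat

variable {k : Type u} [Field k]

/-- The product `b · a = (-1)^{|a|} μ²(b, a)` (in degree `m`). -/
def prodOf {Q : GrQuiver.{u, v, w} k} (μ : Cochain Q Q (fun X => X) (fun X => X) 2)
    {X Y Z : Q.Ob} {p q : ℤ} (b : Q.Hom Y Z q) (a : Q.Hom X Y p) (m : ℤ) : Q.Hom X Z m :=
  p.negOnePow • μ.val (str₂ b a) m

/-- `a` and `a'` differ by a coboundary for `μ¹`. -/
def HomologousOf {Q : GrQuiver.{u, v, w} k} (μ : Cochain Q Q (fun X => X) (fun X => X) 2)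
    {X Y : Q.Ob} {n : ℤ} (a a' : Q.Hom X Y n) : Prop :=
  ∃ η : Q.Hom X Y (n - 1), μ.lin (n - 1) n η = a - a'

/-- `e` is a cocycle of degree `0` whose class is a two-sided unit for the cohomological
product. -/
structure IsCohUnitOf {Q : GrQuiver.{u, v, w} k} (μ : Cochain Q Q (fun X => X) (fun X => X) 2)
    {X : Q.Ob} (e : Q.Hom X X 0) : Prop where
  closed : μ.lin 0 1 e = 0
  right_unit : ∀ {Y : Q.Ob} {n : ℤ} (a : Q.Hom X Y n), μ.lin n (n + 1) a = 0 →
    HomologousOf μ (prodOf μ a e n) a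
  left_unit : ∀ {Y : Q.Ob} {n : ℤ} (a : Q.Hom Y X n), μ.lin n (n + 1) a = 0 →
    HomologousOf μ (prodOf μ e a n) a

/-- A cohomologically unital `ℤ`-graded `A∞`-category over `k`, with the sign conventions in
which the relations read
`∑ (-1)^{‖a_1‖ + ⋯ + ‖a_i‖} μ(a_d, …, μ(a_{i+j}, …, a_{i+1}), a_i, …, a_1) = 0`,
where `‖a‖ = |a| - 1`. -/
structure AInfCat (k : Type u) [Field k] where
  toGrQuiver : GrQuiver.{u, v, w} k
  μ : Cochain toGrQuiver toGrQuiver (fun X => X) (fun X => X) 2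
  μ_nil : ∀ (X : toGrQuiver.Ob) (n : ℤ), μ.val (Quiver.Path.nil : Quiver.Path X X) n = 0
  rel : ∀ {X Y : toGrQuiver.Ob} (p : Quiver.Path X Y) (n : ℤ),
    lsum (cuts3 p) (fun c => (red c.fst).negOnePow •
      μ.val ((c.fst.cons (μ.arrow c.mid)).comp c.last) n) = 0
  exists_unit : ∀ X : toGrQuiver.Ob, ∃ e : toGrQuiver.Hom X X 0, IsCohUnitOf μ e

namespace AInfCat

variable (A : AInfCat.{u, v, w} k)

/-- The objects. -/
abbrev Ob : Type v := A.toGrQuiver.Ob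

/-- The graded morphism spaces. -/
abbrev Hom (X Y : A.Ob) (n : ℤ) : Type w := A.toGrQuiver.Hom X Y n

/-- The differential `μ¹`. -/
abbrev d {X Y : A.Ob} (n m : ℤ) : A.Hom X Y n →ₗ[k] A.Hom X Y m := A.μ.lin n m

/-- The product `b · a = (-1)^{|a|} μ²(b, a)`. -/
abbrev prod {X Y Z : A.Ob} {p q : ℤ} (b : A.Hom Y Z q) (a : A.Hom X Y p) (m : ℤ) : A.Hom X Z m :=
  prodOf A.μ b a m

/-- `a` and `a'` differ by a coboundary. -/
abbrev Homologous {X Y : A.Ob} {n : ℤ} (a a' : A.Hom X Y n) : Prop := HomologousOf A.μ a a'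

/-- `e` represents the unit of `X` in the cohomological category. -/
abbrev IsCohUnit {X : A.Ob} (e : A.Hom X X 0) : Prop := IsCohUnitOf A.μ e

end AInfCat

/-- A cohomologically unital `A∞`-functor with action `f` on objects; the relations read
`∑ μ_B(F(…), …, F(…)) = ∑ (-1)^{‖a_1‖ + ⋯ + ‖a_i‖} F(a_d, …, μ_A(…), a_i, …, a_1)`. -/
structure AInfFunctor (A : AInfCat.{u, v, w} k) (B : AInfCat.{u, v', w'} k) (f : A.Ob → B.Ob)
    extends Cochain A.toGrQuiver B.toGrQuiver f f 1 where
  val_nil : ∀ (X : A.Ob) (n : ℤ), val (Quiver.Path.nil : Quiver.Path X X) n = 0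
  rel : ∀ {X Y : A.Ob} (p : Quiver.Path X Y) (n : ℤ),
    lsum (toCochain.blocks p) (fun q => B.μ.val q n)
      = lsum (cuts3 p) (fun c => (red c.fst).negOnePow •
          val ((c.fst.cons (A.μ.arrow c.mid)).comp c.last) n)
  unital : ∀ {X : A.Ob} (e : A.Hom X X 0), A.IsCohUnit e → B.IsCohUnit (toCochain.lin 0 0 e)

namespace Cochain

variable {Q : GrQuiver.{u, v, w} k} {R : GrQuiver.{u, v', w'} k} {f g : Q.Ob → R.Ob} {e : ℤ}

theorem val_zero (T : Cochain Q R f g e) {X Y Z W : Q.Ob} (p : Quiver.Path X Y) (i : ℤ)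
    (q : Quiver.Path Z W) (n : ℤ) :
    T.val ((p.cons (⟨i, (0 : Q.Hom Y Z i)⟩ : Y ⟶ Z)).comp q) n = 0 := by
  have := T.val_smul p i (0 : k) (0 : Q.Hom Y Z i) q n
  rwa [zero_smul, zero_smul] at this

end Cochain

namespace AInfCat

variable (A : AInfCat.{u, v, w} k)

theorem d_eq_zero {X Y : A.Ob} {n m : ℤ} (h : m ≠ n + 1) (a : A.Hom X Y n) : A.d n m a = 0 :=
  A.μ.val_eq_zero _ _ (by simp only [red]; omega)

theorem bilin_eq_zero {X Y Z : A.Ob} {n₁ n₂ m : ℤ} (h : m ≠ n₁ + n₂) (a : A.Hom X Y n₁)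
    (b : A.Hom Y Z n₂) : A.μ.bilin n₁ n₂ m a b = 0 :=
  A.μ.val_eq_zero _ _ (by simp only [red]; omega)

theorem val_nil_arrow {X Y Z : A.Ob} (p : Quiver.Path X Y) (q : Quiver.Path Y Z) (n : ℤ) :
    A.μ.val ((p.cons (A.μ.arrow (Quiver.Path.nil : Quiver.Path Y Y))).comp q) n = 0 := by
  have : A.μ.arrow (Quiver.Path.nil : Quiver.Path Y Y)
      = (⟨red (Quiver.Path.nil : Quiver.Path Y Y) + 2, 0⟩ : Y ⟶ Y) := by
    simp only [Cochain.arrow, A.μ_nil]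
  rw [this]
  exact A.μ.val_zero p _ q n

theorem arrow_str₁ {X Y : A.Ob} {n : ℤ} (a : A.Hom X Y n) :
    A.μ.arrow (str₁ a) = (⟨n + 1, A.d n (n + 1) a⟩ : X ⟶ Y) := by
  have h : red (str₁ a) + 2 = n + 1 := by simp only [red]; ring
  simp only [Cochain.arrow]
  rw [h]
  rfl

theorem arrow_str₂ {X Y Z : A.Ob} {n m : ℤ} (b : A.Hom Y Z m) (a : A.Hom X Y n) :
    A.μ.arrow (str₂ b a) = (⟨n + m, A.μ.bilin n m (n + m) a b⟩ : X ⟶ Z) := by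
  have h : red (str₂ b a) + 2 = n + m := by simp only [red]; ring
  simp only [Cochain.arrow]
  rw [h]
  rfl

theorem d_d {X Y : A.Ob} (l m n : ℤ) (a : A.Hom X Y l) : A.d m n (A.d l m a) = 0 := by
  by_cases h : m = l + 1
  · subst h
    have := A.rel (str₁ a) n
    simp only [lsum, cuts3, cuts2, List.map_cons, List.map_nil, List.nil_append, List.cons_append,
      List.flatMap_cons, List.flatMap_nil, List.append_nil, List.sum_cons, List.sum_nil,
      val_nil_arrow, smul_zero, zero_add, add_zero, arrow_str₁, red, Int.negOnePow_zero,
      one_smul] at this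
    exact this
  · rw [A.d_eq_zero h, map_zero]

/-- The Leibniz rule. -/
theorem d_bilin {X Y Z : A.Ob} {n₁ n₂ : ℤ} (m : ℤ) (a : A.Hom X Y n₁) (b : A.Hom Y Z n₂) :
    A.d (n₁ + n₂) m (A.μ.bilin n₁ n₂ (n₁ + n₂) a b)
      + A.μ.bilin (n₁ + 1) n₂ m (A.d n₁ (n₁ + 1) a) b
      + (n₁ - 1).negOnePow • A.μ.bilin n₁ (n₂ + 1) m a (A.d n₂ (n₂ + 1) b) = 0 := by
  have := A.rel (str₂ b a) m
  simp only [lsum, cuts3, cuts2, List.map_cons, List.map_nil, List.nil_append, List.cons_append,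
      List.flatMap_cons, List.flatMap_nil, List.append_nil, List.sum_cons, List.sum_nil,
      val_nil_arrow, smul_zero, zero_add, add_zero, arrow_str₁, arrow_str₂, red,
      Int.negOnePow_zero, one_smul] at this
  rw [add_assoc, add_left_comm]
  exact this

/-- Associativity up to homotopy. -/
theorem d_assoc {X Y Z W : A.Ob} {n₁ n₂ n₃ : ℤ} (m : ℤ) (a : A.Hom X Y n₁) (b : A.Hom Y Z n₂)
    (c : A.Hom Z W n₃) (ha : A.d n₁ (n₁ + 1) a = 0) (hb : A.d n₂ (n₂ + 1) b = 0)
    (hc : A.d n₃ (n₃ + 1) c = 0) :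
    ∃ η, A.d (m - 1) m η = A.μ.bilin (n₁ + n₂) n₃ m (A.μ.bilin n₁ n₂ (n₁ + n₂) a b) c
      + (n₁ - 1).negOnePow • A.μ.bilin n₁ (n₂ + n₃) m a (A.μ.bilin n₂ n₃ (n₂ + n₃) b c) := by
  have := A.rel ((str₂ b a).cons (⟨n₃, c⟩ : Z ⟶ W)) m
  have z₁ := A.arrow_str₁ a
  have z₂ := A.arrow_str₁ b
  have z₃ := A.arrow_str₁ c
  rw [ha] at z₁
  rw [hb] at z₂
  rw [hc] at z₃
  have hz : ∀ {U V S T : A.Ob} (p : Quiver.Path U V) (i : ℤ)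
    (q : Quiver.Path S T) (n : ℤ),
    A.μ.val ((p.cons (⟨i, (0 : A.toGrQuiver.Hom V S i)⟩ : V ⟶ S)).comp q) n = 0 := A.μ.val_zero
  simp only [lsum, cuts3, cuts2, List.map_cons, List.map_nil, List.nil_append, List.cons_append,
      List.flatMap_cons, List.flatMap_nil, List.append_nil, List.sum_cons, List.sum_nil,
      val_nil_arrow, smul_zero, zero_add, add_zero, arrow_str₂, red, z₁, z₂, z₃, hz,
      Int.negOnePow_zero, one_smul] at this
  have key : ∃ η, A.d (m - 1) m η = A.μ.val (Quiver.Path.nil.cons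
      (A.μ.arrow ((str₂ b a).cons (⟨n₃, c⟩ : Z ⟶ W)))) m := by
    generalize A.μ.arrow ((str₂ b a).cons (⟨n₃, c⟩ : Z ⟶ W)) = t
    obtain ⟨N, x⟩ := t
    by_cases h : N = m - 1
    · subst h
      exact ⟨x, rfl⟩
    · exact ⟨0, (map_zero _).trans (A.d_eq_zero (by omega) x).symm⟩
  obtain ⟨η, hη⟩ := key
  refine ⟨-η, ?_⟩
  rw [map_neg, hη, neg_eq_iff_add_eq_zero, add_left_comm]
  exact this

/-- The cocycles of degree `n`. -/
abbrev cocycles (X Y : A.Ob) (n : ℤ) : Submodule k (A.Hom X Y n) := LinearMap.ker (A.d n (n + 1))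

/-- The coboundaries of degree `n`, inside the cocycles. -/
abbrev coboundaries (X Y : A.Ob) (n : ℤ) : Submodule k (A.cocycles X Y n) :=
  (LinearMap.range (A.d (X := X) (Y := Y) (n - 1) n)).submoduleOf (A.cocycles X Y n)

/-- The cohomology of a morphism complex. -/
abbrev HHom (X Y : A.Ob) (n : ℤ) : Type w := A.cocycles X Y n ⧸ A.coboundaries X Y n

/-- The cohomology class of a cocycle. -/
def cls {X Y : A.Ob} {n : ℤ} : A.cocycles X Y n →ₗ[k] A.HHom X Y n :=
  (A.coboundaries X Y n).mkQ

theorem cls_surjective {X Y : A.Ob} {n : ℤ} (x : A.HHom X Y n) :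
    ∃ a : A.cocycles X Y n, A.cls a = x := (A.coboundaries X Y n).mkQ_surjective x

theorem cls_eq_zero {X Y : A.Ob} {n : ℤ} (a : A.cocycles X Y n) :
    A.cls a = 0 ↔ ∃ η, A.d (n - 1) n η = a.1 := by
  exact (Submodule.Quotient.mk_eq_zero _)

theorem bilin_closed {X Y Z : A.Ob} {n₁ n₂ : ℤ} (m : ℤ) (a : A.cocycles X Y n₁)
    (b : A.cocycles Y Z n₂) : A.d m (m + 1) (A.μ.bilin n₁ n₂ m a.1 b.1) = 0 := by
  by_cases h : m = n₁ + n₂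
  · subst h
    have := A.d_bilin (n₁ + n₂ + 1) a.1 b.1
    rwa [a.2, b.2, map_zero, map_zero, LinearMap.zero_apply, smul_zero, add_zero, add_zero] at this
  · rw [A.bilin_eq_zero h, map_zero]

/-- `(a, b) ↦ [μ²(b, a)]` on cocycles. -/
def cocycleBilin (X Y Z : A.Ob) (n₁ n₂ m : ℤ) :
    A.cocycles X Y n₁ →ₗ[k] A.cocycles Y Z n₂ →ₗ[k] A.HHom X Z m :=
  LinearMap.mk₂ k (fun a b => A.cls ⟨A.μ.bilin n₁ n₂ m a.1 b.1, A.bilin_closed m a b⟩)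
    (fun a a' b => by rw [← map_add]; congr 1; ext; simp)
    (fun r a b => by rw [← map_smul]; congr 1; ext; simp)
    (fun a b b' => by rw [← map_add]; congr 1; ext; simp)
    (fun r a b => by rw [← map_smul]; congr 1; ext; simp)

theorem cocycleBilin_left {X Y Z : A.Ob} {n₁ n₂ m : ℤ} (a : A.cocycles X Y n₁)
    (ha : a ∈ A.coboundaries X Y n₁) (b : A.cocycles Y Z n₂) :
    A.cocycleBilin X Y Z n₁ n₂ m a b = 0 := by
  obtain ⟨η, hη⟩ := ha
  refine (A.cls_eq_zero _).2 ?_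
  by_cases h : m = n₁ + n₂
  · subst h
    have := A.d_bilin (n₁ + n₂) η b.1
    rw [b.2, map_zero, smul_zero, add_zero, sub_add_cancel] at this
    have e : n₁ - 1 + n₂ = n₁ + n₂ - 1 := by ring
    rw [e, hη] at this
    exact ⟨-A.μ.bilin (n₁ - 1) n₂ _ η b.1, by
      rw [map_neg]; exact neg_eq_of_add_eq_zero_right this⟩
  · exact ⟨0, (map_zero _).trans (A.bilin_eq_zero h _ _).symm⟩

theorem cocycleBilin_right {X Y Z : A.Ob} {n₁ n₂ m : ℤ} (a : A.cocycles X Y n₁)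
    (b : A.cocycles Y Z n₂) (hb : b ∈ A.coboundaries Y Z n₂) :
    A.cocycleBilin X Y Z n₁ n₂ m a b = 0 := by
  obtain ⟨η, hη⟩ := hb
  refine (A.cls_eq_zero _).2 ?_
  by_cases h : m = n₁ + n₂
  · subst h
    have := A.d_bilin (n₁ + n₂) a.1 η
    rw [a.2, map_zero, LinearMap.zero_apply, add_zero, sub_add_cancel] at this
    have e : n₁ + (n₂ - 1) = n₁ + n₂ - 1 := by ring
    rw [e, hη] at this
    refine ⟨-((n₁ - 1).negOnePow • A.μ.bilin n₁ (n₂ - 1) _ a.1 η), ?_⟩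
    rw [map_neg, Units.smul_def, map_zsmul, ← Units.smul_def, eq_comm, eq_neg_iff_add_eq_zero]
    have h2 := congrArg (fun x => (n₁ - 1).negOnePow • x) this
    simp only [smul_add, smul_smul, Int.units_mul_self, one_smul, smul_zero] at h2
    exact (add_comm _ _).trans h2
  · exact ⟨0, (map_zero _).trans (A.bilin_eq_zero h _ _).symm⟩

/-- `(x, y) ↦ y x`, the map `μ²` on cohomology induced by `μ²`. -/
def cohBilin (X Y Z : A.Ob) (n₁ n₂ m : ℤ) :
    A.HHom X Y n₁ →ₗ[k] A.HHom Y Z n₂ →ₗ[k] A.HHom X Z m :=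
  LinearMap.flip ((A.coboundaries Y Z n₂).liftQ
    (LinearMap.flip ((A.coboundaries X Y n₁).liftQ (A.cocycleBilin X Y Z n₁ n₂ m)
      (fun a ha => LinearMap.ext fun b => A.cocycleBilin_left a ha b)))
    (fun b hb => LinearMap.ext fun x => by
      obtain ⟨a, rfl⟩ := A.cls_surjective x
      exact A.cocycleBilin_right a b hb))

theorem cohBilin_cls {X Y Z : A.Ob} {n₁ n₂ : ℤ} (m : ℤ) (a : A.cocycles X Y n₁)
    (b : A.cocycles Y Z n₂) :
    A.cohBilin X Y Z n₁ n₂ m (A.cls a) (A.cls b)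
      = A.cls ⟨A.μ.bilin n₁ n₂ m a.1 b.1, A.bilin_closed m a b⟩ := rfl

/-- The graded quiver of cohomology groups of the morphism complexes. -/
abbrev cohQuiver : GrQuiver.{u, v, w} k where
  Ob := A.Ob
  Hom X Y n := A.HHom X Y n

/-- The values of the structure maps of the cohomological category: `μ²` is the induced product
and all other operations vanish. -/
def cohVal {X : A.cohQuiver.Ob} :
    ∀ {Y : A.cohQuiver.Ob}, Quiver.Path X Y → ∀ n : ℤ, A.cohQuiver.Hom X Y n
  | _, .cons (.cons .nil a) b, m => A.cohBilin _ _ _ a.1 b.1 m a.2 b.2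
  | _, _, _ => 0

theorem cohVal_of_length {X Y : A.cohQuiver.Ob} (p : Quiver.Path X Y) (n : ℤ) (h : p.length ≠ 2) :
    A.cohVal p n = 0 := by
  match p, h with
  | .nil, _ => rfl
  | .cons .nil _, _ => rfl
  | .cons (.cons .nil _) _, h => exact absurd rfl h
  | .cons (.cons (.cons _ _) _) _, _ => rfl

theorem cohVal_eq_zero {X Y : A.cohQuiver.Ob} (p : Quiver.Path X Y) (n : ℤ)
    (h : n ≠ red p + 2) : A.cohVal p n = 0 := by
  match p, h with
  | .nil, _ => rfl
  | .cons .nil _, _ => rfl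
  | .cons (.cons .nil ⟨n₁, x⟩) ⟨n₂, y⟩, h =>
    obtain ⟨a, rfl⟩ := A.cls_surjective x
    obtain ⟨b, rfl⟩ := A.cls_surjective y
    refine (A.cls_eq_zero _).2 ⟨0, (map_zero _).trans (A.bilin_eq_zero ?_ _ _).symm⟩
    intro h'
    apply h
    simp only [red, h']
    ring
  | .cons (.cons (.cons _ _) _) _, _ => rfl

/-- The operations of the cohomological category. -/
def cohμ : Cochain A.cohQuiver A.cohQuiver (fun X => X) (fun X => X) 2 where
  val := A.cohVal
  val_eq_zero := A.cohVal_eq_zero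
  val_add p i a b q n := by
    cases q with
    | nil =>
      cases p with
      | nil => exact (add_zero _).symm
      | cons p e =>
        cases p with
        | nil => exact (A.cohBilin _ _ _ _ _ _ _).map_add _ _
        | cons _ _ => exact (add_zero _).symm
    | cons q e =>
      cases q with
      | nil =>
        cases p with
        | nil => exact (A.cohBilin _ _ _ _ _ _).map_add₂ _ _ _
        | cons _ _ => exact (add_zero _).symm
      | cons q e' =>
        rw [A.cohVal_of_length, A.cohVal_of_length, A.cohVal_of_length, add_zero] <;>
          simp only [Quiver.Path.length_comp, Quiver.Path.length_cons, Quiver.Path.comp_cons] <;> omega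
  val_smul p i r a q n := by
    cases q with
    | nil =>
      cases p with
      | nil => exact (smul_zero _).symm
      | cons p e =>
        cases p with
        | nil => exact (A.cohBilin _ _ _ _ _ _ _).map_smul _ _
        | cons _ _ => exact (smul_zero _).symm
    | cons q e =>
      cases q with
      | nil =>
        cases p with
        | nil => exact (A.cohBilin _ _ _ _ _ _).map_smul₂ _ _ _
        | cons _ _ => exact (smul_zero _).symm
      | cons q e' =>
        rw [A.cohVal_of_length, A.cohVal_of_length, smul_zero] <;>
          simp only [Quiver.Path.length_comp, Quiver.Path.length_cons, Quiver.Path.comp_cons] <;> omega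

theorem length_of_mem_cuts2 {Q : GrQuiver.{u, v, w} k} {X Y : Q.Ob} (p : Quiver.Path X Y) :
    ∀ c ∈ cuts2 p, c.fst.length + c.snd.length = p.length := by
  induction p with
  | nil => simp [cuts2]
  | cons p e ih =>
    intro c hc
    simp only [cuts2, List.mem_append, List.mem_map, List.mem_singleton] at hc
    rcases hc with ⟨c', hc', rfl⟩ | rfl
    · have := ih c' hc'
      simp only [Quiver.Path.length_cons]
      omega
    · simp

theorem length_of_mem_cuts3 {Q : GrQuiver.{u, v, w} k} {X Y : Q.Ob} (p : Quiver.Path X Y) :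
    ∀ c ∈ cuts3 p, c.fst.length + c.mid.length + c.last.length = p.length := by
  intro c hc
  simp only [cuts3, List.mem_flatMap, List.mem_map] at hc
  obtain ⟨c₁, h₁, c₂, h₂, rfl⟩ := hc
  have e₁ := length_of_mem_cuts2 p c₁ h₁
  have e₂ := length_of_mem_cuts2 _ c₂ h₂
  simp only
  omega

theorem cohμ_term_eq_zero {X Y Z W : A.cohQuiver.Ob} (p : Quiver.Path X Y)
    (q : Quiver.Path Y Z) (r : Quiver.Path Z W) (n : ℤ)
    (h : q.length ≠ 2 ∨ p.length + r.length ≠ 1) :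
    A.cohμ.val ((p.cons (A.cohμ.arrow q)).comp r) n = 0 := by
  by_cases h' : q.length = 2
  · refine A.cohVal_of_length _ _ ?_
    simp only [Quiver.Path.length_comp, Quiver.Path.length_cons]
    omega
  · have : A.cohμ.arrow q = (⟨red q + 2, 0⟩ : Y ⟶ Z) := by
      simp only [Cochain.arrow, cohμ, A.cohVal_of_length _ _ h']
    rw [this]
    exact A.cohμ.val_zero _ _ _ _

theorem cohμ_arrow {X Y Z : A.cohQuiver.Ob} {n m : ℤ} (y : A.cohQuiver.Hom Y Z m)
    (x : A.cohQuiver.Hom X Y n) :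
    A.cohμ.arrow (str₂ y x) = (⟨n + m, A.cohBilin X Y Z n m (n + m) x y⟩ : X ⟶ Z) := by
  have h : red (str₂ y x) + 2 = n + m := by simp only [red]; ring
  simp only [Cochain.arrow]
  rw [h]
  rfl

theorem cohBilin_assoc {X Y Z W : A.cohQuiver.Ob} {n₁ n₂ n₃ : ℤ} (n : ℤ)
    (x : A.cohQuiver.Hom X Y n₁) (y : A.cohQuiver.Hom Y Z n₂) (z : A.cohQuiver.Hom Z W n₃) :
    A.cohBilin X Z W (n₁ + n₂) n₃ n (A.cohBilin X Y Z n₁ n₂ (n₁ + n₂) x y) z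
      + (n₁ - 1).negOnePow •
        A.cohBilin X Y W n₁ (n₂ + n₃) n x (A.cohBilin Y Z W n₂ n₃ (n₂ + n₃) y z) = 0 := by
  obtain ⟨a, rfl⟩ := A.cls_surjective x
  obtain ⟨b, rfl⟩ := A.cls_surjective y
  obtain ⟨c, rfl⟩ := A.cls_surjective z
  rw [cohBilin_cls, cohBilin_cls, cohBilin_cls, cohBilin_cls, Units.smul_def, ← map_zsmul,
    ← map_add]
  refine (A.cls_eq_zero _).2 ?_
  obtain ⟨η, hη⟩ := A.d_assoc n a.1 b.1 c.1 a.2 b.2 c.2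
  refine ⟨η, hη.trans ?_⟩
  rw [Submodule.coe_add, Submodule.coe_smul_of_tower, Units.smul_def]

theorem cohμ_rel {X Y : A.cohQuiver.Ob} (p : Quiver.Path X Y) (n : ℤ) :
    lsum (cuts3 p) (fun c => (red c.fst).negOnePow •
      A.cohμ.val ((c.fst.cons (A.cohμ.arrow c.mid)).comp c.last) n) = 0 := by
  by_cases hp : p.length = 3
  · match p, hp with
    | .cons (.cons (.cons .nil ⟨n₁, x⟩) ⟨n₂, y⟩) ⟨n₃, z⟩, _ =>
    have Z : ∀ {X Y Z W : A.cohQuiver.Ob} (s : ℤˣ) (p : Quiver.Path X Y)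
        (q : Quiver.Path Y Z) (r : Quiver.Path Z W)
        (_ : q.length ≠ 2 ∨ p.length + r.length ≠ 1),
        s • A.cohμ.val ((p.cons (A.cohμ.arrow q)).comp r) n = 0 := fun s p q r h => by
      rw [A.cohμ_term_eq_zero p q r n h, smul_zero]
    have aux : ∀ {M : Type w} [AddCommGroup M] {a b c d e f g h i j : M}, a = 0 → b = 0 → d = 0 →
        e = 0 → f = 0 → h = 0 → i = 0 → j = 0 → c + g = 0 →
        a + (b + (c + (d + (e + (f + (g + (h + (i + (j + 0))))))))) = 0 := by
      intro M _ a b c d e f g h i j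
      rintro rfl rfl rfl rfl rfl rfl rfl rfl h
      simpa using h
    refine aux (Z _ _ _ _ (by simp)) (Z _ _ _ _ (by simp)) (Z _ _ _ _ (by simp))
      (Z _ _ _ _ (by simp)) (Z _ _ _ _ (by simp)) (Z _ _ _ _ (by simp)) (Z _ _ _ _ (by simp))
      (Z _ _ _ _ (by simp)) ?_
    refine (congrArg₂ (· + ·) ?_ ?_).trans (A.cohBilin_assoc n x y z)
    · refine (one_smul _ _).trans ?_
      exact congrArg (fun t => A.cohμ.val (Quiver.Path.cons (.cons .nil t) ⟨n₃, z⟩) n)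
        (A.cohμ_arrow y x)
    · refine congrArg₂ (· • ·) ?_ ?_
      · simp only [red, zero_add]
      · exact congrArg (fun t => A.cohμ.val (Quiver.Path.cons (.cons .nil ⟨n₁, x⟩) t) n)
          (A.cohμ_arrow z y)
  · refine List.sum_eq_zero fun x hx => ?_
    obtain ⟨c, hc, rfl⟩ := List.mem_map.1 hx
    rw [A.cohμ_term_eq_zero, smul_zero]
    have := length_of_mem_cuts3 p c hc
    omega

/-- A chosen cocycle representing the unit of `X`. -/
noncomputable def unit (X : A.Ob) : A.Hom X X 0 := Classical.choose (A.exists_unit X)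

theorem isCohUnit_unit (X : A.Ob) : A.IsCohUnit (A.unit X) :=
  Classical.choose_spec (A.exists_unit X)

/-- The unit of `X` in the cohomological category. -/
noncomputable def hUnit (X : A.Ob) : A.cohQuiver.Hom X X 0 := A.cls ⟨A.unit X, (A.isCohUnit_unit X).closed⟩

theorem cohμ_prod {X Y Z : A.Ob} {p q : ℤ} (b : A.cocycles Y Z q) (a : A.cocycles X Y p) (m : ℤ) :
    prodOf A.cohμ (A.cls b) (A.cls a) m
      = A.cls (p.negOnePow • ⟨A.μ.bilin p q m a.1 b.1, A.bilin_closed m a b⟩) := by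
  rw [Units.smul_def, map_zsmul, ← Units.smul_def]
  rfl

theorem coh_homologous_iff {X Y Z : A.Ob} {p q n : ℤ} (b : A.cocycles Y Z q)
    (a : A.cocycles X Y p) (c : A.cocycles X Z n) :
    HomologousOf A.cohμ (prodOf A.cohμ (A.cls b) (A.cls a) n) (A.cls c)
      ↔ A.Homologous (A.prod b.1 a.1 n) c.1 := by
  have h0 : ∀ η : A.HHom X Z (n - 1), A.cohμ.lin (n - 1) n η = 0 := fun η => rfl
  rw [cohμ_prod]
  have h1 : HomologousOf A.cohμ
      (A.cls (p.negOnePow • ⟨A.μ.bilin p q n a.1 b.1, A.bilin_closed n a b⟩)) (A.cls c)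
      ↔ A.cls (p.negOnePow • ⟨A.μ.bilin p q n a.1 b.1, A.bilin_closed n a b⟩ - c) = 0 := by
    rw [map_sub]
    exact ⟨fun ⟨η, hη⟩ => hη.symm.trans (h0 η), fun h => ⟨0, (h0 0).trans h.symm⟩⟩
  rw [h1, cls_eq_zero]
  refine exists_congr fun η => ?_
  rw [Units.smul_def, Submodule.coe_sub, Submodule.coe_smul_of_tower, ← Units.smul_def]
  rfl

theorem coh_isCohUnit_iff {X : A.Ob} (e : A.cocycles X X 0) :
    IsCohUnitOf (Q := A.cohQuiver) A.cohμ (A.cls e) ↔ A.IsCohUnit e.1 := by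
  constructor
  · intro h
    refine ⟨e.2, fun a ha => ?_, fun a ha => ?_⟩
    · exact (A.coh_homologous_iff ⟨a, ha⟩ e ⟨a, ha⟩).1 (h.right_unit (A.cls ⟨a, ha⟩) rfl)
    · exact (A.coh_homologous_iff e ⟨a, ha⟩ ⟨a, ha⟩).1 (h.left_unit (A.cls ⟨a, ha⟩) rfl)
  · intro h
    refine ⟨rfl, fun x _ => ?_, fun x _ => ?_⟩
    · obtain ⟨a, rfl⟩ := A.cls_surjective x
      exact (A.coh_homologous_iff a e a).2 (h.right_unit a.1 a.2)
    · obtain ⟨a, rfl⟩ := A.cls_surjective x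
      exact (A.coh_homologous_iff e a a).2 (h.left_unit a.1 a.2)

theorem isCohUnit_hUnit (X : A.Ob) : IsCohUnitOf (Q := A.cohQuiver) A.cohμ (A.hUnit X) :=
  (A.coh_isCohUnit_iff _).2 (A.isCohUnit_unit X)

/-- The cohomological category `H A`, as an `A∞`-category whose only nonvanishing operation is
the product induced by `μ²`. -/
def coh : AInfCat.{u, v, w} k where
  toGrQuiver := A.cohQuiver
  μ := A.cohμ
  μ_nil _ _ := rfl
  rel := A.cohμ_rel
  exists_unit X := ⟨A.hUnit X, A.isCohUnit_hUnit X⟩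

end AInfCat

end Cat

/-! ### Combinatorics of decompositions -/

section Combinatorics

variable {k : Type u} [Field k]
variable {A : GrQuiver.{u, v, w} k} {B : GrQuiver.{u, v', w'} k} {C : GrQuiver.{u, v'', w''} k}

section lsum

variable {α β M N : Type*} [AddCommGroup M] [AddCommGroup N]

theorem lsum_nil (φ : α → M) : lsum [] φ = 0 := rfl

theorem lsum_cons (a : α) (l : List α) (φ : α → M) : lsum (a :: l) φ = φ a + lsum l φ := rfl

theorem lsum_singleton (a : α) (φ : α → M) : lsum [a] φ = φ a := add_zero _

theorem lsum_append (l l' : List α) (φ : α → M) : lsum (l ++ l') φ = lsum l φ + lsum l' φ := by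
  simp [lsum]

theorem lsum_map (l : List β) (h : β → α) (φ : α → M) :
    lsum (l.map h) φ = lsum l (fun b => φ (h b)) := by
  simp [lsum, Function.comp_def]

theorem lsum_flatMap (l : List β) (h : β → List α) (φ : α → M) :
    lsum (l.flatMap h) φ = lsum l (fun b => lsum (h b) φ) := by
  induction l with
  | nil => rfl
  | cons b l ih => rw [List.flatMap_cons, lsum_append, ih, lsum_cons]

theorem lsum_congr {l : List α} {φ ψ : α → M} (h : ∀ a ∈ l, φ a = ψ a) : lsum l φ = lsum l ψ := by
  rw [lsum, lsum, List.map_congr_left h]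

theorem lsum_zero (l : List α) : lsum l (fun _ => (0 : M)) = 0 := by
  simp [lsum]

theorem lsum_eq_zero {l : List α} {φ : α → M} (h : ∀ a ∈ l, φ a = 0) : lsum l φ = 0 :=
  (lsum_congr h).trans (lsum_zero l)

theorem lsum_add (l : List α) (φ ψ : α → M) :
    lsum l (fun a => φ a + ψ a) = lsum l φ + lsum l ψ := by
  induction l with
  | nil => simp [lsum]
  | cons a l ih => rw [lsum_cons, ih, lsum_cons, lsum_cons]; abel

theorem lsum_add₃ (l : List α) (φ ψ χ : α → M) :
    lsum l φ + lsum l ψ + lsum l χ = lsum l (fun a => φ a + ψ a + χ a) := by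
  rw [lsum_add, lsum_add]

theorem map_lsum (h : M →+ N) (l : List α) (φ : α → M) :
    h (lsum l φ) = lsum l (fun a => h (φ a)) := by
  induction l with
  | nil => simp [lsum]
  | cons a l ih => rw [lsum_cons, map_add, ih, lsum_cons]

theorem smul_lsum {S : Type*} [DistribSMul S M] (s : S) (l : List α) (φ : α → M) :
    s • lsum l φ = lsum l (fun a => s • φ a) := map_lsum (DistribSMul.toAddMonoidHom M s) l φ

theorem lsum_comm (l : List α) (l' : List β) (φ : α → β → M) :
    lsum l (fun a => lsum l' (fun b => φ a b)) = lsum l' (fun b => lsum l (fun a => φ a b)) := by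
  induction l with
  | nil => exact (lsum_zero l').symm
  | cons a l ih => simp only [lsum_cons, ih, lsum_add]

end lsum

variable {M : Type*} [AddCommGroup M]

theorem red_comp {X Y Z : A.Ob} (p : Quiver.Path X Y) (q : Quiver.Path Y Z) :
    red (p.comp q) = red p + red q := by
  induction q with
  | nil => simp [red]
  | cons q e ih => simp only [Quiver.Path.comp_cons, red, ih]; ring

theorem red_marked {X Y Z W : A.Ob} (p : Quiver.Path X Y) (e : Y ⟶ Z) (q : Quiver.Path Z W) :
    red ((p.cons e).comp q) = red p + (e.1 - 1) + red q := by
  rw [red_comp]; rfl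

theorem lsum_cuts2_cons {X Y Z : A.Ob} (p : Quiver.Path X Y) (e : Y ⟶ Z) (φ : Cut2 X Z → M) :
    lsum (cuts2 (p.cons e)) φ
      = lsum (cuts2 p) (fun c => φ ⟨c.Z, c.fst, c.snd.cons e⟩) + φ ⟨_, p.cons e, .nil⟩ := by
  rw [cuts2, lsum_append, lsum_map, lsum_singleton]

theorem lsum_cuts3 {X Y : A.Ob} (p : Quiver.Path X Y) (φ : Cut3 X Y → M) :
    lsum (cuts3 p) φ = lsum (cuts2 p) (fun c => lsum (cuts2 c.snd)
      (fun c' => φ ⟨c.Z, c'.Z, c.fst, c'.fst, c'.snd⟩)) := by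
  rw [cuts3, lsum_flatMap]
  exact lsum_congr fun c _ => lsum_map _ _ _

theorem red_of_mem_cuts2 {X Y : A.Ob} (p : Quiver.Path X Y) :
    ∀ c ∈ cuts2 p, red c.fst + red c.snd = red p := by
  induction p with
  | nil => simp [cuts2, red]
  | cons p e ih =>
    intro c hc
    simp only [cuts2, List.mem_append, List.mem_map, List.mem_singleton] at hc
    rcases hc with ⟨c', hc', rfl⟩ | rfl
    · have := ih c' hc'
      simp only [red]
      omega
    · simp [red]

theorem red_of_mem_cuts3 {X Y : A.Ob} (p : Quiver.Path X Y) :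
    ∀ c ∈ cuts3 p, red c.fst + red c.mid + red c.last = red p := by
  intro c hc
  simp only [cuts3, List.mem_flatMap, List.mem_map] at hc
  obtain ⟨c₁, h₁, c₂, h₂, rfl⟩ := hc
  have e₁ := red_of_mem_cuts2 p c₁ h₁
  have e₂ := red_of_mem_cuts2 _ c₂ h₂
  simp only
  omega

theorem lsum_cuts2_marked {X Y Z W : A.Ob} (p : Quiver.Path X Y) (e : Y ⟶ Z)
    (q : Quiver.Path Z W) (φ : Cut2 X W → M) :
    lsum (cuts2 ((p.cons e).comp q)) φ
      = lsum (cuts2 p) (fun c => φ ⟨c.Z, c.fst, (c.snd.cons e).comp q⟩)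
        + lsum (cuts2 q) (fun c => φ ⟨c.Z, (p.cons e).comp c.fst, c.snd⟩) := by
  induction q with
  | nil =>
    rw [Quiver.Path.comp_nil, lsum_cuts2_cons]
    simp only [Quiver.Path.comp_nil, cuts2, lsum_singleton]
  | cons q e' ih =>
    rw [Quiver.Path.comp_cons, lsum_cuts2_cons, ih, lsum_cuts2_cons, add_assoc]
    rfl

theorem lsum_cuts3_marked {X Y Z W : A.Ob} (p : Quiver.Path X Y) (e : Y ⟶ Z)
    (q : Quiver.Path Z W) (φ : Cut3 X W → M) :
    lsum (cuts3 ((p.cons e).comp q)) φ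
      = lsum (cuts3 p) (fun c => φ ⟨c.Z, c.W, c.fst, c.mid, (c.last.cons e).comp q⟩)
        + lsum (cuts2 p) (fun a => lsum (cuts2 q) (fun b =>
            φ ⟨a.Z, b.Z, a.fst, (a.snd.cons e).comp b.fst, b.snd⟩))
        + lsum (cuts3 q) (fun c => φ ⟨c.Z, c.W, (p.cons e).comp c.fst, c.mid, c.last⟩) := by
  rw [lsum_cuts3, lsum_cuts2_marked]
  simp only [lsum_cuts2_marked, lsum_add, lsum_cuts3]

theorem cuts2_coassoc {X Y : A.Ob} (p : Quiver.Path X Y)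
    (φ : ∀ {Z W : A.Ob}, Quiver.Path X Z → Quiver.Path Z W → Quiver.Path W Y → M) :
    lsum (cuts2 p) (fun c => lsum (cuts2 c.fst) (fun c' => φ c'.fst c'.snd c.snd))
      = lsum (cuts2 p) (fun c => lsum (cuts2 c.snd) (fun c' => φ c.fst c'.fst c'.snd)) := by
  induction p with
  | nil => rfl
  | cons p e ih =>
    rw [lsum_cuts2_cons, lsum_cuts2_cons]
    simp only
    rw [ih (fun a b c => φ a b (c.cons e))]
    simp only [lsum_cuts2_cons, lsum_add]
    rw [add_assoc]
    congr 1
    simp [cuts2, lsum_singleton]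

theorem lsum_cuts2_snd_nil {X Y : A.Ob} (p : Quiver.Path X Y) (φ : Cut2 X Y → M)
    (h : ∀ c : Cut2 X Y, c.snd.length ≠ 0 → φ c = 0) :
    lsum (cuts2 p) φ = φ ⟨Y, p, .nil⟩ := by
  cases p with
  | nil => exact lsum_singleton _ _
  | cons p e =>
    rw [lsum_cuts2_cons, lsum_eq_zero, zero_add]
    intro c _
    exact h _ (by simp)

theorem lsum_cuts2_fst_nil {X Y : A.Ob} (p : Quiver.Path X Y) (φ : Cut2 X Y → M)
    (h : ∀ c : Cut2 X Y, c.fst.length ≠ 0 → φ c = 0) :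
    lsum (cuts2 p) φ = φ ⟨X, .nil, p⟩ := by
  induction p with
  | nil => exact lsum_singleton _ _
  | cons p e ih =>
    rw [lsum_cuts2_cons, h ⟨_, p.cons e, .nil⟩ (by simp), add_zero,
      ih _ (fun c hc => h _ hc)]

theorem lsum_cuts3_mid {X Y : A.Ob} (p : Quiver.Path X Y) (φ : Cut3 X Y → M)
    (h : ∀ c : Cut3 X Y, c.fst.length + c.last.length ≠ 0 → φ c = 0) :
    lsum (cuts3 p) φ = φ ⟨X, Y, .nil, p, .nil⟩ := by
  rw [lsum_cuts3, lsum_cuts2_fst_nil, lsum_cuts2_snd_nil]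
  · intro c hc
    exact h _ (by simpa using hc)
  · intro c hc
    exact lsum_eq_zero fun c' _ => h _ (by simp only; omega)

/-- `Φ` is multilinear in the arrows of a string. -/
structure IsML [Module k M] {X Y : A.Ob} (Φ : Quiver.Path X Y → M) : Prop where
  add : ∀ {Z W : A.Ob} (p : Quiver.Path X Z) (i : ℤ) (a b : A.Hom Z W i) (q : Quiver.Path W Y),
    Φ ((p.cons ⟨i, a + b⟩).comp q) = Φ ((p.cons ⟨i, a⟩).comp q) + Φ ((p.cons ⟨i, b⟩).comp q)
  smul : ∀ {Z W : A.Ob} (p : Quiver.Path X Z) (i : ℤ) (r : k) (a : A.Hom Z W i)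
    (q : Quiver.Path W Y), Φ ((p.cons ⟨i, r • a⟩).comp q) = r • Φ ((p.cons ⟨i, a⟩).comp q)

namespace IsML

variable [Module k M]

theorem cons {X Y Y' : A.Ob} {Φ : Quiver.Path X Y' → M} (h : IsML Φ) (e : Y ⟶ Y') :
    IsML (fun q : Quiver.Path X Y => Φ (q.cons e)) where
  add p i a b q := h.add p i a b (q.cons e)
  smul p i r a q := h.smul p i r a (q.cons e)

theorem lsum {α : Type*} {X Y : A.Ob} {Φ : α → Quiver.Path X Y → M} (h : ∀ a, IsML (Φ a))
    (l : List α) : IsML (fun p => AInf.lsum l (fun a => Φ a p)) where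
  add p i a b q := by simp only [(h _).add, lsum_add]
  smul p i r a q := by simp only [(h _).smul, smul_lsum]

theorem units_smul {X Y : A.Ob} {Φ : Quiver.Path X Y → M} (h : IsML Φ) (s : ℤˣ) :
    IsML (fun p => s • Φ p) where
  add p i a b q := by simp only [h.add, smul_add]
  smul p i r a q := by simp only [h.smul, smul_comm s r]

theorem insert_zero {X Y : A.Ob} {Φ : Quiver.Path X Y → M} (h : IsML Φ) {Z W : A.Ob}
    (p : Quiver.Path X Z) (i : ℤ) (q : Quiver.Path W Y) :
    Φ ((p.cons (⟨i, (0 : A.Hom Z W i)⟩ : Z ⟶ W)).comp q) = 0 := by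
  have := h.smul p i (0 : k) (0 : A.Hom Z W i) q
  rwa [zero_smul, zero_smul] at this

theorem insert_lsum {X Y : A.Ob} {Φ : Quiver.Path X Y → M} (h : IsML Φ) {Z W : A.Ob}
    (p : Quiver.Path X Z) (i : ℤ) {α : Type*} (l : List α) (φ : α → A.Hom Z W i)
    (q : Quiver.Path W Y) :
    Φ ((p.cons (⟨i, AInf.lsum l φ⟩ : Z ⟶ W)).comp q)
      = AInf.lsum l (fun a => Φ ((p.cons (⟨i, φ a⟩ : Z ⟶ W)).comp q)) := by
  induction l with
  | nil => exact h.insert_zero p i q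
  | cons a l ih => rw [lsum_cons, h.add, ih, lsum_cons]

theorem insert_units_smul {X Y : A.Ob} {Φ : Quiver.Path X Y → M} (h : IsML Φ) {Z W : A.Ob}
    (p : Quiver.Path X Z) (i : ℤ) (s : ℤˣ) (a : A.Hom Z W i) (q : Quiver.Path W Y) :
    Φ ((p.cons (⟨i, s • a⟩ : Z ⟶ W)).comp q) = s • Φ ((p.cons (⟨i, a⟩ : Z ⟶ W)).comp q) := by
  have e : ∀ {N : Type _} [AddCommGroup N] [Module k N] (x : N), s • x = ((s : ℤ) : k) • x := by
    intro N _ _ x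
    rw [Units.smul_def, Int.cast_smul_eq_zsmul]
  have e' : s • Φ ((p.cons (⟨i, a⟩ : Z ⟶ W)).comp q)
      = ((s : ℤ) : k) • Φ ((p.cons (⟨i, a⟩ : Z ⟶ W)).comp q) := by
    rw [Units.smul_def, Int.cast_smul_eq_zsmul]
  rw [e, e', h.smul]

end IsML

namespace Cochain

theorem isML {f g : A.Ob → B.Ob} {d : ℤ} (T : Cochain A B f g d) {X Y : A.Ob} (n : ℤ) :
    IsML (fun p : Quiver.Path X Y => T.val p n) where
  add p i a b q := T.val_add p i a b q n
  smul p i r a q := T.val_smul p i r a q n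

theorem arrow_eq {f g : A.Ob → B.Ob} {d : ℤ} (T : Cochain A B f g d) {X Y : A.Ob}
    (p : Quiver.Path X Y) {N : ℤ} (h : red p + d = N) :
    T.arrow p = (⟨N, T.val p N⟩ : f X ⟶ g Y) := by
  subst h; rfl

theorem arrow_marked {f g : A.Ob → B.Ob} {d : ℤ} (T : Cochain A B f g d) {X Y Z W : A.Ob}
    (p : Quiver.Path X Y) (i : ℤ) (x : A.Hom Y Z i) (q : Quiver.Path Z W) :
    T.arrow ((p.cons (⟨i, x⟩ : Y ⟶ Z)).comp q)
      = (⟨red p + (i - 1) + red q + d, T.val ((p.cons (⟨i, x⟩ : Y ⟶ Z)).comp q) _⟩ : f X ⟶ g W) :=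
  T.arrow_eq _ (by rw [red_marked])

variable {f : A.Ob → B.Ob} {d : ℤ}

theorem lsum_blocksAux (T : Cochain A B f f d) {X Z Y : A.Ob} (p : Quiver.Path X Z)
    (s : Quiver.Path Z Y) (Φ : Quiver.Path (f X) (f Y) → M) :
    lsum (T.blocksAux p s) Φ = lsum (cuts2 p) (fun c => lsum (T.blocks c.fst)
      (fun r => Φ (r.cons (T.arrow (c.snd.comp s))))) := by
  induction p generalizing Y with
  | nil => simp [blocksAux, cuts2, blocks, lsum_singleton]
  | cons p e ih =>
    rw [blocksAux, lsum_append, lsum_map, ih, lsum_cuts2_cons]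
    simp only [Quiver.Path.nil_comp, blocks]
    congr 1
    refine lsum_congr fun c _ => lsum_congr fun r _ => ?_
    rw [← Quiver.Path.comp_assoc]
    rfl

theorem lsum_blocks_cons (T : Cochain A B f f d) {X Z Y : A.Ob} (p : Quiver.Path X Z)
    (e : Z ⟶ Y) (Φ : Quiver.Path (f X) (f Y) → M) :
    lsum (T.blocks (p.cons e)) Φ = lsum (cuts2 p) (fun c => lsum (T.blocks c.fst)
      (fun r => Φ (r.cons (T.arrow (c.snd.cons e))))) :=
  T.lsum_blocksAux p e.toPath Φ

theorem lsum_blocks_nil (T : Cochain A B f f d) {X : A.Ob} (Φ : Quiver.Path (f X) (f X) → M) :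
    lsum (T.blocks (Quiver.Path.nil : Quiver.Path X X)) Φ = Φ .nil := lsum_singleton _ _

theorem lsum_blocks_str₁ (T : Cochain A B f f d) {X Y : A.Ob} {n : ℤ} (a : A.Hom X Y n)
    (Φ : Quiver.Path (f X) (f Y) → M) :
    lsum (T.blocks (str₁ a)) Φ = Φ (Quiver.Path.nil.cons (T.arrow (str₁ a))) := lsum_singleton _ _

theorem lsum_blocks_marked (T : Cochain A B f f d) {X Y Z W : A.Ob} (p : Quiver.Path X Y)
    (e : Y ⟶ Z) (q : Quiver.Path Z W) (Φ : Quiver.Path (f X) (f W) → M) :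
    lsum (T.blocks ((p.cons e).comp q)) Φ
      = lsum (cuts2 p) (fun a => lsum (cuts2 q) (fun b =>
          lsum (T.blocks a.fst) (fun r => lsum (T.blocks b.snd) (fun t =>
            Φ ((r.cons (T.arrow ((a.snd.cons e).comp b.fst))).comp t))))) := by
  induction hn : q.length using Nat.strong_induction_on generalizing W with
  | _ n ih =>
  cases q with
  | nil =>
    rw [Quiver.Path.comp_nil, lsum_blocks_cons]
    simp only [cuts2, lsum_singleton, blocks, Quiver.Path.comp_nil]
  | cons q e' =>
    rw [Quiver.Path.comp_cons, lsum_blocks_cons, lsum_cuts2_marked]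
    simp only [lsum_cuts2_cons, lsum_add, lsum_blocks_nil, Quiver.Path.comp_nil]
    rw [add_comm]
    congr 1
    · have h1 : lsum (cuts2 q) (fun c => lsum (T.blocks ((p.cons e).comp c.fst))
          (fun r => Φ (r.cons (T.arrow (c.snd.cons e')))))
          = lsum (cuts2 q) (fun c => lsum (cuts2 c.fst) (fun b =>
            lsum (cuts2 p) (fun a => lsum (T.blocks a.fst) (fun r => lsum (T.blocks b.snd)
              (fun t => Φ (((r.cons (T.arrow ((a.snd.cons e).comp b.fst))).comp t).cons
                (T.arrow (c.snd.cons e')))))))) := by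
        refine lsum_congr fun c hc => ?_
        rw [ih c.fst.length (by
          have := AInfCat.length_of_mem_cuts2 q c hc
          simp only [Quiver.Path.length_cons] at hn
          omega) c.fst _ rfl, lsum_comm]
      rw [h1, cuts2_coassoc q (fun x y z => lsum (cuts2 p) (fun a => lsum (T.blocks a.fst)
        (fun r => lsum (T.blocks y) (fun t =>
          Φ (((r.cons (T.arrow ((a.snd.cons e).comp x))).comp t).cons
                (T.arrow (z.cons e')))))))]
      rw [lsum_comm (cuts2 p)]
      refine lsum_congr fun c _ => ?_
      rw [lsum_comm (cuts2 c.snd)]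
      refine lsum_congr fun a _ => ?_
      rw [lsum_comm (cuts2 c.snd)]
      refine lsum_congr fun r _ => ?_
      rw [lsum_blocks_cons]
      rfl

theorem lsum_blocks_cuts2 (T : Cochain A B f f d) {X Y : A.Ob} (p : Quiver.Path X Y)
    (Ψ : Cut2 (f X) (f Y) → M) :
    lsum (T.blocks p) (fun r => lsum (cuts2 r) Ψ)
      = lsum (cuts2 p) (fun a => lsum (T.blocks a.fst) (fun r => lsum (T.blocks a.snd)
          (fun t => Ψ ⟨f a.Z, r, t⟩))) := by
  induction hn : p.length using Nat.strong_induction_on generalizing Y with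
  | _ n ih =>
  cases p with
  | nil => simp [cuts2, blocks, lsum_singleton]
  | cons p e =>
    rw [lsum_blocks_cons, lsum_cuts2_cons]
    simp only [lsum_cuts2_cons, lsum_add, lsum_blocks_nil]
    congr 1
    · have h1 : lsum (cuts2 p) (fun c => lsum (T.blocks c.fst) (fun r => lsum (cuts2 r)
          (fun d => Ψ ⟨d.Z, d.fst, d.snd.cons (T.arrow (c.snd.cons e))⟩)))
          = lsum (cuts2 p) (fun c => lsum (cuts2 c.fst) (fun a => lsum (T.blocks a.fst) (fun r =>
            lsum (T.blocks a.snd) (fun t => Ψ ⟨f a.Z, r, t.cons (T.arrow (c.snd.cons e))⟩)))) := by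
        refine lsum_congr fun c hc => ?_
        exact ih c.fst.length (by
          have := AInfCat.length_of_mem_cuts2 p c hc
          simp only [Quiver.Path.length_cons] at hn
          omega) c.fst (fun d => Ψ ⟨d.Z, d.fst, d.snd.cons (T.arrow (c.snd.cons e))⟩) rfl
      rw [h1, cuts2_coassoc p (fun {Z _} x y z => lsum (T.blocks x) (fun r =>
            lsum (T.blocks y) (fun t => Ψ ⟨f Z, r, t.cons (T.arrow (z.cons e))⟩)))]
      refine lsum_congr fun c _ => ?_
      rw [lsum_comm (cuts2 c.snd)]
      refine lsum_congr fun r _ => ?_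
      rw [lsum_blocks_cons]
    · rw [lsum_blocks_cons]

theorem lsum_blocks_cuts3 (T : Cochain A B f f d) {X Y : A.Ob} (p : Quiver.Path X Y)
    (Ψ : Cut3 (f X) (f Y) → M) :
    lsum (T.blocks p) (fun r => lsum (cuts3 r) Ψ)
      = lsum (cuts3 p) (fun a => lsum (T.blocks a.fst) (fun r => lsum (T.blocks a.mid)
          (fun s => lsum (T.blocks a.last) (fun t => Ψ ⟨f a.Z, f a.W, r, s, t⟩)))) := by
  simp only [lsum_cuts3]
  rw [lsum_blocks_cuts2]
  refine lsum_congr fun c _ => ?_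
  rw [lsum_comm (cuts2 c.snd)]
  refine lsum_congr fun r _ => ?_
  rw [lsum_blocks_cuts2 T c.snd
    (fun c' => Ψ ⟨f c.Z, c'.Z, r, c'.fst, c'.snd⟩)]

theorem red_of_mem_blocks (T : Cochain A B f f 1) {X Y : A.Ob} (p : Quiver.Path X Y) :
    ∀ r ∈ T.blocks p, red r = red p := by
  have aux : ∀ {X Z : A.Ob} (p : Quiver.Path X Z) {Y : A.Ob} (s : Quiver.Path Z Y),
      ∀ r ∈ T.blocksAux p s, red r = red p + red s := by
    intro X Z p
    induction p with
    | nil =>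
      intro Y s r hr
      simp only [blocksAux, List.mem_singleton] at hr
      subst hr
      simp [red, arrow]
    | cons p e ih =>
      intro Y s r hr
      simp only [blocksAux, List.mem_append, List.mem_map] at hr
      rcases hr with hr | ⟨r', hr', rfl⟩
      · rw [ih _ r hr, red_comp]
        simp only [Quiver.Hom.toPath, red]
        ring
      · simp only [red, ih _ r' hr', arrow, Quiver.Hom.toPath]
        ring
  cases p with
  | nil => intro r hr; simp only [blocks, List.mem_singleton] at hr; subst hr; rfl
  | cons p e =>
    intro r hr
    rw [aux p e.toPath r hr]
    simp [Quiver.Hom.toPath, red]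

theorem isML_blocks [Module k M] (T : Cochain A B f f d) {X Y : A.Ob}
    {Φ : Quiver.Path (f X) (f Y) → M} (h : IsML Φ) :
    IsML (fun p : Quiver.Path X Y => lsum (T.blocks p) Φ) where
  add p i a b q := by
    simp only [lsum_blocks_marked, ← lsum_add]
    refine lsum_congr fun c _ => lsum_congr fun c' _ => lsum_congr fun r _ =>
      lsum_congr fun t _ => ?_
    rw [arrow_marked, arrow_marked, arrow_marked, T.val_add, h.add]
  smul p i s a q := by
    simp only [lsum_blocks_marked, smul_lsum]
    refine lsum_congr fun c _ => lsum_congr fun c' _ => lsum_congr fun r _ =>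
      lsum_congr fun t _ => ?_
    rw [arrow_marked, arrow_marked, T.val_smul, h.smul]

end Cochain

end Combinatorics

/-! ### Composition of functors, identity functors, functors induced on cohomology -/

section Functors

variable {k : Type u} [Field k]

theorem cuts3_coassoc {A : GrQuiver.{u, v, w} k} {M : Type*} [AddCommGroup M] {X Y : A.Ob}
    (p : Quiver.Path X Y)
    (φ : ∀ {Z Z' W W' : A.Ob}, Quiver.Path X Z → Quiver.Path Z Z' → Quiver.Path Z' W →
      Quiver.Path W W' → Quiver.Path W' Y → M) :
    lsum (cuts3 p) (fun c => lsum (cuts2 c.fst) (fun a => lsum (cuts2 c.last)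
        (fun b => φ a.fst a.snd c.mid b.fst b.snd)))
      = lsum (cuts3 p) (fun c => lsum (cuts3 c.mid)
          (fun d => φ c.fst d.fst d.mid d.last c.last)) := by
  have h1 : lsum (cuts3 p) (fun c => lsum (cuts2 c.fst) (fun a => lsum (cuts2 c.last)
        (fun b => φ a.fst a.snd c.mid b.fst b.snd)))
      = lsum (cuts2 p) (fun c => lsum (cuts2 c.snd) (fun a => lsum (cuts2 a.snd)
          (fun b => lsum (cuts2 b.snd) (fun d => φ c.fst a.fst b.fst d.fst d.snd)))) := by
    have h2 := cuts2_coassoc p (fun x y z => lsum (cuts2 z) (fun b => lsum (cuts2 b.snd)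
      (fun d => φ x y b.fst d.fst d.snd)))
    rw [← h2, lsum_cuts3]
    refine lsum_congr fun c _ => ?_
    rw [lsum_comm]
  rw [h1, lsum_cuts3]
  refine lsum_congr fun c _ => ?_
  have h3 := cuts2_coassoc c.snd (fun x y z => lsum (cuts2 y) (fun d => φ c.fst x d.fst d.snd z))
  simp only [lsum_cuts3]
  rw [h3]
  refine lsum_congr fun a _ => ?_
  exact (cuts2_coassoc a.snd (fun x y z => φ c.fst a.fst x y z)).symm

namespace Cochain

variable {A : GrQuiver.{u, v, w} k} {B : GrQuiver.{u, v', w'} k} {C : GrQuiver.{u, v'', w''} k}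
variable {f : A.Ob → B.Ob} {g : B.Ob → C.Ob}

/-- The composition `(G ∘ F)(a_d, …, a_1) = ∑ G(F(…), …, F(…))`. -/
def comp (G : Cochain B C g g 1) (F : Cochain A B f f 1) :
    Cochain A C (fun X => g (f X)) (fun X => g (f X)) 1 where
  val p n := lsum (F.blocks p) (fun r => G.val r n)
  val_eq_zero p n h := lsum_eq_zero fun r hr => G.val_eq_zero r n (by
    rwa [F.red_of_mem_blocks p r hr])
  val_add p i a b q n := (F.isML_blocks (G.isML n)).add p i a b q
  val_smul p i r a q n := (F.isML_blocks (G.isML n)).smul p i r a q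

theorem lsum_blocks_comp {M : Type*} [AddCommGroup M] [Module k M] (G : Cochain B C g g 1)
    (F : Cochain A B f f 1) {X Y : A.Ob} (p : Quiver.Path X Y)
    {Φ : Quiver.Path (g (f X)) (g (f Y)) → M} (hΦ : IsML Φ) :
    lsum ((G.comp F).blocks p) Φ = lsum (F.blocks p) (fun r => lsum (G.blocks r) Φ) := by
  induction hn : p.length using Nat.strong_induction_on generalizing Y with
  | _ n ih =>
  cases p with
  | nil => simp [blocks, lsum_singleton]
  | cons p e =>
    rw [lsum_blocks_cons, lsum_blocks_cons]
    have hl : ∀ c ∈ cuts2 p, lsum ((G.comp F).blocks c.fst)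
        (fun r => Φ (r.cons ((G.comp F).arrow (c.snd.cons e))))
        = lsum (F.blocks c.fst) (fun r => lsum (G.blocks r) (fun q =>
          lsum (F.blocks (c.snd.cons e)) (fun t => Φ (q.cons (G.arrow t))))) := by
      intro c hc
      rw [ih c.fst.length (by
        have := AInfCat.length_of_mem_cuts2 p c hc
        simp only [Quiver.Path.length_cons] at hn
        omega) c.fst (hΦ.cons _) rfl]
      refine lsum_congr fun r _ => lsum_congr fun q _ => ?_
      refine (hΦ.insert_lsum q _ _ _ Quiver.Path.nil).trans (lsum_congr fun t ht => ?_)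
      have := F.red_of_mem_blocks _ t ht
      rw [G.arrow_eq t (congrArg (· + 1) this)]
      rfl
    rw [lsum_congr hl]
    have hr : ∀ c : Cut2 X _, lsum (F.blocks c.fst)
        (fun r => lsum (G.blocks (r.cons (F.arrow (c.snd.cons e)))) Φ)
        = lsum (cuts2 c.fst) (fun a => lsum (F.blocks a.fst) (fun r => lsum (F.blocks a.snd)
          (fun t => lsum (G.blocks r)
            (fun q => Φ (q.cons (G.arrow (t.cons (F.arrow (c.snd.cons e))))))))) := by
      intro c
      rw [← lsum_blocks_cuts2 F c.fst (fun d => lsum (G.blocks d.fst)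
            (fun q => Φ (q.cons (G.arrow (d.snd.cons (F.arrow (c.snd.cons e)))))))]
      refine lsum_congr fun r _ => ?_
      rw [lsum_blocks_cons]
    simp only [hr]
    rw [cuts2_coassoc p (fun x y z => lsum (F.blocks x) (fun r => lsum (F.blocks y)
          (fun t => lsum (G.blocks r)
            (fun q => Φ (q.cons (G.arrow (t.cons (F.arrow (z.cons e)))))))))]
    refine lsum_congr fun c _ => ?_
    rw [lsum_comm (cuts2 c.snd)]
    refine lsum_congr fun r _ => ?_
    simp only [lsum_blocks_cons]
    rw [lsum_comm (G.blocks r)]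
    refine lsum_congr fun c' _ => ?_
    rw [lsum_comm (G.blocks r)]

end Cochain

namespace AInfFunctor

variable {A : AInfCat.{u, v, w} k} {B : AInfCat.{u, v', w'} k} {C : AInfCat.{u, v'', w''} k}
variable {f : A.Ob → B.Ob} {g : B.Ob → C.Ob}

/-- Applying the functor relation inside a multilinear expression. -/
theorem lsum_blocks_insert {M : Type*} [AddCommGroup M] [Module k M] (F : AInfFunctor A B f)
    {X Y : A.Ob} {Φ : Quiver.Path (f X) (f Y) → M} (hΦ : IsML Φ) (p : Quiver.Path X Y) :
    lsum (cuts3 p) (fun c => (red c.fst).negOnePow • lsum (F.toCochain.blocks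
        ((c.fst.cons (A.μ.arrow c.mid)).comp c.last)) Φ)
      = lsum (F.toCochain.blocks p) (fun r => lsum (cuts3 r) (fun c =>
          (red c.fst).negOnePow • Φ ((c.fst.cons (B.μ.arrow c.mid)).comp c.last))) := by
  rw [Cochain.lsum_blocks_cuts3]
  simp only [Cochain.lsum_blocks_marked]
  have h1 : ∀ c ∈ cuts3 p, (red c.fst).negOnePow • lsum (cuts2 c.fst) (fun a =>
        lsum (cuts2 c.last) (fun b => lsum (F.toCochain.blocks a.fst) (fun r =>
          lsum (F.toCochain.blocks b.snd) (fun t => Φ ((r.cons (F.toCochain.arrow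
            ((a.snd.cons (A.μ.arrow c.mid)).comp b.fst))).comp t)))))
      = lsum (cuts2 c.fst) (fun a => lsum (cuts2 c.last) (fun b =>
          lsum (F.toCochain.blocks a.fst) (fun r => lsum (F.toCochain.blocks b.snd) (fun t =>
            (red a.fst + red a.snd).negOnePow • Φ ((r.cons (F.toCochain.arrow
            ((a.snd.cons (A.μ.arrow c.mid)).comp b.fst))).comp t))))) := by
    intro c _
    simp only [smul_lsum]
    refine lsum_congr fun a ha => ?_
    rw [red_of_mem_cuts2 _ a ha]
  rw [lsum_congr h1, cuts3_coassoc p (fun x y z y' x' => lsum (F.toCochain.blocks x) (fun r =>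
    lsum (F.toCochain.blocks x') (fun t => (red x + red y).negOnePow • Φ ((r.cons
      (F.toCochain.arrow ((y.cons (A.μ.arrow z)).comp y'))).comp t))))]
  refine lsum_congr fun c _ => ?_
  rw [lsum_comm (cuts3 c.mid)]
  refine lsum_congr fun r hr => ?_
  rw [lsum_comm (cuts3 c.mid), lsum_comm (F.toCochain.blocks c.mid)]
  refine lsum_congr fun t _ => ?_
  have hred := Cochain.red_of_mem_blocks _ _ r hr
  have e1 : ∀ s ∈ F.toCochain.blocks c.mid, (red r).negOnePow •
      Φ ((r.cons (B.μ.arrow s)).comp t) = (red r).negOnePow • Φ ((r.cons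
        (⟨red c.mid + 2, B.μ.val s (red c.mid + 2)⟩ : f c.Z ⟶ f c.W)).comp t) := by
    intro s hs
    rw [B.μ.arrow_eq s (congrArg (· + 2) (Cochain.red_of_mem_blocks _ _ s hs))]
  rw [lsum_congr e1, ← smul_lsum, ← hΦ.insert_lsum, F.rel, hΦ.insert_lsum, smul_lsum]
  refine lsum_congr fun d hd => ?_
  rw [hΦ.insert_units_smul, smul_smul, ← Int.negOnePow_add, hred]
  congr 4
  refine F.toCochain.arrow_eq _ ?_
  have := red_of_mem_cuts3 _ d hd
  rw [red_marked]
  simp only [Cochain.arrow]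
  omega

/-- The composition of `A∞`-functors. -/
def comp (G : AInfFunctor B C g) (F : AInfFunctor A B f) :
    AInfFunctor A C (fun X => g (f X)) where
  toCochain := G.toCochain.comp F.toCochain
  val_nil X n := (Cochain.lsum_blocks_nil F.toCochain (fun r => G.val r n)).trans
    (G.val_nil (f X) n)
  rel p n := by
    rw [Cochain.lsum_blocks_comp _ _ _ (C.μ.isML n), lsum_congr fun r _ => G.rel r n]
    exact (F.lsum_blocks_insert (G.toCochain.isML n) p).symm
  unital e he := by
    have h := G.unital _ (F.unital e he)
    have : (G.toCochain.comp F.toCochain).lin 0 0 e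
        = G.toCochain.lin 0 0 (F.toCochain.lin 0 0 e) := by
      refine (Cochain.lsum_blocks_str₁ _ _ _).trans ?_
      rw [F.toCochain.arrow_eq (str₁ e) (N := 0) (by simp [red])]
      rfl
    rwa [this]

end AInfFunctor

/-! #### Functors and vector fields with only a linear part -/

namespace Cochain

variable {A : GrQuiver.{u, v, w} k} {B : GrQuiver.{u, v', w'} k} {f : A.Ob → B.Ob}

/-- The values of the cochain whose only component is the linear map `L`. -/
noncomputable def linVal (L : ∀ X Y n, A.Hom X Y n →ₗ[k] B.Hom (f X) (f Y) n) {X : A.Ob} :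
    ∀ {Y : A.Ob}, Quiver.Path X Y → ∀ n : ℤ, B.Hom (f X) (f Y) n
  | _, .cons .nil a, m => Pi.single (M := fun i => B.Hom (f _) (f _) i) a.1 (L _ _ a.1 a.2) m
  | _, _, _ => 0

theorem linVal_of_length (L : ∀ X Y n, A.Hom X Y n →ₗ[k] B.Hom (f X) (f Y) n) {X Y : A.Ob}
    (p : Quiver.Path X Y) (n : ℤ) (h : p.length ≠ 1) : linVal L p n = 0 := by
  match p, h with
  | .nil, _ => rfl
  | .cons .nil _, h => exact absurd rfl h
  | .cons (.cons _ _) _, _ => rfl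

/-- The degree-preserving linear maps `L` as a cochain with only an order-one part. -/
noncomputable def ofLin (L : ∀ X Y n, A.Hom X Y n →ₗ[k] B.Hom (f X) (f Y) n) :
    Cochain A B f f 1 where
  val := linVal L
  val_eq_zero p n h := by
    match p, h with
    | .nil, _ => rfl
    | .cons .nil ⟨i, a⟩, h =>
      refine Pi.single_eq_of_ne ?_ _
      rintro rfl
      exact h (by simp [red])
    | .cons (.cons _ _) _, _ => rfl
  val_add p i a b q n := by
    cases q with
    | nil =>
      cases p with
      | nil =>
        refine (congrArg (fun t => Pi.single (M := fun i => B.Hom (f _) (f _) i) i t n)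
          ((L _ _ i).map_add a b)).trans ?_
        rw [Pi.single_add]
        rfl
      | cons _ _ => exact (add_zero _).symm
    | cons q e =>
      rw [linVal_of_length, linVal_of_length, linVal_of_length, add_zero] <;>
        simp only [Quiver.Path.length_comp, Quiver.Path.length_cons, Quiver.Path.comp_cons] <;>
        omega
  val_smul p i r a q n := by
    cases q with
    | nil =>
      cases p with
      | nil =>
        refine (congrArg (fun t => Pi.single (M := fun i => B.Hom (f _) (f _) i) i t n)
          ((L _ _ i).map_smul r a)).trans ?_
        rw [Pi.single_smul]
        rfl
      | cons _ _ => exact (smul_zero _).symm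
    | cons q e =>
      rw [linVal_of_length, linVal_of_length, smul_zero] <;>
        simp only [Quiver.Path.length_comp, Quiver.Path.length_cons, Quiver.Path.comp_cons] <;>
        omega

/-- Apply `L` to every arrow of a string. -/
def mapStr (L : ∀ X Y n, A.Hom X Y n →ₗ[k] B.Hom (f X) (f Y) n) {X : A.Ob} :
    ∀ {Y : A.Ob}, Quiver.Path X Y → Quiver.Path (f X) (f Y)
  | _, .nil => .nil
  | _, .cons p e => (mapStr L p).cons (⟨e.1, L _ _ e.1 e.2⟩ : f _ ⟶ f _)

theorem ofLin_arrow (L : ∀ X Y n, A.Hom X Y n →ₗ[k] B.Hom (f X) (f Y) n) {X Y : A.Ob} {n : ℤ}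
    (a : A.Hom X Y n) : (ofLin L).arrow (str₁ a) = (⟨n, L X Y n a⟩ : f X ⟶ f Y) := by
  rw [(ofLin L).arrow_eq (str₁ a) (N := n) (by simp [red])]
  congr 1
  exact Pi.single_eq_same _ _

theorem lsum_blocks_ofLin {M : Type*} [AddCommGroup M] [Module k M]
    (L : ∀ X Y n, A.Hom X Y n →ₗ[k] B.Hom (f X) (f Y) n) {X Y : A.Ob} (p : Quiver.Path X Y)
    {Φ : Quiver.Path (f X) (f Y) → M} (hΦ : IsML Φ) :
    lsum ((ofLin L).blocks p) Φ = Φ (mapStr L p) := by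
  induction p with
  | nil => exact lsum_singleton _ _
  | cons p e ih =>
    rw [lsum_blocks_cons, lsum_cuts2_snd_nil]
    · refine (ih (hΦ.cons _)).trans ?_
      refine congrArg (fun t => Φ ((mapStr L p).cons t)) ?_
      exact ofLin_arrow L e.2
    · intro c hc
      refine lsum_eq_zero fun r _ => ?_
      have : (ofLin L).arrow (c.snd.cons e) = ⟨red (c.snd.cons e) + 1, 0⟩ := by
        simp only [arrow]
        congr 1
        exact linVal_of_length _ _ _ (by simpa using hc)
      rw [this]
      exact hΦ.insert_zero r _ Quiver.Path.nil

end Cochain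

end Functors

section LinearFunctors

variable {k : Type u} [Field k]

namespace AInfFunctor

variable {A : AInfCat.{u, v, w} k} {B : AInfCat.{u, v', w'} k} {f : A.Ob → B.Ob}

/-- An `A∞`-functor with only a linear part. -/
noncomputable def ofLin (L : ∀ X Y n, A.Hom X Y n →ₗ[k] B.Hom (f X) (f Y) n)
    (hL : ∀ {X Y : A.Ob} (p : Quiver.Path X Y),
      B.μ.val (Cochain.mapStr L p) (red p + 2) = L X Y _ (A.μ.val p (red p + 2)))
    (hu : ∀ {X : A.Ob} (e : A.Hom X X 0), A.IsCohUnit e → B.IsCohUnit (L X X 0 e)) :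
    AInfFunctor A B f where
  toCochain := Cochain.ofLin L
  val_nil _ _ := rfl
  rel {X Y} p n := by
    rw [Cochain.lsum_blocks_ofLin L p (B.μ.isML n), lsum_cuts3_mid]
    · refine Eq.trans ?_ (one_smul _ _).symm
      by_cases h : n = red p + 2
      · subst h
        exact (hL p).trans (Pi.single_eq_same (M := fun i => B.Hom (f X) (f Y) i) _ _).symm
      · refine (B.μ.val_eq_zero _ _ ?_).trans
          (Pi.single_eq_of_ne (M := fun i => B.Hom (f X) (f Y) i) h _).symm
        have : red (Cochain.mapStr L p) = red p := by
          clear h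
          induction p with
          | nil => rfl
          | cons p e ih => simp only [Cochain.mapStr, red, ih]
        rwa [this]
    · intro c hc
      refine (congrArg _ (Cochain.linVal_of_length L _ n ?_)).trans (smul_zero _)
      simp only [Quiver.Path.length_comp, Quiver.Path.length_cons]
      omega
  unital {X} e he := by
    have : (Cochain.ofLin L).lin 0 0 e = L X X 0 e :=
      Pi.single_eq_same (M := fun i => B.Hom (f X) (f X) i) 0 (L X X 0 e)
    rw [this]
    exact hu e he

/-- The identity functor. -/
noncomputable def id (A : AInfCat.{u, v, w} k) : AInfFunctor A A (fun X => X) :=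
  ofLin (fun _ _ _ => LinearMap.id)
    (fun p => by
      have : Cochain.mapStr (f := fun X : A.Ob => X) (fun _ _ _ => LinearMap.id) p = p := by
        induction p with
        | nil => rfl
        | cons p e ih => rw [Cochain.mapStr, ih]; rfl
      rw [this]; rfl)
    (fun _ he => he)

variable (F : AInfFunctor A B f)

theorem d_lin {X Y : A.Ob} (n m : ℤ) (a : A.Hom X Y n) :
    B.d n m (F.toCochain.lin n n a) = F.toCochain.lin m m (A.d n m a) := by
  by_cases h : m = n + 1
  · subst h
    have := F.rel (str₁ a) (n + 1)
    rw [Cochain.lsum_blocks_str₁, F.toCochain.arrow_eq (str₁ a) (N := n) (by simp [red])] at this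
    refine this.trans ?_
    rw [lsum_cuts3]
    simp only [cuts2, lsum_cons, lsum_nil, List.map_cons, List.map_nil,
      List.nil_append, List.cons_append]
    have z : ∀ {X Y Z : A.Ob} (p : Quiver.Path X Y) (q : Quiver.Path Y Z),
        F.val ((p.cons (A.μ.arrow (Quiver.Path.nil : Quiver.Path Y Y))).comp q) (n + 1) = 0 := by
      intro X Y Z p q
      have : A.μ.arrow (Quiver.Path.nil : Quiver.Path Y Y)
          = (⟨red (Quiver.Path.nil : Quiver.Path Y Y) + 2, 0⟩ : Y ⟶ Y) := by
        simp only [Cochain.arrow, A.μ_nil]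
      rw [this]
      exact F.toCochain.val_zero p _ q _
    simp only [z, smul_zero, zero_add, add_zero, A.arrow_str₁]
    exact one_smul _ _
  · rw [B.d_eq_zero h, A.d_eq_zero h, map_zero]

/-- `F¹` on cocycles. -/
def cocycleMap (X Y : A.Ob) (n : ℤ) : A.cocycles X Y n →ₗ[k] B.cocycles (f X) (f Y) n :=
  (F.toCochain.lin n n).restrict fun a ha => by
    rw [LinearMap.mem_ker] at ha ⊢
    rw [F.d_lin, ha, map_zero]

/-- The map induced by `F¹` on cohomology. -/
def cohMap (X Y : A.Ob) (n : ℤ) : A.HHom X Y n →ₗ[k] B.HHom (f X) (f Y) n :=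
  Submodule.mapQ _ _ (F.cocycleMap X Y n) (by
    rintro a ⟨η, hη⟩
    refine ⟨F.toCochain.lin (n - 1) (n - 1) η, ?_⟩
    rw [F.d_lin, hη]
    rfl)

theorem cohMap_cls {X Y : A.Ob} {n : ℤ} (a : A.cocycles X Y n) :
    F.cohMap X Y n (A.cls a) = B.cls (F.cocycleMap X Y n a) := rfl

theorem lin_bilin {X Y Z : A.Ob} {n₁ n₂ : ℤ} (a : A.Hom X Y n₁) (b : A.Hom Y Z n₂)
    (ha : A.d n₁ (n₁ + 1) a = 0) (hb : A.d n₂ (n₂ + 1) b = 0) :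
    ∃ η, B.d (n₁ + n₂ - 1) (n₁ + n₂) η
      = B.μ.bilin n₁ n₂ (n₁ + n₂) (F.toCochain.lin n₁ n₁ a) (F.toCochain.lin n₂ n₂ b)
        - F.toCochain.lin (n₁ + n₂) (n₁ + n₂) (A.μ.bilin n₁ n₂ (n₁ + n₂) a b) := by
  have key := F.rel (str₂ b a) (n₁ + n₂)
  have z₁ := A.arrow_str₁ a
  have z₂ := A.arrow_str₁ b
  rw [ha] at z₁
  rw [hb] at z₂
  have z : ∀ {X Y Z : A.Ob} (p : Quiver.Path X Y) (q : Quiver.Path Y Z),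
      F.val ((p.cons (A.μ.arrow (Quiver.Path.nil : Quiver.Path Y Y))).comp q) (n₁ + n₂) = 0 := by
    intro X Y Z p q
    have : A.μ.arrow (Quiver.Path.nil : Quiver.Path Y Y)
        = (⟨red (Quiver.Path.nil : Quiver.Path Y Y) + 2, 0⟩ : Y ⟶ Y) := by
      simp only [Cochain.arrow, A.μ_nil]
    rw [this]
    exact F.toCochain.val_zero p _ q _
  have hz : ∀ {U V S T : A.Ob} (p : Quiver.Path U V) (i : ℤ) (q : Quiver.Path S T),
      F.val ((p.cons (⟨i, (0 : A.toGrQuiver.Hom V S i)⟩ : V ⟶ S)).comp q) (n₁ + n₂) = 0 :=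
    fun p i q => F.toCochain.val_zero p i q _
  rw [lsum_cuts3] at key
  simp only [cuts2, lsum_cons, lsum_nil, List.map_cons, List.map_nil,
      List.nil_append, List.cons_append, z, smul_zero, zero_add, add_zero, z₁, z₂, hz,
      A.arrow_str₂, Cochain.lsum_blocks_cons, Cochain.lsum_blocks_nil] at key
  refine ⟨-F.toCochain.val (str₂ b a) (n₁ + n₂ - 1), ?_⟩
  rw [map_neg]
  have e₁ : F.toCochain.arrow (str₂ b a) = (⟨n₁ + n₂ - 1, F.val (str₂ b a) _⟩ : f X ⟶ f Z) :=
    F.toCochain.arrow_eq _ (by simp only [red]; ring)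
  have e₂ : F.toCochain.arrow (str₁ a) = (⟨n₁, F.toCochain.lin n₁ n₁ a⟩ : f X ⟶ f Y) :=
    F.toCochain.arrow_eq _ (by simp only [red]; ring)
  have e₃ : F.toCochain.arrow (str₁ b) = (⟨n₂, F.toCochain.lin n₂ n₂ b⟩ : f Y ⟶ f Z) :=
    F.toCochain.arrow_eq _ (by simp only [red]; ring)
  rw [e₁, e₂, e₃] at key
  have key' : B.d (n₁ + n₂ - 1) (n₁ + n₂) (F.toCochain.val (str₂ b a) (n₁ + n₂ - 1))
      + B.μ.bilin n₁ n₂ (n₁ + n₂) (F.toCochain.lin n₁ n₁ a) (F.toCochain.lin n₂ n₂ b)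
      = F.toCochain.lin (n₁ + n₂) (n₁ + n₂) (A.μ.bilin n₁ n₂ (n₁ + n₂) a b) :=
    key.trans (one_smul _ _)
  rw [← key']
  abel

theorem cohMap_cohBilin {X Y Z : A.Ob} {n₁ n₂ : ℤ} (x : A.HHom X Y n₁) (y : A.HHom Y Z n₂) :
    B.cohBilin _ _ _ n₁ n₂ (n₁ + n₂) (F.cohMap X Y n₁ x) (F.cohMap Y Z n₂ y)
      = F.cohMap X Z (n₁ + n₂) (A.cohBilin X Y Z n₁ n₂ (n₁ + n₂) x y) := by
  obtain ⟨a, rfl⟩ := A.cls_surjective x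
  obtain ⟨b, rfl⟩ := A.cls_surjective y
  rw [AInfCat.cohBilin_cls, cohMap_cls, cohMap_cls, cohMap_cls, AInfCat.cohBilin_cls,
    ← sub_eq_zero, ← map_sub]
  refine (B.cls_eq_zero _).2 ?_
  exact F.lin_bilin a.1 b.1 a.2 b.2

/-- The functor `H F : H A → H B` of cohomological categories, as an `A∞`-functor with only a
linear part. -/
noncomputable def coh : AInfFunctor A.coh B.coh f :=
  ofLin (A := A.coh) (B := B.coh) (fun X Y n => F.cohMap X Y n)
    (fun p => by
      match p with
      | .nil => exact (map_zero (F.cohMap _ _ _)).symm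
      | .cons .nil e => exact (map_zero (F.cohMap _ _ _)).symm
      | .cons (.cons .nil ⟨n₁, x⟩) ⟨n₂, y⟩ =>
        have aux : ∀ N : ℤ, N = n₁ + n₂ → B.cohBilin _ _ _ n₁ n₂ N (F.cohMap _ _ n₁ x)
            (F.cohMap _ _ n₂ y) = F.cohMap _ _ N (A.cohBilin _ _ _ n₁ n₂ N x y) := by
          rintro N rfl
          exact F.cohMap_cohBilin x y
        exact aux _ (by simp only [red]; ring)
      | .cons (.cons (.cons _ _) _) _ => exact (map_zero (F.cohMap _ _ _)).symm)
    (fun {X} e he => by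
      obtain ⟨a, rfl⟩ := A.cls_surjective e
      exact (B.coh_isCohUnit_iff (F.cocycleMap X X 0 a)).2
        (F.unital a.1 ((A.coh_isCohUnit_iff a).1 he)))

end AInfFunctor

/-- The Euler vector field of the cohomological category, which multiplies the elements of
degree `n` by `n`. -/
noncomputable def euler (A : AInfCat.{u, v, w} k) :
    Cochain A.coh.toGrQuiver A.coh.toGrQuiver (fun X => X) (fun X => X) 1 :=
  Cochain.ofLin (fun _ _ n => (n : k) • LinearMap.id)

end LinearFunctors

/-! ### Bimodules -/

section Bimodules

variable {k : Type u} [Field k]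

/-- The graded vector spaces `P(Y, X)`, for objects `X` of `A` and `Y` of `B`, underlying an
`(A, B)`-bimodule. -/
structure GrBimod (A : GrQuiver.{u, v, w} k) (B : GrQuiver.{u, v', w'} k) where
  Mod : B.Ob → A.Ob → ℤ → Type z
  [addCommGroup : ∀ Y X n, AddCommGroup (Mod Y X n)]
  [module : ∀ Y X n, Module k (Mod Y X n)]

attribute [instance] GrBimod.addCommGroup GrBimod.module

/-- A pre-morphism of degree `deg` of graded `(A, B)`-bimodules: a family of multilinear maps
`A(X_{r-1}, X_r) ⊗ ⋯ ⊗ A(X_0, X_1) ⊗ P(Y_0, X_0) ⊗ B(Y_1, Y_0) ⊗ ⋯ ⊗ B(Y_s, Y_{s-1}) → Q(Y_s, X_r)`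
of degree `deg - r - s`. In `val p m q`, the string `p` is `(x_r, …, x_1)` and the string `q` is
`(y_1, …, y_s)`, whose arrow applied first is `y_s`. -/
structure BiCochain {A : GrQuiver.{u, v, w} k} {B : GrQuiver.{u, v', w'} k}
    (P : GrBimod.{u, v, w, v', w', z} A B) (Q : GrBimod.{u, v, w, v', w', z'} A B)
    (deg : ℤ) where
  val : ∀ {X X' : A.Ob} {Y Y' : B.Ob}, Quiver.Path X X' → ∀ {n : ℤ}, P.Mod Y X n →
    Quiver.Path Y' Y → ∀ n' : ℤ, Q.Mod Y' X' n'
  val_eq_zero : ∀ {X X' : A.Ob} {Y Y' : B.Ob} (p : Quiver.Path X X') {n : ℤ} (m : P.Mod Y X n)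
    (q : Quiver.Path Y' Y) (n' : ℤ), n' ≠ red p + n + red q + deg → val p m q n' = 0
  val_add : ∀ {X X' : A.Ob} {Y Y' : B.Ob} (p : Quiver.Path X X') {n : ℤ} (m m' : P.Mod Y X n)
    (q : Quiver.Path Y' Y) (n' : ℤ), val p (m + m') q n' = val p m q n' + val p m' q n'
  val_smul : ∀ {X X' : A.Ob} {Y Y' : B.Ob} (p : Quiver.Path X X') {n : ℤ} (r : k)
    (m : P.Mod Y X n) (q : Quiver.Path Y' Y) (n' : ℤ), val p (r • m) q n' = r • val p m q n'
  left_isML : ∀ {X X' : A.Ob} {Y Y' : B.Ob} {n : ℤ} (m : P.Mod Y X n) (q : Quiver.Path Y' Y)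
    (n' : ℤ), IsML (fun p : Quiver.Path X X' => val p m q n')
  right_isML : ∀ {X X' : A.Ob} {Y Y' : B.Ob} (p : Quiver.Path X X') {n : ℤ} (m : P.Mod Y X n)
    (n' : ℤ), IsML (fun q : Quiver.Path Y' Y => val p m q n')

namespace BiCochain

variable {A : GrQuiver.{u, v, w} k} {B : GrQuiver.{u, v', w'} k}
variable {P : GrBimod.{u, v, w, v', w', z} A B} {Q : GrBimod.{u, v, w, v', w', z'} A B} {deg : ℤ}

/-- The order-zero part `P(Y, X) → Q(Y, X)`. -/
def lin (T : BiCochain P Q deg) {X : A.Ob} {Y : B.Ob} (n n' : ℤ) :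
    P.Mod Y X n →ₗ[k] Q.Mod Y X n' where
  toFun m := T.val .nil m .nil n'
  map_add' m m' := T.val_add _ m m' _ n'
  map_smul' r m := T.val_smul _ r m _ n'

/-- The action `c · m = -(-1)^{|m|} μ^{1|1|0}(c, m)` of a morphism of degree `0` of `A`. -/
def leftAct (μ : BiCochain P P 1) {X X' : A.Ob} {Y : B.Ob} {n : ℤ} (c : A.Hom X X' 0)
    (m : P.Mod Y X n) : P.Mod Y X' n :=
  -(n.negOnePow • μ.val (str₁ c) m .nil n)

/-- The action `m · c = μ^{0|1|1}(m, c)` of a morphism of degree `0` of `B`. -/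
def rightAct (μ : BiCochain P P 1) {X : A.Ob} {Y Y' : B.Ob} {n : ℤ} (m : P.Mod Y X n)
    (c : B.Hom Y' Y 0) : P.Mod Y' X n :=
  μ.val .nil m (str₁ c) n

theorem val_lsum (T : BiCochain P Q deg) {X X' : A.Ob} {Y Y' : B.Ob} (p : Quiver.Path X X')
    {n : ℤ} {α : Type*} (l : List α) (φ : α → P.Mod Y X n) (q : Quiver.Path Y' Y) (n' : ℤ) :
    T.val p (lsum l φ) q n' = lsum l (fun a => T.val p (φ a) q n') :=
  map_lsum (AddMonoidHom.mk' (fun m => T.val p m q n') fun m m' => T.val_add p m m' q n') l φ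

theorem val_units_smul (T : BiCochain P Q deg) {X X' : A.Ob} {Y Y' : B.Ob}
    (p : Quiver.Path X X') {n : ℤ} (s : ℤˣ) (m : P.Mod Y X n) (q : Quiver.Path Y' Y) (n' : ℤ) :
    T.val p (s • m) q n' = s • T.val p m q n' := by
  rw [Units.smul_def, Units.smul_def]
  exact map_zsmul (AddMonoidHom.mk' (fun m => T.val p m q n')
    fun m m' => T.val_add p m m' q n') _ m

end BiCochain

/-- A cohomologically unital `A∞`-bimodule over `(A, B)`. In the relations, the inner operation
is applied to consecutive inputs which either all belong to `A`, or include the element of `P`,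
or all belong to `B`. -/
structure AInfBimodule (A : AInfCat.{u, v, w} k) (B : AInfCat.{u, v', w'} k) where
  toGrBimod : GrBimod.{u, v, w, v', w', z} A.toGrQuiver B.toGrQuiver
  μ : BiCochain toGrBimod toGrBimod 1
  rel : ∀ {X X' : A.Ob} {Y Y' : B.Ob} (p : Quiver.Path X X') {n : ℤ} (m : toGrBimod.Mod Y X n)
    (q : Quiver.Path Y' Y) (n' : ℤ),
    lsum (cuts3 p) (fun c => (red q + n + red c.fst).negOnePow •
        μ.val ((c.fst.cons (A.μ.arrow c.mid)).comp c.last) m q n')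
      + lsum (cuts2 p) (fun a => lsum (cuts2 q) (fun b => (red b.fst).negOnePow •
        μ.val a.snd (μ.val a.fst m b.snd (red a.fst + n + red b.snd + 1)) b.fst n'))
      + lsum (cuts3 q) (fun c => (red c.fst).negOnePow •
        μ.val p m ((c.fst.cons (B.μ.arrow c.mid)).comp c.last) n') = 0
  left_unit : ∀ {X : A.Ob} {Y : B.Ob} (e : A.Hom X X 0), A.IsCohUnit e → ∀ {n : ℤ}
    (m : toGrBimod.Mod Y X n), μ.lin n (n + 1) m = 0 →
    ∃ η : toGrBimod.Mod Y X (n - 1), μ.lin (n - 1) n η = μ.leftAct e m - m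
  right_unit : ∀ {X : A.Ob} {Y : B.Ob} (e : B.Hom Y Y 0), B.IsCohUnit e → ∀ {n : ℤ}
    (m : toGrBimod.Mod Y X n), μ.lin n (n + 1) m = 0 →
    ∃ η : toGrBimod.Mod Y X (n - 1), μ.lin (n - 1) n η = μ.rightAct m e - m

namespace AInfBimodule

section Pullback

variable {A : AInfCat.{u, v, w} k} {B : AInfCat.{u, v', w'} k}
variable {C : AInfCat.{u, v'', w''} k} {D : AInfCat.{u, x, x'} k}
variable {f : A.Ob → C.Ob} {g : B.Ob → D.Ob}

/-- The structure maps of the two-sided pullback. -/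
def pullμ (P : AInfBimodule.{u, v'', w'', x, x', z} C D) (F : AInfFunctor A C f) (G : AInfFunctor B D g) :
    BiCochain (A := A.toGrQuiver) (B := B.toGrQuiver)
      ⟨fun Y X n => P.toGrBimod.Mod (g Y) (f X) n⟩
      ⟨fun Y X n => P.toGrBimod.Mod (g Y) (f X) n⟩ 1 where
  val p _ m q n' := lsum (F.toCochain.blocks p) fun r => lsum (G.toCochain.blocks q) fun t =>
    P.μ.val r m t n'
  val_eq_zero p n m q n' h := lsum_eq_zero fun r hr => lsum_eq_zero fun t ht =>
    P.μ.val_eq_zero r m t n' (by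
      rwa [Cochain.red_of_mem_blocks _ _ r hr, Cochain.red_of_mem_blocks _ _ t ht])
  val_add p n m m' q n' := by simp only [P.μ.val_add, lsum_add]
  val_smul p n r m q n' := by simp only [P.μ.val_smul, smul_lsum]
  left_isML m q n' := F.toCochain.isML_blocks
    (IsML.lsum (fun t => P.μ.left_isML m t n') (G.toCochain.blocks q))
  right_isML p n m n' := by
    simp only [lsum_comm (F.toCochain.blocks p)]
    exact G.toCochain.isML_blocks
      (IsML.lsum (fun r => P.μ.right_isML r m n') (F.toCochain.blocks p))

/-- The two-sided pullback `_F P _G`, which assigns `P(G Y, F X)` to objects `X`, `Y`, with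
structure maps `∑ μ_P(F(…), …, F(…), m, G(…), …, G(…))`. -/
def pull (P : AInfBimodule.{u, v'', w'', x, x', z} C D) (F : AInfFunctor A C f)
    (G : AInfFunctor B D g) : AInfBimodule.{u, v, w, v', w', z} A B where
  toGrBimod := ⟨fun Y X n => P.toGrBimod.Mod (g Y) (f X) n⟩
  μ := P.pullμ F G
  rel {X X' Y Y'} p n m q n' := by
    have S₁ : lsum (cuts3 p) (fun c => (red q + n + red c.fst).negOnePow •
        (P.pullμ F G).val ((c.fst.cons (A.μ.arrow c.mid)).comp c.last) m q n')
        = lsum (F.toCochain.blocks p) (fun r => lsum (G.toCochain.blocks q) (fun t =>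
          lsum (cuts3 r) (fun c => (red t + n + red c.fst).negOnePow •
            P.μ.val ((c.fst.cons (C.μ.arrow c.mid)).comp c.last) m t n'))) := by
      have key := F.lsum_blocks_insert (Φ := fun r => lsum (G.toCochain.blocks q)
        (fun t => P.μ.val r m t n')) (IsML.lsum (fun t => P.μ.left_isML m t n') _) p
      have h1 : lsum (cuts3 p) (fun c => (red q + n + red c.fst).negOnePow •
          (P.pullμ F G).val ((c.fst.cons (A.μ.arrow c.mid)).comp c.last) m q n')
          = (red q + n).negOnePow • lsum (cuts3 p) (fun c => (red c.fst).negOnePow •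
            lsum (F.toCochain.blocks ((c.fst.cons (A.μ.arrow c.mid)).comp c.last))
              (fun r => lsum (G.toCochain.blocks q) (fun t => P.μ.val r m t n'))) := by
        rw [smul_lsum]
        refine lsum_congr fun c _ => ?_
        rw [smul_smul, ← Int.negOnePow_add]
        rfl
      rw [h1, key, smul_lsum]
      refine lsum_congr fun r _ => ?_
      rw [lsum_comm (G.toCochain.blocks q), smul_lsum]
      refine lsum_congr fun c _ => ?_
      rw [smul_smul, ← Int.negOnePow_add, smul_lsum]
      refine lsum_congr fun t ht => ?_
      rw [Cochain.red_of_mem_blocks _ _ t ht]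
    have S₃ : lsum (cuts3 q) (fun c => (red c.fst).negOnePow •
        (P.pullμ F G).val p m ((c.fst.cons (B.μ.arrow c.mid)).comp c.last) n')
        = lsum (F.toCochain.blocks p) (fun r => lsum (G.toCochain.blocks q) (fun t =>
          lsum (cuts3 t) (fun c => (red c.fst).negOnePow •
            P.μ.val r m ((c.fst.cons (D.μ.arrow c.mid)).comp c.last) n'))) := by
      have key := G.lsum_blocks_insert (Φ := fun t => lsum (F.toCochain.blocks p)
        (fun r => P.μ.val r m t n')) (IsML.lsum (fun r => P.μ.right_isML r m n') _) q
      have h1 : lsum (cuts3 q) (fun c => (red c.fst).negOnePow •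
          (P.pullμ F G).val p m ((c.fst.cons (B.μ.arrow c.mid)).comp c.last) n')
          = lsum (cuts3 q) (fun c => (red c.fst).negOnePow •
            lsum (G.toCochain.blocks ((c.fst.cons (B.μ.arrow c.mid)).comp c.last))
              (fun t => lsum (F.toCochain.blocks p) (fun r => P.μ.val r m t n'))) := by
        refine lsum_congr fun c _ => ?_
        rw [lsum_comm (G.toCochain.blocks _)]
        rfl
      rw [h1, key, lsum_comm (F.toCochain.blocks p)]
      refine lsum_congr fun t _ => ?_
      rw [lsum_comm (F.toCochain.blocks p)]
      refine lsum_congr fun c _ => ?_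
      rw [smul_lsum]
    have S₂ : lsum (cuts2 p) (fun a => lsum (cuts2 q) (fun b => (red b.fst).negOnePow •
        (P.pullμ F G).val a.snd ((P.pullμ F G).val a.fst m b.snd
          (red a.fst + n + red b.snd + 1)) b.fst n'))
        = lsum (F.toCochain.blocks p) (fun r => lsum (G.toCochain.blocks q) (fun t =>
          lsum (cuts2 r) (fun a => lsum (cuts2 t) (fun b => (red b.fst).negOnePow •
            P.μ.val a.snd (P.μ.val a.fst m b.snd (red a.fst + n + red b.snd + 1))
              b.fst n')))) := by
      have h1 : ∀ r : Quiver.Path (f X) (f X'), lsum (G.toCochain.blocks q) (fun t =>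
          lsum (cuts2 r) (fun a => lsum (cuts2 t) (fun b => (red b.fst).negOnePow •
            P.μ.val a.snd (P.μ.val a.fst m b.snd (red a.fst + n + red b.snd + 1))
              b.fst n'))) = lsum (cuts2 r) (fun a => lsum (cuts2 q) (fun b =>
            lsum (G.toCochain.blocks b.fst) (fun t => lsum (G.toCochain.blocks b.snd) (fun t' =>
              (red t).negOnePow • P.μ.val a.snd (P.μ.val a.fst m t'
                (red a.fst + n + red t' + 1)) t n')))) := by
        intro r
        rw [lsum_comm (G.toCochain.blocks q)]
        refine lsum_congr fun a _ => ?_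
        rw [Cochain.lsum_blocks_cuts2]
      rw [lsum_congr fun r _ => h1 r, Cochain.lsum_blocks_cuts2]
      refine lsum_congr fun a _ => ?_
      have hc : ∀ r : Quiver.Path (f X) (f a.Z), lsum (F.toCochain.blocks a.snd) (fun r' =>
          lsum (cuts2 q) (fun b => lsum (G.toCochain.blocks b.fst) (fun t =>
            lsum (G.toCochain.blocks b.snd) (fun t' => (red t).negOnePow •
              P.μ.val r' (P.μ.val r m t' (red r + n + red t' + 1)) t n'))))
          = lsum (cuts2 q) (fun b => lsum (F.toCochain.blocks a.snd) (fun r' =>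
            lsum (G.toCochain.blocks b.fst) (fun t => lsum (G.toCochain.blocks b.snd) (fun t' =>
              (red t).negOnePow •
                P.μ.val r' (P.μ.val r m t' (red r + n + red t' + 1)) t n')))) :=
        fun r => lsum_comm _ _ _
      rw [lsum_congr fun r _ => hc r, lsum_comm _ (cuts2 q)]
      refine lsum_congr fun b _ => ?_
      have h2 : ∀ r ∈ F.toCochain.blocks a.fst, lsum (F.toCochain.blocks a.snd) (fun r' =>
          lsum (G.toCochain.blocks b.fst) (fun t => lsum (G.toCochain.blocks b.snd) (fun t' =>
            (red t).negOnePow • P.μ.val r' (P.μ.val r m t' (red r + n + red t' + 1)) t n')))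
          = lsum (F.toCochain.blocks a.snd) (fun r' => lsum (G.toCochain.blocks b.fst) (fun t =>
            lsum (G.toCochain.blocks b.snd) (fun t' => (red b.fst).negOnePow •
              P.μ.val r' (P.μ.val r m t' (red a.fst + n + red b.snd + 1)) t n'))) := by
        intro r hr
        refine lsum_congr fun r' _ => lsum_congr fun t ht => lsum_congr fun t' ht' => ?_
        rw [Cochain.red_of_mem_blocks _ _ t ht, Cochain.red_of_mem_blocks _ _ t' ht',
          Cochain.red_of_mem_blocks _ _ r hr]
      rw [lsum_congr h2, lsum_comm (F.toCochain.blocks a.fst)]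
      simp only [pullμ, smul_lsum]
      refine lsum_congr fun r' _ => ?_
      refine Eq.trans ?_ (lsum_comm (G.toCochain.blocks b.fst) (F.toCochain.blocks a.fst) _)
      refine lsum_congr fun t _ => ?_
      simp only [BiCochain.val_lsum, smul_lsum]
    rw [S₁, S₂, S₃]
    refine (lsum_add₃ _ _ _ _).trans ?_
    refine lsum_eq_zero fun r _ => ?_
    refine (lsum_add₃ _ _ _ _).trans ?_
    exact lsum_eq_zero fun t _ => P.rel r m t n'
  left_unit {X Y} e he n m hm := by
    have hlin : ∀ i j (m : P.toGrBimod.Mod (g Y) (f X) i),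
        (P.pullμ F G).lin i j m = P.μ.lin i j m := fun i j m =>
      (lsum_singleton _ _).trans (lsum_singleton _ _)
    obtain ⟨η, hη⟩ := P.left_unit _ (F.unital e he) m ((hlin _ _ m).symm.trans hm)
    refine ⟨η, (hlin _ _ η).trans (hη.trans ?_)⟩
    congr 1
    have h1 : (P.pullμ F G).val (str₁ e) m .nil n = P.μ.val (.cons .nil
        (F.toCochain.arrow (str₁ e))) m .nil n :=
      (lsum_singleton _ _).trans (lsum_singleton _ _)
    refine Eq.trans ?_ (congrArg (fun y => -(n.negOnePow • y)) h1.symm)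
    rw [F.toCochain.arrow_eq (str₁ e) (N := 0) (by simp [red])]
    rfl
  right_unit {X Y} e he n m hm := by
    have hlin : ∀ i j (m : P.toGrBimod.Mod (g Y) (f X) i),
        (P.pullμ F G).lin i j m = P.μ.lin i j m := fun i j m =>
      (lsum_singleton _ _).trans (lsum_singleton _ _)
    obtain ⟨η, hη⟩ := P.right_unit _ (G.unital e he) m ((hlin _ _ m).symm.trans hm)
    refine ⟨η, (hlin _ _ η).trans (hη.trans ?_)⟩
    congr 1
    have h1 : (P.pullμ F G).val .nil m (str₁ e) n = P.μ.val .nil m (.cons .nil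
        (G.toCochain.arrow (str₁ e))) n :=
      (lsum_singleton _ _).trans (lsum_singleton _ _)
    refine Eq.trans ?_ h1.symm
    rw [G.toCochain.arrow_eq (str₁ e) (N := 0) (by simp [red])]
    rfl

end Pullback

section Diagonal

variable (B : AInfCat.{u, v, w} k)

/-- The structure maps `μ^{r|1|s} = (-1)^{‖y_1‖ + ⋯ + ‖y_s‖ + 1} μ^{r+1+s}` of the diagonal
bimodule. -/
def diagμ : BiCochain (A := B.toGrQuiver) (B := B.toGrQuiver)
    ⟨fun Y X n => B.Hom Y X n⟩ ⟨fun Y X n => B.Hom Y X n⟩ 1 where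
  val {X X' Y Y'} p n m q n' :=
    (red q + 1).negOnePow • B.μ.val ((q.cons (⟨n, m⟩ : Y ⟶ X)).comp p) n'
  val_eq_zero {X X' Y Y'} p n m q n' h := by
    rw [B.μ.val_eq_zero, smul_zero]
    rw [red_marked]
    intro h'
    exact h (h'.trans (by simp only; ring))
  val_add p n m m' q n' := by rw [B.μ.val_add, smul_add]
  val_smul p n r m q n' := by rw [B.μ.val_smul, smul_comm]
  left_isML {X X' Y Y' n} m q n' := IsML.units_smul
    { add := fun p i a b q' => by
        have := B.μ.val_add ((q.cons (⟨n, m⟩ : Y ⟶ X)).comp p) i a b q' n'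
        simpa only [Quiver.Path.comp_assoc, ← Quiver.Path.comp_cons] using this
      smul := fun p i r a q' => by
        have := B.μ.val_smul ((q.cons (⟨n, m⟩ : Y ⟶ X)).comp p) i r a q' n'
        simpa only [Quiver.Path.comp_assoc, ← Quiver.Path.comp_cons] using this } _
  right_isML {X X' Y Y'} p n m n' :=
    { add := fun p' i a b q => by
        have := B.μ.val_add p' i a b ((q.cons (⟨n, m⟩ : Y ⟶ X)).comp p) n'
        simp only [red_marked, ← smul_add, Quiver.Path.comp_assoc, ← Quiver.Path.comp_cons] at this ⊢
        rw [this]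
      smul := fun p' i r a q => by
        have := B.μ.val_smul p' i r a ((q.cons (⟨n, m⟩ : Y ⟶ X)).comp p) n'
        simp only [red_marked, smul_comm r, Quiver.Path.comp_assoc, ← Quiver.Path.comp_cons] at this ⊢
        rw [this] }

/-- The diagonal bimodule `Δ^B`, which assigns `B(Y, X)` to objects `X`, `Y`. -/
def diag : AInfBimodule.{u, v, w, v, w, w} B B where
  toGrBimod := ⟨fun Y X n => B.Hom Y X n⟩
  μ := diagμ B
  rel {X X' Y Y'} p n m q n' := by
    have key := congrArg (fun y => (red q).negOnePow • y)
      (B.rel ((q.cons (⟨n, m⟩ : Y ⟶ X)).comp p) n')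
    simp only [smul_zero] at key
    rw [lsum_cuts3_marked, smul_add, smul_add] at key
    have hp : ∀ c ∈ cuts3 p, (red q + n + red c.fst).negOnePow • ((red q + 1).negOnePow •
        B.μ.val ((q.cons (⟨n, m⟩ : Y ⟶ X)).comp ((c.fst.cons (B.μ.arrow c.mid)).comp c.last)) n')
        = (red q).negOnePow • ((red ((q.cons (⟨n, m⟩ : Y ⟶ X)).comp c.fst)).negOnePow •
          B.μ.val ((((q.cons (⟨n, m⟩ : Y ⟶ X)).comp c.fst).cons (B.μ.arrow c.mid)).comp c.last)
            n') := by
      intro c _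
      rw [smul_smul, smul_smul, ← Int.negOnePow_add, ← Int.negOnePow_add, red_marked]
      congr 1
      · rw [Int.negOnePow_eq_iff]
        exact ⟨1, by ring⟩
      · rw [← Quiver.Path.comp_cons, ← Quiver.Path.comp_assoc]
    have hq : ∀ c ∈ cuts3 q, (red c.fst).negOnePow •
        ((red ((c.fst.cons (B.μ.arrow c.mid)).comp c.last) + 1).negOnePow •
          B.μ.val (((((c.fst.cons (B.μ.arrow c.mid)).comp c.last).cons
            (⟨n, m⟩ : Y ⟶ X)).comp p)) n')
        = (red q).negOnePow • ((red c.fst).negOnePow •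
          B.μ.val ((c.fst.cons (B.μ.arrow c.mid)).comp
            ((c.last.cons (⟨n, m⟩ : Y ⟶ X)).comp p)) n') := by
      intro c hc
      have := red_of_mem_cuts3 q c hc
      rw [smul_smul, smul_smul, ← Int.negOnePow_add, ← Int.negOnePow_add, red_marked]
      congr 1
      · rw [Int.negOnePow_eq_iff]
        refine ⟨1, ?_⟩
        simp only [Cochain.arrow]
        linarith
      · rw [← Quiver.Path.comp_assoc, Quiver.Path.comp_cons]
    have hm : ∀ (a : Cut2 (A := B.toGrQuiver) X X') (_ : a ∈ cuts2 p)
        (b : Cut2 (A := B.toGrQuiver) Y' Y) (_ : b ∈ cuts2 q),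
        (red b.fst).negOnePow • ((red b.fst + 1).negOnePow • B.μ.val ((b.fst.cons
          (⟨red a.fst + n + red b.snd + 1, (red b.snd + 1).negOnePow • B.μ.val
            ((b.snd.cons (⟨n, m⟩ : Y ⟶ X)).comp a.fst) (red a.fst + n + red b.snd + 1)⟩ :
              b.Z ⟶ a.Z)).comp a.snd) n')
        = (red q).negOnePow • ((red b.fst).negOnePow • B.μ.val ((b.fst.cons
          (B.μ.arrow ((b.snd.cons (⟨n, m⟩ : Y ⟶ X)).comp a.fst))).comp a.snd) n') := by
      intro a ha b hb
      have := red_of_mem_cuts2 q b hb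
      rw [B.μ.arrow_eq (N := red a.fst + n + red b.snd + 1) _ (by rw [red_marked]; simp only; ring),
        (B.μ.isML n').insert_units_smul]
      rw [smul_smul, smul_smul, smul_smul, ← Int.negOnePow_add, ← Int.negOnePow_add,
        ← Int.negOnePow_add]
      congr 1
      rw [Int.negOnePow_eq_iff]
      exact ⟨1, by linarith⟩
    simp only [smul_lsum] at key
    rw [← lsum_congr hp, ← lsum_congr hq, lsum_comm (cuts2 q),
      ← lsum_congr fun a ha => lsum_congr fun b hb => hm a ha b hb] at key
    refine Eq.trans ?_ key
    rw [add_comm, add_comm (lsum (cuts3 p) _), ← add_assoc]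
    rfl
  left_unit {X Y} e he n m hm := by
    have hlin : ∀ i j (m : B.Hom Y X i), (diagμ B).lin i j m = -B.d i j m := fun i j m => by
      have h1 : (diagμ B).lin i j m = (0 + 1 : ℤ).negOnePow • B.d i j m := rfl
      rw [h1]; simp
    have hm' : B.d n (n + 1) m = 0 := by
      have := (hlin n (n + 1) m).symm.trans hm
      rwa [neg_eq_zero] at this
    obtain ⟨η, hη⟩ := he.left_unit m hm'
    refine ⟨-η, (hlin _ _ _).trans ?_⟩
    have h2 : (diagμ B).leftAct e m = B.prod e m n := by
      have h1 : (diagμ B).leftAct e m = -(n.negOnePow • ((0 + 1 : ℤ).negOnePow •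
        B.μ.val (str₂ e m) n)) := rfl
      rw [h1]; simp [prodOf]
    rw [map_neg, neg_neg]
    exact hη.trans (congrArg (fun y => y - m) h2.symm)
  right_unit {X Y} e he n m hm := by
    have hlin : ∀ i j (m : B.Hom Y X i), (diagμ B).lin i j m = -B.d i j m := fun i j m => by
      have h1 : (diagμ B).lin i j m = (0 + 1 : ℤ).negOnePow • B.d i j m := rfl
      rw [h1]; simp
    have hm' : B.d n (n + 1) m = 0 := by
      have := (hlin n (n + 1) m).symm.trans hm
      rwa [neg_eq_zero] at this
    obtain ⟨η, hη⟩ := he.right_unit m hm'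
    refine ⟨-η, (hlin _ _ _).trans ?_⟩
    have h2 : (diagμ B).rightAct m e = B.prod m e n := by
      have h1 : (diagμ B).rightAct m e = (red (str₁ e) + 1 : ℤ).negOnePow •
        B.μ.val (str₂ m e) n := rfl
      rw [h1]; simp [prodOf, red]
    rw [map_neg, neg_neg]
    exact hη.trans (congrArg (fun y => y - m) h2.symm)

end Diagonal

end AInfBimodule

end Bimodules

/-! ### Vector fields and purity -/

section Purity

variable {k : Type u} [Field k]

namespace AInfCat

variable (A : AInfCat.{u, v, w} k)

/-- The Hochschild differential of `σ ∈ CC^d(A, A)`, evaluated on a string. -/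
def hochschildD {d : ℤ} (σ : Cochain A.toGrQuiver A.toGrQuiver (fun X => X) (fun X => X) d)
    {X Y : A.Ob} (p : Quiver.Path X Y) (n : ℤ) : A.Hom X Y n :=
  lsum (cuts3 p) (fun c => ((d - 1) * red c.fst).negOnePow •
      A.μ.val ((c.fst.cons (σ.arrow c.mid)).comp c.last) n)
    + lsum (cuts3 p) (fun c => (d + red c.fst).negOnePow •
      σ.val ((c.fst.cons (A.μ.arrow c.mid)).comp c.last) n)

end AInfCat

/-- A pure structure on an `A∞`-category: an nc-vector field `b` (a Hochschild cocycle of degree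
one) together with equivariant structures `c_X` on the objects, `μ¹(c_X) = -b⁰_X`, such that the
chain maps `a ↦ b¹(a) - c_Y · a + a · c_X` act on the cohomology of degree `i` as multiplication
by `i`. If `b⁰ = 0` one can take `c_X = 0`, and the condition is that `b¹` induces the Euler
vector field on cohomology. -/
structure PureStructure (A : AInfCat.{u, v, w} k) where
  b : Cochain A.toGrQuiver A.toGrQuiver (fun X => X) (fun X => X) 1
  closed : ∀ {X Y : A.Ob} (p : Quiver.Path X Y) (n : ℤ), A.hochschildD b p n = 0
  c : ∀ X : A.Ob, A.Hom X X 0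
  d_c : ∀ X : A.Ob, A.d 0 1 (c X) = -b.val (Quiver.Path.nil : Quiver.Path X X) 1
  pure : ∀ {X Y : A.Ob} (i : ℤ) (a : A.Hom X Y i), A.d i (i + 1) a = 0 →
    A.Homologous (b.lin i i a - A.prod (c Y) a i + A.prod a (c X) i) (i • a)

namespace AInfBimodule

variable {A : AInfCat.{u, v, w} k} {B : AInfCat.{u, v', w'} k}
variable (P : AInfBimodule.{u, v, w, v', w', z} A B)

/-- The differential `μ_P ∘ c - (-1)^{|c|} c ∘ (μ_A, μ_P, μ_B)` of a pre-endomorphism `c`. -/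
def endD {deg : ℤ} (c : BiCochain P.toGrBimod P.toGrBimod deg) {X X' : A.Ob} {Y Y' : B.Ob}
    (p : Quiver.Path X X') {n : ℤ} (m : P.toGrBimod.Mod Y X n) (q : Quiver.Path Y' Y) (n' : ℤ) :
    P.toGrBimod.Mod Y' X' n' :=
  lsum (cuts2 p) (fun a => lsum (cuts2 q) (fun b => (deg * red b.fst).negOnePow •
      P.μ.val a.snd (c.val a.fst m b.snd (red a.fst + n + red b.snd + deg)) b.fst n'))
    - deg.negOnePow •
      (lsum (cuts3 p) (fun r => (red q + n + red r.fst).negOnePow •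
          c.val ((r.fst.cons (A.μ.arrow r.mid)).comp r.last) m q n')
        + lsum (cuts2 p) (fun a => lsum (cuts2 q) (fun b => (red b.fst).negOnePow •
          c.val a.snd (P.μ.val a.fst m b.snd (red a.fst + n + red b.snd + 1)) b.fst n'))
        + lsum (cuts3 q) (fun r => (red r.fst).negOnePow •
          c.val p m ((r.fst.cons (B.μ.arrow r.mid)).comp r.last) n'))

/-- The left multiplication `ν_A(b)` by an nc-vector field of `A`, with the sign for which the
order-zero part is `m ↦ (-1)^{|m|} b⁰ · m`. -/
def nuLeft (b : Cochain A.toGrQuiver A.toGrQuiver (fun X => X) (fun X => X) 1) {X X' : A.Ob}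
    {Y Y' : B.Ob} (p : Quiver.Path X X') {n : ℤ} (m : P.toGrBimod.Mod Y X n)
    (q : Quiver.Path Y' Y) (n' : ℤ) : P.toGrBimod.Mod Y' X' n' :=
  -lsum (cuts3 p) (fun r => P.μ.val ((r.fst.cons (b.arrow r.mid)).comp r.last) m q n')

/-- The right multiplication `ν_B(b)` by an nc-vector field of `B`. -/
def nuRight (b : Cochain B.toGrQuiver B.toGrQuiver (fun X => X) (fun X => X) 1) {X X' : A.Ob}
    {Y Y' : B.Ob} (p : Quiver.Path X X') {n : ℤ} (m : P.toGrBimod.Mod Y X n)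
    (q : Quiver.Path Y' Y) (n' : ℤ) : P.toGrBimod.Mod Y' X' n' :=
  lsum (cuts3 q) (fun r => P.μ.val p m ((r.fst.cons (b.arrow r.mid)).comp r.last) n')

/-- `P` carries a pure equivariant structure: a pre-endomorphism `c_P` of degree zero with
`d c_P = ν_A(b_A) - ν_B(b_B)` such that the chain maps `φ ↦ c_P(φ) - c_X · φ + φ · c_Y` on
`P(Y, X)` act on the cohomology of degree `i` as multiplication by `i`. -/
def IsPure (sA : PureStructure A) (sB : PureStructure B) : Prop :=
  ∃ c : BiCochain P.toGrBimod P.toGrBimod 0,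
    (∀ {X X' : A.Ob} {Y Y' : B.Ob} (p : Quiver.Path X X') {n : ℤ} (m : P.toGrBimod.Mod Y X n)
      (q : Quiver.Path Y' Y) (n' : ℤ),
      P.endD c p m q n' = P.nuLeft sA.b p m q n' - P.nuRight sB.b p m q n') ∧
    ∀ {X : A.Ob} {Y : B.Ob} (i : ℤ) (φ : P.toGrBimod.Mod Y X i), P.μ.lin i (i + 1) φ = 0 →
      ∃ η : P.toGrBimod.Mod Y X (i - 1), P.μ.lin (i - 1) i η
        = c.lin i i φ - P.μ.leftAct (sA.c X) φ + P.μ.rightAct φ (sB.c Y) - i • φ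

end AInfBimodule

end Purity

/-! ### Functors: graph bimodules, natural transformations, formality -/

section Functors

variable {k : Type u} [Field k]

namespace AInfFunctor

section Graph

variable {A : AInfCat.{u, v, w} k} {B : AInfCat.{u, v', w'} k} {f : A.Ob → B.Ob}

/-- The left pullback `_F Δ^B` of the diagonal bimodule, an `(A, B)`-bimodule. -/
noncomputable def leftGraph (F : AInfFunctor A B f) : AInfBimodule.{u, v, w, v', w', w'} A B :=
  (AInfBimodule.diag B).pull F (AInfFunctor.id B)

/-- The right pullback `Δ^B_F` of the diagonal bimodule, a `(B, A)`-bimodule. -/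
noncomputable def rightGraph (F : AInfFunctor A B f) : AInfBimodule.{u, v', w', v, w, w'} B A :=
  (AInfBimodule.diag B).pull (AInfFunctor.id B) F

/-- The two-sided pullback `_F Δ^B_F` of the diagonal bimodule, an `(A, A)`-bimodule. -/
def twoSidedGraph (F : AInfFunctor A B f) : AInfBimodule.{u, v, w, v, w, w'} A A :=
  (AInfBimodule.diag B).pull F F

/-- A functor is pure if one of its graph bimodules `_F Δ^B`, `Δ^B_F` carries a pure equivariant
structure. -/
def IsPure (F : AInfFunctor A B f) (sA : PureStructure A) (sB : PureStructure B) : Prop :=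
  F.leftGraph.IsPure sA sB ∨ F.rightGraph.IsPure sB sA

end Graph

section Transformations

variable {A : AInfCat.{u, v, w} k} {B : AInfCat.{u, v', w'} k} {f g h : A.Ob → B.Ob}

/-- The differential of a pre-natural transformation `T : F → G` of degree `d`, evaluated on a
string. -/
def homD (F : AInfFunctor A B f) (G : AInfFunctor A B g) {d : ℤ}
    (T : Cochain A.toGrQuiver B.toGrQuiver f g d) {X Y : A.Ob} (p : Quiver.Path X Y) (n : ℤ) :
    B.Hom (f X) (g Y) n :=
  lsum (cuts3 p) (fun c => lsum (F.toCochain.blocks c.fst) (fun r =>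
      lsum (G.toCochain.blocks c.last) (fun t => ((d - 1) * red c.fst).negOnePow •
        B.μ.val ((r.cons (T.arrow c.mid)).comp t) n)))
    - (d - 1).negOnePow • lsum (cuts3 p) (fun c => (red c.fst).negOnePow •
        T.val ((c.fst.cons (A.μ.arrow c.mid)).comp c.last) n)

/-- The composition `μ²(S, T)` of pre-natural transformations `T : F → G` and `S : G → H`,
evaluated on a string. -/
def homMul (F : AInfFunctor A B f) (G : AInfFunctor A B g) (H : AInfFunctor A B h) {d e : ℤ}
    (S : Cochain A.toGrQuiver B.toGrQuiver g h e) (T : Cochain A.toGrQuiver B.toGrQuiver f g d)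
    {X Y : A.Ob} (p : Quiver.Path X Y) (n : ℤ) : B.Hom (f X) (h Y) n :=
  lsum (cuts3 p) (fun a => lsum (cuts3 a.last) (fun b =>
    lsum (F.toCochain.blocks a.fst) (fun r => lsum (G.toCochain.blocks b.fst) (fun s =>
      lsum (H.toCochain.blocks b.last) (fun t =>
        ((d - 1) * red a.fst + (e - 1) * (red a.fst + red a.mid + red b.fst)).negOnePow •
          B.μ.val ((((r.cons (T.arrow a.mid)).comp s).cons (S.arrow b.mid)).comp t) n)))))

/-- The nc-vector fields `a` of `A` and `b` of `B` agree under `F`: the cochains `F ∘ a` and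
`b ∘ F` of `CC^1(A, B)` differ by a coboundary. -/
def Relates (F : AInfFunctor A B f)
    (a : Cochain A.toGrQuiver A.toGrQuiver (fun X => X) (fun X => X) 1)
    (b : Cochain B.toGrQuiver B.toGrQuiver (fun X => X) (fun X => X) 1) : Prop :=
  ∃ T : Cochain A.toGrQuiver B.toGrQuiver f f 0,
    ∀ {X Y : A.Ob} (p : Quiver.Path X Y) (n : ℤ),
      homD F F T p n
        = lsum (cuts3 p) (fun c => F.val ((c.fst.cons (a.arrow c.mid)).comp c.last) n)
          - lsum (F.toCochain.blocks p) (fun q => b.val q n)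

end Transformations

section Equivalences

variable {A : AInfCat.{u, v, w} k} {B : AInfCat.{u, v', w'} k} {f g : A.Ob → B.coh.Ob}

/-- The identity transformation of a functor with values in a cohomological category, evaluated
on a string: it has order zero, and is given by the units. -/
noncomputable def idVal (f : A.Ob → B.coh.Ob) {X : A.Ob} :
    ∀ {Y : A.Ob}, Quiver.Path X Y → ∀ n : ℤ, B.coh.Hom (f X) (f Y) n
  | _, .nil, n => Pi.single (M := fun n => B.coh.Hom (f X) (f X) n) 0 (B.hUnit (f X)) n
  | _, .cons _ _, _ => 0

/-- Two functors with values in a cohomological category are equivalent if they are isomorphic in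
the degree zero cohomology of the `A∞`-category of functors. -/
def NatEquiv (F : AInfFunctor A B.coh f) (G : AInfFunctor A B.coh g) : Prop :=
  ∃ (T : Cochain A.toGrQuiver B.coh.toGrQuiver f g 0)
    (S : Cochain A.toGrQuiver B.coh.toGrQuiver g f 0)
    (U : Cochain A.toGrQuiver B.coh.toGrQuiver f f (-1))
    (V : Cochain A.toGrQuiver B.coh.toGrQuiver g g (-1)),
    ∀ {X Y : A.Ob} (p : Quiver.Path X Y) (n : ℤ),
      homD F G T p n = 0 ∧ homD G F S p n = 0 ∧
      homMul F G F S T p n - idVal f p n = homD F F U p n ∧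
      homMul G F G T S p n - idVal g p n = homD G G V p n

end Equivalences

end AInfFunctor

/-- An equivalence `ψ : H A → A` as induced by a pure structure, with an inverse `θ : A → H A`:
both fix the objects, `ψ` induces the identity on cohomology, and the pullback of `b` agrees with
the Euler vector field of `H A`. -/
structure FormalityEquiv (A : AInfCat.{u, v, w} k) (s : PureStructure A) where
  ψ : AInfFunctor A.coh A (fun X => X)
  coh_ψ : ∀ {X Y : A.Ob} {n : ℤ} (a : A.cocycles X Y n),
    A.Homologous (ψ.toCochain.lin n n (A.cls a)) a.1
  euler_ψ : ψ.Relates (euler A) s.b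
  θ : AInfFunctor A A.coh (fun X => X)
  θ_ψ : AInfFunctor.NatEquiv (θ.comp ψ) (AInfFunctor.id A.coh)

namespace AInfFunctor

variable {A : AInfCat.{u, v, w} k} {B : AInfCat.{u, v', w'} k} {f : A.Ob → B.Ob}

/-- The functor `H F` is equivalent to the composition `H A → A → B → H B` formed with the given
equivalences. -/
def IsFormalWith (F : AInfFunctor A B f) {sA : PureStructure A} {sB : PureStructure B}
    (EA : FormalityEquiv A sA) (EB : FormalityEquiv B sB) : Prop :=
  NatEquiv F.coh (EB.θ.comp (F.comp EA.ψ))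

/-- `F` is formal, with respect to equivalences induced by pure structures. -/
def IsFormal (F : AInfFunctor A B f) (sA : PureStructure A) (sB : PureStructure B) : Prop :=
  ∃ (EA : FormalityEquiv A sA) (EB : FormalityEquiv B sB), F.IsFormalWith EA EB

end AInfFunctor

end Functors

end AInf

/-!
A pure structure is an infinitesimal grading operator. On a complex which is built from it, it
induces an operator that commutes with the differential and acts on the cohomology of each order
with a weight which depends only on the degree and on the number of inputs. In characteristic zero,
obstructions of nonzero weight vanish, and all constructions below proceed by this principle, one
order at a time. The leading term of a differential only involves `μ¹` (`homDC_leading`), and a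
choice of primitives (`exists_contraction`) solves the equation at each order.

All signs are confined to one operation, the insertion `ins F G T Φ p` of a cochain `T` along a pair
of functors, which is the transpose of a coderivation of the bar construction. Its composition law
`ins_ins` contains `homDC_homDC`, the Bianchi identities for the failure of the functor relations,
and the compatibility with compositions of functors (`homDC_insC`, `homDC_pre`).

*Categories with a pure structure are formal* (`PureStructure.nonempty_formalityEquiv`). A functor
`ψ : H A → A` and a homotopy `T` between `ψ ∘ e` and `b ∘ ψ` are constructed together. At order `m`
the obstruction to the functor relations has weight `2 - m` (`exact_functorDefect`), and that to the
equation for `T` has weight `1 - m` (`exists_fieldDefect_exact`). The two exceptional orders are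
those at which the obstruction vanishes by the choice of cocycle representatives.

*Formal functors are pure, and all their graph bimodules are.* The linear functor `H F` preserves
the Euler fields. Equivalent functors also preserve them, up to homotopy (`isRelated_of_natEquiv`),
and the quasi-equivalences `ψ_A` and `θ_B` can be cancelled (`IsRelated.of_comp_right`,
`IsRelated.of_comp_left`), so that the vector fields of `A` and `B` agree under `F`, together with
the equivariant structures (`IsFormalWith.isRelated`). The vector field of `B` is a pure equivariant
structure on the diagonal bimodule (`diag_isPure`), and purity is inherited by pullbacks under
functors which relate the pure structures (`AInfBimodule.IsPure.pull`). Hence all three graph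
bimodules are pure (`IsRelated.graphs_isPure`).

*Pure functors are formal* (`AInfFunctor.IsPure.isFormalWith`). The pullback of a pure graph
bimodule to `H A` is one of the bimodules `B(ψ_B HF, F ψ_A)` and `B(F ψ_A, ψ_B HF)`, pure with
respect to the Euler fields. Cochains with values in it are the pre-natural transformations between
the two functors (`homDC_eq_evD`). The pure equivariant structure yields an operator on them which
commutes with the differential (`evD_evEuler`) and has weight `d - m` in degree `d` and order `m`
(`evEuler_leading`). The units are natural up to homotopy, because both functors induce `H F` on
cohomology, and the obstructions to extending them have nonzero weight (`exists_natural`). This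
argument applies to either graph bimodule, so that purity of one implies formality, which in turn
implies purity of all.
-/

namespace AInf

variable {k : Type u} [Field k]

/-- The underlying graded quiver of an `A∞`-category. -/
notation:max A:max "ᵍ" => AInfCat.toGrQuiver A

/-- The composable strings of homogeneous morphisms of a graded quiver. -/
local notation "Path" => Quiver.Path

/-! ### The vector space of cochains -/

theorem negOnePow_congr {a b : ℤ} (h : Even (a - b)) : a.negOnePow = b.negOnePow :=
  (Int.negOnePow_eq_iff a b).2 h

namespace Cochain

section Group

variable {A : GrQuiver k} {B : GrQuiver k} {f g : A.Ob → B.Ob} {d : ℤ}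

@[ext]
theorem ext {T S : Cochain A B f g d}
    (h : ∀ {X Y : A.Ob} (p : Path X Y) (n : ℤ), T.val p n = S.val p n) : T = S := by
  have : @T.val = @S.val := by
    funext X Y p n
    exact h p n
  cases T
  cases S
  congr

instance : Zero (Cochain A B f g d) :=
  ⟨⟨fun _ _ => 0, fun _ _ _ => rfl, fun _ _ _ _ _ _ => (add_zero _).symm,
    fun _ _ _ _ _ _ => (smul_zero _).symm⟩⟩

instance : Add (Cochain A B f g d) :=
  ⟨fun T S => ⟨fun p n => T.val p n + S.val p n,
    fun p n h => by rw [T.val_eq_zero p n h, S.val_eq_zero p n h, add_zero],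
    fun p i a b q n => by rw [T.val_add, S.val_add, add_add_add_comm],
    fun p i r a q n => by rw [T.val_smul, S.val_smul, smul_add]⟩⟩

instance : Neg (Cochain A B f g d) :=
  ⟨fun T => ⟨fun p n => -T.val p n,
    fun p n h => by rw [T.val_eq_zero p n h, neg_zero],
    fun p i a b q n => by rw [T.val_add, neg_add],
    fun p i r a q n => by rw [T.val_smul, smul_neg]⟩⟩

instance : SMul k (Cochain A B f g d) :=
  ⟨fun c T => ⟨fun p n => c • T.val p n,
    fun p n h => by rw [T.val_eq_zero p n h, smul_zero],
    fun p i a b q n => by rw [T.val_add, smul_add],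
    fun p i r a q n => by rw [T.val_smul, smul_comm]⟩⟩

theorem zero_val {X Y : A.Ob} (p : Path X Y) (n : ℤ) :
    (0 : Cochain A B f g d).val p n = 0 := rfl

theorem add_val (T S : Cochain A B f g d) {X Y : A.Ob} (p : Path X Y) (n : ℤ) :
    (T + S).val p n = T.val p n + S.val p n := rfl

theorem neg_val (T : Cochain A B f g d) {X Y : A.Ob} (p : Path X Y) (n : ℤ) :
    (-T).val p n = -T.val p n := rfl

theorem smul_val (c : k) (T : Cochain A B f g d) {X Y : A.Ob} (p : Path X Y) (n : ℤ) :
    (c • T).val p n = c • T.val p n := rfl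

instance : AddCommGroup (Cochain A B f g d) where
  add_assoc _ _ _ := ext fun _ _ => add_assoc _ _ _
  zero_add _ := ext fun _ _ => zero_add _
  add_zero _ := ext fun _ _ => add_zero _
  add_comm _ _ := ext fun _ _ => add_comm _ _
  neg_add_cancel _ := ext fun _ _ => neg_add_cancel _
  nsmul := nsmulRec
  zsmul := zsmulRec

/-- Evaluation on a string, as an additive map. -/
def valHom {X Y : A.Ob} (p : Path X Y) (n : ℤ) :
    Cochain A B f g d →+ B.Hom (f X) (g Y) n where
  toFun T := T.val p n
  map_zero' := rfl
  map_add' _ _ := rfl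

theorem sub_val (T S : Cochain A B f g d) {X Y : A.Ob} (p : Path X Y) (n : ℤ) :
    (T - S).val p n = T.val p n - S.val p n := map_sub (valHom p n) T S

theorem units_smul_val (s : ℤˣ) (T : Cochain A B f g d) {X Y : A.Ob} (p : Path X Y)
    (n : ℤ) : (s • T).val p n = s • T.val p n := by
  rw [Units.smul_def, Units.smul_def]
  exact map_zsmul (valHom p n) _ T

end Group

end Cochain

/-! ### Sums over decompositions -/

section ML

variable {A : GrQuiver k} {B : GrQuiver k}
variable {M : Type*} [AddCommGroup M] {N : Type*} [AddCommGroup N]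

theorem lsum_sub {α : Type*} (l : List α) (φ ψ : α → M) :
    lsum l (fun a => φ a - ψ a) = lsum l φ - lsum l ψ := by
  induction l with
  | nil => simp [lsum]
  | cons a l ih => rw [lsum_cons, ih, lsum_cons, lsum_cons]; abel

theorem lsum_neg {α : Type*} (l : List α) (φ : α → M) :
    lsum l (fun a => -φ a) = -lsum l φ := by
  induction l with
  | nil => simp [lsum]
  | cons a l ih => rw [lsum_cons, ih, lsum_cons]; abel

namespace IsML

variable [Module k M] [Module k N]

theorem comp_right {X Y Z : A.Ob} {Φ : Path X Z → M} (h : IsML Φ) (q : Path Y Z) :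
    IsML (fun p : Path X Y => Φ (p.comp q)) where
  add p i a b r := by
    simp only [Quiver.Path.comp_assoc]
    exact h.add p i a b _
  smul p i c a r := by
    simp only [Quiver.Path.comp_assoc]
    exact h.smul p i c a _

theorem comp_left {X Y Z : A.Ob} {Φ : Path X Z → M} (h : IsML Φ) (q : Path X Y) :
    IsML (fun p : Path Y Z => Φ (q.comp p)) where
  add p i a b r := by
    simp only [← Quiver.Path.comp_assoc, Quiver.Path.comp_cons]
    exact h.add _ i a b _
  smul p i c a r := by
    simp only [← Quiver.Path.comp_assoc, Quiver.Path.comp_cons]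
    exact h.smul _ i c a _

theorem add' {X Y : A.Ob} {Φ Ψ : Path X Y → M} (h : IsML Φ) (h' : IsML Ψ) :
    IsML (fun p => Φ p + Ψ p) where
  add p i a b q := by simp only [h.add, h'.add]; abel
  smul p i r a q := by simp only [h.smul, h'.smul, smul_add]

theorem sub {X Y : A.Ob} {Φ Ψ : Path X Y → M} (h : IsML Φ) (h' : IsML Ψ) :
    IsML (fun p => Φ p - Ψ p) where
  add p i a b q := by simp only [h.add, h'.add]; abel
  smul p i r a q := by simp only [h.smul, h'.smul, smul_sub]

/-- A function of two strings which is multilinear in each gives, by summing over the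
decompositions of a string, a multilinear function. The units `s` allow for signs depending on
the reduced degrees. -/
theorem cuts2 {X Y : A.Ob} {Φ : ∀ Z : A.Ob, Path X Z → Path Z Y → M}
    (h₁ : ∀ Z (q : Path Z Y), IsML (fun p => Φ Z p q))
    (h₂ : ∀ Z (p : Path X Z), IsML (fun q => Φ Z p q)) (s : ℤ → ℤ → ℤˣ) :
    IsML (fun p => AInf.lsum (AInf.cuts2 p)
      (fun c => s (red c.fst) (red c.snd) • Φ c.Z c.fst c.snd)) where
  add p i a b q := by
    simp only [lsum_cuts2_marked, red_marked, (h₁ _ _).add, (h₂ _ _).add, smul_add, lsum_add]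
    abel
  smul p i r a q := by
    simp only [lsum_cuts2_marked, red_marked, (h₁ _ _).smul, (h₂ _ _).smul, smul_comm _ r,
      smul_add, smul_lsum]

end IsML

end ML

namespace Cochain

section Ins

variable {A : GrQuiver k} {B : GrQuiver k} {C : GrQuiver k}
variable {f g : A.Ob → B.Ob} {d e : ℤ}
variable {M : Type*} [AddCommGroup M] {N : Type*} [AddCommGroup N]

theorem add_arrow (T S : Cochain A B f g d) {X Y : A.Ob} (p : Path X Y) :
    (T + S).arrow p = (⟨red p + d, T.val p (red p + d) + S.val p (red p + d)⟩ : f X ⟶ g Y) := rfl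

/-- The sum over all ways of applying `T` to one block of consecutive (possibly no) inputs of a
string, `F` to blocks of the inputs before and `G` to blocks of the inputs after it, and then
`Φ`. It is the transpose of the coderivation along `(F, G)` which `T` induces on strings. -/
def ins (F : Cochain A B f f 1) (G : Cochain A B g g 1) (T : Cochain A B f g d)
    {X Y : A.Ob} (Φ : Path (f X) (g Y) → M) (p : Path X Y) : M :=
  lsum (cuts3 p) fun c => lsum (F.blocks c.fst) fun r => lsum (G.blocks c.last) fun t =>
    ((d - 1) * red c.fst).negOnePow • Φ ((r.cons (T.arrow c.mid)).comp t)

variable (F : Cochain A B f f 1) (G : Cochain A B g g 1) (T S : Cochain A B f g d)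
variable {X Y : A.Ob}

theorem ins_congr {Φ Ψ : Path (f X) (g Y) → M} (h : ∀ q, Φ q = Ψ q)
    (p : Path X Y) : ins F G T Φ p = ins F G T Ψ p := by
  rw [show Φ = Ψ from funext h]

theorem ins_map (L : M →+ N) (Φ : Path (f X) (g Y) → M) (p : Path X Y) :
    L (ins F G T Φ p) = ins F G T (fun q => L (Φ q)) p := by
  simp only [ins, map_lsum, Units.smul_def, map_zsmul]

theorem ins_lsum {α : Type*} (l : List α) (Φ : α → Path (f X) (g Y) → M)
    (p : Path X Y) :
    ins F G T (fun q => lsum l fun a => Φ a q) p = lsum l fun a => ins F G T (Φ a) p := by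
  simp only [ins, smul_lsum]
  rw [lsum_comm l]
  refine lsum_congr fun c _ => ?_
  rw [lsum_comm l]
  refine lsum_congr fun r _ => ?_
  rw [lsum_comm l]

theorem ins_add (Φ Ψ : Path (f X) (g Y) → M) (p : Path X Y) :
    ins F G T (fun q => Φ q + Ψ q) p = ins F G T Φ p + ins F G T Ψ p := by
  simp only [ins, smul_add, lsum_add]

theorem ins_units_smul (s : ℤˣ) (Φ : Path (f X) (g Y) → M) (p : Path X Y) :
    ins F G T (fun q => s • Φ q) p = s • ins F G T Φ p := by
  simp only [ins, smul_lsum, smul_comm s]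

theorem ins_zero_fun (p : Path X Y) : ins F G T (fun _ => (0 : M)) p = 0 := by
  simp only [ins, smul_zero, lsum_zero]

theorem ins_sub (Φ Ψ : Path (f X) (g Y) → M) (p : Path X Y) :
    ins F G T (fun q => Φ q - Ψ q) p = ins F G T Φ p - ins F G T Ψ p := by
  simp only [ins, smul_sub, lsum_sub]

section

variable [Module k M] [Module k N] {Φ : Path (f X) (g Y) → M}

theorem ins_add_left (hΦ : IsML Φ) (p : Path X Y) :
    ins F G (T + S) Φ p = ins F G T Φ p + ins F G S Φ p := by
  simp only [ins, add_arrow, hΦ.add, smul_add, lsum_add]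
  rfl

theorem ins_k_smul_left (c : k) (hΦ : IsML Φ) (p : Path X Y) :
    ins F G (c • T) Φ p = c • ins F G T Φ p := by
  have : ∀ {Z W : A.Ob} (q : Path Z W), (c • T).arrow q
    = (⟨red q + d, c • T.val q (red q + d)⟩ : f Z ⟶ g W) := fun _ => rfl
  simp only [ins, this, hΦ.smul, smul_comm _ c, smul_lsum]
  rfl

/-- `T ↦ ins F G T Φ p` as an additive map. -/
def insHom (hΦ : IsML Φ) (p : Path X Y) : Cochain A B f g d →+ M :=
  AddMonoidHom.mk' (fun T => ins F G T Φ p) fun T S => ins_add_left F G T S hΦ p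

theorem ins_sub_left (hΦ : IsML Φ) (p : Path X Y) :
    ins F G (T - S) Φ p = ins F G T Φ p - ins F G S Φ p := map_sub (insHom F G hΦ p) T S

theorem ins_zero_left (hΦ : IsML Φ) (p : Path X Y) :
    ins F G (0 : Cochain A B f g d) Φ p = 0 := map_zero (insHom F G hΦ p)

theorem ins_units_smul_left (s : ℤˣ) (hΦ : IsML Φ) (p : Path X Y) :
    ins F G (s • T) Φ p = s • ins F G T Φ p := by
  rw [Units.smul_def, Units.smul_def]
  exact map_zsmul (insHom F G hΦ p) _ T

theorem isML_arrow (hΦ : IsML Φ) {Z W : A.Ob} (r : Path (f X) (f Z))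
    (t : Path (g W) (g Y)) :
    IsML (fun q : Path Z W => Φ ((r.cons (T.arrow q)).comp t)) where
  add p i a b q := by
    simp only [arrow_marked, T.val_add]
    exact hΦ.add r _ _ _ t
  smul p i c a q := by
    simp only [arrow_marked, T.val_smul]
    exact hΦ.smul r _ _ _ t

theorem ins_eq_cuts2 (Φ : Path (f X) (g Y) → M) (p : Path X Y) :
    ins F G T Φ p = lsum (cuts2 p) fun c => ((d - 1) * red c.fst).negOnePow •
      lsum (F.blocks c.fst) fun r => lsum (cuts2 c.snd) fun c' => lsum (G.blocks c'.snd) fun t =>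
        Φ ((r.cons (T.arrow c'.fst)).comp t) := by
  rw [ins, lsum_cuts3]
  refine lsum_congr fun c _ => ?_
  simp only [smul_lsum]
  rw [lsum_comm]

theorem isML_ins_aux (hΦ : IsML Φ) {Z : A.Ob} (r : Path (f X) (f Z)) :
    IsML (fun q : Path Z Y => lsum (cuts2 q) fun c' => lsum (G.blocks c'.snd) fun t =>
        Φ ((r.cons (T.arrow c'.fst)).comp t)) := by
  have := IsML.cuts2 (A := A) (X := Z) (Y := Y) (Φ := fun W p q => lsum (G.blocks q) fun t =>
        Φ ((r.cons (T.arrow p)).comp t))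
    (fun W q => IsML.lsum (fun t => isML_arrow T hΦ r t) _)
    (fun W p => G.isML_blocks (hΦ.comp_left _)) (fun _ _ => 1)
  simpa only [one_smul] using this

theorem isML_ins (hΦ : IsML Φ) : IsML (fun p : Path X Y => ins F G T Φ p) := by
  have := IsML.cuts2 (A := A) (X := X) (Y := Y) (Φ := fun Z p q => lsum (F.blocks p) fun r =>
      lsum (cuts2 q) fun c' => lsum (G.blocks c'.snd) fun t => Φ ((r.cons (T.arrow c'.fst)).comp t))
    (fun Z q => F.isML_blocks (IsML.lsum (Φ := fun (c : Cut2 Z Y) r => lsum (G.blocks c.snd)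
      fun t => Φ ((r.cons (T.arrow c.fst)).comp t)) (fun c => IsML.lsum (fun t =>
      (hΦ.comp_right t).cons (T.arrow c.fst)) _) _))
    (fun Z p => IsML.lsum (fun r => isML_ins_aux G T hΦ r) _)
    (fun a _ => ((d - 1) * a).negOnePow)
  simpa only [ins_eq_cuts2] using this

end

variable {h h' : B.Ob → C.Ob}

/-- The cochain `p ↦ ∑ ± S(F(…), …, T(…), …, G(…))`. -/
def insC (S : Cochain B C h h' e) (r : ℤ) (hr : r = d + e - 1 := by omega) :
    Cochain A C (fun X => h (f X)) (fun X => h' (g X)) r where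
  val p n := ins F G T (fun q => S.val q n) p
  val_eq_zero p n hn := by
    refine lsum_eq_zero fun c hc => lsum_eq_zero fun r hr' => lsum_eq_zero fun t ht => ?_
    refine (congrArg _ (S.val_eq_zero _ _ ?_)).trans (smul_zero _)
    rw [red_marked, F.red_of_mem_blocks _ r hr', G.red_of_mem_blocks _ t ht]
    have := red_of_mem_cuts3 _ c hc
    simp only [arrow]
    omega
  val_add p i a b q n := (isML_ins F G T (S.isML n)).add p i a b q
  val_smul p i r a q n := (isML_ins F G T (S.isML n)).smul p i r a q

theorem insC_val (S : Cochain B C h h' e) (r : ℤ) (hr : r = d + e - 1) (p : Path X Y)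
    (n : ℤ) : (insC F G T S r hr).val p n = ins F G T (fun q => S.val q n) p := rfl

/-- The cochain `p ↦ ∑ S(F(…), …, F(…))`. -/
def pre (S : Cochain B C h h' e) (F : Cochain A B f f 1) :
    Cochain A C (fun X => h (f X)) (fun X => h' (f X)) e where
  val p n := lsum (F.blocks p) (fun r => S.val r n)
  val_eq_zero p n h := lsum_eq_zero fun r hr => S.val_eq_zero r n (by
    rwa [F.red_of_mem_blocks p r hr])
  val_add p i a b q n := (F.isML_blocks (S.isML n)).add p i a b q
  val_smul p i r a q n := (F.isML_blocks (S.isML n)).smul p i r a q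

theorem pre_val (S : Cochain B C h h' e) (F : Cochain A B f f 1) (p : Path X Y) (n : ℤ) :
    (S.pre F).val p n = lsum (F.blocks p) (fun r => S.val r n) := rfl

end Ins
end Cochain

/-! ### Inserting a cochain into a string -/

section Coassoc

variable {A : GrQuiver k} {M : Type*} [AddCommGroup M] {X Y : A.Ob}

theorem cuts3_fst_coassoc (p : Path X Y)
    (φ : ∀ {Z W V : A.Ob}, Path X Z → Path Z W → Path W V →
      Path V Y → M) :
    lsum (cuts3 p) (fun c => lsum (cuts2 c.fst) (fun a => φ a.fst a.snd c.mid c.last))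
      = lsum (cuts2 p) (fun a => lsum (cuts3 a.snd) (fun c => φ a.fst c.fst c.mid c.last)) := by
  have h := cuts2_coassoc p (fun x y z => lsum (cuts2 z) (fun b => φ x y b.fst b.snd))
  simp only [lsum_cuts3]
  rw [← h]
  refine lsum_congr fun c _ => ?_
  rw [lsum_comm]

theorem cuts3_last_coassoc (p : Path X Y)
    (φ : ∀ {Z W V : A.Ob}, Path X Z → Path Z W → Path W V →
      Path V Y → M) :
    lsum (cuts3 p) (fun c => lsum (cuts2 c.last) (fun a => φ c.fst c.mid a.fst a.snd))
      = lsum (cuts2 p) (fun a => lsum (cuts3 a.fst) (fun c => φ c.fst c.mid c.last a.snd)) := by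
  have h := cuts2_coassoc p (fun x y z => lsum (cuts2 y) (fun b => φ x b.fst b.snd z))
  simp only [lsum_cuts3]
  rw [h]
  refine lsum_congr fun c _ => ?_
  exact (cuts2_coassoc c.snd (fun x y z => φ c.fst x y z)).symm

theorem cuts3_eq_cuts2_fst (p : Path X Y)
    (φ : ∀ {Z W : A.Ob}, Path X Z → Path Z W → Path W Y → M) :
    lsum (cuts3 p) (fun c => φ c.fst c.mid c.last)
      = lsum (cuts2 p) (fun a => lsum (cuts2 a.fst) (fun c => φ c.fst c.snd a.snd)) := by
  rw [lsum_cuts3]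
  exact (cuts2_coassoc p φ).symm

end Coassoc

/-- The additive map which inserts an element in the middle of a string. -/
def IsML.insertHom {A : GrQuiver k} {M : Type*} [AddCommGroup M] [Module k M]
    {X Y Z W : A.Ob} {Φ : Path X Y → M} (h : IsML Φ) (r : Path X Z) (i : ℤ)
    (t : Path W Y) : A.Hom Z W i →+ M :=
  AddMonoidHom.mk' (fun x => Φ ((r.cons (⟨i, x⟩ : Z ⟶ W)).comp t)) fun a b => h.add r i a b t

namespace Cochain

variable {A : GrQuiver k} {B : GrQuiver k} {C : GrQuiver k}
variable {f g : A.Ob → B.Ob} {h h' : B.Ob → C.Ob} {d e : ℤ}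
variable {M : Type*} [AddCommGroup M] {X Y : A.Ob}
variable (F : Cochain A B f f 1) (G : Cochain A B g g 1) (T : Cochain A B f g d)

theorem ins_congr_red {Φ Ψ : Path (f X) (g Y) → M} (p : Path X Y)
    (h : ∀ q, red q = red p + (d - 1) → Φ q = Ψ q) : ins F G T Φ p = ins F G T Ψ p := by
  refine lsum_congr fun c hc => lsum_congr fun r hr => lsum_congr fun t ht => ?_
  rw [h]
  rw [red_marked, F.red_of_mem_blocks _ r hr, G.red_of_mem_blocks _ t ht]
  have := red_of_mem_cuts3 _ c hc
  simp only [arrow]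
  omega

/-- Applying the composite `insC F G T S` to a string amounts to inserting `T` into that string, and
then applying `S` to the whole result. -/
theorem insert_insC [Module k M] {X' Y' : C.Ob} {Φ : Path X' Y' → M} (hΦ : IsML Φ)
    (S : Cochain B C h h' e) (n : ℤ) (hn : n = d + e - 1) (q : Path X Y)
    (r : Path X' (h (f X))) (t : Path (h' (g Y)) Y') :
    Φ ((r.cons ((insC F G T S n hn).arrow q)).comp t)
      = ins F G T (fun s => Φ ((r.cons (S.arrow s)).comp t)) q := by
  refine (ins_map F G T (hΦ.insertHom r (red q + n) t) (fun s => S.val s (red q + n)) q).trans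
    (ins_congr_red F G T q ?_)
  intro s hs
  rw [S.arrow_eq s (N := red q + n) (by omega)]
  rfl

theorem insert_pre [Module k M] {X' Y' : C.Ob} {Φ : Path X' Y' → M} (hΦ : IsML Φ)
    (S : Cochain B C h h' e) (q : Path X Y)
    (r : Path X' (h (f X))) (t : Path (h' (f Y)) Y') :
    Φ ((r.cons ((S.pre F).arrow q)).comp t)
      = lsum (F.blocks q) (fun s => Φ ((r.cons (S.arrow s)).comp t)) := by
  refine (map_lsum (hΦ.insertHom r (red q + e) t) _ _).trans (lsum_congr ?_)
  intro s hs
  rw [S.arrow_eq s (N := red q + e) (by rw [F.red_of_mem_blocks _ s hs])]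
  rfl

/-- The coderivation property of insertion: in a decomposition of the output string, the inserted
value lies either in the first or in the second piece. -/
theorem ins_cuts2 (Ψ : Cut2 (f X) (g Y) → M) (p : Path X Y) :
    ins F G T (fun q => lsum (cuts2 q) Ψ) p
      = lsum (cuts2 p) (fun a => lsum (G.blocks a.snd) fun t =>
          ins F G T (fun s => Ψ ⟨g a.Z, s, t⟩) a.fst)
        + lsum (cuts2 p) (fun a => ((d - 1) * red a.fst).negOnePow • lsum (F.blocks a.fst)
            fun r => ins F G T (fun s => Ψ ⟨f a.Z, r, s⟩) a.snd) := by
  have e₁ : ins F G T (fun q => lsum (cuts2 q) Ψ) p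
      = lsum (cuts3 p) (fun c => lsum (F.blocks c.fst) fun r => lsum (G.blocks c.last) fun t =>
          lsum (cuts2 t) fun b => ((d - 1) * red c.fst).negOnePow •
            Ψ ⟨b.Z, (r.cons (T.arrow c.mid)).comp b.fst, b.snd⟩)
        + lsum (cuts3 p) (fun c => lsum (G.blocks c.last) fun t => lsum (F.blocks c.fst) fun r =>
          lsum (cuts2 r) fun b => ((d - 1) * red c.fst).negOnePow •
            Ψ ⟨b.Z, b.fst, (b.snd.cons (T.arrow c.mid)).comp t⟩) := by
    rw [ins, ← lsum_add]
    refine lsum_congr fun c _ => ?_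
    rw [lsum_comm (G.blocks c.last), ← lsum_add]
    refine lsum_congr fun r _ => ?_
    rw [← lsum_add]
    refine lsum_congr fun t _ => ?_
    rw [lsum_cuts2_marked, smul_add, smul_lsum, smul_lsum, add_comm]
  rw [e₁]
  congr 1
  · have e₂ : ∀ c : Cut3 X Y, (lsum (F.blocks c.fst) fun r => lsum (G.blocks c.last) fun t =>
        lsum (cuts2 t) fun b => ((d - 1) * red c.fst).negOnePow •
            Ψ ⟨b.Z, (r.cons (T.arrow c.mid)).comp b.fst, b.snd⟩)
        = lsum (cuts2 c.last) fun a => lsum (F.blocks c.fst) fun r => lsum (G.blocks a.fst) fun t =>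
          lsum (G.blocks a.snd) fun t' => ((d - 1) * red c.fst).negOnePow •
            Ψ ⟨g a.Z, (r.cons (T.arrow c.mid)).comp t, t'⟩ := by
      intro c
      rw [lsum_comm (cuts2 c.last)]
      refine lsum_congr fun r _ => ?_
      exact G.lsum_blocks_cuts2 c.last (fun b => ((d - 1) * red c.fst).negOnePow •
            Ψ ⟨b.Z, (r.cons (T.arrow c.mid)).comp b.fst, b.snd⟩)
    simp only [e₂]
    rw [cuts3_last_coassoc p (fun {Z W V} x y z t => lsum (F.blocks x) fun r =>
      lsum (G.blocks z) fun s => lsum (G.blocks t) fun t' => ((d - 1) * red x).negOnePow •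
            Ψ ⟨g V, (r.cons (T.arrow y)).comp s, t'⟩)]
    refine lsum_congr fun a _ => ?_
    simp only [ins]
    rw [lsum_comm (G.blocks a.snd)]
    refine lsum_congr fun c _ => ?_
    rw [lsum_comm (G.blocks a.snd)]
    refine lsum_congr fun r _ => ?_
    rw [lsum_comm (G.blocks a.snd)]
  · have e₂ : ∀ c : Cut3 X Y, (lsum (G.blocks c.last) fun t => lsum (F.blocks c.fst) fun r =>
          lsum (cuts2 r) fun b => ((d - 1) * red c.fst).negOnePow •
            Ψ ⟨b.Z, b.fst, (b.snd.cons (T.arrow c.mid)).comp t⟩)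
        = lsum (cuts2 c.fst) fun a => lsum (G.blocks c.last) fun t => lsum (F.blocks a.fst) fun r =>
          lsum (F.blocks a.snd) fun r' => ((d - 1) * (red a.fst + red a.snd)).negOnePow •
            Ψ ⟨f a.Z, r, (r'.cons (T.arrow c.mid)).comp t⟩ := by
      intro c
      rw [lsum_comm (cuts2 c.fst)]
      refine lsum_congr fun t _ => ?_
      rw [F.lsum_blocks_cuts2 c.fst (fun b => ((d - 1) * red c.fst).negOnePow •
            Ψ ⟨b.Z, b.fst, (b.snd.cons (T.arrow c.mid)).comp t⟩)]
      refine lsum_congr fun a ha => ?_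
      rw [red_of_mem_cuts2 _ a ha]
    simp only [e₂]
    rw [cuts3_fst_coassoc p (fun {Z W V} x y z t => lsum (G.blocks t) fun s =>
      lsum (F.blocks x) fun r => lsum (F.blocks y) fun r' =>
        ((d - 1) * (red x + red y)).negOnePow •
            Ψ ⟨f Z, r, (r'.cons (T.arrow z)).comp s⟩)]
    refine lsum_congr fun a _ => ?_
    simp only [ins, smul_lsum]
    rw [lsum_comm (F.blocks a.fst)]
    refine lsum_congr fun c _ => ?_
    rw [lsum_comm (G.blocks c.last)]
    refine lsum_congr fun r _ => ?_
    rw [lsum_comm (G.blocks c.last)]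
    refine lsum_congr fun r' _ => lsum_congr fun t _ => ?_
    rw [smul_smul, ← Int.negOnePow_add, mul_add]

/-- Inserting `T` and then applying `H` to blocks is the insertion of the cochain `insC F G T H`
into the composite functors. -/
theorem ins_blocks [Module k M] (H : Cochain B C h h 1)
    {Φ : Path (h (f X)) (h (g Y)) → M} (hΦ : IsML Φ) (p : Path X Y) :
    ins F G T (fun q => lsum (H.blocks q) Φ) p
      = ins (H.comp F) (H.comp G) (insC F G T H d) Φ p := by
  have e₁ : ins (H.comp F) (H.comp G) (insC F G T H d) Φ p
      = lsum (cuts3 p) fun c => lsum (cuts3 c.mid) fun b =>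
          lsum (F.blocks c.fst) fun r => lsum (F.blocks b.fst) fun r' =>
          lsum (G.blocks b.last) fun t' => lsum (G.blocks c.last) fun t =>
          ((d - 1) * (red c.fst + red b.fst)).negOnePow • lsum (H.blocks r) fun u =>
            lsum (H.blocks t) fun v =>
              Φ ((u.cons (H.arrow ((r'.cons (T.arrow b.mid)).comp t'))).comp v) := by
    refine lsum_congr fun c _ => ?_
    have e₂ : ∀ r : Path (h (f X)) (h (f c.Z)), (lsum ((H.comp G).blocks c.last) fun t => ((d - 1) * red c.fst).negOnePow •
          Φ ((r.cons ((insC F G T H d).arrow c.mid)).comp t))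
        = lsum (G.blocks c.last) fun t => lsum (H.blocks t) fun v =>
            ((d - 1) * red c.fst).negOnePow •
              Φ ((r.cons ((insC F G T H d).arrow c.mid)).comp v) := fun r =>
      lsum_blocks_comp H G c.last ((hΦ.comp_left _).units_smul _)
    simp only [e₂]
    rw [lsum_blocks_comp H F c.fst (IsML.lsum (fun t => IsML.lsum (fun v =>
      ((hΦ.comp_right v).cons _).units_smul _) _) _)]
    simp only [insert_insC F G T hΦ]
    rw [lsum_comm (cuts3 c.mid)]
    refine lsum_congr fun r _ => ?_
    simp only [ins, smul_lsum]
    rw [lsum_comm (H.blocks r)]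
    simp only [lsum_comm (H.blocks r) (cuts3 c.mid), lsum_comm (H.blocks _) (cuts3 c.mid),
      lsum_comm (G.blocks _) (cuts3 c.mid)]
    refine lsum_congr fun b _ => ?_
    simp only [lsum_comm (H.blocks _) (F.blocks b.fst), lsum_comm (G.blocks _) (F.blocks b.fst)]
    refine lsum_congr fun r' _ => ?_
    simp only [lsum_comm (H.blocks _) (G.blocks b.last)]
    rw [lsum_comm (G.blocks c.last)]
    refine lsum_congr fun t' _ => lsum_congr fun t _ => lsum_congr fun u _ =>
      lsum_congr fun v _ => ?_
    rw [smul_smul, ← Int.negOnePow_add, mul_add]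
  rw [e₁, ← cuts3_coassoc p (fun x y z y' x' => lsum (F.blocks x) fun r =>
    lsum (F.blocks y) fun r' => lsum (G.blocks y') fun t' => lsum (G.blocks x') fun t =>
          ((d - 1) * (red x + red y)).negOnePow • lsum (H.blocks r) fun u =>
            lsum (H.blocks t) fun v =>
              Φ ((u.cons (H.arrow ((r'.cons (T.arrow z)).comp t'))).comp v))]
  refine lsum_congr fun c _ => ?_
  have e₃ : ∀ r, (lsum (G.blocks c.last) fun t => ((d - 1) * red c.fst).negOnePow •
        lsum (H.blocks ((r.cons (T.arrow c.mid)).comp t)) Φ)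
      = lsum (cuts2 r) fun a => lsum (cuts2 c.last) fun b => lsum (G.blocks b.fst) fun t' =>
        lsum (G.blocks b.snd) fun t => ((d - 1) * red c.fst).negOnePow •
        lsum (H.blocks a.fst) fun u => lsum (H.blocks t) fun v =>
          Φ ((u.cons (H.arrow ((a.snd.cons (T.arrow c.mid)).comp t'))).comp v) := by
    intro r
    rw [lsum_comm (cuts2 r)]
    have := G.lsum_blocks_cuts2 c.last (fun b => lsum (cuts2 r) fun a =>
      ((d - 1) * red c.fst).negOnePow • lsum (H.blocks a.fst) fun u => lsum (H.blocks b.snd) fun v =>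
          Φ ((u.cons (H.arrow ((a.snd.cons (T.arrow c.mid)).comp b.fst))).comp v))
    simp only [lsum_comm (cuts2 r) (G.blocks _)]
    rw [← this]
    refine lsum_congr fun t _ => ?_
    rw [lsum_blocks_marked, smul_lsum, lsum_comm]
    refine lsum_congr fun a _ => ?_
    rw [smul_lsum]
  simp only [e₃]
  rw [F.lsum_blocks_cuts2 c.fst (fun a => lsum (cuts2 c.last) fun b =>
    lsum (G.blocks b.fst) fun t' => lsum (G.blocks b.snd) fun t =>
    ((d - 1) * red c.fst).negOnePow • lsum (H.blocks a.fst) fun u => lsum (H.blocks t) fun v =>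
          Φ ((u.cons (H.arrow ((a.snd.cons (T.arrow c.mid)).comp t'))).comp v))]
  refine lsum_congr fun a ha => ?_
  rw [red_of_mem_cuts2 _ a ha, lsum_comm (cuts2 c.last)]
  refine lsum_congr fun r _ => ?_
  rw [lsum_comm (cuts2 c.last)]

/-- Applying `F` to blocks and then inserting `S` is the insertion of `S.pre F` into the composite
functors. -/
theorem blocks_ins [Module k M] (H : Cochain B C h h 1) (K : Cochain B C h' h' 1)
    (S : Cochain B C h h' e) {Φ : Path (h (f X)) (h' (f Y)) → M} (hΦ : IsML Φ)
    (p : Path X Y) :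
    lsum (F.blocks p) (fun q => ins H K S Φ q) = ins (H.comp F) (K.comp F) (S.pre F) Φ p := by
  simp only [ins]
  rw [lsum_blocks_cuts3]
  refine lsum_congr fun c _ => ?_
  have e₂ : ∀ r : Path (h (f X)) (h (f c.Z)), (lsum ((K.comp F).blocks c.last) fun t => ((e - 1) * red c.fst).negOnePow •
          Φ ((r.cons ((S.pre F).arrow c.mid)).comp t))
        = lsum (F.blocks c.last) fun t => lsum (K.blocks t) fun v =>
            ((e - 1) * red c.fst).negOnePow •
              Φ ((r.cons ((S.pre F).arrow c.mid)).comp v) := fun r =>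
      lsum_blocks_comp K F c.last ((hΦ.comp_left _).units_smul _)
  simp only [e₂]
  rw [lsum_blocks_comp H F c.fst (IsML.lsum (fun t => IsML.lsum (fun v =>
      ((hΦ.comp_right v).cons _).units_smul _) _) _)]
  refine lsum_congr fun r hr => ?_
  rw [F.red_of_mem_blocks _ r hr, lsum_comm (H.blocks r), lsum_comm (F.blocks c.mid)]
  refine lsum_congr fun t _ => ?_
  simp only [insert_pre F hΦ, smul_lsum]
  rw [lsum_comm (F.blocks c.mid)]
  refine lsum_congr fun u _ => ?_
  rw [lsum_comm (F.blocks c.mid)]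

end Cochain

/-! ### Composing two insertions -/

namespace Cochain

section InsTwo

variable {A : GrQuiver k} {B : GrQuiver k} {C : GrQuiver k}
variable {f₀ f₁ f₂ : A.Ob → B.Ob} {d e : ℤ}
variable {M : Type*} [AddCommGroup M] {X Y : A.Ob}

/-- The sum over all ways of applying `S` and `T`, in this order, to two disjoint blocks of
consecutive inputs of a string, and `F₀`, `F₁`, `F₂` to blocks of the remaining inputs. -/
def ins₂ (F₀ : Cochain A B f₀ f₀ 1) (F₁ : Cochain A B f₁ f₁ 1) (F₂ : Cochain A B f₂ f₂ 1)
    (S : Cochain A B f₀ f₁ d) (T : Cochain A B f₁ f₂ e)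
    (Φ : Path (f₀ X) (f₂ Y) → M) (p : Path X Y) : M :=
  lsum (cuts2 p) fun a => ((e - 1) * red a.fst).negOnePow • ins F₀ F₁ S (fun u =>
    lsum (cuts2 a.snd) fun b => lsum (F₂.blocks b.snd) fun v =>
      Φ ((u.cons (T.arrow b.fst)).comp v)) a.fst

variable (F₀ : Cochain A B f₀ f₀ 1) (F₁ : Cochain A B f₁ f₁ 1) (F₂ : Cochain A B f₂ f₂ 1)
    (S : Cochain A B f₀ f₁ d) (T : Cochain A B f₁ f₂ e)

/-- The double insertion with the block of `S` chosen first, and `T` inserted into the inputs to the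
right of that block. -/
theorem ins₂_eq (Φ : Path (f₀ X) (f₂ Y) → M) (p : Path X Y) :
    ins₂ F₀ F₁ F₂ S T Φ p
      = lsum (cuts2 p) fun a => ((d + e) * red a.fst).negOnePow • lsum (F₀.blocks a.fst) fun u =>
          lsum (cuts2 a.snd) fun b => ((e - 1) * red b.fst).negOnePow •
            ins F₁ F₂ T (fun v => Φ ((u.cons (S.arrow b.fst)).comp v)) b.snd := by
  have e₁ : ins₂ F₀ F₁ F₂ S T Φ p = lsum (cuts2 p) fun a => lsum (cuts3 a.fst) fun c =>
      lsum (cuts2 a.snd) fun b => lsum (F₀.blocks c.fst) fun r => lsum (F₁.blocks c.last) fun t =>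
        lsum (F₂.blocks b.snd) fun v => ((e - 1) * (red c.fst + red c.mid + red c.last) +
          (d - 1) * red c.fst).negOnePow •
          Φ ((((r.cons (S.arrow c.mid)).comp t).cons (T.arrow b.fst)).comp v) := by
    refine lsum_congr fun a _ => ?_
    rw [ins, smul_lsum]
    refine lsum_congr fun c hc => ?_
    rw [red_of_mem_cuts3 _ c hc]
    simp only [smul_lsum, smul_smul, ← Int.negOnePow_add, lsum_comm (cuts2 a.snd)]
  have e₂ : (lsum (cuts2 p) fun a => ((d + e) * red a.fst).negOnePow •
      lsum (F₀.blocks a.fst) fun u => lsum (cuts2 a.snd) fun b =>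
        ((e - 1) * red b.fst).negOnePow •
            ins F₁ F₂ T (fun v => Φ ((u.cons (S.arrow b.fst)).comp v)) b.snd)
      = lsum (cuts2 p) fun a => lsum (cuts2 a.snd) fun b => lsum (cuts3 b.snd) fun c =>
        lsum (F₀.blocks a.fst) fun r => lsum (F₁.blocks c.fst) fun t =>
        lsum (F₂.blocks c.last) fun v => ((e - 1) * (red a.fst + red b.fst + red c.fst) +
          (d - 1) * red a.fst).negOnePow •
          Φ ((((r.cons (S.arrow b.fst)).comp t).cons (T.arrow c.mid)).comp v) := by
    refine lsum_congr fun a _ => ?_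
    simp only [ins, smul_lsum, smul_smul, ← Int.negOnePow_add]
    simp only [lsum_comm (F₀.blocks a.fst)]
    refine lsum_congr fun b _ => lsum_congr fun c _ => lsum_congr fun r _ => lsum_congr fun t _ =>
      lsum_congr fun v _ => ?_
    rw [← Quiver.Path.comp_assoc, Quiver.Path.comp_cons]
    congr 1
    refine negOnePow_congr ⟨red a.fst, ?_⟩
    ring
  rw [e₁, e₂]
  have key := cuts2_coassoc p (fun {Z W} x y z' => lsum (cuts2 y) fun c => lsum (cuts2 z') fun b =>
    lsum (F₀.blocks x) fun r => lsum (F₁.blocks c.snd) fun t =>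
        lsum (F₂.blocks b.snd) fun v => ((e - 1) * (red x + red c.fst + red c.snd) +
          (d - 1) * red x).negOnePow •
          Φ ((((r.cons (S.arrow c.fst)).comp t).cons (T.arrow b.fst)).comp v))
  simp only [lsum_cuts3]
  rw [key]
  refine lsum_congr fun a _ => ?_
  exact cuts2_coassoc a.snd (fun {Z W} x y z' => lsum (cuts2 z') fun b =>
    lsum (F₀.blocks a.fst) fun r => lsum (F₁.blocks y) fun t =>
        lsum (F₂.blocks b.snd) fun v => ((e - 1) * (red a.fst + red x + red y) +
          (d - 1) * red a.fst).negOnePow •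
          Φ ((((r.cons (S.arrow x)).comp t).cons (T.arrow b.fst)).comp v))

end InsTwo

section Compose

variable {A : GrQuiver k} {B : GrQuiver k} {C : GrQuiver k}
variable {f g : A.Ob → B.Ob} {h h' : B.Ob → C.Ob} {d e : ℤ}
variable {M : Type*} [AddCommGroup M] [Module k M] {X Y : A.Ob}
variable (F : Cochain A B f f 1) (G : Cochain A B g g 1) (T : Cochain A B f g d)
variable (H : Cochain B C h h 1) (K : Cochain B C h' h' 1) (S : Cochain B C h h' e)

/-- The composition of two insertions. The value of `T` is either among the inputs of `S`, or is
used by `K` after `S`, or by `H` before `S`. -/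
theorem ins_ins (r : ℤ) (hr : r = d + e - 1) {Φ : Path (h (f X)) (h' (g Y)) → M}
    (hΦ : IsML Φ) (p : Path X Y) :
    ins F G T (fun q => ins H K S Φ q) p
      = ins (H.comp F) (K.comp G) (insC F G T S r hr) Φ p
        + ins₂ (H.comp F) (K.comp F) (K.comp G) (S.pre F) (insC F G T K d) Φ p
        + ((d - 1) * (e - 1)).negOnePow •
          ins₂ (H.comp F) (H.comp G) (K.comp G) (insC F G T H d) (S.pre G) Φ p := by
  obtain ⟨N, hN⟩ : ∃ N : ∀ {Z : B.Ob}, Path (h (f X)) (h Z) → Path Z (g Y) → M,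
      ∀ {Z : B.Ob} (u : Path (h (f X)) (h Z)) (s : Path Z (g Y)), N u s
        = lsum (cuts2 s) fun c => lsum (K.blocks c.snd) fun v =>
          Φ ((u.cons (S.arrow c.fst)).comp v) := ⟨_, fun _ _ => rfl⟩
  have hN1 : ∀ {Z : B.Ob} (t : Path Z (g Y)), IsML (fun u => N u t) := fun {Z} t => by
    simp only [hN]
    exact IsML.lsum (Φ := fun (c : Cut2 Z (g Y)) u => lsum (K.blocks c.snd)
      fun v => Φ ((u.cons (S.arrow c.fst)).comp v)) (fun c => IsML.lsum (fun v =>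
      (hΦ.comp_right v).cons _) _) _
  have e₀ : ∀ q, ins H K S Φ q = lsum (cuts2 q) fun c => ((e - 1) * red c.fst).negOnePow •
      lsum (H.blocks c.fst) fun u => N u c.snd := fun q => by
    simp only [hN]
    exact ins_eq_cuts2 H K S Φ q
  rw [ins_congr F G T e₀, ins_cuts2 F G T]
  have t₁ : (lsum (cuts2 p) fun a => lsum (G.blocks a.snd) fun t => ins F G T (fun s =>
        ((e - 1) * red s).negOnePow • lsum (H.blocks s) fun u => N u t) a.fst)
      = ((d - 1) * (e - 1)).negOnePow •
          ins₂ (H.comp F) (H.comp G) (K.comp G) (insC F G T H d) (S.pre G) Φ p := by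
    rw [ins₂, smul_lsum]
    refine lsum_congr fun a _ => ?_
    have s₁ : ∀ t, ins F G T (fun s => ((e - 1) * red s).negOnePow • lsum (H.blocks s)
          fun u => N u t) a.fst
        = ((d - 1) * (e - 1) + (e - 1) * red a.fst).negOnePow •
          ins (H.comp F) (H.comp G) (insC F G T H d) (fun u => N u t) a.fst := by
      intro t
      rw [← ins_blocks F G T H (hN1 t), ← ins_units_smul]
      refine ins_congr_red F G T _ fun q hq => ?_
      rw [hq]
      congr 2
      ring
    simp only [s₁]
    rw [smul_smul, ← Int.negOnePow_add, ← smul_lsum, ← ins_lsum]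
    congr 1
    refine ins_congr _ _ _ (fun u => ?_) _
    simp only [hN]
    rw [G.lsum_blocks_cuts2 a.snd (fun c => lsum (K.blocks c.snd) fun v =>
      Φ ((u.cons (S.arrow c.fst)).comp v))]
    refine lsum_congr fun b _ => ?_
    have s₂ := lsum_blocks_comp K G b.snd (Φ := fun v => Φ ((u.cons ((S.pre G).arrow b.fst)).comp v))
      (hΦ.comp_left _)
    refine Eq.trans ?_ s₂.symm
    rw [lsum_comm (G.blocks b.fst)]
    refine lsum_congr fun t _ => ?_
    simp only [insert_pre G hΦ]
    rw [lsum_comm (G.blocks b.fst)]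
  have t₂ : (lsum (cuts2 p) fun a => ((d - 1) * red a.fst).negOnePow • lsum (F.blocks a.fst)
        fun r => ins F G T (fun s => ((e - 1) * red r).negOnePow • lsum (H.blocks r)
          fun u => N u s) a.snd)
      = lsum (cuts2 p) fun a => ((d - 1 + (e - 1)) * red a.fst).negOnePow •
        lsum ((H.comp F).blocks a.fst) fun u => ins F G T (fun s => N u s) a.snd := by
    refine lsum_congr fun a _ => ?_
    rw [lsum_blocks_comp H F a.fst (Φ := fun u => ins F G T (fun s => N u s) a.snd) (by
      refine IsML.lsum (fun c => IsML.lsum (fun r => IsML.lsum (fun t => ?_) _) _) _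
      exact IsML.units_smul (hN1 _) _), smul_lsum, smul_lsum]
    refine lsum_congr fun r hr => ?_
    rw [F.red_of_mem_blocks _ r hr, ins_units_smul, ins_lsum, smul_smul, ← Int.negOnePow_add,
      ← add_mul]
  have t₃ : ∀ (a : Cut2 X Y) (u : Path (h (f X)) (h (f a.Z))),
      ins F G T (fun s => N u s) a.snd
      = (lsum (cuts2 a.snd) fun b => lsum ((K.comp G).blocks b.snd) fun v =>
          Φ ((u.cons ((insC F G T S r hr).arrow b.fst)).comp v))
        + lsum (cuts2 a.snd) fun b => ((d - 1) * red b.fst).negOnePow •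
          ins (K.comp F) (K.comp G) (insC F G T K d)
            (fun v => Φ ((u.cons ((S.pre F).arrow b.fst)).comp v)) b.snd := by
    intro a u
    simp only [hN]
    rw [ins_cuts2 F G T]
    congr 1
    · refine lsum_congr fun b _ => ?_
      rw [lsum_blocks_comp K G b.snd (hΦ.comp_left _)]
      refine lsum_congr fun t _ => ?_
      refine (ins_lsum F G T (K.blocks t)
        (fun v s => Φ ((u.cons (S.arrow s)).comp v)) b.fst).trans (lsum_congr fun v _ => ?_)
      rw [insert_insC F G T hΦ]
    · refine lsum_congr fun b _ => ?_
      congr 1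
      have s₃ : ∀ r : Path (f a.Z) (f b.Z), ins F G T (fun s => lsum (K.blocks s) fun v =>
            Φ ((u.cons (S.arrow r)).comp v)) b.snd
          = ins (K.comp F) (K.comp G) (insC F G T K d)
              (fun v => Φ ((u.cons (S.arrow r)).comp v)) b.snd := fun r =>
        ins_blocks F G T K (hΦ.comp_left _) b.snd
      simp only [s₃, ← ins_lsum]
      refine ins_congr _ _ _ (fun v => ?_) _
      rw [insert_pre F hΦ]
  rw [t₁]
  erw [t₂]
  rw [add_comm]
  congr 1
  simp only [t₃, lsum_add, smul_add]
  congr 1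
  · rw [ins_eq_cuts2]
    refine lsum_congr fun a _ => ?_
    congr 2
    rw [hr]
    ring
  · rw [ins₂_eq]
    refine lsum_congr fun a _ => ?_
    congr 1
    refine negOnePow_congr ⟨-red a.fst, ?_⟩
    ring

end Compose

end Cochain

/-! ### Leading terms and the identity functor -/

section Membership

variable {A : GrQuiver k} {M : Type*} [AddCommGroup M] {X Y : A.Ob}

theorem lsum_cuts2_eq_snd_nil (p : Path X Y) (φ : Cut2 X Y → M)
    (h : ∀ c ∈ cuts2 p, c.snd.length ≠ 0 → φ c = 0) :
    lsum (cuts2 p) φ = φ ⟨Y, p, .nil⟩ := by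
  cases p with
  | nil => exact lsum_singleton _ _
  | cons p e =>
    rw [lsum_cuts2_cons, lsum_eq_zero, zero_add]
    intro c hc
    refine h _ ?_ (by simp)
    simp only [cuts2, List.mem_append, List.mem_map]
    exact Or.inl ⟨c, hc, rfl⟩

theorem lsum_cuts2_eq_fst_nil (p : Path X Y) (φ : Cut2 X Y → M)
    (h : ∀ c ∈ cuts2 p, c.fst.length ≠ 0 → φ c = 0) :
    lsum (cuts2 p) φ = φ ⟨X, .nil, p⟩ := by
  induction p with
  | nil => exact lsum_singleton _ _
  | cons p e ih =>
    rw [lsum_cuts2_cons, h ⟨_, p.cons e, .nil⟩ (by simp [cuts2]) (by simp), add_zero]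
    refine ih (fun c => φ ⟨c.Z, c.fst, c.snd.cons e⟩) fun c hc => h ⟨c.Z, c.fst, c.snd.cons e⟩ ?_
    simp only [cuts2, List.mem_append, List.mem_map]
    exact Or.inl ⟨c, hc, rfl⟩

theorem lsum_cuts3_eq_mid (p : Path X Y) (φ : Cut3 X Y → M)
    (h : ∀ c ∈ cuts3 p, c.fst.length + c.last.length ≠ 0 → φ c = 0) :
    lsum (cuts3 p) φ = φ ⟨X, Y, .nil, p, .nil⟩ := by
  rw [lsum_cuts3, lsum_cuts2_eq_fst_nil, lsum_cuts2_eq_snd_nil]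
  · intro c hc hc'
    refine h _ ?_ (by simpa using hc')
    simp only [cuts3, List.mem_flatMap, List.mem_map]
    have : (⟨X, .nil, p⟩ : Cut2 X Y) ∈ cuts2 p := by
      clear h hc hc' φ c
      induction p with
      | nil => simp [cuts2]
      | cons p e ih =>
        simp only [cuts2, List.mem_append, List.mem_map]
        exact Or.inl ⟨_, ih, rfl⟩
    exact ⟨_, this, c, hc, rfl⟩
  · intro c hc hc'
    refine lsum_eq_zero fun c' hc'' => h _ ?_ (by simp only; omega)
    simp only [cuts3, List.mem_flatMap, List.mem_map]
    exact ⟨c, hc, c', hc'', rfl⟩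

end Membership

namespace Cochain

section Leading

variable {A : GrQuiver k} {B : GrQuiver k} {C : GrQuiver k}
variable {f g f₀ f₁ f₂ : A.Ob → B.Ob} {d e : ℤ}

/-- `T` vanishes on all strings of length less than `m`. -/
structure VanishesBelow (T : Cochain A B f g d) (m : ℕ) : Prop where
  eq_zero : ∀ {X Y : A.Ob} (p : Path X Y) (n : ℤ), p.length < m → T.val p n = 0

theorem VanishesBelow.add {T S : Cochain A B f g d} {m : ℕ} (h : T.VanishesBelow m)
    (h' : S.VanishesBelow m) : (T + S).VanishesBelow m := ⟨fun p n hp => by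
  rw [add_val, h.eq_zero p n hp, h'.eq_zero p n hp, add_zero]⟩

theorem VanishesBelow.neg {T : Cochain A B f g d} {m : ℕ} (h : T.VanishesBelow m) :
    (-T).VanishesBelow m := ⟨fun p n hp => by rw [neg_val, h.eq_zero p n hp, neg_zero]⟩

theorem VanishesBelow.sub {T S : Cochain A B f g d} {m : ℕ} (h : T.VanishesBelow m)
    (h' : S.VanishesBelow m) : (T - S).VanishesBelow m := ⟨fun p n hp => by
  rw [sub_val, h.eq_zero p n hp, h'.eq_zero p n hp, sub_zero]⟩

theorem VanishesBelow.mono {T : Cochain A B f g d} {m m' : ℕ} (h : T.VanishesBelow m)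
    (hm : m' ≤ m) : T.VanishesBelow m' := ⟨fun p n hp => h.eq_zero p n (by omega)⟩

theorem vanishesBelow_zero (T : Cochain A B f g d) : T.VanishesBelow 0 :=
  ⟨fun p n hp => absurd hp (Nat.not_lt_zero _)⟩

theorem VanishesBelow.arrow {T : Cochain A B f g d} {m : ℕ} (h : T.VanishesBelow m)
    {X Y : A.Ob} (p : Path X Y) (hp : p.length < m) :
    T.arrow p = (⟨red p + d, 0⟩ : f X ⟶ g Y) := by rw [Cochain.arrow, h.eq_zero p _ hp]

variable {M : Type*} [AddCommGroup M] [Module k M] {X Y : A.Ob}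

/-- If `T` vanishes below the length of `p`, it can only be inserted on all of `p`. -/
theorem ins_eq_leading (F : Cochain A B f f 1) (G : Cochain A B g g 1) {T : Cochain A B f g d}
    {Φ : Path (f X) (g Y) → M} (hΦ : IsML Φ) (p : Path X Y)
    (hT : T.VanishesBelow p.length) : ins F G T Φ p = Φ (Quiver.Path.nil.cons (T.arrow p)) := by
  rw [ins, lsum_cuts3_eq_mid]
  · simp [blocks, lsum_singleton, red]
  · intro c hc hc'
    have := AInfCat.length_of_mem_cuts3 p c hc
    refine lsum_eq_zero fun r _ => lsum_eq_zero fun t _ => ?_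
    rw [hT.arrow c.mid (by omega), hΦ.insert_zero, smul_zero]

theorem ins_eq_zero (F : Cochain A B f f 1) (G : Cochain A B g g 1) {T : Cochain A B f g d}
    {Φ : Path (f X) (g Y) → M} (hΦ : IsML Φ) (p : Path X Y)
    {m : ℕ} (hT : T.VanishesBelow m) (hp : p.length < m) : ins F G T Φ p = 0 := by
  rw [ins_eq_leading F G hΦ p (hT.mono hp.le), hT.arrow p hp]
  exact hΦ.insert_zero .nil _ .nil

variable (F₀ : Cochain A B f₀ f₀ 1) (F₁ : Cochain A B f₁ f₁ 1) (F₂ : Cochain A B f₂ f₂ 1)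

theorem ins₂_eq_leading_right (S : Cochain A B f₀ f₁ d) {T : Cochain A B f₁ f₂ e}
    {Φ : Path (f₀ X) (f₂ Y) → M} (hΦ : IsML Φ) (p : Path X Y)
    (hT : T.VanishesBelow p.length) : ins₂ F₀ F₁ F₂ S T Φ p
      = Φ ((Quiver.Path.nil.cons (S.arrow (.nil : Path X X))).cons (T.arrow p)) := by
  rw [ins₂_eq, lsum_cuts2_eq_fst_nil]
  · simp only [red, mul_zero, Int.negOnePow_zero, one_smul, lsum_blocks_nil]
    rw [lsum_cuts2_eq_fst_nil]
    · rw [ins_eq_leading F₁ F₂ (hΦ.comp_left _) p hT]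
      simp [red]
    · intro c hc hc'
      have := AInfCat.length_of_mem_cuts2 p c hc
      rw [ins_eq_zero F₁ F₂ (hΦ.comp_left _) c.snd hT (by omega), smul_zero]
  · intro c hc hc'
    have := AInfCat.length_of_mem_cuts2 p c hc
    rw [lsum_eq_zero, smul_zero]
    intro u _
    refine lsum_eq_zero fun b hb => ?_
    have := AInfCat.length_of_mem_cuts2 _ b hb
    rw [ins_eq_zero F₁ F₂ (hΦ.comp_left _) b.snd hT (by omega), smul_zero]

theorem ins₂_eq_leading_left {S : Cochain A B f₀ f₁ d} (T : Cochain A B f₁ f₂ e)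
    {Φ : Path (f₀ X) (f₂ Y) → M} (hΦ : IsML Φ) (p : Path X Y)
    (hS : S.VanishesBelow p.length) : ins₂ F₀ F₁ F₂ S T Φ p
      = ((e - 1) * red p).negOnePow •
        Φ ((Quiver.Path.nil.cons (S.arrow p)).cons (T.arrow (.nil : Path Y Y))) := by
  have hml : ∀ {Z : A.Ob} (s : Path Z Y), IsML (fun u : Path (f₀ X) (f₁ Z) =>
      lsum (cuts2 s) fun b => lsum (F₂.blocks b.snd) fun v =>
      Φ ((u.cons (T.arrow b.fst)).comp v)) := fun s =>
    IsML.lsum (Φ := fun (b : Cut2 _ Y) (u : Path (f₀ X) (f₁ _)) =>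
      lsum (F₂.blocks b.snd) fun v =>
      Φ ((u.cons (T.arrow b.fst)).comp v))
      (fun b => IsML.lsum (fun v => (hΦ.comp_right v).cons _) _) _
  rw [ins₂, lsum_cuts2_eq_snd_nil]
  · rw [ins_eq_leading F₀ F₁ (hml _) p hS]
    simp [cuts2, lsum_singleton, blocks]
  · intro c hc hc'
    have := AInfCat.length_of_mem_cuts2 p c hc
    rw [ins_eq_zero F₀ F₁ (hml _) c.fst hS (by omega), smul_zero]

theorem ins₂_eq_zero_right (S : Cochain A B f₀ f₁ d) {T : Cochain A B f₁ f₂ e}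
    {Φ : Path (f₀ X) (f₂ Y) → M} (hΦ : IsML Φ) (p : Path X Y) {m : ℕ}
    (hT : T.VanishesBelow m) (hp : p.length < m) : ins₂ F₀ F₁ F₂ S T Φ p = 0 := by
  rw [ins₂_eq_leading_right F₀ F₁ F₂ S hΦ p (hT.mono hp.le), hT.arrow p hp]
  exact hΦ.insert_zero _ _ .nil

theorem ins₂_eq_zero_left {S : Cochain A B f₀ f₁ d} (T : Cochain A B f₁ f₂ e)
    {Φ : Path (f₀ X) (f₂ Y) → M} (hΦ : IsML Φ) (p : Path X Y) {m : ℕ}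
    (hS : S.VanishesBelow m) (hp : p.length < m) : ins₂ F₀ F₁ F₂ S T Φ p = 0 := by
  rw [ins₂_eq_leading_left F₀ F₁ F₂ T hΦ p (hS.mono hp.le), hS.arrow p hp]
  exact (congrArg (fun y => ((e - 1) * red p).negOnePow • y)
    (hΦ.insert_zero .nil (red p + d) (Quiver.Path.nil.cons (T.arrow .nil)))).trans (smul_zero _)

/-- The difference between applying two functors with the same action on objects, as a
telescoping sum. -/
theorem blocks_sub_blocks (F G : Cochain A B f f 1)
    (h : ∀ (X : A.Ob) (n : ℤ), G.val (.nil : Path X X) n = F.val .nil n)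
    {Φ : Path (f X) (f Y) → M} (hΦ : IsML Φ) (p : Path X Y) :
    lsum (G.blocks p) Φ - lsum (F.blocks p) Φ = ins F G (G - F) Φ p := by
  induction hn : p.length using Nat.strong_induction_on generalizing Y with
  | _ n ih =>
  have hnil : ∀ {X Y : A.Ob} {Φ : Path (f X) (f Y) → M} (_ : IsML Φ) {Z : A.Ob}
      (r : Path (f X) (f Z)) (t : Path (f Z) (f Y)),
      Φ ((r.cons ((G - F).arrow (.nil : Path Z Z))).comp t) = 0 := by
    intro X Y Φ hΦ Z r t
    have : (G - F).arrow (.nil : Path Z Z)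
        = (⟨red (.nil : Path Z Z) + 1, 0⟩ : f Z ⟶ f Z) := by
      rw [arrow, sub_val, h, sub_self]
    rw [this]
    exact hΦ.insert_zero r _ t
  cases p with
  | nil =>
    have := hnil hΦ (.nil : Path (f X) (f X)) .nil
    simp only [Quiver.Path.comp_nil] at this
    simp [blocks, lsum_singleton, ins, cuts3, cuts2, this]
  | cons p a =>
    have e₁ : ins F G (G - F) Φ (p.cons a)
        = (lsum (cuts2 p) fun c => lsum (F.blocks c.fst) fun r =>
            Φ (r.cons ((G - F).arrow (c.snd.cons a))))
          + lsum (cuts2 p) fun c => ins F G (G - F) (fun q => Φ (q.cons (G.arrow (c.snd.cons a))))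
              c.fst := by
      have e₂ : ins F G (G - F) Φ (p.cons a) = lsum (cuts3 (p.cons a)) fun c =>
          lsum (F.blocks c.fst) fun r => lsum (G.blocks c.last) fun t =>
          Φ ((r.cons ((G - F).arrow c.mid)).comp t) := by
        simp [ins]
      rw [e₂, lsum_cuts3, lsum_cuts2_cons]
      simp only [lsum_cuts2_cons, lsum_add, lsum_blocks_nil, Quiver.Path.comp_nil]
      have e₃ : ∀ r : Path (f X) (f _), Φ (r.cons ((G - F).arrow (.nil : Path _ _))) = 0 :=
        fun r => hnil hΦ r .nil
      simp only [cuts2, lsum_singleton, lsum_blocks_nil, Quiver.Path.comp_nil, e₃, lsum_zero,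
        add_zero]
      rw [add_comm]
      congr 1
      simp only [ins, sub_self, zero_mul, Int.negOnePow_zero, one_smul]
      rw [← cuts3_last_coassoc p (fun x y z t => lsum (F.blocks x) fun r => lsum (G.blocks z)
        fun s => Φ (((r.cons ((G - F).arrow y)).comp s).cons (G.arrow (t.cons a)))), lsum_cuts3]
      refine lsum_congr fun c _ => lsum_congr fun c' _ => ?_
      rw [lsum_comm (cuts2 _)]
      refine lsum_congr fun r _ => ?_
      rw [lsum_blocks_cons]
      rfl
    rw [e₁, lsum_blocks_cons, lsum_blocks_cons, ← lsum_sub, ← lsum_add]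
    refine lsum_congr fun c hc => ?_
    rw [← ih c.fst.length (by
        have := AInfCat.length_of_mem_cuts2 p c hc
        simp only [Quiver.Path.length_cons] at hn
        omega) (hΦ.cons _) c.fst rfl]
    have e₄ : ∀ r : Path (f X) (f c.Z), Φ (r.cons ((G - F).arrow (c.snd.cons a)))
        = Φ (r.cons (G.arrow (c.snd.cons a))) - Φ (r.cons (F.arrow (c.snd.cons a))) := fun r => by
      rw [arrow, sub_val]
      exact map_sub (hΦ.insertHom r (red (c.snd.cons a) + 1) .nil) (G.val (c.snd.cons a) _)
        (F.val (c.snd.cons a) _)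
    simp only [e₄, lsum_sub]
    abel

/-- The effect of changing the first functor in an insertion. -/
theorem ins_sub_ins_left (F F' : Cochain A B f f 1) (G : Cochain A B g g 1)
    (h : ∀ (X : A.Ob) (n : ℤ), F'.val (.nil : Path X X) n = F.val .nil n)
    (T : Cochain A B f g d) {Φ : Path (f X) (g Y) → M} (hΦ : IsML Φ)
    (p : Path X Y) :
    ins F' G T Φ p - ins F G T Φ p = ins₂ F F' G (F' - F) T Φ p := by
  have hml : ∀ {Z : A.Ob} (s : Path Z Y), IsML (fun u : Path (f X) (f Z) =>
      lsum (cuts2 s) fun b => lsum (G.blocks b.snd) fun v =>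
      Φ ((u.cons (T.arrow b.fst)).comp v)) := fun s =>
    IsML.lsum (Φ := fun (b : Cut2 _ Y) (u : Path (f X) (f _)) =>
      lsum (G.blocks b.snd) fun v =>
      Φ ((u.cons (T.arrow b.fst)).comp v))
      (fun b => IsML.lsum (fun v => (hΦ.comp_right v).cons _) _) _
  rw [ins_eq_cuts2, ins_eq_cuts2, ← lsum_sub, ins₂]
  refine lsum_congr fun a _ => ?_
  rw [← smul_sub, blocks_sub_blocks F F' h (hml a.snd)]

/-- The effect of changing the second functor in an insertion. -/
theorem ins_sub_ins_right (F : Cochain A B f f 1) (G G' : Cochain A B g g 1)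
    (h : ∀ (X : A.Ob) (n : ℤ), G'.val (.nil : Path X X) n = G.val .nil n)
    (T : Cochain A B f g d) {Φ : Path (f X) (g Y) → M} (hΦ : IsML Φ)
    (p : Path X Y) :
    ins F G' T Φ p - ins F G T Φ p = ins₂ F G G' T (G' - G) Φ p := by
  rw [ins_eq_cuts2, ins_eq_cuts2, ← lsum_sub, ins₂_eq]
  refine lsum_congr fun a _ => ?_
  rw [← smul_sub, ← lsum_sub]
  congr 1
  · exact negOnePow_congr ⟨-red a.fst, by ring⟩
  refine lsum_congr fun r _ => ?_
  rw [← lsum_sub]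
  refine lsum_congr fun b _ => ?_
  rw [sub_self, zero_mul, Int.negOnePow_zero, one_smul, ← blocks_sub_blocks G G' h
    (hΦ.comp_left _)]

end Leading

section IdC

variable {A : GrQuiver k} {B : GrQuiver k}
variable {f g : A.Ob → B.Ob} {d e : ℤ}
variable {M : Type*} [AddCommGroup M] [Module k M] {X Y : A.Ob}

/-- The identity functor of a graded quiver. -/
noncomputable def idC (A : GrQuiver k) : Cochain A A (fun X => X) (fun X => X) 1 :=
  ofLin fun _ _ _ => LinearMap.id

theorem mapStr_id (p : Path X Y) :
    mapStr (f := fun X : A.Ob => X) (fun _ _ _ => LinearMap.id) p = p := by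
  induction p with
  | nil => rfl
  | cons p e ih => rw [mapStr, ih]; rfl

theorem lsum_blocks_idC {Φ : Path X Y → M} (hΦ : IsML Φ) (p : Path X Y) :
    lsum ((idC A).blocks p) Φ = Φ p := by
  refine (lsum_blocks_ofLin _ p hΦ).trans ?_
  rw [mapStr_id]

theorem idC_val_nil (X : A.Ob) (n : ℤ) : (idC A).val (.nil : Path X X) n = 0 := rfl

theorem idC_val_of_length (p : Path X Y) (n : ℤ) (h : p.length ≠ 1) :
    (idC A).val p n = 0 :=
  linVal_of_length (f := fun X => X) (fun _ _ _ => LinearMap.id) p n h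

theorem idC_val_str (a : X ⟶ Y) (n : ℤ) :
    (idC A).val (Quiver.Path.nil.cons a) n = Pi.single (M := fun i => A.Hom X Y i) a.1 a.2 n :=
  rfl

theorem idC_val_arrow (T : Cochain A B f g d) (p : Path X Y) (n : ℤ) :
    (idC B).val (Quiver.Path.nil.cons (T.arrow p)) n = T.val p n := by
  rw [idC_val_str]
  by_cases hn : n = red p + d
  · subst hn
    exact Pi.single_eq_same (M := fun i => B.Hom (f X) (g Y) i) _ _
  · rw [T.val_eq_zero p n hn]
    exact Pi.single_eq_of_ne (M := fun i => B.Hom (f X) (g Y) i) hn _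

theorem pre_idC (S : Cochain A B f g d) : S.pre (idC A) = S :=
  ext fun p n => lsum_blocks_idC (S.isML n) p

theorem comp_idC (S : Cochain A B f f 1) : S.comp (idC A) = S := pre_idC S

theorem idC_insC (F : Cochain A B f f 1) (G : Cochain A B g g 1) (T : Cochain A B f g d)
    (hd : d = d + 1 - 1) : insC F G T (idC B) d hd = T := by
  refine ext fun {X Y} p n => ?_
  rw [insC_val, ins, lsum_cuts3_eq_mid]
  · simp only [blocks, lsum_singleton, red, mul_zero, Int.negOnePow_zero, one_smul]
    exact idC_val_arrow T p n
  · intro c _ hc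
    refine lsum_eq_zero fun r hr => lsum_eq_zero fun t ht => ?_
    rw [idC_val_of_length, smul_zero]
    have h₁ : ∀ {X Y : A.Ob} {f : A.Ob → B.Ob} (F : Cochain A B f f 1) (p : Path X Y),
        ∀ r ∈ F.blocks p, p.length ≠ 0 → r.length ≠ 0 := by
      intro X Y f F p r hr hp
      have aux : ∀ {X Z : A.Ob} (p : Path X Z) {Y : A.Ob} (s : Path Z Y),
          ∀ r ∈ F.blocksAux p s, r.length ≠ 0 := by
        intro X Z p
        induction p with
        | nil =>
          intro Y s r hr
          simp only [blocksAux, List.mem_singleton] at hr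
          subst hr
          simp
        | cons p e ih =>
          intro Y s r hr
          simp only [blocksAux, List.mem_append, List.mem_map] at hr
          rcases hr with hr | ⟨r', _, rfl⟩
          · exact ih _ r hr
          · simp
      cases p with
      | nil => simp at hp
      | cons p e => exact aux p _ r hr
    have h₂ := h₁ F c.fst r hr
    have h₃ := h₁ G c.last t ht
    simp only [Quiver.Path.length_comp, Quiver.Path.length_cons]
    omega

theorem idC_comp (F : Cochain A B f f 1)
    (hF : ∀ (X : A.Ob) (n : ℤ), F.val (.nil : Path X X) n = 0) : (idC B).comp F = F := by
  refine ext fun {X Y} p n => ?_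
  have h := blocks_sub_blocks (0 : Cochain A B f f 1) F (fun X n => hF X n)
    ((idC B).isML n) p
  have h' := idC_insC (0 : Cochain A B f f 1) F F (by ring)
  have h₀ : lsum ((0 : Cochain A B f f 1).blocks p) (fun q => (idC B).val q n) = 0 := by
    cases p with
    | nil => exact (lsum_blocks_nil _ _).trans (idC_val_nil _ _)
    | cons p a =>
      rw [lsum_blocks_cons]
      refine lsum_eq_zero fun c _ => lsum_eq_zero fun r _ => ?_
      exact ((idC B).isML n).insert_zero r _ .nil
  rw [h₀, sub_zero, sub_zero] at h
  refine h.trans ?_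
  exact congrArg (fun T : Cochain A B f f 1 => T.val p n) h'

end IdC

end Cochain

/-! ### The differential of pre-natural transformations -/

namespace Cochain

variable {A : GrQuiver k} {B : GrQuiver k} {C : GrQuiver k}
variable {f g : A.Ob → B.Ob} {d e : ℤ}

theorem ins_idC {M : Type*} [AddCommGroup M] [Module k M]
    (a : Cochain A A (fun X => X) (fun X => X) d) {X Y : A.Ob} {Φ : Path X Y → M}
    (hΦ : IsML Φ) (p : Path X Y) :
    ins (idC A) (idC A) a Φ p = lsum (cuts3 p) fun c => ((d - 1) * red c.fst).negOnePow •
      Φ ((c.fst.cons (a.arrow c.mid)).comp c.last) := by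
  refine lsum_congr fun c _ => ?_
  have h : ∀ r : Path X c.Z, (lsum ((idC A).blocks c.last) fun t =>
      ((d - 1) * red c.fst).negOnePow • Φ ((r.cons (a.arrow c.mid)).comp t))
      = ((d - 1) * red c.fst).negOnePow • Φ ((r.cons (a.arrow c.mid)).comp c.last) := fun r =>
    lsum_blocks_idC ((hΦ.comp_left _).units_smul _) c.last
  rw [lsum_congr fun r _ => h r]
  exact lsum_blocks_idC (((hΦ.comp_right _).cons _).units_smul _) c.fst

end Cochain

open Cochain

/-- The `A∞`-relations: the coderivation given by `μ` squares to zero. -/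
theorem AInfCat.ins_μ_μ (A : AInfCat k) {X Y : A.Ob} (p : Path X Y) (n : ℤ) :
    ins (idC Aᵍ) (idC Aᵍ) A.μ (fun q => A.μ.val q n) p = 0 := by
  rw [ins_idC A.μ (A.μ.isML n)]
  simpa using A.rel p n

namespace AInfFunctor

variable {A : AInfCat k} {B : AInfCat k} {C : AInfCat k}
variable {f g h : A.Ob → B.Ob} {d e : ℤ}

/-- The functor relation as an equality of cochains. -/
theorem pre_μ (F : AInfFunctor A B f) : B.μ.pre F.toCochain
    = insC (idC Aᵍ) (idC Aᵍ) A.μ F.toCochain 2 := by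
  refine ext fun {X Y} p n => ?_
  rw [insC_val, pre_val, ins_idC A.μ (F.isML n), F.rel p n]
  simp

/-- The differential of a pre-natural transformation, as a cochain. -/
noncomputable def homDC (F : AInfFunctor A B f) (G : AInfFunctor A B g)
    (T : Cochain Aᵍ Bᵍ f g d) :
    Cochain Aᵍ Bᵍ f g (d + 1) :=
  insC F.toCochain G.toCochain T B.μ (d + 1)
    - (d - 1).negOnePow • insC (idC Aᵍ) (idC Aᵍ) A.μ T (d + 1)

theorem homDC_val' (F : AInfFunctor A B f) (G : AInfFunctor A B g)
    (T : Cochain Aᵍ Bᵍ f g d) {X Y : A.Ob} (p : Path X Y) (n : ℤ) :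
    (homDC F G T).val p n = ins F.toCochain G.toCochain T (fun q => B.μ.val q n) p
      - (d - 1).negOnePow • ins (idC Aᵍ) (idC Aᵍ) A.μ
        (fun q => T.val q n) p := by
  rw [homDC, sub_val, units_smul_val]
  rfl

theorem homDC_val (F : AInfFunctor A B f) (G : AInfFunctor A B g)
    (T : Cochain Aᵍ Bᵍ f g d) {X Y : A.Ob} (p : Path X Y) (n : ℤ) :
    (homDC F G T).val p n = homD F G T p n := by
  rw [homDC_val', ins_idC A.μ (T.isML n)]
  simp only [show (2 - 1 : ℤ) = 1 from rfl, one_mul]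
  rfl

section Linear

variable (F : AInfFunctor A B f) (G : AInfFunctor A B g)
  (T S : Cochain Aᵍ Bᵍ f g d)

theorem homDC_add : homDC F G (T + S) = homDC F G T + homDC F G S := by
  refine ext fun {X Y} p n => ?_
  rw [add_val, homDC_val', homDC_val', homDC_val', ins_add_left _ _ _ _ (B.μ.isML n)]
  have := ins_add (idC Aᵍ) (idC Aᵍ) A.μ (fun q => T.val q n)
    (fun q => S.val q n) p
  have h : ins (idC Aᵍ) (idC Aᵍ) A.μ (fun q => (T + S).val q n) p = _ := this
  rw [h, smul_add]
  abel

/-- The differential of pre-natural transformations as an additive map. -/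
noncomputable def homDHom : Cochain Aᵍ Bᵍ f g d →+
    Cochain Aᵍ Bᵍ f g (d + 1) :=
  AddMonoidHom.mk' (homDC F G) (homDC_add F G)

theorem homDC_sub : homDC F G (T - S) = homDC F G T - homDC F G S := map_sub (homDHom F G) T S

theorem homDC_zero : homDC F G (0 : Cochain Aᵍ Bᵍ f g d) = 0 :=
  map_zero (homDHom F G)

end Linear

/-- The source part of the differential, of a transformation followed by a further insertion. -/
theorem ins_μ_ins (F : AInfFunctor A B f) (G : AInfFunctor A B g)
    (T : Cochain Aᵍ Bᵍ f g d) {M : Type*} [AddCommGroup M] [Module k M]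
    {X Y : A.Ob} {Φ : Path (f X) (g Y) → M} (hΦ : IsML Φ) (p : Path X Y) :
    ins (idC Aᵍ) (idC Aᵍ) A.μ (fun q => ins F.toCochain G.toCochain T Φ q) p
      = ins F.toCochain G.toCochain (insC (idC Aᵍ) (idC Aᵍ) A.μ T (d + 1)) Φ p
        + ins₂ F.toCochain G.toCochain G.toCochain T (B.μ.pre G.toCochain) Φ p
        + (d - 1).negOnePow •
          ins₂ F.toCochain F.toCochain G.toCochain (B.μ.pre F.toCochain) T Φ p := by
  rw [ins_ins (idC Aᵍ) (idC Aᵍ) A.μ F.toCochain G.toCochain T (d + 1)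
    (by ring) hΦ p]
  rw [pre_μ, pre_μ, show (2 - 1) * (d - 1) = d - 1 by ring]
  simp only [comp_idC, pre_idC]

theorem ins_ins_μ (F : AInfFunctor A B f) (G : AInfFunctor A B g)
    (T : Cochain Aᵍ Bᵍ f g d) {M : Type*} [AddCommGroup M] [Module k M]
    {X Y : A.Ob} {Φ : Path (f X) (g Y) → M} (hΦ : IsML Φ) (p : Path X Y) :
    ins F.toCochain G.toCochain T
        (fun q => ins (idC Bᵍ) (idC Bᵍ) B.μ Φ q) p
      = ins F.toCochain G.toCochain (insC F.toCochain G.toCochain T B.μ (d + 1)) Φ p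
        + ins₂ F.toCochain F.toCochain G.toCochain (B.μ.pre F.toCochain) T Φ p
        + (d - 1).negOnePow •
          ins₂ F.toCochain G.toCochain G.toCochain T (B.μ.pre G.toCochain) Φ p := by
  have h := ins_ins F.toCochain G.toCochain T (idC Bᵍ) (idC Bᵍ) B.μ (d + 1)
    (by ring) hΦ p
  rw [idC_comp _ F.val_nil, idC_comp _ G.val_nil, idC_insC,
    show (d - 1) * (2 - 1) = d - 1 by ring] at h
  exact h

theorem ins_homDC (F : AInfFunctor A B f) (G : AInfFunctor A B g)
    (T : Cochain Aᵍ Bᵍ f g d) {M : Type*} [AddCommGroup M] [Module k M]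
    {X Y : A.Ob} {Φ : Path (f X) (g Y) → M} (hΦ : IsML Φ) (p : Path X Y) :
    ins F.toCochain G.toCochain (homDC F G T) Φ p
      = ins F.toCochain G.toCochain T
          (fun q => ins (idC Bᵍ) (idC Bᵍ) B.μ Φ q) p
        - (d - 1).negOnePow • ins (idC Aᵍ) (idC Aᵍ) A.μ
          (fun q => ins F.toCochain G.toCochain T Φ q) p := by
  rw [ins_ins_μ F G T hΦ, ins_μ_ins F G T hΦ, homDC, ins_sub_left _ _ _ _ hΦ,
    ins_units_smul_left _ _ _ _ hΦ, smul_add, smul_add, smul_smul, Int.units_mul_self, one_smul]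
  abel

theorem ins_μ_ins_μ (A : AInfCat k) {M : Type*} [AddCommGroup M] [Module k M]
    {X Y : A.Ob} {Φ : Path X Y → M} (hΦ : IsML Φ) (p : Path X Y) :
    ins (idC Aᵍ) (idC Aᵍ) A.μ
        (fun q => ins (idC Aᵍ) (idC Aᵍ) A.μ Φ q) p = 0 := by
  have h := ins_μ_ins (AInfFunctor.id A) (AInfFunctor.id A) A.μ hΦ p
  refine h.trans ?_
  have h0 : insC (idC Aᵍ) (idC Aᵍ) A.μ A.μ (2 + 1) = 0 :=
    ext fun {X Y} p n => A.ins_μ_μ p n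
  have h1 : A.μ.pre (AInfFunctor.id A).toCochain = A.μ := pre_idC A.μ
  rw [h0, ins_zero_left _ _ hΦ, h1]
  simp

/-- The differential of pre-natural transformations squares to zero, because the coderivations given
by `μ_A` and `μ_B` do and `F`, `G` intertwine them. -/
theorem homDC_homDC (F : AInfFunctor A B f) (G : AInfFunctor A B g)
    (T : Cochain Aᵍ Bᵍ f g d) : homDC F G (homDC F G T) = 0 := by
  refine ext fun {X Y} p n => ?_
  have e₁ : ∀ q : Path X Y, (homDC F G T).val q n = _ := fun q => homDC_val' F G T q n
  rw [homDC_val', ins_homDC F G T (B.μ.isML n), ins_congr _ _ _ (fun q => B.ins_μ_μ q n),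
    ins_zero_fun, ins_congr _ _ _ (Φ := fun q => (homDC F G T).val q n) e₁, ins_sub, ins_units_smul, ins_μ_ins_μ A (T.isML n),
    show d + 1 - 1 = d - 1 + 1 by ring, Int.negOnePow_succ]
  simp [zero_val, Units.neg_smul]

section PrePost

variable (F : AInfFunctor A B f) (G : AInfFunctor A B g)
  (T : Cochain Aᵍ Bᵍ f g d)

/-- Composition with a further functor is compatible with the differential. -/
theorem homDC_insC {c : B.Ob → C.Ob} (K : AInfFunctor B C c) :
    homDC (K.comp F) (K.comp G) (insC F.toCochain G.toCochain T K.toCochain d)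
      = insC F.toCochain G.toCochain (homDC F G T) K.toCochain (d + 1) := by
  refine ext fun {X Y} p n => ?_
  rw [homDC_val', insC_val, ins_homDC F G T (K.isML n)]
  congr 1
  refine (ins_blocks F.toCochain G.toCochain T K.toCochain (C.μ.isML n) p).symm.trans ?_
  refine ins_congr _ _ _ (fun q => ?_) p
  exact congrArg (fun S : Cochain Bᵍ Cᵍ c c 2 => S.val q n) K.pre_μ

theorem ins_μ_blocks {M : Type*} [AddCommGroup M] [Module k M] {X Y : A.Ob}
    {Φ : Path (f X) (f Y) → M} (hΦ : IsML Φ) (p : Path X Y) :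
    ins (idC Aᵍ) (idC Aᵍ) A.μ (fun q => lsum (F.blocks q) Φ) p
      = lsum (F.blocks p)
          (fun q => ins (idC Bᵍ) (idC Bᵍ) B.μ Φ q) := by
  have h₁ := ins_blocks (idC Aᵍ) (idC Aᵍ) A.μ F.toCochain (X := X) (Y := Y) hΦ p
  have h₂ := blocks_ins F.toCochain (idC Bᵍ) (idC Bᵍ) B.μ (X := X) (Y := Y) hΦ p
  rw [idC_comp _ F.val_nil, pre_μ] at h₂
  rw [h₂, ← comp_idC F.toCochain]
  simp only [comp_idC] at h₁ ⊢
  exact h₁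

/-- Composition with a previous functor is compatible with the differential. -/
theorem homDC_pre {C : AInfCat k} {c : C.Ob → A.Ob} (K : AInfFunctor C A c) :
    homDC (F.comp K) (G.comp K) (T.pre K.toCochain) = (homDC F G T).pre K.toCochain := by
  refine ext fun {X Y} p n => ?_
  rw [homDC_val', pre_val]
  have h₁ := blocks_ins K.toCochain F.toCochain G.toCochain T (X := X) (Y := Y) (B.μ.isML n) p
  have h₂ := K.ins_μ_blocks (T.isML n) p
  have e₁ : ∀ q : Path (c X) (c Y), (homDC F G T).val q n = _ :=
    fun q => homDC_val' F G T q n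
  simp only [e₁]
  rw [lsum_sub, ← smul_lsum]
  exact congrArg₂ (· - (d - 1).negOnePow • ·) h₁.symm h₂

end PrePost

/-- The Hochschild differential is the differential of pre-natural transformations of the identity
functor. -/
theorem homDC_id_val {d : ℤ} (b : Cochain Aᵍ Aᵍ (fun X => X) (fun X => X) d)
    {X Y : A.Ob} (p : Path X Y) (n : ℤ) :
    (homDC (AInfFunctor.id A) (AInfFunctor.id A) b).val p n = A.hochschildD b p n := by
  rw [homDC_val']
  have h := ins_idC b (A.μ.isML n) p
  refine (congrArg (· - _) h).trans ?_
  rw [ins_idC A.μ (b.isML n), AInfCat.hochschildD, sub_eq_add_neg, ← Units.neg_smul, smul_lsum]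
  congr 1
  refine lsum_congr fun c _ => ?_
  rw [smul_smul, show d + red c.fst = (d - 1) + 1 + red c.fst by ring, Int.negOnePow_add,
    Int.negOnePow_succ]
  simp

theorem homDC_of_hochschildD {d : ℤ} (b : Cochain Aᵍ Aᵍ (fun X => X) (fun X => X) d)
    (hb : ∀ {X Y : A.Ob} (p : Path X Y) (n : ℤ), A.hochschildD b p n = 0) :
    homDC (AInfFunctor.id A) (AInfFunctor.id A) b = 0 :=
  ext fun p n => (homDC_id_val b p n).trans (hb p n)

/-- The cochains `F ∘ a` obtained from a vector field `a`. -/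
noncomputable abbrev postVF (F : AInfFunctor A B f)
    (a : Cochain Aᵍ Aᵍ (fun X => X) (fun X => X) 1) :
    Cochain Aᵍ Bᵍ f f 1 :=
  insC (idC Aᵍ) (idC Aᵍ) a F.toCochain 1

theorem homDC_postVF (F : AInfFunctor A B f)
    {a : Cochain Aᵍ Aᵍ (fun X => X) (fun X => X) 1}
    (ha : homDC (AInfFunctor.id A) (AInfFunctor.id A) a = 0) : homDC F F (F.postVF a) = 0 := by
  have h := homDC_insC (AInfFunctor.id A) (AInfFunctor.id A) a F
  rw [ha] at h
  have e : ∀ K : AInfFunctor A B f, K.toCochain = F.toCochain →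
    homDC K K (F.postVF a) = homDC F F (F.postVF a) := fun K hK => by
      rw [homDC, homDC, hK]
  refine (e (F.comp (AInfFunctor.id A)) (comp_idC F.toCochain)).symm.trans (h.trans ?_)
  exact ext fun {X Y} p n => ins_zero_left (idC Aᵍ) (idC Aᵍ)
    (F.isML n) p

theorem homDC_pre_VF (F : AInfFunctor A B f)
    {b : Cochain Bᵍ Bᵍ (fun X => X) (fun X => X) 1}
    (hb : homDC (AInfFunctor.id B) (AInfFunctor.id B) b = 0) :
    homDC F F (b.pre F.toCochain) = 0 := by
  have h := homDC_pre (AInfFunctor.id B) (AInfFunctor.id B) b F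
  rw [hb] at h
  have e : ∀ K : AInfFunctor A B f, K.toCochain = F.toCochain →
    homDC K K (b.pre F.toCochain) = homDC F F (b.pre F.toCochain) := fun K hK => by
      rw [homDC, homDC, hK]
  refine (e ((AInfFunctor.id B).comp F) (idC_comp F.toCochain F.val_nil)).symm.trans (h.trans ?_)
  exact ext fun {X Y} p n => lsum_zero _

theorem relates_iff (F : AInfFunctor A B f)
    (a : Cochain Aᵍ Aᵍ (fun X => X) (fun X => X) 1)
    (b : Cochain Bᵍ Bᵍ (fun X => X) (fun X => X) 1) :
    F.Relates a b ↔ ∃ T : Cochain Aᵍ Bᵍ f f 0,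
      homDC F F T = F.postVF a - b.pre F.toCochain := by
  have e : ∀ {X Y : A.Ob} (p : Path X Y) (n : ℤ), (F.postVF a - b.pre F.toCochain).val p n
      = lsum (cuts3 p) (fun c => F.val ((c.fst.cons (a.arrow c.mid)).comp c.last) n)
          - lsum (F.blocks p) (fun q => b.val q n) := by
    intro X Y p n
    rw [sub_val, insC_val, ins_idC a (F.isML n)]
    simp [pre_val]
  constructor
  · rintro ⟨T, hT⟩
    exact ⟨T, ext fun p n => by rw [homDC_val, hT, e]⟩
  · rintro ⟨T, hT⟩
    refine ⟨T, fun p n => ?_⟩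
    rw [← homDC_val, ← e]
    exact congrArg (fun S : Cochain Aᵍ Bᵍ f f 1 => S.val p n) hT

end AInfFunctor

/-! ### Cochains with only a linear part -/

namespace Cochain

section LinearCochains

variable {A : GrQuiver k} {B : GrQuiver k} {C : GrQuiver k}
variable {f g : A.Ob → B.Ob} {c c' : B.Ob → C.Ob} {d e : ℤ}

/-- The linear part of `S` applied to the values of `T`. -/
def thenC (T : Cochain A B f g d) (S : Cochain B C c c' e) (r : ℤ)
    (hr : r = d + e - 1 := by omega) : Cochain A C (fun X => c (f X)) (fun X => c' (g X)) r where
  val p n := S.val (Quiver.Path.nil.cons (T.arrow p)) n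
  val_eq_zero p n hn := S.val_eq_zero _ _ (by simp only [red, arrow]; omega)
  val_add p i a b q n := (isML_arrow T (S.isML n) .nil .nil).add p i a b q
  val_smul p i r a q n := (isML_arrow T (S.isML n) .nil .nil).smul p i r a q

theorem thenC_val (T : Cochain A B f g d) (S : Cochain B C c c' e) (r : ℤ)
    (hr : r = d + e - 1) {X Y : A.Ob} (p : Path X Y) (n : ℤ) :
    (T.thenC S r hr).val p n = S.lin (red p + d) n (T.val p (red p + d)) := rfl

/-- The part of a cochain which is supported on strings of length `m`. -/
def atLength (T : Cochain A B f g d) (m : ℕ) : Cochain A B f g d where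
  val p n := if p.length = m then T.val p n else 0
  val_eq_zero p n h := by rw [T.val_eq_zero p n h, ite_self]
  val_add p i a b q n := by
    simp only [Quiver.Path.length_comp, Quiver.Path.length_cons]
    split_ifs
    · exact T.val_add p i a b q n
    · exact (add_zero _).symm
  val_smul p i r a q n := by
    simp only [Quiver.Path.length_comp, Quiver.Path.length_cons]
    split_ifs
    · exact T.val_smul p i r a q n
    · exact (smul_zero _).symm

theorem atLength_val (T : Cochain A B f g d) (m : ℕ) {X Y : A.Ob} (p : Path X Y) (n : ℤ) :
    (T.atLength m).val p n = if p.length = m then T.val p n else 0 := rfl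

theorem vanishesBelow_atLength (T : Cochain A B f g d) (m : ℕ) :
    (T.atLength m).VanishesBelow m := ⟨fun p n hp => if_neg (by omega)⟩

/-- A cochain with only a linear part. -/
structure IsLinear (S : Cochain A B f g d) : Prop where
  eq_zero : ∀ {X Y : A.Ob} (p : Path X Y) (n : ℤ), p.length ≠ 1 → S.val p n = 0

/-- The cochain given by linear maps of degree `d - 1`. -/
def ofLinDeg (d : ℤ) (L : ∀ X Y (n m : ℤ), A.Hom X Y n →ₗ[k] B.Hom (f X) (g Y) m)
    (hL : ∀ X Y n m, m ≠ n - 1 + d → L X Y n m = 0) : Cochain A B f g d where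
  val {X Y} p m := match Y, p with
    | _, .cons .nil a => L _ _ a.1 m a.2
    | _, .nil => 0
    | _, .cons (.cons _ _) _ => 0
  val_eq_zero p n h := by
    match p, h with
    | .nil, _ => rfl
    | .cons .nil ⟨i, a⟩, h =>
      exact congrArg (fun l => l a) (hL _ _ i n (by simpa [red] using h))
    | .cons (.cons _ _) _, _ => rfl
  val_add p i a b q n := by
    cases q with
    | nil =>
      cases p with
      | nil => exact (L _ _ i n).map_add a b
      | cons _ _ => exact (add_zero _).symm
    | cons q _ => cases q <;> exact (add_zero _).symm
  val_smul p i r a q n := by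
    cases q with
    | nil =>
      cases p with
      | nil => exact (L _ _ i n).map_smul r a
      | cons _ _ => exact (smul_zero _).symm
    | cons q _ => cases q <;> exact (smul_zero _).symm

theorem isLinear_ofLinDeg (L : ∀ X Y (n m : ℤ), A.Hom X Y n →ₗ[k] B.Hom (f X) (g Y) m)
    (hL : ∀ X Y n m, m ≠ n - 1 + d → L X Y n m = 0) : (ofLinDeg d L hL).IsLinear := by
  refine ⟨fun {X Y} p n h => ?_⟩
  match p, h with
  | .nil, _ => rfl
  | .cons .nil _, h => exact absurd rfl h
  | .cons (.cons _ _) _, _ => rfl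

theorem isLinear_ofLin (L : ∀ X Y n, A.Hom X Y n →ₗ[k] B.Hom (f X) (f Y) n) :
    (ofLin L).IsLinear := ⟨fun p n h => linVal_of_length L p n h⟩

theorem length_of_mem_blocks (F : Cochain A B f f d) {X Y : A.Ob} (p : Path X Y) :
    ∀ r ∈ F.blocks p, p.length ≠ 0 → r.length ≠ 0 := by
  intro r hr hp
  have aux : ∀ {X Z : A.Ob} (p : Path X Z) {Y : A.Ob} (s : Path Z Y),
      ∀ r ∈ F.blocksAux p s, r.length ≠ 0 := by
    intro X Z p
    induction p with
    | nil =>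
      intro Y s r hr
      simp only [blocksAux, List.mem_singleton] at hr
      subst hr
      simp
    | cons p e ih =>
      intro Y s r hr
      simp only [blocksAux, List.mem_append, List.mem_map] at hr
      rcases hr with hr | ⟨r', _, rfl⟩
      · exact ih _ r hr
      · simp
  cases p with
  | nil => simp at hp
  | cons p e => exact aux p _ r hr

theorem IsLinear.insC {S : Cochain B C c c' e} (hS : S.IsLinear) (F : Cochain A B f f 1)
    (G : Cochain A B g g 1) (T : Cochain A B f g d) (r : ℤ) (hr : r = d + e - 1) :
    insC F G T S r hr = T.thenC S r hr := by
  refine ext fun {X Y} p n => ?_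
  rw [insC_val, ins, lsum_cuts3_eq_mid]
  · simp only [blocks, lsum_singleton, red, mul_zero, Int.negOnePow_zero, one_smul]
    rfl
  · intro c _ hc
    refine lsum_eq_zero fun r hr => lsum_eq_zero fun t ht => ?_
    rw [hS.eq_zero, smul_zero]
    have h₂ := length_of_mem_blocks F c.fst r hr
    have h₃ := length_of_mem_blocks G c.last t ht
    simp only [Quiver.Path.length_comp, Quiver.Path.length_cons]
    omega

theorem lsum_blocks_of_length_ne_one {M : Type*} [AddCommGroup M] [Module k M]
    (F : Cochain A B f f 1) {X Y : A.Ob}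
    {Φ : Path (f X) (f Y) → M} (hΦ : IsML Φ) (h : ∀ q, q.length ≠ 1 → Φ q = 0)
    (p : Path X Y) (hF : ∀ (X : A.Ob) (n : ℤ), F.val (.nil : Path X X) n = 0) :
    lsum (F.blocks p) Φ = Φ (Quiver.Path.nil.cons (F.arrow p)) := by
  cases p with
  | nil =>
    rw [lsum_blocks_nil, h _ (by simp), arrow, hF]
    exact (hΦ.insert_zero .nil _ .nil).symm
  | cons p a =>
    rw [lsum_blocks_cons, lsum_cuts2_eq_fst_nil]
    · exact lsum_blocks_nil _ _
    · intro c _ hc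
      refine lsum_eq_zero fun r hr => h _ ?_
      have := length_of_mem_blocks F c.fst r hr hc
      simpa using this

theorem IsLinear.pre {S : Cochain B C c c' e} (hS : S.IsLinear) (F : Cochain A B f f 1)
    (hF : ∀ (X : A.Ob) (n : ℤ), F.val (.nil : Path X X) n = 0) :
    S.pre F = F.thenC S e := ext fun {_ _} p n =>
  lsum_blocks_of_length_ne_one F (S.isML n) (fun q hq => hS.eq_zero q n hq) p hF

theorem IsLinear.ext {S T : Cochain A B f g d} (hS : S.IsLinear) (hT : T.IsLinear)
    (h : ∀ {X Y : A.Ob} (n m : ℤ), S.lin (X := X) (Y := Y) n m = T.lin n m) : S = T := by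
  refine Cochain.ext fun {X Y} p n => ?_
  match p with
  | .nil => rw [hS.eq_zero _ _ (by simp), hT.eq_zero _ _ (by simp)]
  | .cons .nil ⟨i, a⟩ => exact congrArg (fun l => l a) (h i n)
  | .cons (.cons _ _) _ => rw [hS.eq_zero _ _ (by simp), hT.eq_zero _ _ (by simp)]

theorem IsLinear.thenC {T : Cochain A B f g d} (hT : T.IsLinear) (S : Cochain B C c c' e) (r : ℤ)
    (hr : r = d + e - 1) : (T.thenC S r hr).IsLinear := ⟨fun p n h => by
  rw [thenC_val, hT.eq_zero p _ h, map_zero]⟩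

theorem thenC_lin (T : Cochain A B f g d) (S : Cochain B C c c' e) (r : ℤ)
    (hr : r = d + e - 1) {X Y : A.Ob} (n m : ℤ) (a : A.Hom X Y n) :
    (T.thenC S r hr).lin n m a = S.lin (n - 1 + d) m (T.lin n (n - 1 + d) a) := by
  refine (thenC_val T S r hr (str₁ a) m).trans ?_
  have h : red (str₁ a) = n - 1 := by simp [red]
  rw [h]
  rfl

theorem IsLinear.add {S T : Cochain A B f g d} (hS : S.IsLinear) (hT : T.IsLinear) :
    (S + T).IsLinear :=
  ⟨fun p n h => by rw [add_val, hS.eq_zero p n h, hT.eq_zero p n h, add_zero]⟩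

theorem IsLinear.sub {S T : Cochain A B f g d} (hS : S.IsLinear) (hT : T.IsLinear) :
    (S - T).IsLinear :=
  ⟨fun p n h => by rw [sub_val, hS.eq_zero p n h, hT.eq_zero p n h, sub_zero]⟩

theorem ofLin_lin (L : ∀ X Y n, A.Hom X Y n →ₗ[k] B.Hom (f X) (f Y) n) {X Y : A.Ob} (n : ℤ)
    (a : A.Hom X Y n) : (ofLin L).lin n n a = L X Y n a :=
  Pi.single_eq_same (M := fun i => B.Hom (f X) (f Y) i) _ _

theorem lin_eq_zero (T : Cochain A B f g d) {X Y : A.Ob} {n m : ℤ} (h : m ≠ n - 1 + d)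
    (a : A.Hom X Y n) : T.lin n m a = 0 :=
  T.val_eq_zero _ _ (by simp only [red]; omega)

end LinearCochains

end Cochain

/-! ### Contractions onto cohomology -/

section Contraction

theorem _root_.LinearMap.exists_generalizedInverse {V W : Type*} [AddCommGroup V] [Module k V]
    [AddCommGroup W] [Module k W] (φ : V →ₗ[k] W) : ∃ s : W →ₗ[k] V, ∀ v, φ (s (φ v)) = φ v := by
  obtain ⟨s, hs⟩ := φ.rangeRestrict.exists_rightInverse_of_surjective φ.range_rangeRestrict
  obtain ⟨t, ht⟩ := s.exists_extend
  refine ⟨t, fun v => ?_⟩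
  have h₁ : t (φ v) = s (φ.rangeRestrict v) :=
    congrArg (fun l => l (φ.rangeRestrict v)) ht
  rw [h₁]
  exact congrArg Subtype.val (congrArg (fun l => l (φ.rangeRestrict v)) hs)

namespace AInfCat

variable (A : AInfCat k)

/-- A linear map of degree `-1` which provides a primitive for every coboundary. -/
noncomputable def primitive (X Y : A.Ob) (n m : ℤ) : A.Hom X Y n →ₗ[k] A.Hom X Y m :=
  if m = n - 1 then Classical.choose (A.d (X := X) (Y := Y) m n).exists_generalizedInverse else 0

theorem primitive_eq_zero (X Y : A.Ob) {n m : ℤ} (h : m ≠ n - 1) : A.primitive X Y n m = 0 :=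
  if_neg h

theorem d_primitive {X Y : A.Ob} {n : ℤ} (a : A.Hom X Y n) (h : ∃ η, A.d (n - 1) n η = a) :
    A.d (n - 1) n (A.primitive X Y n (n - 1) a) = a := by
  obtain ⟨η, rfl⟩ := h
  rw [primitive, if_pos rfl]
  exact Classical.choose_spec (A.d (X := X) (Y := Y) (n - 1) n).exists_generalizedInverse η

theorem cls_eq_cls {X Y : A.Ob} {n : ℤ} (a b : A.cocycles X Y n) :
    A.cls a = A.cls b ↔ A.Homologous a.1 b.1 := by
  rw [← sub_eq_zero, ← map_sub, cls_eq_zero]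
  rfl

/-- Over a field, a choice of cocycle representatives `i` is part of a homotopy retraction of a
complex onto its cohomology, with a homotopy that vanishes on the representatives. -/
theorem exists_contraction {X Y : A.Ob} (i : ∀ n, A.HHom X Y n →ₗ[k] A.Hom X Y n)
    (hi : ∀ n x, A.d n (n + 1) (i n x) = 0) (hc : ∀ n x, A.cls ⟨i n x, hi n x⟩ = x) :
    ∃ (p : ∀ n, A.Hom X Y n →ₗ[k] A.HHom X Y n) (h : ∀ n m, A.Hom X Y n →ₗ[k] A.Hom X Y m),
      (∀ n (a : A.cocycles X Y n), p n a.1 = A.cls a) ∧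
      (∀ n m a, p m (A.d n m a) = 0) ∧
      (∀ n m, m ≠ n - 1 → h n m = 0) ∧
      (∀ n m x, h n m (i n x) = 0) ∧
      ∀ n a, A.d (n - 1) n (h n (n - 1) a) + h (n + 1) n (A.d n (n + 1) a) = a - i n (p n a) := by
  have key : ∀ s : ∀ n m, A.Hom X Y n →ₗ[k] A.Hom X Y m,
      (∀ n a, A.d (n - 1) n (s n (n - 1) (A.d (n - 1) n a)) = A.d (n - 1) n a) →
      ∃ (N : ∀ n, A.Hom X Y n →ₗ[k] A.cocycles X Y n),
        (∀ n a, (N n a).1 = a - A.d (n - 1) n (s n (n - 1) a) - s (n + 1) n (A.d n (n + 1) a)) := by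
    intro s hs
    refine ⟨fun n => LinearMap.codRestrict _ (LinearMap.id - A.d (n - 1) n ∘ₗ s n (n - 1) -
      s (n + 1) n ∘ₗ A.d n (n + 1)) fun a => ?_, fun n a => rfl⟩
    have h := hs (n + 1)
    rw [add_sub_cancel_right] at h
    simp only [LinearMap.mem_ker, LinearMap.sub_apply, LinearMap.comp_apply, LinearMap.id_apply,
      map_sub, A.d_d, sub_zero, h, sub_self]
  have hN : ∀ (s : ∀ n m, A.Hom X Y n →ₗ[k] A.Hom X Y m)
      (hs : ∀ n a, A.d (n - 1) n (s n (n - 1) (A.d (n - 1) n a)) = A.d (n - 1) n a)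
      (N : ∀ n, A.Hom X Y n →ₗ[k] A.cocycles X Y n)
      (_ : ∀ n a, (N n a).1 = a - A.d (n - 1) n (s n (n - 1) a) - s (n + 1) n (A.d n (n + 1) a)),
      (∀ n (a : A.cocycles X Y n), A.cls (N n a.1) = A.cls a) ∧
        ∀ n m a, N m (A.d n m a) = 0 := by
    intro s hs N hN
    constructor
    · intro n a
      have ha : A.d n (n + 1) a.1 = 0 := a.2
      rw [cls_eq_cls]
      refine ⟨-s n (n - 1) a.1, ?_⟩
      rw [hN, ha, map_zero, map_neg]
      abel
    · intro n m a
      by_cases hm : m = n + 1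
      · obtain rfl : n = m - 1 := by omega
        refine Subtype.ext ?_
        rw [hN, hs, A.d_d, map_zero, sub_self, sub_zero]
        rfl
      · rw [A.d_eq_zero hm, map_zero]
  have hs₀ : ∀ n a, A.d (n - 1) n (A.primitive X Y n (n - 1) (A.d (n - 1) n a))
      = A.d (n - 1) n a := fun n a => A.d_primitive _ ⟨a, rfl⟩
  obtain ⟨N₀, h₀⟩ := key _ hs₀
  obtain ⟨c₀, b₀⟩ := hN _ hs₀ N₀ h₀
  obtain ⟨s, es⟩ : ∃ s : ∀ n m, A.Hom X Y n →ₗ[k] A.Hom X Y m, ∀ n m a, s n m a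
      = A.primitive X Y n m (a - i n (A.cls (N₀ n a))) :=
    ⟨fun n m => A.primitive X Y n m ∘ₗ (LinearMap.id - i n ∘ₗ A.cls ∘ₗ N₀ n), fun _ _ _ => rfl⟩
  have hs : ∀ n a, A.d (n - 1) n (s n (n - 1) (A.d (n - 1) n a)) = A.d (n - 1) n a := by
    intro n a
    rw [es, b₀, map_zero, map_zero, sub_zero, hs₀]
  have si : ∀ n m x, s n m (i n x) = 0 := by
    intro n m x
    rw [es, c₀ n ⟨i n x, hi n x⟩, hc, sub_self, map_zero]
  obtain ⟨N, h₁⟩ := key _ hs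
  obtain ⟨c₁, b₁⟩ := hN _ hs N h₁
  refine ⟨fun n => A.cls ∘ₗ N n, fun n m => s n m ∘ₗ (LinearMap.id +
    (cocycles A X Y n).subtype ∘ₗ N n - i n ∘ₗ A.cls ∘ₗ N n), fun n a => c₁ n a,
    fun n m a => ?_, fun n m h => ?_, fun n m x => ?_, fun n a => ?_⟩
  · rw [LinearMap.comp_apply, b₁, map_zero]
  · refine LinearMap.ext fun a => ?_
    rw [LinearMap.comp_apply, es, A.primitive_eq_zero X Y h]
    rfl
  · have e : A.cls (N n (i n x)) = x := (c₁ n ⟨i n x, hi n x⟩).trans (hc n x)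
    have e' : (N n (i n x)).1 = i n x := by
      rw [h₁, si, hi, map_zero, map_zero, sub_zero, sub_zero]
    have : (LinearMap.id + (cocycles A X Y n).subtype ∘ₗ N n - i n ∘ₗ A.cls ∘ₗ N n : A.Hom X Y (n) →ₗ[k] A.Hom X Y (n)) (i n x)
        = i n x := by
      change i n x + (N n (i n x)).1 - i n (A.cls (N n (i n x))) = _
      rw [e, e', add_sub_cancel_right]
    rw [LinearMap.comp_apply, this, si]
  · have e₁ : (LinearMap.id + (cocycles A X Y (n + 1)).subtype ∘ₗ N (n + 1)
        - i (n + 1) ∘ₗ A.cls ∘ₗ N (n + 1) : A.Hom X Y (n + 1) →ₗ[k] A.Hom X Y (n + 1)) (A.d n (n + 1) a) = A.d n (n + 1) a := by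
      change A.d n (n + 1) a + (N (n + 1) (A.d n (n + 1) a)).1
        - i (n + 1) (A.cls (N (n + 1) (A.d n (n + 1) a))) = _
      rw [b₁]
      simp
    have e₂ : (LinearMap.id + (cocycles A X Y n).subtype ∘ₗ N n - i n ∘ₗ A.cls ∘ₗ N n : A.Hom X Y (n) →ₗ[k] A.Hom X Y (n)) a
        = a + ((N n a).1 - i n (A.cls (N n a))) := by
      change a + (N n a).1 - i n (A.cls (N n a)) = _
      abel
    obtain ⟨η, hη⟩ : A.Homologous (N n a).1 (i n (A.cls (N n a))) :=
      (A.cls_eq_cls (N n a) ⟨_, hi n _⟩).1 (hc n _).symm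
    have e₃ := hs n η
    rw [LinearMap.comp_apply, LinearMap.comp_apply, e₁, e₂, map_add, map_add, LinearMap.comp_apply,
      ← hη, e₃, hη, h₁]
    abel

end AInfCat

end Contraction

/-! ### Constructions by induction on the length of strings -/

/-- Dependent choice for a construction by successive approximation. -/
theorem exists_seq_of_step {α : Type*} (P : ℕ → α → Prop) (R : ℕ → α → α → Prop)
    (h₀ : ∃ a, P 0 a) (hs : ∀ n a, P n a → ∃ b, P (n + 1) b ∧ R n a b) :
    ∃ s : ℕ → α, (∀ n, P n (s n)) ∧ ∀ n, R n (s n) (s (n + 1)) := by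
  obtain ⟨a, ha⟩ := h₀
  choose! step h₁ h₂ using hs
  refine ⟨fun n => Nat.rec a step n, ?_, ?_⟩
  · intro n
    induction n with
    | zero => exact ha
    | succ n ih => exact h₁ n _ ih
  · intro n
    refine h₂ n _ ?_
    induction n with
    | zero => exact ha
    | succ n ih => exact h₁ n _ ih

namespace Cochain

section Limit

variable {A : GrQuiver k} {B : GrQuiver k} {C : GrQuiver k}
variable {f g : A.Ob → B.Ob} {d e : ℤ}

/-- A sequence of cochains whose consecutive terms agree on strings of increasing length converges.
-/
theorem exists_limit (T : ℕ → Cochain A B f g d)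
    (h : ∀ m, (T (m + 1) - T m).VanishesBelow m) : ∃ L, ∀ m, (L - T m).VanishesBelow m := by
  have hT : ∀ {X Y : A.Ob} (p : Path X Y) (n : ℤ) (m : ℕ), p.length < m →
      (T m).val p n = (T (p.length + 1)).val p n := by
    intro X Y p n m hm
    induction m with
    | zero => omega
    | succ m ih =>
      rcases Nat.lt_succ_iff_lt_or_eq.1 hm with h' | h'
      · rw [← ih h', ← sub_eq_zero, ← sub_val]
        exact (h m).eq_zero p n h'
      · rw [h']
  refine ⟨⟨fun p n => (T (p.length + 1)).val p n, fun p n hn => (T _).val_eq_zero p n hn,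
    fun p i a b q n => ?_, fun p i r a q n => ?_⟩, fun m => ⟨fun {X Y} p n hp => ?_⟩⟩
  · simp only [Quiver.Path.length_comp, Quiver.Path.length_cons]
    exact (T _).val_add p i a b q n
  · simp only [Quiver.Path.length_comp, Quiver.Path.length_cons]
    exact (T _).val_smul p i r a q n
  · rw [sub_val, sub_eq_zero]
    exact (hT p n m hp).symm

theorem eq_zero_of_vanishesBelow {T : Cochain A B f g d} (h : ∀ m, T.VanishesBelow m) : T = 0 :=
  ext fun p n => (h (p.length + 1)).eq_zero p n (Nat.lt_succ_self _)

theorem VanishesBelow.succ {T : Cochain A B f g d} {m : ℕ} (h : T.VanishesBelow m)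
    (h' : ∀ {X Y : A.Ob} (p : Path X Y) (n : ℤ), p.length = m → T.val p n = 0) :
    T.VanishesBelow (m + 1) := ⟨fun p n hp => by
  rcases Nat.lt_succ_iff_lt_or_eq.1 hp with hp | hp
  · exact h.eq_zero p n hp
  · exact h' p n hp⟩

theorem length_le_of_mem_blocks (F : Cochain A B f f d) {X Y : A.Ob} (p : Path X Y) :
    ∀ r ∈ F.blocks p, r.length ≤ p.length := by
  have aux : ∀ {X Z : A.Ob} (p : Path X Z) {Y : A.Ob} (s : Path Z Y),
      ∀ r ∈ F.blocksAux p s, r.length ≤ p.length + 1 := by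
    intro X Z p
    induction p with
    | nil =>
      intro Y s r hr
      simp only [blocksAux, List.mem_singleton] at hr
      subst hr
      simp
    | cons p e ih =>
      intro Y s r hr
      simp only [blocksAux, List.mem_append, List.mem_map] at hr
      rcases hr with hr | ⟨r', hr', rfl⟩
      · have := ih _ r hr
        simp only [Quiver.Path.length_cons]
        omega
      · have := ih _ r' hr'
        simp only [Quiver.Path.length_cons]
        omega
  intro r hr
  cases p with
  | nil => simp only [blocks, List.mem_singleton] at hr; subst hr; simp
  | cons p e => exact aux p _ r hr

/-- If `Φ` vanishes on short strings, only the linear part of a functor contributes. -/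
theorem lsum_blocks_leading {M : Type*} [AddCommGroup M] (F F' : Cochain A B f f 1)
    (h : ∀ {X Y : A.Ob} (a : X ⟶ Y), F.arrow (Quiver.Path.nil.cons a)
      = F'.arrow (Quiver.Path.nil.cons a)) {X Y : A.Ob} {Φ : Path (f X) (f Y) → M}
    (p : Path X Y) (hΦ : ∀ q, q.length < p.length → Φ q = 0) :
    lsum (F.blocks p) Φ = lsum (F'.blocks p) Φ := by
  induction p with
  | nil => rw [lsum_blocks_nil, lsum_blocks_nil]
  | cons p a ih =>
    have key : ∀ F : Cochain A B f f 1, lsum (F.blocks (p.cons a)) Φ = lsum (F.blocks p) fun r =>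
        Φ (r.cons (F.arrow (Quiver.Path.nil.cons a))) := fun F => by
      rw [lsum_blocks_cons, lsum_cuts2_eq_snd_nil]
      intro c hc hc'
      refine lsum_eq_zero fun r hr => hΦ _ ?_
      have h₁ := F.length_le_of_mem_blocks c.fst r hr
      have h₂ := AInfCat.length_of_mem_cuts2 p c hc
      simp only [Quiver.Path.length_cons]
      omega
    rw [key, key, h]
    refine ih fun q hq => hΦ _ ?_
    simp only [Quiver.Path.length_cons]
    omega

end Limit

end Cochain

/-! ### The leading part of the differential -/

namespace AInfCat

variable (A : AInfCat k)

/-- The cohomological category, in a form which unfolds reducibly: its objects and morphism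
spaces are seen to be those of `A.cohQuiver` by instance search and rewriting. -/
abbrev hcat : AInfCat k where
  toGrQuiver := A.cohQuiver
  μ := A.cohμ
  μ_nil _ _ := rfl
  rel := A.cohμ_rel
  exists_unit X := ⟨A.hUnit X, A.isCohUnit_hUnit X⟩

/-- The graded quiver of the cohomology of an `A∞`-category. -/
notation:max A:max "ʰ" => AInfCat.toGrQuiver (AInfCat.hcat A)

/-- The differential `μ¹`, as a cochain with only a linear part. -/
def d₁ : Cochain Aᵍ Aᵍ (fun X => X) (fun X => X) 2 :=
  ofLinDeg 2 (fun _ _ n m => A.d n m) fun _ _ n m h => LinearMap.ext fun a =>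
    A.d_eq_zero (by omega) a

theorem isLinear_d₁ : A.d₁.IsLinear := isLinear_ofLinDeg _ _

theorem d₁_lin {X Y : A.Ob} (n m : ℤ) (a : A.Hom X Y n) : A.d₁.lin n m a = A.d n m a := rfl

/-- If `Φ` vanishes on shorter strings, only `μ¹` contributes to the insertion of `μ`. -/
theorem ins_μ_leading {M : Type*} [AddCommGroup M] [Module k M] {X Y : A.Ob}
    {Φ : Path X Y → M} (hΦ : IsML Φ) (p : Path X Y)
    (h : ∀ q, q.length < p.length → Φ q = 0) :
    ins (idC Aᵍ) (idC Aᵍ) A.μ Φ p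
      = ins (idC Aᵍ) (idC Aᵍ) A.d₁ Φ p := by
  rw [ins_idC _ hΦ, ins_idC _ hΦ]
  refine lsum_congr fun c hc => ?_
  have hl := length_of_mem_cuts3 p c hc
  obtain ⟨Z, W, a, m, b⟩ := c
  congr 1
  cases m with
  | nil =>
    have e₁ : A.μ.arrow (.nil : Path Z Z)
        = (⟨red (Quiver.Path.nil : Path Z Z) + 2, 0⟩ : Z ⟶ Z) := by
      simp only [arrow, A.μ_nil]
    have e₂ : A.d₁.arrow (.nil : Path Z Z)
        = (⟨red (Quiver.Path.nil : Path Z Z) + 2, 0⟩ : Z ⟶ Z) := rfl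
    exact congrArg (fun t => Φ ((a.cons t).comp b)) (e₁.trans e₂.symm)
  | cons m e =>
    cases m with
    | nil => rfl
    | cons m e' =>
      rw [h, h] <;>
      · simp only [Quiver.Path.length_comp, Quiver.Path.length_cons] at hl ⊢
        omega

theorem ins_d₁_eq_zero {M : Type*} [AddCommGroup M] [Module k M] {X Y : A.Ob}
    {Φ : Path X Y → M} (hΦ : IsML Φ) (p : Path X Y)
    (h : ∀ q, q.length = p.length → Φ q = 0) :
    ins (idC Aᵍ) (idC Aᵍ) A.d₁ Φ p = 0 := by
  rw [ins_idC _ hΦ]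
  refine lsum_eq_zero fun c hc => ?_
  have hl := length_of_mem_cuts3 p c hc
  by_cases hm : c.mid.length = 1
  · rw [h, smul_zero]
    simp only [Quiver.Path.length_comp, Quiver.Path.length_cons]
    omega
  · have : A.d₁.arrow c.mid = (⟨red c.mid + 2, 0⟩ : c.Z ⟶ c.W) := by
      rw [arrow, A.isLinear_d₁.eq_zero _ _ hm]
    rw [this, hΦ.insert_zero, smul_zero]

theorem hcat_d₁ : A.hcat.d₁ = 0 := by
  refine IsLinear.ext A.hcat.isLinear_d₁ ⟨fun _ _ _ => rfl⟩ fun n m => ?_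
  rfl

end AInfCat

namespace AInfFunctor

variable {A : AInfCat k} {B : AInfCat k} {C : AInfCat k}
variable {f g h : A.Ob → B.Ob} {d e : ℤ}

/-- The part of the differential of a pre-natural transformation which preserves the length of
strings. -/
noncomputable def linD (T : Cochain Aᵍ Bᵍ f g d) :
    Cochain Aᵍ Bᵍ f g (d + 1) :=
  T.thenC B.μ (d + 1) - (d - 1).negOnePow •
    insC (idC Aᵍ) (idC Aᵍ) A.d₁ T (d + 1)

theorem linD_val (T : Cochain Aᵍ Bᵍ f g d) {X Y : A.Ob}
    (p : Path X Y) (n : ℤ) : (linD T).val p n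
      = B.d (red p + d) n (T.val p (red p + d)) - (d - 1).negOnePow •
        ins (idC Aᵍ) (idC Aᵍ) A.d₁ (fun q => T.val q n) p := by
  rw [linD, sub_val, units_smul_val]
  rfl

/-- On the shortest strings on which `T` can be nonzero, its differential only involves `μ¹`. -/
theorem homDC_leading (F : AInfFunctor A B f) (G : AInfFunctor A B g)
    {T : Cochain Aᵍ Bᵍ f g d} {X Y : A.Ob} (p : Path X Y) (n : ℤ)
    (hT : T.VanishesBelow p.length) : (homDC F G T).val p n = (linD T).val p n := by
  rw [homDC_val', linD_val, ins_eq_leading _ _ (B.μ.isML n) p hT,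
    A.ins_μ_leading (T.isML n) p fun q hq => hT.eq_zero q n hq]
  rfl

theorem linD_congr {T S : Cochain Aᵍ Bᵍ f g d} {X Y : A.Ob}
    (p : Path X Y) (n : ℤ)
    (h : ∀ {X Y : A.Ob} (q : Path X Y) (n : ℤ), q.length = p.length → T.val q n = S.val q n) :
    (linD T).val p n = (linD S).val p n := by
  rw [linD_val, linD_val, h p _ rfl, ← sub_eq_zero, sub_sub_sub_cancel_left, ← smul_sub,
    ← ins_sub, A.ins_d₁_eq_zero ((S.isML n).sub (T.isML n)), smul_zero]
  intro q hq
  rw [h q n hq, sub_self]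

theorem linD_zero : linD (0 : Cochain Aᵍ Bᵍ f g d) = 0 := by
  refine ext fun {X Y} p n => ?_
  rw [linD_val, zero_val, map_zero]
  have : ins (idC Aᵍ) (idC Aᵍ) A.d₁
    (fun q : Path X Y => (0 : Cochain Aᵍ Bᵍ f g d).val q n) p = 0 :=
    ins_zero_fun _ _ _ _
  rw [this, smul_zero, sub_zero]
  rfl

theorem linD_add (T S : Cochain Aᵍ Bᵍ f g d) :
    linD (T + S) = linD T + linD S := by
  refine ext fun {X Y} p n => ?_
  rw [add_val, linD_val, linD_val, linD_val, add_val, map_add]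
  have : ins (idC Aᵍ) (idC Aᵍ) A.d₁
    (fun q : Path X Y => (T + S).val q n) p = _ := ins_add _ _ _ (fun q => T.val q n)
      (fun q => S.val q n) p
  rw [this, smul_add]
  abel

/-- The leading part of the differential, as an additive map. -/
noncomputable def linDHom : Cochain Aᵍ Bᵍ f g d →+
    Cochain Aᵍ Bᵍ f g (d + 1) := AddMonoidHom.mk' linD linD_add

theorem linD_neg (T : Cochain Aᵍ Bᵍ f g d) : linD (-T) = -linD T :=
  map_neg linDHom T

theorem linD_sub (T S : Cochain Aᵍ Bᵍ f g d) :
    linD (T - S) = linD T - linD S := map_sub linDHom T S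

theorem linD_units_smul (s : ℤˣ) (T : Cochain Aᵍ Bᵍ f g d) :
    linD (s • T) = s • linD T := by
  rw [Units.smul_def, Units.smul_def]
  exact map_zsmul linDHom _ T

theorem linD_atLength (T : Cochain Aᵍ Bᵍ f g d) (m : ℕ) :
    linD (T.atLength m) = (linD T).atLength m := by
  refine ext fun {X Y} p n => ?_
  rw [atLength_val]
  split_ifs with h
  · exact linD_congr p n fun q n hq => if_pos (hq.trans h)
  · refine (linD_congr (S := 0) p n fun q n hq => if_neg (by omega)).trans ?_
    rw [linD_zero]
    rfl

theorem vanishesBelow_homDC (F : AInfFunctor A B f) (G : AInfFunctor A B g)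
    {T : Cochain Aᵍ Bᵍ f g d} {m : ℕ} (hT : T.VanishesBelow m) :
    (homDC F G T).VanishesBelow m := ⟨fun p n hp => by
  rw [homDC_leading F G p n (hT.mono hp.le), linD_congr (S := 0) p n fun q n hq => hT.eq_zero q n
    (by omega), linD_zero]
  rfl⟩

end AInfFunctor

/-! ### Contracting strings onto cohomology -/

/-- A choice of cocycle representatives `i`, together with a projection `p` onto cohomology and
a homotopy `h` between the identity and `i p`, on all morphism complexes. -/
structure Contraction (A : AInfCat k) where
  i : ∀ X Y n, A.HHom X Y n →ₗ[k] A.Hom X Y n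
  p : ∀ X Y n, A.Hom X Y n →ₗ[k] A.HHom X Y n
  h : ∀ X Y n m, A.Hom X Y n →ₗ[k] A.Hom X Y m
  d_i : ∀ {X Y n} (a : A.HHom X Y n) m, A.d n m (i X Y n a) = 0
  p_cocycle : ∀ {X Y n} (a : A.cocycles X Y n), p X Y n a.1 = A.cls a
  p_d : ∀ {X Y n m} (a : A.Hom X Y n), p X Y m (A.d n m a) = 0
  p_i : ∀ {X Y n} (a : A.HHom X Y n), p X Y n (i X Y n a) = a
  h_eq_zero : ∀ X Y n m, m ≠ n - 1 → h X Y n m = 0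
  h_i : ∀ {X Y n m} (a : A.HHom X Y n), h X Y n m (i X Y n a) = 0
  homotopy : ∀ {X Y n} (a : A.Hom X Y n),
    A.d (n - 1) n (h X Y n (n - 1) a) + h X Y (n + 1) n (A.d n (n + 1) a)
      = a - i X Y n (p X Y n a)

namespace Contraction

theorem exists_of_section {A : AInfCat k} (i : ∀ X Y n, A.HHom X Y n →ₗ[k] A.Hom X Y n)
    (hi : ∀ X Y n x, A.d n (n + 1) (i X Y n x) = 0)
    (hc : ∀ X Y n x, A.cls ⟨i X Y n x, hi X Y n x⟩ = x) : ∃ K : Contraction A, K.i = i := by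
  choose p h h₁ h₂ h₃ h₄ h₅ using fun X Y => A.exists_contraction (i X Y) (hi X Y) (hc X Y)
  refine ⟨⟨i, p, h, fun {X Y n} a m => ?_, fun a => h₁ _ _ _ a, fun a => h₂ _ _ _ _ a, fun {X Y n} a => ?_,
    h₃, fun a => h₄ _ _ _ _ a, fun a => h₅ _ _ _ a⟩, rfl⟩
  · by_cases hm : m = n + 1
    · rw [hm, hi]
    · exact A.d_eq_zero hm _
  · exact (h₁ X Y n ⟨i X Y n a, hi X Y n a⟩).trans (hc X Y n a)

theorem nonempty (A : AInfCat k) : Nonempty (Contraction A) := by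
  choose s hs using fun X Y n => (A.cls (X := X) (Y := Y) (n := n)).exists_rightInverse_of_surjective
    (LinearMap.range_eq_top.2 A.cls_surjective)
  obtain ⟨K, _⟩ := exists_of_section (fun X Y n => (A.cocycles X Y n).subtype ∘ₗ s X Y n)
    (fun X Y n x => (s X Y n x).2) (fun X Y n x => congrArg (fun l => l x) (hs X Y n))
  exact ⟨K⟩

variable {A : AInfCat k} (K : Contraction A)

/-- The linear part of a functor `H A → A` given by the representatives. -/
noncomputable def I : Cochain Aʰ Aᵍ (fun X => X) (fun X => X) 1 :=
  ofLin (A := Aʰ) K.i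

/-- The projection onto cohomology, as a cochain. -/
noncomputable def P : Cochain Aᵍ Aʰ (fun X => X) (fun X => X) 1 :=
  ofLin (B := Aʰ) K.p

/-- The homotopy, as a cochain. -/
def H : Cochain Aᵍ Aᵍ (fun X => X) (fun X => X) 0 :=
  ofLinDeg 0 K.h fun X Y n m h => K.h_eq_zero X Y n m (by omega)

theorem isLinear_I : K.I.IsLinear := isLinear_ofLin _
theorem isLinear_P : K.P.IsLinear := isLinear_ofLin _
theorem isLinear_H : K.H.IsLinear := isLinear_ofLinDeg _ _

theorem I_lin {X Y : A.Ob} (n : ℤ) (a : A.HHom X Y n) : K.I.lin n n a = K.i X Y n a :=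
  ofLin_lin (A := Aʰ) K.i n a

theorem P_lin {X Y : A.Ob} (n : ℤ) (a : A.Hom X Y n) : K.P.lin n n a = K.p X Y n a :=
  ofLin_lin (B := Aʰ) K.p n a

theorem isLinear_eq_zero {Q : GrQuiver k} {R : GrQuiver k}
    {f g : Q.Ob → R.Ob} {d : ℤ} {T : Cochain Q R f g d} (hT : T.IsLinear)
    (h : ∀ {X Y : Q.Ob} (n : ℤ) (a : Q.Hom X Y n) (m : ℤ), m = n - 1 + d → T.lin n m a = 0) : T = 0 := by
  refine hT.ext ⟨fun _ _ _ => rfl⟩ fun n m => LinearMap.ext fun a => ?_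
  by_cases hm : m = n - 1 + d
  · exact h n a m hm
  · exact T.lin_eq_zero hm a

theorem isLinear_thenC_lin {Q : GrQuiver k} {R : GrQuiver k}
    {S : GrQuiver k} {f g : Q.Ob → R.Ob} {c c' : R.Ob → S.Ob} {d e : ℤ}
    (T : Cochain Q R f g d) (U : Cochain R S c c' e) (r : ℤ)
    (hr : r = d + e - 1) {X Y : Q.Ob} (n l m : ℤ) (hl : l = n - 1 + d) (a : Q.Hom X Y n) :
    (T.thenC U r hr).lin n m a = U.lin l m (T.lin n l a) := by
  subst hl
  exact thenC_lin T U r hr n m a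

theorem I_P : K.P.comp K.I = idC Aʰ := by
  have e : K.P.comp K.I = K.I.thenC K.P 1 := K.isLinear_P.pre K.I fun _ _ => rfl
  rw [e]
  refine (K.isLinear_I.thenC _ _ _).ext (isLinear_ofLin _) fun {X Y} n m => LinearMap.ext fun a => ?_
  by_cases hm : m = n
  · subst hm
    rw [isLinear_thenC_lin K.I K.P 1 rfl m m m (by ring), I_lin, P_lin, K.p_i]
    exact (ofLin_lin (A := Aʰ) (B := Aʰ) (f := fun X => X)
      (fun _ _ _ => LinearMap.id) m a).symm
  · rw [lin_eq_zero _ (by omega), lin_eq_zero _ (by omega)]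

theorem d₁_pre_I : A.d₁.pre K.I = 0 := by
  rw [A.isLinear_d₁.pre K.I fun _ _ => rfl]
  refine isLinear_eq_zero (K.isLinear_I.thenC _ _ _) fun n a m hm => ?_
  rw [isLinear_thenC_lin K.I A.d₁ 2 (by ring) n n m (by ring), I_lin, A.d₁_lin]
  exact K.d_i a _

theorem H_pre_I : K.H.pre K.I = 0 := by
  rw [K.isLinear_H.pre K.I fun _ _ => rfl]
  refine isLinear_eq_zero (K.isLinear_I.thenC _ _ _) fun n a m hm => ?_
  rw [isLinear_thenC_lin K.I K.H 0 (by ring) n n m (by ring), I_lin]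
  exact K.h_i a

theorem insC_d₁_P (F G : Cochain Aᵍ Aᵍ (fun X => X) (fun X => X) 1) :
    insC F G A.d₁ K.P 2 = 0 := by
  rw [K.isLinear_P.insC]
  refine isLinear_eq_zero (A.isLinear_d₁.thenC _ _ _) fun n a m hm => ?_
  rw [isLinear_thenC_lin A.d₁ K.P 2 (by ring) n (n + 1) m (by ring), A.d₁_lin]
  obtain rfl : m = n + 1 := by omega
  rw [P_lin]
  exact K.p_d a

/-- The composition `i p`, as a cochain. -/
noncomputable def J : Cochain Aᵍ Aᵍ (fun X => X) (fun X => X) 1 := K.I.comp K.P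

theorem J_eq : K.J = K.P.thenC K.I 1 := K.isLinear_I.pre K.P fun _ _ => rfl

theorem isLinear_J : K.J.IsLinear := by
  rw [J_eq]
  exact K.isLinear_P.thenC _ _ _

theorem J_lin {X Y : A.Ob} (n : ℤ) (a : A.Hom X Y n) : K.J.lin n n a = K.i X Y n (K.p X Y n a) := by
  rw [J_eq, isLinear_thenC_lin K.P K.I 1 (by ring) n n n (by ring), P_lin, I_lin]

theorem pre_pre {Q : GrQuiver k} {R : GrQuiver k}
    {S : GrQuiver k} {U : GrQuiver k} {f : Q.Ob → R.Ob} {g : R.Ob → S.Ob}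
    {c c' : S.Ob → U.Ob} {d : ℤ} (T : Cochain S U c c' d) (G : Cochain R S g g 1)
    (F : Cochain Q R f f 1) : (T.pre G).pre F = T.pre (G.comp F) :=
  ext fun p n => (lsum_blocks_comp G F p (T.isML n)).symm

theorem d₁_pre_J : A.d₁.pre K.J = 0 := by
  rw [J, ← pre_pre, d₁_pre_I]
  exact ext fun {X Y} p n => lsum_zero _

theorem insC_d₁_J (F G : Cochain Aᵍ Aᵍ (fun X => X) (fun X => X) 1) :
    insC F G A.d₁ K.J 2 = 0 := by
  rw [K.isLinear_J.insC]
  refine isLinear_eq_zero (A.isLinear_d₁.thenC _ _ _) fun n a m hm => ?_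
  rw [isLinear_thenC_lin A.d₁ K.J 2 (by ring) n (n + 1) m (by ring), A.d₁_lin]
  obtain rfl : m = n + 1 := by omega
  rw [J_lin, K.p_d, map_zero]

theorem homotopy_eq : A.d₁.thenC K.H 1 + K.H.thenC A.d₁ 1 = idC Aᵍ - K.J := by
  refine ((A.isLinear_d₁.thenC _ _ _).add (K.isLinear_H.thenC _ _ _)).ext
    ((isLinear_ofLin _).sub K.isLinear_J) fun {X Y} n m => LinearMap.ext fun a => ?_
  by_cases hm : m = n
  · subst hm
    have e₁ : (idC Aᵍ).lin m m a = a := ofLin_lin (f := fun X => X) _ m a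
    have e₂ : (idC Aᵍ - K.J).lin m m a
      = (idC Aᵍ).lin m m a - K.J.lin m m a := sub_val _ _ _ _
    have e₃ : (A.d₁.thenC K.H 1 + K.H.thenC A.d₁ 1).lin m m a
      = (A.d₁.thenC K.H 1).lin m m a + (K.H.thenC A.d₁ 1).lin m m a := rfl
    rw [e₂, e₃, e₁, J_lin, ← K.homotopy a,
      isLinear_thenC_lin A.d₁ K.H 1 (by ring) m (m + 1) m (by ring),
      isLinear_thenC_lin K.H A.d₁ 1 (by ring) m (m - 1) m (by ring), add_comm]
    rfl
  · rw [lin_eq_zero _ (by omega), lin_eq_zero _ (by omega)]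

theorem ins₂_zero_left {Q : GrQuiver k} {R : GrQuiver k}
    {f₀ f₁ f₂ : Q.Ob → R.Ob} {d e : ℤ} {M : Type*} [AddCommGroup M] [Module k M]
    (F₀ : Cochain Q R f₀ f₀ 1) (F₁ : Cochain Q R f₁ f₁ 1) (F₂ : Cochain Q R f₂ f₂ 1)
    (T : Cochain Q R f₁ f₂ e) {X Y : Q.Ob} {Φ : Path (f₀ X) (f₂ Y) → M} (hΦ : IsML Φ)
    (p : Path X Y) : ins₂ F₀ F₁ F₂ (0 : Cochain Q R f₀ f₁ d) T Φ p = 0 :=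
  ins₂_eq_zero_left F₀ F₁ F₂ T hΦ p (m := p.length + 1) ⟨fun _ _ _ => rfl⟩ (Nat.lt_succ_self _)

/-- The homotopy between the identity and `i p`, extended to strings. -/
theorem string_homotopy {M : Type*} [AddCommGroup M] [Module k M] {X Y : A.Ob}
    {Φ : Path X Y → M} (hΦ : IsML Φ) (p : Path X Y) :
    ins (idC Aᵍ) (idC Aᵍ) A.d₁
        (fun q => ins K.J (idC Aᵍ) K.H Φ q) p
      + ins K.J (idC Aᵍ) K.H
        (fun q => ins (idC Aᵍ) (idC Aᵍ) A.d₁ Φ q) p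
      = Φ p - lsum (K.J.blocks p) Φ := by
  have hJ : ∀ (X : A.Ob) (n : ℤ), K.J.val (.nil : Path X X) n = 0 := fun X n =>
    K.isLinear_J.eq_zero _ _ (by simp)
  have h₁ := ins_ins (idC Aᵍ) (idC Aᵍ) A.d₁ K.J (idC Aᵍ) K.H 1
    (by ring) hΦ p
  have h₂ := ins_ins K.J (idC Aᵍ) K.H (idC Aᵍ) (idC Aᵍ) A.d₁ 1
    (by ring) hΦ p
  rw [insC_d₁_J] at h₁
  rw [d₁_pre_J, ins₂_zero_left _ _ _ _ hΦ, add_zero] at h₂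
  rw [ins₂_zero_left _ _ _ _ hΦ, smul_zero, add_zero, idC_insC] at h₁
  rw [idC_insC] at h₂
  simp only [comp_idC, pre_idC, idC_comp _ hJ] at h₁ h₂
  rw [K.isLinear_H.insC] at h₁
  rw [A.isLinear_d₁.insC] at h₂
  have h₃ := ins_add_left K.J (idC Aᵍ) (A.d₁.thenC K.H 1) (K.H.thenC A.d₁ 1) hΦ p
  rw [homotopy_eq, ← blocks_sub_blocks K.J (idC Aᵍ) (fun X n => by
    rw [hJ]; rfl) hΦ p, lsum_blocks_idC hΦ] at h₃
  refine (congrArg₂ (· + ·) h₁ h₂).trans ?_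
  rw [h₃]
  simp only [zero_sub, show (2 - 1 : ℤ) = 1 from rfl, mul_one, Int.negOnePow_neg,
    Int.negOnePow_one, Units.neg_smul, one_smul]
  abel

end Contraction

/-! ### Lifting transformations along a minimal model -/

namespace Cochain

section ThenC

variable {Q : GrQuiver k} {R : GrQuiver k} {S₀ : GrQuiver k}
  {U : GrQuiver k}
variable {f g : Q.Ob → R.Ob} {h h' : R.Ob → S₀.Ob} {c c' : S₀.Ob → U.Ob} {d e l : ℤ}

theorem thenC_pre (T : Cochain R S₀ h h' e) (V : Cochain S₀ U c c' l) (F : Cochain Q R f f 1) (r : ℤ)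
    (hr : r = e + l - 1) : (T.thenC V r hr).pre F = (T.pre F).thenC V r hr :=
  ext fun p n => (insert_pre F (V.isML n) T p .nil .nil).symm

theorem insC_thenC (F : Cochain Q R f f 1) (G : Cochain Q R g g 1) (T : Cochain Q R f g d)
    (S : Cochain R S₀ h h' e) (V : Cochain S₀ U c c' l) (r r' s : ℤ) (hr : r = e + l - 1)
    (hr' : r' = d + r - 1) (hs : s = d + e - 1) (hs' : r' = s + l - 1 := by omega) :
    insC F G T (S.thenC V r hr) r' hr' = (insC F G T S s hs).thenC V r' hs' :=
  ext fun p n => (insert_insC F G T (V.isML n) S s hs p .nil .nil).symm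

theorem add_pre (T S : Cochain R S₀ h h' e) (F : Cochain Q R f f 1) :
    (T + S).pre F = T.pre F + S.pre F := ext fun p n => lsum_add _ _ _

theorem neg_pre (T : Cochain R S₀ h h' e) (F : Cochain Q R f f 1) :
    (-T).pre F = -T.pre F := ext fun p n => lsum_neg _ _

theorem sub_pre (T S : Cochain R S₀ h h' e) (F : Cochain Q R f f 1) :
    (T - S).pre F = T.pre F - S.pre F := ext fun p n => by
  rw [sub_val, pre_val, pre_val, pre_val, ← lsum_sub]
  exact lsum_congr fun r _ => sub_val T S r n

theorem units_smul_pre (s : ℤˣ) (T : Cochain R S₀ h h' e) (F : Cochain Q R f f 1) :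
    (s • T).pre F = s • T.pre F := ext fun p n => by
  rw [units_smul_val, pre_val, pre_val, smul_lsum]
  exact lsum_congr fun r _ => units_smul_val s T r n

theorem zero_pre (F : Cochain Q R f f 1) : (0 : Cochain R S₀ h h' e).pre F = 0 :=
  ext fun p n => lsum_zero _

theorem insC_zero_left (F : Cochain Q R f f 1) (G : Cochain Q R g g 1)
    (V : Cochain R S₀ h h' e) (r : ℤ) (hr : r = d + e - 1) :
    insC F G (0 : Cochain Q R f g d) V r hr = 0 :=
  ext fun p n => ins_zero_left F G (V.isML n) p

theorem insC_sub_left (F : Cochain Q R f f 1) (G : Cochain Q R g g 1) (T T' : Cochain Q R f g d)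
    (V : Cochain R S₀ h h' e) (r : ℤ) (hr : r = d + e - 1) :
    insC F G (T - T') V r hr = insC F G T V r hr - insC F G T' V r hr := ext fun p n => by
  rw [sub_val]
  exact ins_sub_left F G T T' (V.isML n) p

theorem insC_add_left (F : Cochain Q R f f 1) (G : Cochain Q R g g 1) (T T' : Cochain Q R f g d)
    (V : Cochain R S₀ h h' e) (r : ℤ) (hr : r = d + e - 1) :
    insC F G (T + T') V r hr = insC F G T V r hr + insC F G T' V r hr := ext fun p n => by
  rw [add_val]
  exact ins_add_left F G T T' (V.isML n) p

theorem insC_units_smul (F : Cochain Q R f f 1) (G : Cochain Q R g g 1) (T : Cochain Q R f g d)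
    (s : ℤˣ) (V : Cochain R S₀ h h' e) (r : ℤ) (hr : r = d + e - 1) :
    insC F G T (s • V) r hr = s • insC F G T V r hr := ext fun p n => by
  rw [units_smul_val, insC_val, insC_val, ← ins_units_smul]
  exact ins_congr _ _ _ (fun q => units_smul_val s V q n) p

theorem atLength_pre_of_isLinear (T : Cochain R S₀ h h' e) {F : Cochain Q R f f 1}
    (hF : F.IsLinear) (m : ℕ) : (T.atLength m).pre F = (T.pre F).atLength m := by
  have hl : ∀ {X Y : Q.Ob} (p : Path X Y) {M : Type _} [AddCommGroup M] [Module k M]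
      {Φ : Path (f X) (f Y) → M} (_ : IsML Φ), (∀ q, q.length = p.length → Φ q = 0) →
      lsum (F.blocks p) Φ = 0 := by
    intro X Y p
    induction p with
    | nil => intro M _ _ Φ hΦ h; rw [lsum_blocks_nil]; exact h _ rfl
    | cons p a ih =>
      intro M _ _ Φ hΦ h
      rw [lsum_blocks_cons, lsum_cuts2_snd_nil]
      · exact ih (hΦ.cons _) fun q hq => h _ (by simp [hq])
      · intro c hc
        refine lsum_eq_zero fun r _ => ?_
        have : F.arrow (c.snd.cons a) = (⟨red (c.snd.cons a) + 1, 0⟩ : f c.Z ⟶ f _) := by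
          rw [arrow, hF.eq_zero _ _ (by simpa using hc)]
        rw [this]
        exact hΦ.insert_zero r _ .nil
  refine ext fun {X Y} p n => ?_
  rw [atLength_val, pre_val, pre_val]
  split_ifs with hp
  · rw [← sub_eq_zero, ← lsum_sub]
    refine hl p (((T.atLength m).isML n).sub (T.isML n)) fun q hq => ?_
    rw [atLength_val, if_pos (hq.trans hp), sub_self]
  · refine hl p ((T.atLength m).isML n) fun q hq => ?_
    rw [atLength_val, if_neg (by omega)]

theorem thenC_atLength (T : Cochain Q R f g d) (V : Cochain R S₀ h h' e) (r : ℤ)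
    (hr : r = d + e - 1) (m : ℕ) : (T.atLength m).thenC V r hr = (T.thenC V r hr).atLength m := by
  refine ext fun p n => ?_
  rw [atLength_val, thenC_val, thenC_val, atLength_val]
  split_ifs
  · rfl
  · exact map_zero _

end ThenC

end Cochain

namespace AInfFunctor

variable {A : AInfCat k} {B : AInfCat k} {C : AInfCat k}
variable {f g h : A.Ob → B.Ob} {d e : ℤ}

theorem ins_d₁_P (K : Contraction A) {M : Type*} [AddCommGroup M] [Module k M] {X Y : A.Ob}
    {Φ : Path X Y → M} (E : Cochain Aʰ Bᵍ f g d) (n : ℤ)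
    (p : Path X Y) :
    ins (idC Aᵍ) (idC Aᵍ) A.d₁ (fun q => (E.pre K.P).val q n) p = 0 := by
  have h := ins_blocks (idC Aᵍ) (idC Aᵍ) A.d₁ K.P (X := X) (Y := Y) (E.isML n) p
  rw [K.insC_d₁_P, ins_zero_left _ _ (E.isML n)] at h
  exact h

/-- The linearized lifting problem along `H A → A`. The solution combines the homotopy of
`string_homotopy` with the projection of strings to cohomology. -/
theorem exists_linD_eq (K : Contraction A) (Z : Cochain Aᵍ Bᵍ f g (d + 1))
    (E : Cochain Aʰ Bᵍ f g d) (hZ : linD Z = 0)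
    (hE : Z.pre K.I = E.thenC B.μ (d + 1)) :
    ∃ X : Cochain Aᵍ Bᵍ f g d, linD X = -Z ∧ X.pre K.I = -E := by
  obtain ⟨W, hW⟩ : ∃ W : Cochain Aᵍ Bᵍ f g d, W =
    insC K.J (idC Aᵍ) K.H Z d := ⟨_, rfl⟩
  have e₁ : linD (E.pre K.P) = Z.pre K.J := by
    have h₁ : (E.pre K.P).thenC B.μ (d + 1) = Z.pre K.J := by
      rw [← thenC_pre, ← hE, Contraction.pre_pre]
      rfl
    rw [linD, h₁]
    have h₂ : insC (idC Aᵍ) (idC Aᵍ) A.d₁ (E.pre K.P) (d + 1) (by ring) = 0 :=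
      ext fun p n => ins_d₁_P (Φ := fun _ => (0 : k)) K E n p
    rw [h₂, smul_zero, sub_zero]
  have e₂ : Z.thenC B.μ (d + 1 + 1) = d.negOnePow •
      insC (idC Aᵍ) (idC Aᵍ) A.d₁ Z (d + 1 + 1) := by
    have := hZ
    rw [linD, sub_eq_zero, add_sub_cancel_right] at this
    exact this
  have e₃ : linD W = d.negOnePow • (Z - Z.pre K.J) := by
    refine ext fun {X Y} p n => ?_
    have h₁ := K.string_homotopy (Z.isML n) p
    have h₂ : W.thenC B.μ (d + 1) = d.negOnePow • insC K.J (idC Aᵍ) K.H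
        (insC (idC Aᵍ) (idC Aᵍ) A.d₁ Z (d + 1 + 1)) (d + 1) := by
      rw [hW, ← insC_units_smul, ← e₂]
      exact (insC_thenC _ _ _ _ _ _ _ _ _ _ _ _).symm
    have h₃ : (W.thenC B.μ (d + 1)).val p n = d.negOnePow • ins K.J (idC Aᵍ) K.H
        (fun q => ins (idC Aᵍ) (idC Aᵍ) A.d₁ (fun q => Z.val q n) q) p := by
      rw [h₂, units_smul_val]
      rfl
    have h₄ : (insC (idC Aᵍ) (idC Aᵍ) A.d₁ W (d + 1) (by ring)).val p n
        = ins (idC Aᵍ) (idC Aᵍ) A.d₁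
        (fun q => ins K.J (idC Aᵍ) K.H (fun q => Z.val q n) q) p := by
      rw [hW]
      rfl
    have h₅ : (Z.pre K.J).val p n = lsum (K.J.blocks p) fun q => Z.val q n := rfl
    rw [linD, sub_val, units_smul_val, units_smul_val, sub_val, h₃, h₄, h₅, ← h₁,
      Int.negOnePow_sub, Int.negOnePow_one]
    simp only [mul_neg, mul_one, Units.neg_smul, smul_add]
    abel
  have e₄ : W.pre K.I = 0 := by
    refine ext fun {X Y} p n => ?_
    have h₁ := blocks_ins K.I K.J (idC Aᵍ) K.H (X := X) (Y := Y) (Z.isML n) p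
    rw [K.H_pre_I, ins_zero_left _ _ (Z.isML n)] at h₁
    rw [hW]
    exact h₁
  have e₅ : (E.pre K.P).pre K.I = E := by
    rw [Contraction.pre_pre, K.I_P]
    exact pre_idC E
  refine ⟨-(E.pre K.P) - d.negOnePow • W, ?_, ?_⟩
  · rw [linD_sub, linD_neg, linD_units_smul, e₁, e₃, smul_smul, Int.units_mul_self, one_smul]
    abel
  · rw [sub_pre, neg_pre, units_smul_pre, e₄, e₅, smul_zero, sub_zero]

theorem pre_leading (K : Contraction A) {ψ : AInfFunctor A.hcat A (fun X => X)}
    (hψ : ∀ {X Y : A.Ob} (n : ℤ) (a : A.HHom X Y n), ψ.lin n n a = K.i X Y n a)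
    (T : Cochain Aᵍ Bᵍ f g e) {X Y : A.Ob}
    (p : Quiver.Path (V := A.hcat.Ob) X Y) (n : ℤ) (hT : T.VanishesBelow p.length) :
    (T.pre ψ.toCochain).val p n = (T.pre K.I).val p n :=
  lsum_blocks_leading ψ.toCochain K.I (fun {X Y} a => by
    have e₁ : ψ.arrow (Quiver.Path.nil.cons a)
        = (⟨a.1, K.i X Y a.1 a.2⟩ : Σ n, A.Hom X Y n) := by
      rw [ψ.arrow_eq (N := a.1) _ (by simp [red])]
      exact congrArg (fun y => (⟨a.1, y⟩ : Σ n, A.Hom X Y n)) (hψ a.1 a.2)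
    rw [e₁, K.I.arrow_eq (N := a.1) _ (by simp [red])]
    exact (congrArg (fun y => (⟨a.1, y⟩ : Σ n, A.Hom X Y n)) (K.I_lin a.1 a.2)).symm) p
    (fun q hq => hT.eq_zero q n hq)

/-- Composition with a functor `H A → A` which induces the identity on cohomology is a
surjective quasi-isomorphism between complexes of pre-natural transformations. -/
theorem exists_lift_of_pre (K : Contraction A) {ψ : AInfFunctor A.hcat A (fun X => X)}
    (hψ : ∀ {X Y : A.Ob} (n : ℤ) (a : A.HHom X Y n), ψ.lin n n a = K.i X Y n a)
    (F : AInfFunctor A B f) (G : AInfFunctor A B g)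
    (c : Cochain Aᵍ Bᵍ f g (d + 1)) (hc : homDC F G c = 0)
    (T' : Cochain Aʰ Bᵍ f g d)
    (hT' : homDC (F.comp ψ) (G.comp ψ) T' = c.pre ψ.toCochain) :
    ∃ T : Cochain Aᵍ Bᵍ f g d, homDC F G T = c ∧ T.pre ψ.toCochain = T' := by
  obtain ⟨T, hP, hR⟩ := exists_seq_of_step
    (fun m (T : Cochain Aᵍ Bᵍ f g d) =>
      (homDC F G T - c).VanishesBelow m ∧ (T.pre ψ.toCochain - T').VanishesBelow m)
    (fun m T S => (S - T).VanishesBelow m) ⟨0, vanishesBelow_zero _, vanishesBelow_zero _⟩ (by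
    rintro m T ⟨h₁, h₂⟩
    obtain ⟨Z, hZ⟩ : ∃ Z, Z = homDC F G T - c := ⟨_, rfl⟩
    obtain ⟨E, hE⟩ : ∃ E, E = T.pre ψ.toCochain - T' := ⟨_, rfl⟩
    rw [← hZ] at h₁
    rw [← hE] at h₂
    have z₁ : homDC F G Z = 0 := by rw [hZ, homDC_sub, homDC_homDC, hc, sub_zero]
    have z₂ : homDC (F.comp ψ) (G.comp ψ) E = Z.pre ψ.toCochain := by
      have : homDC (F.comp ψ) (G.comp ψ) (T.pre ψ.toCochain) = _ := homDC_pre F G T ψ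
      rw [hE, homDC_sub, hT', this, hZ, sub_pre]
    have hlead : ∀ {e : ℤ} (T : Cochain Aᵍ Bᵍ f g e) {X Y : A.Ob}
        (p : Quiver.Path (V := A.hcat.Ob) X Y) (n : ℤ), T.VanishesBelow p.length →
        (T.pre ψ.toCochain).val p n = (T.pre K.I).val p n := fun T => pre_leading K hψ T
    obtain ⟨X, hX₁, hX₂⟩ := exists_linD_eq K (Z.atLength m) (E.atLength m) (by
      rw [linD_atLength]
      refine ext fun p n => ?_
      rw [atLength_val]
      split_ifs with hp
      · rw [← homDC_leading F G p n (h₁.mono hp.le), z₁]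
      · rfl) (by
      rw [atLength_pre_of_isLinear _ K.isLinear_I, thenC_atLength]
      refine ext fun p n => ?_
      rw [atLength_val, atLength_val]
      split_ifs with hp
      · rw [← hlead Z p n (h₁.mono hp.le), ← z₂, homDC_leading _ _ p n (h₂.mono hp.le), linD,
          A.hcat_d₁, insC_zero_left, smul_zero, sub_zero]
      · rfl)
    refine ⟨T + X.atLength m, ⟨VanishesBelow.succ ?_ ?_, VanishesBelow.succ ?_ ?_⟩, ?_⟩
    · rw [homDC_add, add_sub_right_comm, ← hZ]
      exact h₁.add (vanishesBelow_homDC F G (vanishesBelow_atLength X m))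
    · intro X' Y p n hp
      rw [homDC_add, add_sub_right_comm, ← hZ, add_val,
        homDC_leading F G p n ((vanishesBelow_atLength X m).mono hp.le), linD_atLength,
        atLength_val, if_pos hp, hX₁, neg_val, atLength_val, if_pos hp, add_neg_cancel]
    · rw [add_pre, add_sub_right_comm, ← hE]
      refine h₂.add ⟨fun p n hp => ?_⟩
      rw [hlead _ p n ((vanishesBelow_atLength X m).mono hp.le),
        atLength_pre_of_isLinear _ K.isLinear_I, atLength_val, if_neg (by omega)]
    · intro X' Y p n hp
      rw [add_pre, add_sub_right_comm, ← hE, add_val,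
        hlead _ p n ((vanishesBelow_atLength X m).mono hp.le),
        atLength_pre_of_isLinear _ K.isLinear_I, atLength_val, if_pos hp, hX₂, neg_val,
        atLength_val, if_pos hp, add_neg_cancel]
    · rw [add_sub_cancel_left]
      exact vanishesBelow_atLength X m)
  obtain ⟨L, hL⟩ := exists_limit T hR
  refine ⟨L, ?_, ?_⟩
  · rw [← sub_eq_zero]
    refine eq_zero_of_vanishesBelow fun m => ?_
    have : homDC F G L - c = homDC F G (L - T m) + (homDC F G (T m) - c) := by
      rw [homDC_sub]; abel
    rw [this]
    exact (vanishesBelow_homDC F G (hL m)).add (hP m).1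
  · rw [← sub_eq_zero]
    refine eq_zero_of_vanishesBelow fun m => ?_
    have : L.pre ψ.toCochain - T' = (L - T m).pre ψ.toCochain
        + ((T m).pre ψ.toCochain - T') := by
      rw [sub_pre]; abel
    rw [this]
    refine VanishesBelow.add ⟨fun p n hp => lsum_eq_zero fun r hr => (hL m).eq_zero r n ?_⟩ (hP m).2
    exact (ψ.toCochain.length_le_of_mem_blocks p r hr).trans_lt hp

end AInfFunctor

/-! ### Euler vector fields -/

namespace Cochain

/-- The vector field which multiplies the elements of degree `n` by `n`. -/
noncomputable def eulerC (A : GrQuiver k) : Cochain A A (fun X => X) (fun X => X) 1 :=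
  ofLin fun _ _ n => (n : k) • LinearMap.id

theorem eulerC_arrow {A : GrQuiver k} {X Y : A.Ob} (a : X ⟶ Y) :
    (eulerC A).arrow (Quiver.Path.nil.cons a) = (⟨a.1, (a.1 : k) • a.2⟩ : X ⟶ Y) :=
  ofLin_arrow _ a.2

/-- The Euler vector field acts on a string by its total degree. -/
theorem ins_eulerC {A : GrQuiver k} {M : Type*} [AddCommGroup M] [Module k M]
    {X Y : A.Ob} {Φ : Path X Y → M} (hΦ : IsML Φ) (p : Path X Y) :
    ins (idC A) (idC A) (eulerC A) Φ p = ((red p + p.length : ℤ) : k) • Φ p := by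
  have e₀ : ∀ {X Y : A.Ob} {Φ : Path X Y → M} (_ : IsML Φ) (p : Path X Y),
      ins (idC A) (idC A) (eulerC A) Φ p
        = lsum (cuts3 p) fun c => Φ ((c.fst.cons ((eulerC A).arrow c.mid)).comp c.last) := by
    intro X Y Φ hΦ p
    rw [ins_idC _ hΦ]
    simp
  rw [e₀ hΦ]
  have hz : ∀ {X Y : A.Ob} (q : Path X Y), q.length ≠ 1 →
      (eulerC A).arrow q = (⟨red q + 1, 0⟩ : X ⟶ Y) := fun q hq => by
    have h : (eulerC A).IsLinear := isLinear_ofLin _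
    rw [arrow, h.eq_zero _ _ hq]
  induction p with
  | nil =>
    simp only [cuts3, cuts2, List.flatMap_cons, List.flatMap_nil, List.map_cons, List.map_nil,
      List.append_nil, lsum_singleton]
    rw [hz .nil (by simp), hΦ.insert_zero]
    simp [red]
  | cons p a ih =>
    have h := lsum_cuts3_marked p a .nil (fun c => Φ ((c.fst.cons ((eulerC A).arrow c.mid)).comp c.last))
    have e₁ : lsum (cuts3 p) (fun c => Φ (((c.fst.cons ((eulerC A).arrow c.mid)).comp c.last).cons a))
        = _ := ih (hΦ.cons a)
    have e₂ : lsum (cuts2 p) (fun c => lsum (cuts2 (Quiver.Path.nil)) (fun b : Cut2 _ _ =>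
        Φ ((c.fst.cons ((eulerC A).arrow ((c.snd.cons a).comp b.fst))).comp b.snd)))
        = (a.1 : k) • Φ (p.cons a) := by
      simp only [cuts2, lsum_singleton, Quiver.Path.comp_nil]
      rw [lsum_cuts2_snd_nil]
      · rw [eulerC_arrow]
        exact hΦ.smul p a.1 (a.1 : k) a.2 .nil
      · intro c hc
        rw [hz _ (by simpa using hc)]
        exact hΦ.insert_zero _ _ .nil
    have e₃ : lsum (cuts3 (Quiver.Path.nil)) (fun c : Cut3 _ _ =>
        Φ ((((p.cons a).comp c.fst).cons ((eulerC A).arrow c.mid)).comp c.last)) = 0 := by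
      simp only [cuts3, cuts2, List.flatMap_cons, List.flatMap_nil, List.map_cons, List.map_nil,
        List.append_nil, lsum_singleton]
      rw [hz .nil (by simp), hΦ.insert_zero]
    refine h.trans ((congrArg₂ (· + ·) (congrArg₂ (· + ·) e₁ e₂) e₃).trans ?_)
    rw [add_zero, ← add_smul, ← Int.cast_add]
    congr 2
    simp only [red, Quiver.Path.length_cons]
    push_cast
    ring

end Cochain

section Quasi

variable {A : AInfCat k} {B : AInfCat k} {f g : A.Ob → B.Ob} {d : ℤ}
variable {M : Type*} [AddCommGroup M] [Module k M] {X Y : A.Ob}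

theorem ins_idC_blocks {A : GrQuiver k} {B : GrQuiver k} {f : A.Ob → B.Ob}
    {X Y : A.Ob} (F : Cochain A B f f 1) (a : Cochain A A (fun X => X) (fun X => X) d)
    {Φ : Path (f X) (f Y) → M} (hΦ : IsML Φ) (p : Path X Y) :
    ins (idC A) (idC A) a (fun q => lsum (F.blocks q) Φ) p
      = ins F F (insC (idC A) (idC A) a F d) Φ p := by
  have h := ins_blocks (idC A) (idC A) a F (X := X) (Y := Y) hΦ p
  simp only [comp_idC] at h
  exact h

theorem blocks_ins_idC {A : GrQuiver k} {B : GrQuiver k} {f : A.Ob → B.Ob}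
    {X Y : A.Ob} {F : Cochain A B f f 1}
    (hF : ∀ (X : A.Ob) (n : ℤ), F.val (.nil : Path X X) n = 0)
    (b : Cochain B B (fun X => X) (fun X => X) d)
    {Φ : Path (f X) (f Y) → M} (hΦ : IsML Φ) (p : Path X Y) :
    lsum (F.blocks p) (fun q => ins (idC B) (idC B) b Φ q) = ins F F (b.pre F) Φ p := by
  have h := blocks_ins F (idC B) (idC B) b (X := X) (Y := Y) hΦ p
  rw [idC_comp _ hF] at h
  exact h

/-- The failure of `F` to satisfy the relations of an `A∞`-functor. -/
noncomputable def functorDefect (A : AInfCat k) (B : AInfCat k)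
    {f : A.Ob → B.Ob} (F : Cochain Aᵍ Bᵍ f f 1) :
    Cochain Aᵍ Bᵍ f f 2 :=
  B.μ.pre F - insC (idC Aᵍ) (idC Aᵍ) A.μ F 2

theorem functorDefect_val (F : Cochain Aᵍ Bᵍ f f 1) (p : Path X Y)
    (n : ℤ) : (functorDefect A B F).val p n = lsum (F.blocks p) (fun q => B.μ.val q n)
      - ins (idC Aᵍ) (idC Aᵍ) A.μ (fun q => F.val q n) p := by
  rw [functorDefect, sub_val]
  rfl

theorem ins_functorDefect (F : Cochain Aᵍ Bᵍ f f 1)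
    (hF : ∀ (X : A.Ob) (n : ℤ), F.val (.nil : Path X X) n = 0)
    {Φ : Path (f X) (f Y) → M} (hΦ : IsML Φ) (p : Path X Y) :
    ins F F (functorDefect A B F) Φ p
      = lsum (F.blocks p) (fun q => ins (idC Bᵍ) (idC Bᵍ) B.μ Φ q)
        - ins (idC Aᵍ) (idC Aᵍ) A.μ (fun q => lsum (F.blocks q) Φ) p := by
  rw [functorDefect, ins_sub_left _ _ _ _ hΦ, blocks_ins_idC hF _ hΦ, ins_idC_blocks _ _ hΦ]

/-- The Bianchi identity for the failure of `F` to be an `A∞`-functor. -/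
theorem ins_μ_functorDefect (F : Cochain Aᵍ Bᵍ f f 1)
    (hF : ∀ (X : A.Ob) (n : ℤ), F.val (.nil : Path X X) n = 0) (p : Path X Y) (n : ℤ) :
    ins (idC Aᵍ) (idC Aᵍ) A.μ (fun q => (functorDefect A B F).val q n) p
      = -ins F F (functorDefect A B F) (fun q => B.μ.val q n) p := by
  have e₁ : ∀ q : Path X Y, (functorDefect A B F).val q n = _ :=
    fun q => functorDefect_val F q n
  rw [ins_congr _ _ _ (Φ := fun q => (functorDefect A B F).val q n) e₁, ins_sub,
    AInfFunctor.ins_μ_ins_μ A (F.isML n), sub_zero, ins_functorDefect F hF (B.μ.isML n), neg_sub,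
    lsum_congr fun q _ => B.ins_μ_μ q n, lsum_zero, sub_zero]

/-- The failure of `T` to be a homotopy between `F ∘ a` and `b ∘ F`. -/
noncomputable def fieldDefect {A : AInfCat k} (B : AInfCat k)
    {f : A.Ob → B.Ob} (a : Cochain Aᵍ Aᵍ (fun X => X) (fun X => X) 1)
    (b : Cochain Bᵍ Bᵍ (fun X => X) (fun X => X) 1)
    (F : Cochain Aᵍ Bᵍ f f 1) (T : Cochain Aᵍ Bᵍ f f 0) :
    Cochain Aᵍ Bᵍ f f 1 :=
  insC F F T B.μ 1 + insC (idC Aᵍ) (idC Aᵍ) A.μ T 1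
    - insC (idC Aᵍ) (idC Aᵍ) a F 1 + b.pre F

section

variable (a : Cochain Aᵍ Aᵍ (fun X => X) (fun X => X) 1)
    (b : Cochain Bᵍ Bᵍ (fun X => X) (fun X => X) 1)
    (F : Cochain Aᵍ Bᵍ f f 1) (T : Cochain Aᵍ Bᵍ f f 0)

theorem fieldDefect_val (p : Path X Y) (n : ℤ) : (fieldDefect B a b F T).val p n
    = ins F F T (fun q => B.μ.val q n) p
      + ins (idC Aᵍ) (idC Aᵍ) A.μ (fun q => T.val q n) p
      - ins (idC Aᵍ) (idC Aᵍ) a (fun q => F.val q n) p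
      + lsum (F.blocks p) (fun q => b.val q n) := by
  rw [fieldDefect, add_val, sub_val]
  rfl

theorem ins_comm_of_closed (ha : AInfFunctor.homDC (AInfFunctor.id A) (AInfFunctor.id A) a = 0)
    {X Y : A.Ob} {Φ : Path X Y → M} (hΦ : IsML Φ) (p : Path X Y) :
    ins (idC Aᵍ) (idC Aᵍ) A.μ
        (fun q => ins (idC Aᵍ) (idC Aᵍ) a Φ q) p
      = ins (idC Aᵍ) (idC Aᵍ) a
        (fun q => ins (idC Aᵍ) (idC Aᵍ) A.μ Φ q) p := by
  have h := AInfFunctor.ins_homDC (AInfFunctor.id A) (AInfFunctor.id A) a hΦ p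
  rw [ha, ins_zero_left _ _ hΦ, sub_self, Int.negOnePow_zero, one_smul] at h
  exact (sub_eq_zero.1 h.symm).symm

/-- The Bianchi identity for the failure of `T` to be a homotopy between `F ∘ a` and `b ∘ F`. -/
theorem ins_μ_fieldDefect
    (ha : AInfFunctor.homDC (AInfFunctor.id A) (AInfFunctor.id A) a = 0)
    (hb : AInfFunctor.homDC (AInfFunctor.id B) (AInfFunctor.id B) b = 0)
    (hF : ∀ (X : A.Ob) (n : ℤ), F.val (.nil : Path X X) n = 0)
    (p : Path X Y) (n : ℤ) :
    ins (idC Aᵍ) (idC Aᵍ) A.μ (fun q => (fieldDefect B a b F T).val q n) p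
      = ins F F (fieldDefect B a b F T) (fun q => B.μ.val q n) p
        - ins₂ F F F T (functorDefect A B F) (fun q => B.μ.val q n) p
        + ins₂ F F F (functorDefect A B F) T (fun q => B.μ.val q n) p
        + ins (idC Aᵍ) (idC Aᵍ) a
            (fun q => (functorDefect A B F).val q n) p
        - ins F F (functorDefect A B F) (fun q => b.val q n) p := by
  have hμ := B.μ.isML (X := f X) (Y := f Y) n
  -- the source differential of the part which involves `T`
  have h₁ := ins_ins (idC Aᵍ) (idC Aᵍ) A.μ F F T 1 (by ring) hμ p
  have h₂ := ins_ins F F T (idC Bᵍ) (idC Bᵍ) B.μ 1 (by ring) hμ p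
  rw [ins_congr F F T (fun q => B.ins_μ_μ q n), ins_zero_fun, idC_insC] at h₂
  simp only [comp_idC, pre_idC, idC_comp _ hF] at h₁ h₂
  have hl : ∀ U, ins₂ F F F T (B.μ.pre F - U) (fun q => B.μ.val q n) p
      = ins₂ F F F T (B.μ.pre F) (fun q => B.μ.val q n) p
        - ins₂ F F F T U (fun q => B.μ.val q n) p := by
    intro U
    rw [ins₂_eq, ins₂_eq, ins₂_eq, ← lsum_sub]
    refine lsum_congr fun c _ => ?_
    rw [← smul_sub, ← lsum_sub]
    congr 1
    refine lsum_congr fun r _ => ?_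
    rw [← lsum_sub]
    refine lsum_congr fun c' _ => ?_
    rw [← smul_sub, ins_sub_left _ _ _ _ (hμ.comp_left _)]
  have hr : ∀ U, ins₂ F F F (B.μ.pre F - U) T (fun q => B.μ.val q n) p
      = ins₂ F F F (B.μ.pre F) T (fun q => B.μ.val q n) p
        - ins₂ F F F U T (fun q => B.μ.val q n) p := by
    intro U
    rw [ins₂, ins₂, ins₂, ← lsum_sub]
    refine lsum_congr fun c _ => ?_
    rw [← smul_sub, ins_sub_left]
    exact IsML.lsum (Φ := fun (c' : Cut2 _ Y) u => lsum (F.blocks c'.snd)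
      fun v => B.μ.val ((u.cons (T.arrow c'.fst)).comp v) n) (fun c' => IsML.lsum (fun v =>
      (hμ.comp_right v).cons _) _) _
  have hD : insC (idC Aᵍ) (idC Aᵍ) A.μ F 2
      = B.μ.pre F - functorDefect A B F := by rw [functorDefect]; abel
  rw [hD, hl, hr] at h₁
  -- the part which involves `a`
  have h₃ := ins_comm_of_closed a ha (F.isML n) p
  have e₃ : ∀ q : Path X Y, ins (idC Aᵍ) (idC Aᵍ) A.μ
      (fun q => F.val q n) q
      = lsum (F.blocks q) (fun q => B.μ.val q n) - (functorDefect A B F).val q n := fun q => by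
    rw [functorDefect_val, sub_sub_cancel]
  rw [ins_congr (idC Aᵍ) (idC Aᵍ) a e₃, ins_sub, ins_idC_blocks _ _ hμ] at h₃
  -- the part which involves `b`
  have h₄ := ins_functorDefect (A := A) (B := B) F hF (b.isML n) p
  have e₄ : ∀ q : Path (f X) (f Y), ins (idC Bᵍ) (idC Bᵍ) B.μ
      (fun q => b.val q n) q
      = ins (idC Bᵍ) (idC Bᵍ) b (fun q => B.μ.val q n) q := fun q => by
    have h := AInfFunctor.homDC_val' (AInfFunctor.id B) (AInfFunctor.id B) b q n
    rw [hb, zero_val, sub_self, Int.negOnePow_zero, one_smul] at h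
    exact (sub_eq_zero.1 h.symm).symm
  rw [lsum_congr fun q _ => e₄ q, blocks_ins_idC hF _ hμ] at h₄
  have e₅ : ∀ q : Path X Y, (fieldDefect B a b F T).val q n = _ :=
    fun q => fieldDefect_val a b F T q n
  have e₆ : ins F F (fieldDefect B a b F T) (fun q => B.μ.val q n) p
      = ins F F (insC F F T B.μ 1) (fun q => B.μ.val q n) p
        + ins F F (insC (idC Aᵍ) (idC Aᵍ) A.μ T 1) (fun q => B.μ.val q n) p
        - ins F F (insC (idC Aᵍ) (idC Aᵍ) a F 1) (fun q => B.μ.val q n) p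
        + ins F F (b.pre F) (fun q => B.μ.val q n) p := by
    rw [fieldDefect, ins_add_left _ _ _ _ hμ, ins_sub_left _ _ _ _ hμ, ins_add_left _ _ _ _ hμ]
  rw [ins_congr _ _ _ (Φ := fun q => (fieldDefect B a b F T).val q n) e₅, ins_add, ins_sub,
    ins_add, AInfFunctor.ins_μ_ins_μ A (T.isML n), h₃, e₆, h₄, h₁]
  simp only [show ((2 : ℤ) - 1) * (0 - 1) = -1 by norm_num,
    show ((0 : ℤ) - 1) * (2 - 1) = -1 by norm_num, Int.negOnePow_neg, Int.negOnePow_one,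
    Units.neg_smul, one_smul] at h₂ ⊢
  have h₂' : ins F F (insC F F T B.μ 1) (fun q => B.μ.val q n) p
      = ins₂ F F F T (B.μ.pre F) (fun q => B.μ.val q n) p
        - ins₂ F F F (B.μ.pre F) T (fun q => B.μ.val q n) p := by
    rw [← sub_eq_zero, h₂]
    abel
  rw [h₂']
  abel

end
end Quasi

/-! ### Minimal models with the Euler vector field -/

namespace AInfCat

theorem hcat_ins_μ_eq_zero (A : AInfCat k) {M : Type*} [AddCommGroup M] [Module k M]
    {X Y : A.hcat.Ob} {Φ : Path X Y → M} (hΦ : IsML Φ) (p : Path X Y)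
    (h : ∀ q, q.length < p.length → Φ q = 0) :
    ins (idC Aʰ) (idC Aʰ) A.hcat.μ Φ p = 0 := by
  rw [A.hcat.ins_μ_leading hΦ p h, A.hcat_d₁]
  exact ins_zero_left _ _ hΦ _

theorem homologous_iff_cls {A : AInfCat k} {X Y : A.Ob} {n : ℤ} (a b : A.cocycles X Y n) :
    A.Homologous a.1 b.1 ↔ A.cls a = A.cls b := (A.cls_eq_cls a b).symm

/-- The coboundaries, as a subspace of the morphism space. -/
abbrev exact (A : AInfCat k) (X Y : A.Ob) (n : ℤ) : Submodule k (A.Hom X Y n) :=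
  LinearMap.range (A.d (n - 1) n)

theorem d_mem_exact (A : AInfCat k) {X Y : A.Ob} {m n : ℤ} (η : A.Hom X Y m) :
    A.d m n η ∈ A.exact X Y n := by
  by_cases h : n = m + 1
  · obtain rfl : m = n - 1 := by omega
    exact ⟨η, rfl⟩
  · rw [A.d_eq_zero h]
    exact zero_mem _

/-- Primitives of coboundaries, as a cochain. -/
noncomputable def primC (A : AInfCat k) :
    Cochain Aᵍ Aᵍ (fun X => X) (fun X => X) 0 :=
  ofLinDeg 0 A.primitive fun _ _ _ _ h => A.primitive_eq_zero _ _ (by omega)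

theorem primC_lin (A : AInfCat k) {X Y : A.Ob} (n m : ℤ) (a : A.Hom X Y n) :
    A.primC.lin n m a = A.primitive X Y n m a := rfl

end AInfCat

section Change

variable {A : GrQuiver k} {B : AInfCat k} {f g : A.Ob → B.Ob} {d : ℤ}

/-- Cochains vanishing below length `m` which take exact values at length `m` are exact there. -/
theorem d_thenC_primC (T : Cochain A Bᵍ f g d) {X Y : A.Ob}
    (p : Path X Y) (r : ℤ) (hr : r = d + 0 - 1)
    (h : T.val p (red p + d) ∈ B.exact (f X) (g Y) (red p + d)) :
    B.d (red p + r) (red p + d) ((T.thenC B.primC r hr).val p (red p + r))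
      = T.val p (red p + d) := by
  obtain rfl : r = d - 1 := by omega
  rw [thenC_val, B.primC_lin, ← add_sub_assoc]
  exact B.d_primitive _ h

theorem Cochain.VanishesBelow.thenC_primC {T : Cochain A Bᵍ f g d} {m : ℕ}
    (hT : T.VanishesBelow m) (r : ℤ) (hr : r = d + 0 - 1) :
    (T.thenC B.primC r hr).VanishesBelow m := ⟨fun p n hp => by
  rw [thenC_val, hT.eq_zero p _ hp, map_zero]⟩

end Change

section Model

variable {A : AInfCat k} {X Y : A.hcat.Ob}
variable (F : Cochain Aʰ Aᵍ (fun X => X) (fun X => X) 1)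
  (T : Cochain Aʰ Aᵍ (fun X => X) (fun X => X) 0)
  (b : Cochain Aᵍ Aᵍ (fun X => X) (fun X => X) 1)

theorem μ_val_str {A : AInfCat k} {B : AInfCat k} {f g : A.Ob → B.Ob} {d : ℤ}
    (U : Cochain Aᵍ Bᵍ f g d) {X Y : A.Ob} (p : Path X Y) (n : ℤ) :
    B.μ.val (Quiver.Path.nil.cons (U.arrow p)) n = B.d (red p + d) n (U.val p (red p + d)) := rfl

/-- A change of `F` at length `m` changes its defect at length `m` by a coboundary. -/
theorem functorDefect_add_linD {A : AInfCat k} {B : AInfCat k}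
    {f : A.Ob → B.Ob} (F : Cochain Aᵍ Bᵍ f f 1)
    {U : Cochain Aᵍ Bᵍ f f 1}
    {m : ℕ} (hm : 0 < m) (hU : U.VanishesBelow m) {X Y : A.Ob} (p : Path X Y) (n : ℤ)
    (hp : p.length ≤ m) : (functorDefect A B (F + U)).val p n
      = (functorDefect A B F).val p n + (AInfFunctor.linD U).val p n := by
  have hnil : ∀ (X : A.Ob) (n : ℤ), (F + U).val (.nil : Path X X) n
      = F.val .nil n := fun X n => by
    rw [add_val, hU.eq_zero (.nil : Path X X) n hm, add_zero]
  have h₁ := blocks_sub_blocks F (F + U) hnil (B.μ.isML n) p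
  rw [add_sub_cancel_left, ins_eq_leading _ _ (B.μ.isML n) p (hU.mono hp), sub_eq_iff_eq_add] at h₁
  have h₂ : ins (idC Aᵍ) (idC Aᵍ) A.μ
      (fun q => (F + U).val q n) p = _ := ins_add _ _ _ (fun q => F.val q n) (fun q => U.val q n) p
  rw [A.ins_μ_leading (U.isML n) p fun q hq => hU.eq_zero q n (hq.trans_le hp)] at h₂
  rw [functorDefect_val, functorDefect_val, h₁, h₂, AInfFunctor.linD_val, sub_self,
    Int.negOnePow_zero, one_smul, μ_val_str]
  abel

theorem functorDefect_add {B : AInfCat k} {f : A.hcat.Ob → B.Ob}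
    (F : Cochain Aʰ Bᵍ f f 1)
    {U : Cochain Aʰ Bᵍ f f 1}
    {m : ℕ} (hm : 0 < m) (hU : U.VanishesBelow m) (p : Quiver.Path (V := A.hcat.Ob) X Y) (n : ℤ)
    (hp : p.length ≤ m) : (functorDefect A.hcat B (F + U)).val p n
      = (functorDefect A.hcat B F).val p n + B.d (red p + 1) n (U.val p (red p + 1)) := by
  rw [functorDefect_add_linD F hm hU p n hp, AInfFunctor.linD_val, A.hcat_d₁,
    ins_zero_left _ _ (U.isML n), smul_zero, sub_zero]

/-- The operator which acts by the degree on the cohomology of a category with pure structure,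
written for arbitrary elements in place of the equivariant structures. -/
def weightOp (b : Cochain Aᵍ Aᵍ (fun X => X) (fun X => X) 1) {X Y : A.Ob}
    (cX : A.Hom X X 0) (cY : A.Hom Y Y 0) {n : ℤ} (x : A.Hom X Y n) : A.Hom X Y n :=
  b.lin n n x - A.prod cY x n + A.prod x cX n

theorem prodOf_arrow {X Y : A.Ob} (cX : A.Hom X X 0) (cY : A.Hom Y Y 0)
    {n : ℤ} (x : A.Hom X Y n) (s : ℤˣ) (hs : s = (n - 1).negOnePow) :
    weightOp b cX cY x = b.val (str₁ x) n + A.μ.val (str₂ x cX) n + s • A.μ.val (str₂ cY x) n := by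
  subst hs
  have h₁ : A.prod x cX n = A.μ.val (str₂ x cX) n := by
    have : A.prod x cX n = (0 : ℤ).negOnePow • A.μ.val (str₂ x cX) n := rfl
    rw [this, Int.negOnePow_zero, one_smul]
  have h₂ : A.prod cY x n = -((n - 1).negOnePow • A.μ.val (str₂ cY x) n) := by
    have : A.prod cY x n = n.negOnePow • A.μ.val (str₂ cY x) n := rfl
    rw [this, Int.negOnePow_sub, Int.negOnePow_one, mul_neg, mul_one, Units.neg_smul, neg_neg]
  rw [weightOp, h₁, h₂]
  have : b.lin n n x = b.val (str₁ x) n := rfl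
  rw [this]
  abel

/-- A change of `F` at length `m` changes the defect of the vector fields at length `m` by the
operator which acts with weight `1 - m`. -/
theorem fieldDefect_add_left
    {U : Cochain Aʰ Aᵍ (fun X => X) (fun X => X) 1}
    {m : ℕ} (hm : 0 < m) (hU : U.VanishesBelow m) (p : Quiver.Path (V := A.hcat.Ob) X Y)
    (hp : p.length ≤ m) :
    (fieldDefect (A := A.hcat) A (eulerC _) b (F + U) T).val p (red p + 1)
      = (fieldDefect (A := A.hcat) A (eulerC _) b F T).val p (red p + 1)
        + weightOp b (T.val .nil 0) (T.val .nil 0) (U.val p (red p + 1))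
        - ((red p + p.length : ℤ) : k) • U.val p (red p + 1) := by
  have hnil : ∀ (X : A.hcat.Ob) (n : ℤ), (F + U).val (.nil : Path X X) n
      = F.val .nil n := fun X n => by rw [add_val, hU.eq_zero (.nil : Path X X) n hm, add_zero]
  have hμ := A.μ.isML (X := X) (Y := Y) (red p + 1)
  have h₁ := blocks_sub_blocks F (F + U) hnil (b.isML (red p + 1)) p
  rw [add_sub_cancel_left, ins_eq_leading _ _ (b.isML _) p (hU.mono hp), sub_eq_iff_eq_add] at h₁
  have h₂ : ins (idC Aʰ) (idC Aʰ) (eulerC _)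
      (fun q => (F + U).val q (red p + 1)) p = _ := ins_add _ _ _ (fun q => F.val q (red p + 1))
        (fun q => U.val q (red p + 1)) p
  rw [ins_eulerC (U.isML _) p] at h₂
  have h₃ := ins_sub_ins_left F (F + U) (F + U) hnil T hμ p
  rw [add_sub_cancel_left, ins₂_eq_leading_left _ _ _ _ hμ p (hU.mono hp),
    sub_eq_iff_eq_add] at h₃
  have h₄ := ins_sub_ins_right F F (F + U) hnil T hμ p
  rw [add_sub_cancel_left, ins₂_eq_leading_right _ _ _ _ hμ p (hU.mono hp),
    sub_eq_iff_eq_add] at h₄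
  rw [prodOf_arrow b _ _ _ (((0 : ℤ) - 1) * red p).negOnePow
    (negOnePow_congr ⟨-red p, by ring⟩)]
  have h₅ : b.val (str₁ (U.val p (red p + 1))) (red p + 1)
    = b.val (Quiver.Path.nil.cons (U.arrow p)) (red p + 1) := rfl
  have h₆ : A.μ.val (str₂ (U.val p (red p + 1)) (T.val .nil 0)) (red p + 1)
    = A.μ.val ((Quiver.Path.nil.cons (T.arrow (.nil : Path X X))).cons (U.arrow p))
      (red p + 1) := rfl
  have h₇ : A.μ.val (str₂ (T.val .nil 0) (U.val p (red p + 1))) (red p + 1)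
    = A.μ.val ((Quiver.Path.nil.cons (U.arrow p)).cons (T.arrow (.nil : Path Y Y)))
      (red p + 1) := rfl
  rw [fieldDefect_val, fieldDefect_val, h₁, h₂, h₃, h₄, h₅, h₆, h₇]
  abel

/-- A change of `T` at length `m` changes the defect at length `m` by a coboundary. -/
theorem fieldDefect_add_right
    {U : Cochain Aʰ Aᵍ (fun X => X) (fun X => X) 0}
    {m : ℕ} (hU : U.VanishesBelow m) (p : Quiver.Path (V := A.hcat.Ob) X Y) (n : ℤ)
    (hp : p.length ≤ m) :
    (fieldDefect (A := A.hcat) A (eulerC _) b F (T + U)).val p n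
      = (fieldDefect (A := A.hcat) A (eulerC _) b F T).val p n
        + A.d (red p + 0) n (U.val p (red p + 0)) := by
  have hμ := A.μ.isML (X := X) (Y := Y) n
  have h₁ : ins F F (T + U) (fun q => A.μ.val q n) p = _ := ins_add_left F F T U hμ p
  rw [ins_eq_leading F F hμ p (hU.mono hp)] at h₁
  have h₂ : ins (idC Aʰ) (idC Aʰ) A.hcat.μ
      (fun q => (T + U).val q n) p = _ := ins_add _ _ _ (fun q => T.val q n) (fun q => U.val q n) p
  rw [A.hcat_ins_μ_eq_zero (U.isML n) p fun q hq => hU.eq_zero q n (hq.trans_le hp),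
    add_zero] at h₂
  rw [fieldDefect_val, fieldDefect_val, h₁, h₂]
  have h₃ : A.μ.val (Quiver.Path.nil.cons (U.arrow p)) n
    = A.d (red p + 0) n (U.val p (red p + 0)) := rfl
  rw [h₃]
  abel

/-- The Euler vector field of a category whose only operation is the product is closed. -/
theorem homDC_euler (A : AInfCat k) :
    AInfFunctor.homDC (AInfFunctor.id A.hcat) (AInfFunctor.id A.hcat) (eulerC Aʰ)
      = 0 := by
  refine ext fun {X Y} p n => ?_
  have h₁ : ins (AInfFunctor.id A.hcat).toCochain (AInfFunctor.id A.hcat).toCochain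
      (eulerC Aʰ) (fun q => A.hcat.μ.val q n) p = _ :=
    ins_eulerC (A := Aʰ) (A.hcat.μ.isML n) p
  have hE : (eulerC Aʰ).IsLinear := isLinear_ofLin _
  have h₂ : ins (idC Aʰ) (idC Aʰ) A.hcat.μ
      (fun q => (eulerC Aʰ).val q n) p = (n : k) • A.hcat.μ.val p n := by
    have := congrArg (fun T => T.val p n) (hE.insC (idC Aʰ) (idC Aʰ)
      A.hcat.μ 2 (by ring))
    refine this.trans ?_
    refine (thenC_val _ _ _ _ p n).trans ?_
    by_cases hn : n = red p + 2
    · subst hn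
      exact ofLin_lin (A := Aʰ) (fun _ _ n => (n : k) • LinearMap.id) (red p + 2) _
    · rw [A.hcat.μ.val_eq_zero p n hn, smul_zero, lin_eq_zero _ (by omega)]
  have h₃ : (AInfFunctor.homDC (AInfFunctor.id A.hcat) (AInfFunctor.id A.hcat)
      (eulerC Aʰ)).val p n = _ := AInfFunctor.homDC_val' _ _ _ _ _
  rw [h₃, h₁, h₂, sub_self, Int.negOnePow_zero, one_smul, zero_val, ← sub_smul]
  by_cases hp : p.length = 2
  · by_cases hn : n = red p + 2
    · rw [hp, hn]; simp
    · rw [A.hcat.μ.val_eq_zero p n hn, smul_zero]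
  · have : A.hcat.μ.val p n = 0 := A.cohVal_of_length p n hp
    rw [this, smul_zero]

end Model

/-! ### The obstructions to formality have nonzero weight -/

namespace Cochain

section OfNil

variable {A : GrQuiver k} {B : GrQuiver k} {f g : A.Ob → B.Ob} {d : ℤ}

/-- The values of `ofNil`. -/
def ofNilVal (c : ∀ X, B.Hom (f X) (g X) d) {X : A.Ob} :
    ∀ {Y : A.Ob}, Path X Y → ∀ n : ℤ, B.Hom (f X) (g Y) n
  | _, .nil, n => Pi.single (M := fun n => B.Hom (f X) (g X) n) d (c X) n
  | _, .cons _ _, _ => 0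

theorem ofNilVal_of_length (c : ∀ X, B.Hom (f X) (g X) d) {X Y : A.Ob} (p : Path X Y) (n : ℤ)
    (h : p.length ≠ 0) : ofNilVal c p n = 0 := by
  cases p with
  | nil => exact absurd rfl h
  | cons p a => rfl

/-- The cochain of order zero with given values on the objects. -/
def ofNil (c : ∀ X, B.Hom (f X) (g X) d) : Cochain A B f g d where
  val p n := ofNilVal c p n
  val_eq_zero p n h := by
    cases p with
    | nil => exact Pi.single_eq_of_ne (M := fun n => B.Hom (f _) (g _) n) (by simpa [red] using h) _
    | cons p a => rfl
  val_add p i a b q n := by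
    rw [ofNilVal_of_length, ofNilVal_of_length, ofNilVal_of_length, add_zero] <;>
    simp
  val_smul p i r a q n := by
    rw [ofNilVal_of_length, ofNilVal_of_length, smul_zero] <;> simp

theorem ofNil_val_nil (c : ∀ X, B.Hom (f X) (g X) d) (X : A.Ob) :
    (ofNil (A := A) c).val (.nil : Path X X) d = c X :=
  Pi.single_eq_same (M := fun n => B.Hom (f X) (g X) n) _ _

theorem ofNil_val (c : ∀ X, B.Hom (f X) (g X) d) {X Y : A.Ob} (p : Path X Y) (n : ℤ)
    (h : p.length ≠ 0) : (ofNil c).val p n = 0 := ofNilVal_of_length c p n h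

theorem lsum_blocks_zero {M : Type*} [AddCommGroup M] [Module k M] {X Y : A.Ob}
    {Φ : Path (f X) (f Y) → M} (hΦ : IsML Φ) (p : Path X Y) (hp : p.length ≠ 0) :
    lsum ((0 : Cochain A B f f 1).blocks p) Φ = 0 := by
  cases p with
  | nil => exact absurd rfl hp
  | cons p a =>
    rw [lsum_blocks_cons]
    exact lsum_eq_zero fun c _ => lsum_eq_zero fun r _ => hΦ.insert_zero r _ .nil

theorem vanishesBelow_of_val {T : Cochain A B f g d} {m : ℕ}
    (h : ∀ {X Y : A.Ob} (p : Path X Y), p.length < m → T.val p (red p + d) = 0) :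
    T.VanishesBelow m := ⟨fun p n hp => by
  by_cases hn : n = red p + d
  · rw [hn, h p hp]
  · exact T.val_eq_zero p n hn⟩

end OfNil

end Cochain

section Model

variable {A : AInfCat k}

theorem PureStructure.weightOp_sub_mem_exact (s : PureStructure A) {X Y : A.Ob} {n : ℤ} (x : A.Hom X Y n)
    (hx : A.d n (n + 1) x = 0) :
    weightOp s.b (s.c X) (s.c Y) x - (n : k) • x ∈ A.exact X Y n := by
  obtain ⟨η, hη⟩ := s.pure n x hx
  refine ⟨η, hη.trans ?_⟩
  rw [Int.cast_smul_eq_zsmul]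
  rfl

theorem PureStructure.homDC_b (s : PureStructure A) :
    AInfFunctor.homDC (AInfFunctor.id A) (AInfFunctor.id A) s.b = 0 :=
  AInfFunctor.homDC_of_hochschildD s.b s.closed

variable (s : PureStructure A)
  {F : Cochain Aʰ Aᵍ (fun X => X) (fun X => X) 1}
  {T : Cochain Aʰ Aᵍ (fun X => X) (fun X => X) 0}

/-- The leading term of the failure of the functor relations is closed. -/
theorem d_functorDefect (hF : ∀ (X : A.Ob) (n : ℤ), F.val (.nil : Quiver.Path (V := A.hcat.Ob) X X) n = 0)
    {X Y : A.hcat.Ob} (p : Path X Y) (hR : (functorDefect A.hcat A F).VanishesBelow p.length)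
    (n : ℤ) : A.d (red p + 2) n ((functorDefect A.hcat A F).val p (red p + 2)) = 0 := by
  have h := ins_μ_functorDefect (A := A.hcat) (B := A) F hF p n
  rw [A.hcat_ins_μ_eq_zero ((functorDefect A.hcat A F).isML n) p fun q hq => hR.eq_zero q n hq,
    ins_eq_leading _ _ (A.μ.isML n) p hR, eq_comm, neg_eq_zero] at h
  exact h

/-- The leading term of the failure of `T` to be a homotopy is closed. -/
theorem d_fieldDefect (hF : ∀ (X : A.Ob) (n : ℤ), F.val (.nil : Quiver.Path (V := A.hcat.Ob) X X) n = 0)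
    {X Y : A.hcat.Ob} (p : Path X Y)
    (hR : (functorDefect A.hcat A F).VanishesBelow (p.length + 1))
    (hW : (fieldDefect (A := A.hcat) A (eulerC _) s.b F T).VanishesBelow p.length) (n : ℤ) :
    A.d (red p + 1) n ((fieldDefect (A := A.hcat) A (eulerC _) s.b F T).val p (red p + 1)) = 0 := by
  have hμ := A.μ.isML (X := X) (Y := Y) n
  have hl := Nat.lt_succ_self p.length
  have h := ins_μ_fieldDefect (A := A.hcat) (B := A) (eulerC _) s.b F T (homDC_euler A) s.homDC_b hF
    p n
  rw [A.hcat_ins_μ_eq_zero ((fieldDefect (A := A.hcat) A (eulerC _) s.b F T).isML n) p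
    fun q hq => hW.eq_zero q n hq, ins_eq_leading _ _ hμ p hW,
    ins₂_eq_zero_right _ _ _ _ hμ p hR hl, ins₂_eq_zero_left _ _ _ _ hμ p hR hl,
    ins_eulerC ((functorDefect A.hcat A F).isML n), hR.eq_zero p n hl, smul_zero,
    ins_eq_zero _ _ (s.b.isML n) p hR hl, sub_zero, add_zero, add_zero, sub_zero] at h
  exact h.symm

/-- The leading term of the failure of the functor relations has weight `2 - m` for strings of
length `m`; hence its class vanishes if `m ≠ 2`. -/
theorem exact_functorDefect [CharZero k]
    (hF : ∀ (X : A.Ob) (n : ℤ), F.val (.nil : Quiver.Path (V := A.hcat.Ob) X X) n = 0)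
    (hT : ∀ X : A.Ob, T.val (.nil : Quiver.Path (V := A.hcat.Ob) X X) 0 = s.c X)
    {X Y : A.hcat.Ob} (p : Path X Y) (hp : p.length ≠ 2)
    (hR : (functorDefect A.hcat A F).VanishesBelow p.length)
    (hW : (fieldDefect (A := A.hcat) A (eulerC _) s.b F T).VanishesBelow p.length) :
    (functorDefect A.hcat A F).val p (red p + 2) ∈ A.exact X Y (red p + 2) := by
  obtain ⟨r, hr⟩ : ∃ r, r = (functorDefect A.hcat A F).val p (red p + 2) := ⟨_, rfl⟩
  have hμ := A.μ.isML (X := X) (Y := Y) (red p + 2)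
  have h := ins_μ_fieldDefect (A := A.hcat) (B := A) (eulerC _) s.b F T (homDC_euler A) s.homDC_b hF
    p (red p + 2)
  have hd := d_functorDefect hF p hR (red p + 2 + 1)
  rw [A.hcat_ins_μ_eq_zero ((fieldDefect (A := A.hcat) A (eulerC _) s.b F T).isML _) p
    fun q hq => hW.eq_zero q _ hq, ins_eq_leading _ _ hμ p hW,
    ins₂_eq_leading_right _ _ _ _ hμ p hR, ins₂_eq_leading_left _ _ _ _ hμ p hR,
    ins_eulerC ((functorDefect A.hcat A F).isML _), ins_eq_leading _ _ (s.b.isML _) p hR] at h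
  have e₁ := prodOf_arrow s.b (s.c X) (s.c Y) r (-(((0 : ℤ) - 1) * red p).negOnePow) (by
    rw [← Int.negOnePow_succ]
    exact negOnePow_congr ⟨-red p, by ring⟩)
  have e₂ : s.b.val (Quiver.Path.nil.cons ((functorDefect A.hcat A F).arrow p)) (red p + 2)
    = s.b.val (str₁ r) (red p + 2) := by rw [hr]; rfl
  have e₃ : A.μ.val ((Quiver.Path.nil.cons (T.arrow (.nil : Quiver.Path (V := A.hcat.Ob) X X))).cons
    ((functorDefect A.hcat A F).arrow p)) (red p + 2) = A.μ.val (str₂ r (s.c X)) (red p + 2) := by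
    rw [hr, ← hT]; rfl
  have e₄ : A.μ.val ((Quiver.Path.nil.cons ((functorDefect A.hcat A F).arrow p)).cons
    (T.arrow (.nil : Quiver.Path (V := A.hcat.Ob) Y Y))) (red p + 2)
      = A.μ.val (str₂ (s.c Y) r) (red p + 2) := by
    rw [hr, ← hT]; rfl
  rw [e₂, e₃, e₄, ← hr] at h
  have hη := s.weightOp_sub_mem_exact r (by rw [hr]; exact hd)
  obtain ⟨ω, hω⟩ : ∃ ω : A.Hom X Y (red p + 1), ω
    = (fieldDefect (A := A.hcat) A (eulerC _) s.b F T).val p (red p + 1) := ⟨_, rfl⟩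
  have e₅ : A.μ.val (Quiver.Path.nil.cons ((fieldDefect (A := A.hcat) A (eulerC _) s.b F T).arrow p))
      (red p + 2) = A.d (red p + 1) (red p + 2) ω := by rw [hω]; rfl
  rw [e₅] at h
  have hk : ((p.length : k) - 2) ≠ 0 := by
    rw [sub_ne_zero]
    exact_mod_cast hp
  have h₀ : A.d (red p + 1) (red p + 2) ω = weightOp s.b (s.c X) (s.c Y) r
      - ((red p + p.length : ℤ) : k) • r := by
    rw [e₁, Units.neg_smul, ← sub_eq_zero, eq_comm, h]
    abel
  have h₁ := Submodule.sub_mem _ (A.d_mem_exact (n := red p + 2) ω) hη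
  rw [h₀, sub_sub_sub_cancel_left, ← sub_smul] at h₁
  have : ((red p + 2 : ℤ) : k) - ((red p + p.length : ℤ) : k) = -((p.length : k) - 2) := by
    push_cast; ring
  rw [this] at h₁
  rw [← hr]
  exact (Submodule.smul_mem_iff _ (neg_ne_zero.2 hk)).1 h₁

end Model

/-! ### Correcting one order at a time -/

namespace AInfCat

variable (A : AInfCat k) {X Y Z : A.Ob}

theorem prod_zero {p q : ℤ} (b : A.Hom Y Z q) (m : ℤ) : A.prod b (0 : A.Hom X Y p) m = 0 :=
  (congrArg (fun y => p.negOnePow • y) (A.μ.val_zero (.nil : Path X X) p (str₁ b) m)).trans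
    (smul_zero _)

theorem zero_prod {p q : ℤ} (a : A.Hom X Y p) (m : ℤ) : A.prod (0 : A.Hom Y Z q) a m = 0 :=
  (congrArg (fun y => p.negOnePow • y) (A.μ.val_zero (str₁ a) q (.nil : Path Z Z) m)).trans
    (smul_zero _)

end AInfCat

theorem ins_ofNil {A : GrQuiver k} {B : GrQuiver k} {f g : A.Ob → B.Ob} {d e : ℤ}
    (c : ∀ X, B.Hom (f X) (g X) d) (T : Cochain A A (fun X => X) (fun X => X) e) {X Y : A.Ob}
    (p : Path X Y) (n : ℤ) :
    ins (idC A) (idC A) T (fun q => (ofNil (B := B) (f := f) (g := g) c).val q n) p = 0 := by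
  rw [ins_idC _ ((ofNil c).isML n)]
  refine lsum_eq_zero fun c' _ => ?_
  rw [ofNil_val, smul_zero]
  simp

section Model

variable {A : AInfCat k} (s : PureStructure A)
  {F F' : Cochain Aʰ Aᵍ (fun X => X) (fun X => X) 1}
  {T : Cochain Aʰ Aᵍ (fun X => X) (fun X => X) 0}

theorem functorDefect_congr {m : ℕ} (hm : 0 < m) (h : (F' - F).VanishesBelow m)
    (hR : (functorDefect A.hcat A F).VanishesBelow m) :
    (functorDefect A.hcat A F').VanishesBelow m := ⟨fun p n hp => by
  have := functorDefect_add F hm h p n hp.le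
  rw [add_sub_cancel, hR.eq_zero p n hp, h.eq_zero p _ hp, map_zero, add_zero] at this
  exact this⟩

theorem fieldDefect_congr_left {b : Cochain Aᵍ Aᵍ (fun X => X) (fun X => X) 1}
    {m : ℕ} (hm : 0 < m) (h : (F' - F).VanishesBelow m)
    (hW : (fieldDefect (A := A.hcat) A (eulerC _) b F T).VanishesBelow m) :
    (fieldDefect (A := A.hcat) A (eulerC _) b F' T).VanishesBelow m :=
  vanishesBelow_of_val fun {X Y} p hp => by
  have h₁ := fieldDefect_add_left F T b hm h p hp.le
  have h₂ : weightOp b (T.val (.nil : Quiver.Path (V := A.hcat.Ob) X X) 0)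
      (T.val (.nil : Quiver.Path (V := A.hcat.Ob) Y Y) 0) (0 : A.Hom X Y (red p + 1)) = 0 := by
    rw [weightOp, AInfCat.prod_zero, AInfCat.zero_prod, map_zero, sub_zero, add_zero]
  rw [add_sub_cancel, hW.eq_zero p _ hp, h.eq_zero p _ hp, h₂, smul_zero, sub_zero, add_zero] at h₁
  exact h₁

theorem fieldDefect_congr_right {b : Cochain Aᵍ Aᵍ (fun X => X) (fun X => X) 1}
    {T' : Cochain Aʰ Aᵍ (fun X => X) (fun X => X) 0}
    {m : ℕ} (h : (T' - T).VanishesBelow m)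
    (hW : (fieldDefect (A := A.hcat) A (eulerC _) b F T).VanishesBelow m) :
    (fieldDefect (A := A.hcat) A (eulerC _) b F T').VanishesBelow m := ⟨fun p n hp => by
  have h₁ := fieldDefect_add_right F T b h p n hp.le
  rw [add_sub_cancel, hW.eq_zero p _ hp, h.eq_zero p _ hp, map_zero, add_zero] at h₁
  exact h₁⟩

/-- An exact obstruction at length `m` is removed by subtracting a primitive from `T`. -/
theorem exists_fieldDefect_succ {b : Cochain Aᵍ Aᵍ (fun X => X) (fun X => X) 1}
    {m : ℕ} (hW : (fieldDefect (A := A.hcat) A (eulerC _) b F T).VanishesBelow m)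
    (hE : ∀ {X Y : A.hcat.Ob} (p : Path X Y), p.length = m →
      (fieldDefect (A := A.hcat) A (eulerC _) b F T).val p (red p + 1) ∈ A.exact X Y (red p + 1)) :
    ∃ T', (T' - T).VanishesBelow m ∧
      (fieldDefect (A := A.hcat) A (eulerC _) b F T').VanishesBelow (m + 1) := by
  have hU := VanishesBelow.thenC_primC (B := A) hW 0 (by ring)
  refine ⟨T + -(fieldDefect (A := A.hcat) A (eulerC _) b F T).thenC A.primC 0, ?_,
    vanishesBelow_of_val fun p hp => ?_⟩
  · rw [add_sub_cancel_left]
    exact hU.neg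
  · rw [fieldDefect_add_right F T b hU.neg p _ (Nat.le_of_lt_succ hp), neg_val, map_neg]
    rcases Nat.lt_succ_iff_lt_or_eq.1 hp with hp | hp
    · rw [hW.eq_zero p _ hp, hU.eq_zero p _ hp, map_zero, neg_zero, add_zero]
    · have h := d_thenC_primC (B := A) (fieldDefect (A := A.hcat) A (eulerC _) b F T) p 0 (by ring)
        (hE p hp)
      rw [h, add_neg_cancel]

/-- An exact obstruction at length `m` is removed by subtracting a primitive from `F`. -/
theorem exists_functorDefect_succ {m : ℕ} (hm : 0 < m)
    (hR : (functorDefect A.hcat A F).VanishesBelow m)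
    (hE : ∀ {X Y : A.hcat.Ob} (p : Path X Y), p.length = m →
      (functorDefect A.hcat A F).val p (red p + 2) ∈ A.exact X Y (red p + 2)) :
    ∃ F', (F' - F).VanishesBelow m ∧ (functorDefect A.hcat A F').VanishesBelow (m + 1) := by
  have hU := VanishesBelow.thenC_primC (B := A) hR 1 (by ring)
  refine ⟨F + -(functorDefect A.hcat A F).thenC A.primC 1, ?_, vanishesBelow_of_val fun p hp => ?_⟩
  · rw [add_sub_cancel_left]
    exact hU.neg
  · rw [functorDefect_add F hm hU.neg p _ (Nat.le_of_lt_succ hp), neg_val, map_neg]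
    rcases Nat.lt_succ_iff_lt_or_eq.1 hp with hp | hp
    · rw [hR.eq_zero p _ hp, hU.eq_zero p _ hp, map_zero, neg_zero, add_zero]
    · have h := d_thenC_primC (B := A) (functorDefect A.hcat A F) p 1 (by ring) (hE p hp)
      rw [h, add_neg_cancel]

theorem val_nil_congr {A : GrQuiver k} {B : GrQuiver k} {f g : A.Ob → B.Ob}
    {d : ℤ} {F F' : Cochain A B f g d} {m : ℕ} (h : (F' - F).VanishesBelow m) {X Y : A.Ob}
    (p : Path X Y) (hp : p.length < m) (n : ℤ) : F'.val p n = F.val p n := by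
  rw [← sub_eq_zero, ← sub_val]
  exact h.eq_zero p n hp

/-- At length `m ≥ 2`, the obstruction for `T` has nonzero weight, and can be absorbed in a change
of `F` by cocycles. -/
theorem exists_fieldDefect_exact [CharZero k]
    (hF : ∀ (X : A.Ob) (n : ℤ), F.val (.nil : Quiver.Path (V := A.hcat.Ob) X X) n = 0)
    (hT : ∀ X : A.Ob, T.val (.nil : Quiver.Path (V := A.hcat.Ob) X X) 0 = s.c X)
    {m : ℕ} (hm : 2 ≤ m) (hR : (functorDefect A.hcat A F).VanishesBelow (m + 1))
    (hW : (fieldDefect (A := A.hcat) A (eulerC _) s.b F T).VanishesBelow m) :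
    ∃ F', (F' - F).VanishesBelow m ∧ (functorDefect A.hcat A F').VanishesBelow (m + 1) ∧
      (fieldDefect (A := A.hcat) A (eulerC _) s.b F' T).VanishesBelow m ∧
      ∀ {X Y : A.hcat.Ob} (p : Path X Y), p.length = m →
      (fieldDefect (A := A.hcat) A (eulerC _) s.b F' T).val p (red p + 1) ∈ A.exact X Y (red p + 1) := by
  have hm' : ((m : k) - 1) ≠ 0 := by
    rw [sub_ne_zero]
    exact_mod_cast (by omega : m ≠ 1)
  obtain ⟨W, hWdef⟩ : ∃ W, W = fieldDefect (A := A.hcat) A (eulerC _) s.b F T := ⟨_, rfl⟩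
  obtain ⟨U, hUdef⟩ : ∃ U, U = ((m : k) - 1)⁻¹ • W := ⟨_, rfl⟩
  rw [← hWdef] at hW
  have hUv : ∀ {X Y : A.hcat.Ob} (p : Path X Y) (n : ℤ),
      U.val p n = ((m : k) - 1)⁻¹ • W.val p n := fun p n => by rw [hUdef]; rfl
  have hU : U.VanishesBelow m := ⟨fun p n hp => by rw [hUv, hW.eq_zero p n hp, smul_zero]⟩
  have hUd : ∀ {X Y : A.hcat.Ob} (p : Path X Y) (n : ℤ), p.length = m →
      A.d (red p + 1) n (U.val p (red p + 1)) = 0 := fun p n hp => by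
    have := d_fieldDefect s (F := F) (T := T) hF p (hR.mono (by omega))
      (hWdef ▸ hW.mono (by omega)) n
    rw [hUv, map_smul, hWdef, this, smul_zero]
  have hF' : (F + U - F).VanishesBelow m := by rwa [add_sub_cancel_left]
  refine ⟨F + U, hF', ⟨fun p n hp => ?_⟩, ?_, fun {X Y} p hp => ?_⟩
  · rw [functorDefect_add F (by omega) hU p n (by omega), hR.eq_zero p n hp, zero_add]
    rcases Nat.lt_succ_iff_lt_or_eq.1 hp with hp | hp
    · rw [hU.eq_zero p _ hp, map_zero]
    · exact hUd p n hp
  · exact fieldDefect_congr_left (by omega) hF' (hWdef ▸ hW)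
  · rw [fieldDefect_add_left F T s.b (by omega) hU p hp.le, hT, hT, ← hWdef]
    have h₁ := s.weightOp_sub_mem_exact (U.val p (red p + 1)) (hUd p _ hp)
    have h₂ : W.val p (red p + 1) = ((m : k) - 1) • U.val p (red p + 1) := by
      rw [hUv, smul_smul, mul_inv_cancel₀ hm', one_smul]
    have h₃ : W.val p (red p + 1) + weightOp s.b (s.c X) (s.c Y) (U.val p (red p + 1))
        - ((red p + p.length : ℤ) : k) • U.val p (red p + 1)
        = weightOp s.b (s.c X) (s.c Y) (U.val p (red p + 1))
          - ((red p + 1 : ℤ) : k) • U.val p (red p + 1) := by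
      rw [h₂, hp]
      push_cast
      module
    rw [h₃]
    exact h₁

variable (K : Contraction A)

theorem cls_i {A : AInfCat k} (K : Contraction A) {X Y : A.Ob} {n : ℤ} (a : A.HHom X Y n) :
    A.cls ⟨K.i X Y n a, K.d_i a _⟩ = a :=
  (K.p_cocycle ⟨K.i X Y n a, K.d_i a _⟩).symm.trans (K.p_i a)

theorem functorDefect_I : (functorDefect A.hcat A K.I).VanishesBelow 2 := ⟨fun {X Y} p n hp => by
  have hI : (K.I).VanishesBelow 1 := ⟨fun p n hp => K.isLinear_I.eq_zero p n (by omega)⟩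
  have h := functorDefect_add (0 : Cochain Aʰ Aᵍ _ _ 1) one_pos hI p n
    (by omega)
  rw [zero_add] at h
  have hz : ins (idC Aʰ) (idC Aʰ) A.hcat.μ (fun q =>
      (0 : Cochain Aʰ Aᵍ (fun X => X) (fun X => X) 1).val q n) p = 0 :=
    ins_zero_fun _ _ _ _
  rw [h, functorDefect_val, hz, sub_zero]
  cases p with
  | nil =>
    rw [lsum_blocks_nil, A.μ_nil, K.isLinear_I.eq_zero _ _ (by simp), map_zero, add_zero]
  | cons p a =>
    rw [lsum_blocks_zero (A.μ.isML n) _ (by simp), zero_add]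
    cases p with
    | cons p a' => simp at hp
    | nil =>
      have e : red (Quiver.Path.nil.cons a) + 1 = a.1 := by simp [red]
      rw [e]
      exact (congrArg _ (K.I_lin a.1 a.2)).trans (K.d_i a.2 n)⟩

/-- The obstruction at length two vanishes, since representatives are multiplicative up to
coboundaries. -/
theorem functorDefect_I_exact {X Y : A.hcat.Ob} (p : Path X Y) (hp : p.length = 2) :
    (functorDefect A.hcat A K.I).val p (red p + 2) ∈ A.exact X Y (red p + 2) := by
  have h₁ : lsum (K.I.blocks p) (fun q => A.μ.val q (red p + 2)) = _ :=
    lsum_blocks_ofLin (A := Aʰ) K.i p (A.μ.isML (red p + 2))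
  have h₂ : ins (idC Aʰ) (idC Aʰ) A.hcat.μ
      (fun q => K.I.val q (red p + 2)) p = _ :=
    congrArg (fun T => T.val p (red p + 2)) (K.isLinear_I.insC (idC Aʰ)
      (idC Aʰ) A.hcat.μ 2 (by ring))
  have h₃ := K.I_lin (red p + 2) (A.hcat.μ.val p (red p + 2))
  rw [functorDefect_val, h₁, h₂, thenC_val, h₃]
  obtain ⟨N, hN⟩ : ∃ N, N = red p + 2 := ⟨_, rfl⟩
  rw [← hN]
  clear h₁ h₂ h₃
  cases p with
  | nil => simp at hp
  | cons p b => cases p with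
    | nil => simp at hp
    | cons p a => cases p with
      | cons p c => simp at hp
      | nil =>
        obtain ⟨n₁, x⟩ := a
        obtain ⟨n₂, y⟩ := b
        have h₄ := cls_i K (A.hcat.μ.val ((Quiver.Path.nil.cons (⟨n₁, x⟩ : Σ n, A.HHom _ _ n)).cons
          (⟨n₂, y⟩ : Σ n, A.HHom _ _ n)) N)
        have h₅ : A.hcat.μ.val ((Quiver.Path.nil.cons (⟨n₁, x⟩ : Σ n, A.HHom _ _ n)).cons
          (⟨n₂, y⟩ : Σ n, A.HHom _ _ n)) N = A.cohBilin _ _ _ n₁ n₂ N x y := rfl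
        have h₆ := A.cohBilin_cls N ⟨K.i _ _ n₁ x, K.d_i x _⟩ ⟨K.i _ _ n₂ y, K.d_i y _⟩
        rw [cls_i, cls_i, ← h₅, ← h₄] at h₆
        obtain ⟨η, hη⟩ := (A.homologous_iff_cls _ _).2 h₆.symm
        exact ⟨η, hη⟩

theorem fieldDefect_I : (fieldDefect (A := A.hcat) A (eulerC _) s.b K.I
    (ofNil (A := Aʰ) s.c)).VanishesBelow 1 := vanishesBelow_of_val fun {X Y} p hp => by
  cases p with
  | cons p a => simp at hp
  | nil =>
    rw [fieldDefect_val, ins_eq_leading _ _ (A.μ.isML _) _ (vanishesBelow_zero _),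
      A.hcat_ins_μ_eq_zero ((ofNil (A := Aʰ) s.c).isML _) _ fun q hq => by simp at hq,
      ins_eulerC (K.I.isML _), K.isLinear_I.eq_zero _ _ (by simp), lsum_blocks_nil, smul_zero,
      add_zero, sub_zero]
    have h₁ := s.d_c X
    have h₂ := ofNil_val_nil (A := Aʰ) s.c X
    rw [← h₂] at h₁
    exact (congrArg (fun y : A.Hom X X 1 => y + s.b.val (.nil : Quiver.Path (V := A.Ob) X X) 1) h₁).trans
      (neg_add_cancel (s.b.val (.nil : Quiver.Path (V := A.Ob) X X) 1))

theorem fieldDefect_zero_ofNil (b : Cochain Aᵍ Aᵍ (fun X => X) (fun X => X) 1)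
    (c : ∀ X : A.Ob, A.Hom X X 0) {X Y : A.hcat.Ob} (p : Path X Y) (hp : p.length = 1) :
    (fieldDefect (A := A.hcat) A (eulerC _) b (0 : Cochain Aʰ Aᵍ
      (fun X => X) (fun X => X) 1) (ofNil (A := Aʰ) c)).val p (red p + 1) = 0 := by
  have hμ := A.μ.isML (X := X) (Y := Y) (red p + 1)
  have hz : IsML (fun q : Quiver.Path (V := A.hcat.Ob) X Y =>
    (0 : Cochain Aʰ Aᵍ (fun X => X) (fun X => X) 1).val q (red p + 1)) :=
    isML _ _
  have h₁ : ins (0 : Cochain Aʰ Aᵍ (fun X => X) (fun X => X) 1)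
      (0 : Cochain Aʰ Aᵍ (fun X => X) (fun X => X) 1)
      (ofNil (A := Aʰ) c) (fun q => A.μ.val q (red p + 1)) p = 0 := by
    refine lsum_eq_zero fun c' hc => ?_
    have hl := AInfCat.length_of_mem_cuts3 p c' hc
    by_cases h₁ : c'.fst.length = 0
    · by_cases h₂ : c'.last.length = 0
      · have e : (ofNil (A := Aʰ) c).arrow c'.mid
            = (⟨red c'.mid + 0, (0 : A.Hom c'.Z c'.W (red c'.mid + 0))⟩ : Σ n, A.Hom c'.Z c'.W n) := by
          rw [arrow, ofNil_val]
          omega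
        refine lsum_eq_zero fun r _ => lsum_eq_zero fun t _ => ?_
        refine (congrArg (fun y => _ • y) ?_).trans (smul_zero _)
        exact (congrArg (fun e => A.μ.val ((r.cons e).comp t) (red p + 1)) e).trans
          (hμ.insert_zero r _ t)
      · refine lsum_eq_zero fun r _ => ?_
        exact lsum_blocks_zero (IsML.units_smul (hμ.comp_left _) _) _ h₂
    · exact lsum_blocks_zero (Φ := fun r => lsum _ fun t => _ • A.μ.val ((r.cons _).comp t) _)
        (IsML.lsum (fun t => ((hμ.comp_right t).cons _).units_smul _) _) _ h₁
  rw [fieldDefect_val, h₁, ins_ofNil, ins_eulerC hz, lsum_blocks_zero (b.isML _) p (by omega),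
    zero_val, smul_zero]
  simp

/-- The obstruction at length one vanishes, since the operator `b¹ - c · + · c` induces the Euler
field. -/
theorem fieldDefect_I_exact {X Y : A.hcat.Ob} (p : Path X Y) (hp : p.length = 1) :
    (fieldDefect (A := A.hcat) A (eulerC _) s.b K.I (ofNil (A := Aʰ) s.c)).val p
      (red p + 1) ∈ A.exact X Y (red p + 1) := by
  have hI : (K.I).VanishesBelow 1 := ⟨fun p n hp => K.isLinear_I.eq_zero p n (by omega)⟩
  have h := fieldDefect_add_left (0 : Cochain Aʰ Aᵍ _ _ 1)
    (ofNil (A := Aʰ) s.c) s.b one_pos hI p hp.le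
  have h₀ := fieldDefect_zero_ofNil s.b s.c p hp
  rw [zero_add, h₀, zero_add, ofNil_val_nil, ofNil_val_nil, hp] at h
  rw [h]
  refine s.weightOp_sub_mem_exact _ ?_
  have h₂ := (functorDefect_add (0 : Cochain Aʰ Aᵍ _ _ 1) one_pos hI p
    (red p + 1 + 1) hp.le)
  cases p with
  | nil => simp at hp
  | cons p a => cases p with
    | cons p a' => simp at hp
    | nil =>
      have e : red (Quiver.Path.nil.cons a) + 1 = a.1 := by simp [red]
      rw [e]
      exact (congrArg _ (K.I_lin a.1 a.2)).trans (K.d_i a.2 _)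

end Model

/-! ### Formality of a category with a pure structure -/

section Model

variable {A : AInfCat k} (s : PureStructure A)

/-- The properties of approximate solutions `(F, T)`, up to strings of length `m`. -/
structure PartialModel (K : Contraction A) (m : ℕ)
    (F : Cochain Aʰ Aᵍ (fun X => X) (fun X => X) 1)
    (T : Cochain Aʰ Aᵍ (fun X => X) (fun X => X) 0) : Prop where
  nil : ∀ (X : A.Ob) (n : ℤ), F.val (.nil : Quiver.Path (V := A.hcat.Ob) X X) n = 0
  lin : ∀ {X Y : A.Ob} (n : ℤ) (a : A.HHom X Y n), F.lin n n a = K.i X Y n a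
  t_nil : ∀ X : A.Ob, T.val (.nil : Quiver.Path (V := A.hcat.Ob) X X) 0 = s.c X
  functor : (functorDefect A.hcat A F).VanishesBelow (m + 1)
  field : (fieldDefect (A := A.hcat) A (eulerC _) s.b F T).VanishesBelow m

variable {s} in
/-- From an exact obstruction for `T` at length `m` to an exact obstruction for `F` at length
`m + 1`. -/
theorem PartialModel.succ_of_exact {K : Contraction A} {m : ℕ} (hm : 0 < m)
    {F : Cochain Aʰ Aᵍ (fun X => X) (fun X => X) 1}
    {T : Cochain Aʰ Aᵍ (fun X => X) (fun X => X) 0}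
    (h : PartialModel s K m F T)
    (hW : ∀ {X Y : A.hcat.Ob} (p : Path X Y), p.length = m →
      (fieldDefect (A := A.hcat) A (eulerC _) s.b F T).val p (red p + 1) ∈ A.exact X Y (red p + 1))
    (hR : ∀ T : Cochain Aʰ Aᵍ (fun X => X) (fun X => X) 0,
      (∀ X : A.Ob, T.val (.nil : Quiver.Path (V := A.hcat.Ob) X X) 0 = s.c X) →
      (fieldDefect (A := A.hcat) A (eulerC _) s.b F T).VanishesBelow (m + 1) →
      ∀ {X Y : A.hcat.Ob} (p : Path X Y), p.length = m + 1 →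
      (functorDefect A.hcat A F).val p (red p + 2) ∈ A.exact X Y (red p + 2)) :
    ∃ F' T', PartialModel s K (m + 1) F' T' ∧ (F' - F).VanishesBelow m ∧
      (T' - T).VanishesBelow m := by
  obtain ⟨T', hT', hW'⟩ := exists_fieldDefect_succ h.field hW
  have ht : ∀ X : A.Ob, T'.val (.nil : Quiver.Path (V := A.hcat.Ob) X X) 0 = s.c X := fun X => by
    rw [val_nil_congr hT' .nil (by simpa using hm), h.t_nil]
  obtain ⟨F', hF', hR'⟩ := exists_functorDefect_succ (Nat.succ_pos m) h.functor (hR T' ht hW')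
  refine ⟨F', T', ⟨fun X n => ?_, fun n a => ?_, ht, hR', ?_⟩, hF'.mono (by omega), hT'⟩
  · rw [val_nil_congr hF' .nil (by simp), h.nil]
  · rw [← h.lin n a]
    exact val_nil_congr hF' (str₁ (A := Aʰ) a) (Nat.succ_lt_succ hm) n
  · exact fieldDefect_congr_left (Nat.succ_pos m) hF' hW'

/-- The start of the induction: representatives of cohomology classes, corrected at order two. -/
theorem exists_partialModel (K : Contraction A) : ∃ F T, PartialModel s K 2 F T := by
  obtain ⟨F, T, h, -, -⟩ := PartialModel.succ_of_exact (s := s) (K := K) (m := 1) one_pos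
    (F := K.I) (T := ofNil (A := Aʰ) s.c)
    ⟨fun X n => K.isLinear_I.eq_zero _ _ (by simp), fun n a => K.I_lin n a,
      fun X => ofNil_val_nil (A := Aʰ) s.c X, functorDefect_I K, fieldDefect_I s K⟩
    (fieldDefect_I_exact s K) (fun _ _ _ => functorDefect_I_exact K)
  exact ⟨F, T, h⟩

/-- A category with a pure structure is formal, compatibly with the Euler vector field. -/
theorem PureStructure.exists_model [CharZero k] (K : Contraction A) :
    ∃ F T, ∀ m, PartialModel s K m F T := by
  obtain ⟨σ, hP, hR⟩ := exists_seq_of_step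
    (fun n (σ : Cochain Aʰ Aᵍ (fun X => X) (fun X => X) 1 ×
      Cochain Aʰ Aᵍ (fun X => X) (fun X => X) 0) =>
      PartialModel s K (n + 2) σ.1 σ.2)
    (fun n σ τ => (τ.1 - σ.1).VanishesBelow (n + 2) ∧ (τ.2 - σ.2).VanishesBelow (n + 2)) (by
      obtain ⟨F, T, h⟩ := exists_partialModel s K
      exact ⟨(F, T), h⟩) (by
    rintro n ⟨F, T⟩ h
    obtain ⟨F₁, hF₁, hR₁, hW₁, hE₁⟩ := exists_fieldDefect_exact s h.nil h.t_nil (by omega)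
      h.functor h.field
    have hnil : ∀ (X : A.Ob) (n : ℤ), F₁.val (.nil : Quiver.Path (V := A.hcat.Ob) X X) n = 0 :=
      fun X n => by
      rw [val_nil_congr hF₁ .nil (by simp)]
      exact h.nil X n
    obtain ⟨F', T', h', hF', hT'⟩ := PartialModel.succ_of_exact (s := s) (K := K) (m := n + 2)
      (by omega) (F := F₁) (T := T) ⟨hnil, fun n a => by
        rw [← h.lin n a]
        exact val_nil_congr hF₁ (str₁ (A := Aʰ) a) (by simp) n,
        h.t_nil, hR₁, hW₁⟩ hE₁ (fun T ht hW X Y p hp => exact_functorDefect s hnil ht p (by omega)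
          (hp ▸ hR₁) (hp ▸ hW))
    refine ⟨(F', T'), h', ?_, hT'⟩
    have := hF'.add hF₁
    rwa [sub_add_sub_cancel] at this)
  obtain ⟨F, hF⟩ := exists_limit (fun n => (σ n).1) fun m => (hR m).1.mono (by omega)
  obtain ⟨T, hT⟩ := exists_limit (fun n => (σ n).2) fun m => (hR m).2.mono (by omega)
  have h₀ := hP 2
  refine ⟨F, T, fun m => ⟨fun X n => ?_, fun n a => ?_, fun X => ?_, ?_, ?_⟩⟩
  · rw [val_nil_congr (hF 2) .nil (by simp)]
    exact h₀.nil X n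
  · rw [← h₀.lin n a]
    exact val_nil_congr (hF 2) (str₁ (A := Aʰ) a) (by simp) n
  · rw [val_nil_congr (hT 2) .nil (by simp)]
    exact h₀.t_nil X
  · exact functorDefect_congr (Nat.succ_pos m) (hF (m + 1)) ((hP (m + 1)).functor.mono (by omega))
  · refine (fieldDefect_congr_left (Nat.succ_pos m) (hF (m + 1)) ?_).mono (Nat.le_succ m)
    exact fieldDefect_congr_right (hT (m + 1)) ((hP (m + 1)).field.mono (by omega))

/-- The limit of the partial models: a functor `H A → A` under which `b` agrees with the Euler
field. -/
theorem PureStructure.exists_ψ [CharZero k] (K : Contraction A) :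
    ∃ ψ : AInfFunctor A.hcat A (fun X => X),
      (∀ {X Y : A.Ob} (n : ℤ) (a : A.HHom X Y n), ψ.lin n n a = K.i X Y n a) ∧
      ∃ T : Cochain Aʰ Aᵍ (fun X => X) (fun X => X) 0,
        AInfFunctor.homDC ψ ψ T = ψ.postVF (eulerC Aʰ) - s.b.pre ψ.toCochain := by
  obtain ⟨F, T, h⟩ := s.exists_model K
  have hR : functorDefect A.hcat A F = 0 := eq_zero_of_vanishesBelow fun m =>
    (h m).functor.mono (by omega)
  have hW : fieldDefect (A := A.hcat) A (eulerC _) s.b F T = 0 :=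
    eq_zero_of_vanishesBelow fun m => (h m).field
  refine ⟨⟨F, (h 0).nil, fun {X Y} p n => ?_, fun {X} e he => ?_⟩, (h 0).lin, T, ?_⟩
  · have := functorDefect_val (A := A.hcat) (B := A) F p n
    rw [hR, zero_val, eq_comm, sub_eq_zero] at this
    refine this.trans ?_
    rw [ins_idC _ (F.isML n)]
    refine lsum_congr fun c _ => ?_
    rw [show (2 - 1 : ℤ) = 1 from rfl, one_mul]
  · have e₁ := cls_i K e
    have e₂ : A.IsCohUnit (K.i X X 0 e) := (A.coh_isCohUnit_iff ⟨K.i X X 0 e, K.d_i e _⟩).1 (by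
      rw [e₁]
      exact he)
    have e₃ := (h 0).lin 0 e
    rw [← e₃] at e₂
    exact e₂
  · refine ext fun {X Y} p n => ?_
    have := fieldDefect_val (A := A.hcat) (B := A) (eulerC _) s.b F T p n
    rw [hW, zero_val, eq_comm] at this
    rw [AInfFunctor.homDC_val', sub_val]
    simp only [show ((0 : ℤ) - 1) = -1 by norm_num, Int.negOnePow_neg, Int.negOnePow_one,
      Units.neg_smul, one_smul]
    change _ = ins (idC Aʰ) (idC Aʰ) (eulerC Aʰ)
        (fun q => F.val q n) p - lsum (F.blocks p) fun q => s.b.val q n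
    rw [sub_neg_eq_add, ← sub_eq_zero, ← this]
    change ins F F T _ p + _ - _ = _
    abel

end Model

/-! ### The inverse of a minimal model -/

section Inverse

variable {A : AInfCat k}

theorem functorDefect_eq_zero {A : AInfCat k} {B : AInfCat k} {f : A.Ob → B.Ob}
    (F : AInfFunctor A B f) : functorDefect A B F.toCochain = 0 := by
  rw [functorDefect, F.pre_μ, sub_self]

theorem functorDefect_pre {A : AInfCat k} {B : AInfCat k}
    {C : AInfCat k} {f : A.Ob → B.Ob} {g : B.Ob → C.Ob} (F : AInfFunctor A B f)
    (G : Cochain Bᵍ Cᵍ g g 1) :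
    functorDefect A C (G.comp F.toCochain) = (functorDefect B C G).pre F.toCochain := by
  rw [functorDefect, functorDefect, sub_pre, Contraction.pre_pre]
  congr 1
  refine ext fun {X Y} p n => ?_
  exact (F.ins_μ_blocks (G.isML n) p).trans rfl

theorem hcat_thenC_μ {Q : GrQuiver k} {f g : Q.Ob → A.hcat.Ob} {d : ℤ}
    (T : Cochain Q Aʰ f g d) (r : ℤ) (hr : r = d + 2 - 1) :
    T.thenC A.hcat.μ r hr = 0 := ext fun _ _ => rfl

/-- A left inverse of `ψ`, built one order at a time: at each order the correction is obtained from
the linearized lifting problem `exists_linD_eq`, applied with values in the graded category `H A`.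
-/
theorem exists_θ (K : Contraction A) {ψ : AInfFunctor A.hcat A (fun X => X)}
    (hψ : ∀ {X Y : A.Ob} (n : ℤ) (a : A.HHom X Y n), ψ.lin n n a = K.i X Y n a) :
    ∃ θ : Cochain Aᵍ Aʰ (fun X => X) (fun X => X) 1,
      (∀ (X : A.Ob) (n : ℤ), θ.val (.nil : Path X X) n = 0) ∧
      functorDefect A A.hcat θ = 0 ∧ θ.comp ψ.toCochain = idC Aʰ := by
  obtain ⟨T, hP, hR⟩ := exists_seq_of_step
    (fun m (θ : Cochain Aᵍ Aʰ (fun X => X) (fun X => X) 1) =>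
      (θ.VanishesBelow 1 ∧ (functorDefect A A.hcat θ).VanishesBelow (m + 1)) ∧
      (θ.pre ψ.toCochain - idC Aʰ).VanishesBelow (m + 1))
    (fun m T S => (S - T).VanishesBelow (m + 1)) ⟨0, by
      refine ⟨⟨⟨fun _ _ _ => rfl⟩, ⟨fun {X Y} p n hp => ?_⟩⟩, ⟨fun {X Y} p n hp => ?_⟩⟩
      · cases p with
        | cons p a => simp at hp
        | nil =>
          have hz : ins (idC Aᵍ) (idC Aᵍ) A.μ (fun q : Path X X =>
            (0 : Cochain Aᵍ Aʰ (fun X => X) (fun X => X) 1).val q n) .nil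
              = 0 := ins_zero_fun _ _ _ _
          rw [functorDefect_val, hz, lsum_blocks_nil, A.hcat.μ_nil, sub_zero]
      · cases p with
        | cons p a => simp at hp
        | nil =>
          rw [zero_pre, zero_sub, neg_val, idC_val_nil, neg_zero]⟩ (by
    rintro m θ ⟨⟨h₀, h₁⟩, h₂⟩
    obtain ⟨Z, hZ⟩ : ∃ Z, Z = functorDefect A A.hcat θ := ⟨_, rfl⟩
    obtain ⟨E, hE⟩ : ∃ E, E = θ.pre ψ.toCochain - idC Aʰ := ⟨_, rfl⟩
    have hnil : ∀ (X : A.Ob) (n : ℤ), θ.val (.nil : Path X X) n = 0 := fun X n =>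
      h₀.eq_zero _ _ (by simp)
    rw [← hZ] at h₁
    rw [← hE] at h₂
    obtain ⟨U, hU₁, hU₂⟩ := AInfFunctor.exists_linD_eq K (Z.atLength (m + 1)) (E.atLength (m + 1)) (by
      rw [AInfFunctor.linD_atLength]
      refine ext fun {X Y} p n => ?_
      rw [atLength_val]
      split_ifs with hp
      · have h := ins_μ_functorDefect (A := A) (B := A.hcat) θ hnil p n
        rw [← hZ, ins_eq_leading _ _ (A.hcat.μ.isML n) p (h₁.mono hp.le),
          A.ins_μ_leading (Z.isML n) p fun q hq => h₁.eq_zero q n (by omega)] at h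
        rw [AInfFunctor.linD_val, h]
        have e₁ : A.hcat.d (red p + (1 + 1)) n (Z.val p (red p + (1 + 1))) = 0 := rfl
        have e₂ : A.hcat.μ.val (Quiver.Path.nil.cons (Z.arrow p)) n = 0 := rfl
        rw [e₁, e₂, neg_zero, smul_zero, sub_zero, zero_val]
      · rfl) (by
      rw [atLength_pre_of_isLinear _ K.isLinear_I, hcat_thenC_μ]
      refine ext fun {X Y} p n => ?_
      rw [atLength_val]
      split_ifs with hp
      · rw [← AInfFunctor.pre_leading K hψ Z p n (h₁.mono hp.le), hZ]
        have e₃ : ((functorDefect A A.hcat θ).pre ψ.toCochain).val p n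
            = (functorDefect A.hcat A.hcat (θ.comp ψ.toCochain)).val p n :=
          congrArg (fun T => T.val p n) (functorDefect_pre ψ θ).symm
        have e : θ.comp ψ.toCochain = idC Aʰ + E := by
          rw [hE, add_sub_cancel]
          rfl
        have e₂ : functorDefect A.hcat A.hcat (idC Aʰ) = 0 :=
          functorDefect_eq_zero (AInfFunctor.id A.hcat)
        rw [e₃, e, functorDefect_add (idC Aʰ) (Nat.succ_pos m) h₂ p n hp.le, e₂]
        exact add_zero _
      · rfl)
    have hV := vanishesBelow_atLength U (m + 1)
    refine ⟨θ + U.atLength (m + 1), ⟨⟨h₀.add (hV.mono (by omega)), VanishesBelow.succ ?_ ?_⟩,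
      VanishesBelow.succ ?_ ?_⟩, ?_⟩
    · refine ⟨fun p n hp => ?_⟩
      rw [functorDefect_add_linD θ (Nat.succ_pos m) hV p n hp.le, ← hZ, h₁.eq_zero p n hp,
        AInfFunctor.linD_atLength, atLength_val, if_neg (by omega), add_zero]
    · intro X Y p n hp
      rw [functorDefect_add_linD θ (Nat.succ_pos m) hV p n hp.le, ← hZ,
        AInfFunctor.linD_atLength, atLength_val, if_pos hp, hU₁, neg_val, atLength_val, if_pos hp,
        add_neg_cancel]
    · rw [add_pre, add_sub_right_comm, ← hE]
      refine h₂.add ⟨fun p n hp => ?_⟩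
      rw [AInfFunctor.pre_leading K hψ _ p n (hV.mono hp.le),
        atLength_pre_of_isLinear _ K.isLinear_I, atLength_val, if_neg (by omega)]
    · intro X Y p n hp
      rw [add_pre, add_sub_right_comm, ← hE, add_val,
        AInfFunctor.pre_leading K hψ _ p n (hV.mono hp.le),
        atLength_pre_of_isLinear _ K.isLinear_I, atLength_val, if_pos hp, hU₂, neg_val,
        atLength_val, if_pos hp, add_neg_cancel]
    · rw [add_sub_cancel_left]
      exact hV)
  obtain ⟨L, hL⟩ := exists_limit T fun m => (hR m).mono (by omega)
  refine ⟨L, fun X n => ?_, ?_, ?_⟩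
  · rw [val_nil_congr (hL 1) .nil (by simp)]
    exact (hP 1).1.1.eq_zero _ _ (by simp)
  · refine eq_zero_of_vanishesBelow fun m => ⟨fun p n hp => ?_⟩
    have h := functorDefect_add_linD (T (m + 1)) (Nat.succ_pos m) (hL (m + 1)) p n (by omega)
    rw [add_sub_cancel, (hP (m + 1)).1.2.eq_zero p n (by omega), zero_add] at h
    rw [h, AInfFunctor.linD_congr (S := 0) p n fun q n hq => (hL (m + 1)).eq_zero q n (by omega),
      AInfFunctor.linD_zero, zero_val]
  · rw [← sub_eq_zero]
    refine eq_zero_of_vanishesBelow fun m => ?_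
    have : L.comp ψ.toCochain - idC Aʰ = (L - T m).pre ψ.toCochain
        + ((T m).pre ψ.toCochain - idC Aʰ) := by
      rw [sub_pre, sub_add_sub_cancel]
      rfl
    rw [this]
    refine VanishesBelow.add ⟨fun p n hp => lsum_eq_zero fun r hr => (hL m).eq_zero r n ?_⟩
      ((hP m).2.mono (by omega))
    exact (ψ.toCochain.length_le_of_mem_blocks p r hr).trans_lt hp

/-- A minimal model has a strict left inverse which is an `A∞`-functor. -/
theorem exists_inverse (K : Contraction A) {ψ : AInfFunctor A.hcat A (fun X => X)}
    (hψ : ∀ {X Y : A.Ob} (n : ℤ) (a : A.HHom X Y n), ψ.lin n n a = K.i X Y n a) :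
    ∃ θ : AInfFunctor A A.hcat (fun X => X), θ.comp ψ = AInfFunctor.id A.hcat := by
  obtain ⟨θ, hnil, hR, hθ⟩ := exists_θ K hψ
  have hrel : ∀ {X Y : A.Ob} (p : Path X Y) (n : ℤ),
      lsum (θ.blocks p) (fun q => A.hcat.μ.val q n)
        = lsum (cuts3 p) (fun c => (red c.fst).negOnePow •
          θ.val ((c.fst.cons (A.μ.arrow c.mid)).comp c.last) n) := fun {X Y} p n => by
    have := functorDefect_val (A := A) (B := A.hcat) θ p n
    rw [hR, zero_val, eq_comm, sub_eq_zero] at this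
    refine this.trans ?_
    rw [ins_idC _ (θ.isML n)]
    refine lsum_congr fun c _ => ?_
    rw [show (2 - 1 : ℤ) = 1 from rfl, one_mul]
  have hd : ∀ {X Y : A.Ob} (n m : ℤ) (a : A.Hom X Y n), θ.lin m m (A.d n m a) = 0 := by
    intro X Y n m a
    by_cases hm : m = n + 1
    · subst hm
      have h := functorDefect_val (A := A) (B := A.hcat) θ (str₁ a) (n + 1)
      have hz : A.hcat.μ.val (Quiver.Path.nil.cons (θ.arrow (str₁ a))) (n + 1) = 0 := rfl
      rw [hR, zero_val, lsum_blocks_str₁, hz, zero_sub, eq_comm, neg_eq_zero,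
        A.ins_μ_leading (θ.isML (n + 1)) _ fun q hq => ?_] at h
      · have h' := congrArg (fun T => T.val (str₁ a) (n + 1)) (IsLinear.insC
          (S := θ.atLength 1) ⟨fun p n h => if_neg h⟩ (idC Aᵍ) (idC Aᵍ) A.d₁ 2
          (by ring))
        have e₁ : ins (idC Aᵍ) (idC Aᵍ) A.d₁
            (fun q => (θ.atLength 1).val q (n + 1)) (str₁ a)
            = ins (idC Aᵍ) (idC Aᵍ) A.d₁ (fun q => θ.val q (n + 1)) (str₁ a) := by
          rw [← sub_eq_zero, ← ins_sub, A.ins_d₁_eq_zero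
            (((θ.atLength 1).isML _).sub (θ.isML _))]
          intro q hq
          rw [atLength_val, if_pos (by simpa using hq), sub_self]
        have h₂ := h'.symm.trans (e₁.trans h)
        rw [thenC_val] at h₂
        have h₃ : red (str₁ a) + 2 = n + 1 := by simp only [red]; ring
        rw [h₃] at h₂
        exact h₂
      · have : q.length = 0 := by simpa using hq
        cases q with
        | nil => exact hnil _ _
        | cons q a => simp at this
    · rw [A.d_eq_zero hm, map_zero]
  refine ⟨⟨θ, hnil, hrel, fun {X} e he => ?_⟩, ?_⟩
  · have h₁ : θ.lin 0 0 (K.i X X 0 (A.cls ⟨e, he.closed⟩)) = A.cls ⟨e, he.closed⟩ := by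
      rw [← hψ]
      have h := congrArg (fun T => T.lin 0 0 (A.cls ⟨e, he.closed⟩)) hθ
      have h₃ : (θ.comp ψ.toCochain).lin 0 0 (A.cls ⟨e, he.closed⟩)
          = θ.lin 0 0 (ψ.lin 0 0 (A.cls ⟨e, he.closed⟩)) := by
        refine (lsum_blocks_str₁ (A := Aʰ) ψ.toCochain _ _).trans ?_
        rw [ψ.arrow_eq (N := 0) _ (by simp [red])]
        rfl
      rw [← h₃]
      exact h.trans (ofLin_lin (A := Aʰ) (f := fun X => X) _ 0 _)
    have h₂ : θ.lin 0 0 e = A.cls ⟨e, he.closed⟩ := by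
      obtain ⟨η, hη⟩ := (A.homologous_iff_cls ⟨_, K.d_i (A.cls ⟨e, he.closed⟩) _⟩
        ⟨e, he.closed⟩).2 (cls_i K _)
      have := hd _ 0 η
      rw [hη, map_sub, h₁, sub_eq_zero] at this
      exact this.symm
    have h₃ : IsCohUnitOf (Q := A.cohQuiver) A.cohμ (θ.lin 0 0 e) := by
      rw [h₂]
      exact (A.coh_isCohUnit_iff _).2 he
    exact h₃
  · have : ∀ G G' : AInfFunctor A.hcat A.hcat (fun X => X), G.toCochain = G'.toCochain → G = G' := by
      rintro ⟨_, _, _, _⟩ ⟨_, _, _, _⟩ rfl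
      rfl
    exact this _ _ hθ

end Inverse

/-! ### The composition product on cochains with values in a cohomological category -/

namespace Cochain

section Star

variable {Q : GrQuiver k} {C : AInfCat k} {f g h : Q.Ob → C.Ob} {d e : ℤ}

/-- The product `(S ⋆ T)(p) = ∑ ± μ²(S(p''), T(p'))` over the decompositions of `p` into two
pieces. -/
def starC (S : Cochain Q Cᵍ g h e) (T : Cochain Q Cᵍ f g d) (r : ℤ)
    (hr : r = d + e := by omega) : Cochain Q Cᵍ f h r where
  val p n := lsum (cuts2 p) fun c => ((e - 1) * red c.fst).negOnePow •
    C.μ.val ((Quiver.Path.nil.cons (T.arrow c.fst)).cons (S.arrow c.snd)) n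
  val_eq_zero p n hn := by
    refine lsum_eq_zero fun c hc => ?_
    rw [C.μ.val_eq_zero, smul_zero]
    have := red_of_mem_cuts2 p c hc
    simp only [red, arrow]
    omega
  val_add {X Y Z W} p i a b q n := (IsML.cuts2 (A := Q)
    (Φ := fun U (p : Path X U) (q : Path U W) =>
    C.μ.val ((Quiver.Path.nil.cons (T.arrow p)).cons (S.arrow q)) n)
    (fun U q => isML_arrow T ((C.μ.isML n).cons _) .nil .nil)
    (fun U p => isML_arrow S ((C.μ.isML n).comp_left (Quiver.Path.nil.cons (T.arrow p))) .nil .nil)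
    (fun x _ => ((e - 1) * x).negOnePow)).add p i a b q
  val_smul {X Y Z W} p i r a q n := (IsML.cuts2 (A := Q)
    (Φ := fun U (p : Path X U) (q : Path U W) =>
    C.μ.val ((Quiver.Path.nil.cons (T.arrow p)).cons (S.arrow q)) n)
    (fun U q => isML_arrow T ((C.μ.isML n).cons _) .nil .nil)
    (fun U p => isML_arrow S ((C.μ.isML n).comp_left (Quiver.Path.nil.cons (T.arrow p))) .nil .nil)
    (fun x _ => ((e - 1) * x).negOnePow)).smul p i r a q

theorem starC_val (S : Cochain Q Cᵍ g h e) (T : Cochain Q Cᵍ f g d) (r : ℤ)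
    (hr : r = d + e) {X Y : Q.Ob} (p : Path X Y) (n : ℤ) : (starC S T r hr).val p n
      = lsum (cuts2 p) fun c => ((e - 1) * red c.fst).negOnePow •
        C.μ.val ((Quiver.Path.nil.cons (T.arrow c.fst)).cons (S.arrow c.snd)) n := rfl

theorem insert_add_arrow {M : Type*} [AddCommGroup M] [Module k M] (T T' : Cochain Q Cᵍ f g d)
    {X Y : Q.Ob} {X' Y' : C.Ob} {Φ : Path X' Y' → M} (hΦ : IsML Φ) (p : Path X Y)
    (r : Path X' (f X)) (t : Path (g Y) Y') :
    Φ ((r.cons ((T + T').arrow p)).comp t)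
      = Φ ((r.cons (T.arrow p)).comp t) + Φ ((r.cons (T'.arrow p)).comp t) :=
  hΦ.add r _ _ _ t

theorem starC_add_right (S : Cochain Q Cᵍ g h e) (T T' : Cochain Q Cᵍ f g d)
    (r : ℤ) (hr : r = d + e) : starC S (T + T') r hr = starC S T r hr + starC S T' r hr := by
  refine ext fun p n => ?_
  rw [add_val, starC_val, starC_val, starC_val, ← lsum_add]
  refine lsum_congr fun c _ => ?_
  rw [← smul_add]
  exact congrArg _ (insert_add_arrow T T' (C.μ.isML n) c.fst .nil
    (Quiver.Path.nil.cons (S.arrow c.snd)))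

theorem starC_add_left (S S' : Cochain Q Cᵍ g h e) (T : Cochain Q Cᵍ f g d)
    (r : ℤ) (hr : r = d + e) : starC (S + S') T r hr = starC S T r hr + starC S' T r hr := by
  refine ext fun p n => ?_
  rw [add_val, starC_val, starC_val, starC_val, ← lsum_add]
  refine lsum_congr fun c _ => ?_
  rw [← smul_add]
  exact congrArg _ (insert_add_arrow S S' (C.μ.isML n) c.snd
    (Quiver.Path.nil.cons (T.arrow c.fst)) .nil)

theorem starC_neg_left (S : Cochain Q Cᵍ g h e) (T : Cochain Q Cᵍ f g d)
    (r : ℤ) (hr : r = d + e) : starC (-S) T r hr = -starC S T r hr :=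
  map_neg (AddMonoidHom.mk' (fun S : Cochain Q Cᵍ g h e => starC S T r hr)
    fun S S' => starC_add_left S S' T r hr) S

theorem starC_sub_left (S S' : Cochain Q Cᵍ g h e) (T : Cochain Q Cᵍ f g d)
    (r : ℤ) (hr : r = d + e) : starC (S - S') T r hr = starC S T r hr - starC S' T r hr :=
  map_sub (AddMonoidHom.mk' (fun S : Cochain Q Cᵍ g h e => starC S T r hr)
    fun S S' => starC_add_left S S' T r hr) S S'

theorem starC_zero_left (T : Cochain Q Cᵍ f g d)
    (r : ℤ) (hr : r = d + e) : starC (0 : Cochain Q Cᵍ g h e) T r hr = 0 :=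
  map_zero (AddMonoidHom.mk' (fun S : Cochain Q Cᵍ g h e => starC S T r hr)
    fun S S' => starC_add_left S S' T r hr)

theorem starC_zero_right (S : Cochain Q Cᵍ g h e)
    (r : ℤ) (hr : r = d + e) : starC S (0 : Cochain Q Cᵍ f g d) r hr = 0 :=
  map_zero (AddMonoidHom.mk' (fun T : Cochain Q Cᵍ f g d => starC S T r hr)
    fun T T' => starC_add_right S T T' r hr)

theorem starC_neg_right (S : Cochain Q Cᵍ g h e) (T : Cochain Q Cᵍ f g d)
    (r : ℤ) (hr : r = d + e) : starC S (-T) r hr = -starC S T r hr :=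
  map_neg (AddMonoidHom.mk' (fun T : Cochain Q Cᵍ f g d => starC S T r hr)
    fun T T' => starC_add_right S T T' r hr) T

theorem starC_units_smul_right (S : Cochain Q Cᵍ g h e) (T : Cochain Q Cᵍ f g d)
    (s : ℤˣ) (r : ℤ) (hr : r = d + e) : starC S (s • T) r hr = s • starC S T r hr := by
  rw [Units.smul_def, Units.smul_def]
  exact map_zsmul (AddMonoidHom.mk' (fun T : Cochain Q Cᵍ f g d => starC S T r hr)
    fun T T' => starC_add_right S T T' r hr) _ T

theorem starC_units_smul_left (S : Cochain Q Cᵍ g h e) (T : Cochain Q Cᵍ f g d)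
    (s : ℤˣ) (r : ℤ) (hr : r = d + e) : starC (s • S) T r hr = s • starC S T r hr := by
  rw [Units.smul_def, Units.smul_def]
  exact map_zsmul (AddMonoidHom.mk' (fun S : Cochain Q Cᵍ g h e => starC S T r hr)
    fun S S' => starC_add_left S S' T r hr) _ S

theorem insert_starC {M : Type*} [AddCommGroup M] [Module k M] (S : Cochain Q Cᵍ g h e)
    (T : Cochain Q Cᵍ f g d) (r : ℤ) (hr : r = d + e)
    {X Y : Q.Ob} {X' Y' : C.Ob} {Φ : Path X' Y' → M} (hΦ : IsML Φ) (p : Path X Y)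
    (u : Path X' (f X)) (t : Path (h Y) Y') :
    Φ ((u.cons ((starC S T r hr).arrow p)).comp t)
      = lsum (cuts2 p) fun c => ((e - 1) * red c.fst).negOnePow •
        Φ ((u.cons (C.μ.arrow ((Quiver.Path.nil.cons (T.arrow c.fst)).cons (S.arrow c.snd)))).comp
          t) := by
  refine (hΦ.insert_lsum u (red p + r) (cuts2 p) _ t).trans (lsum_congr fun c hc => ?_)
  refine (hΦ.insert_units_smul u (red p + r) _ _ t).trans (congrArg _ ?_)
  have := red_of_mem_cuts2 p c hc
  rw [C.μ.arrow_eq (N := red p + r)]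
  simp only [red, arrow]
  omega

end Star

section Assoc

variable {Q : GrQuiver k} {B : AInfCat k} {f g h l : Q.Ob → B.hcat.Ob}
  {d e i : ℤ}

theorem _root_.AInf.AInfCat.assoc_of_binary (C : AInfCat k)
    (h₁ : ∀ {X Y : C.Ob} (a : X ⟶ Y) (n : ℤ), C.μ.val (Quiver.Path.nil.cons a) n = 0)
    (h₃ : ∀ {X Y Z W : C.Ob} (a : X ⟶ Y) (b : Y ⟶ Z) (c : Z ⟶ W) (n : ℤ),
      C.μ.val (((Quiver.Path.nil.cons a).cons b).cons c) n = 0)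
    {X Y Z W : C.Ob} (a : X ⟶ Y) (b : Y ⟶ Z) (c : Z ⟶ W) (n : ℤ) :
    C.μ.val ((Quiver.Path.nil.cons (C.μ.arrow ((Quiver.Path.nil.cons a).cons b))).cons c) n
      = a.1.negOnePow •
      C.μ.val ((Quiver.Path.nil.cons a).cons (C.μ.arrow ((Quiver.Path.nil.cons b).cons c))) n := by
  have h := C.rel (((Quiver.Path.nil.cons a).cons b).cons c) n
  have z₁ : ∀ {X Y Z W : C.Ob} (p : Path X Y) (a : Y ⟶ Z) (q : Path Z W) (n : ℤ),
      C.μ.val ((p.cons (C.μ.arrow (Quiver.Path.nil.cons a))).comp q) n = 0 := fun p a q n => by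
    rw [arrow, h₁]
    exact C.μ.val_zero ..
  have z₂ : C.μ.arrow (((Quiver.Path.nil.cons a).cons b).cons c)
      = (⟨red (((Quiver.Path.nil.cons a).cons b).cons c) + 2, 0⟩ : X ⟶ W) := by
    rw [arrow, h₃]
  have z₃ : C.μ.val ((Quiver.Path.nil.cons (C.μ.arrow (((Quiver.Path.nil.cons a).cons b).cons c))).comp
      .nil) n = 0 := by
    rw [z₂]
    exact C.μ.val_zero ..
  simp only [lsum, cuts3, cuts2, List.map_cons, List.map_nil, List.nil_append, List.cons_append,
      List.flatMap_cons, List.flatMap_nil, List.append_nil, List.sum_cons, List.sum_nil,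
      C.val_nil_arrow, smul_zero, zero_add, add_zero, z₁, z₃,
      Int.negOnePow_zero, one_smul, red] at h
  refine (eq_neg_of_add_eq_zero_left h).trans ?_
  rw [← Units.neg_smul, ← Int.negOnePow_succ]
  exact congrArg₂ (· • ·) (congrArg _ (by ring)) rfl

theorem hcat_assoc {X Y Z W : B.hcat.Ob} (a : X ⟶ Y) (b : Y ⟶ Z) (c : Z ⟶ W) (n : ℤ) :
    B.hcat.μ.val ((Quiver.Path.nil.cons (B.hcat.μ.arrow ((Quiver.Path.nil.cons a).cons b))).cons c) n
      = a.1.negOnePow •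
      B.hcat.μ.val ((Quiver.Path.nil.cons a).cons (B.hcat.μ.arrow ((Quiver.Path.nil.cons b).cons c)))
        n :=
  B.hcat.assoc_of_binary (fun _ _ => rfl) (fun _ _ _ _ => rfl) a b c n

/-- The product `⋆` is associative up to sign, as is the product of a graded category. -/
theorem starC_starC (R : Cochain Q Bʰ h l i) (S : Cochain Q Bʰ g h e)
    (T : Cochain Q Bʰ f g d) (r₁ r₂ r : ℤ) (h₁ : r₁ = d + e) (h₂ : r = r₁ + i)
    (h₃ : r₂ = e + i) (h₄ : r = d + r₂) :
    starC R (starC S T r₁ h₁) r h₂ = d.negOnePow • starC (starC R S r₂ h₃) T r h₄ := by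
  refine ext fun {X Y} p n => ?_
  rw [units_smul_val, starC_val, starC_val]
  have e₁ := fun c : Cut2 X Y => insert_starC S T r₁ h₁ (B.hcat.μ.isML n) c.fst .nil
    (Quiver.Path.nil.cons (R.arrow c.snd))
  have e₂ := fun c : Cut2 X Y => insert_starC R S r₂ h₃ (B.hcat.μ.isML n) c.snd
    (Quiver.Path.nil.cons (T.arrow c.fst)) .nil
  have e₃ := cuts2_coassoc p fun a b c => ((i - 1) * (red a + red b)).negOnePow •
    ((e - 1) * red a).negOnePow • B.hcat.μ.val ((Quiver.Path.nil.cons (B.hcat.μ.arrow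
      ((Quiver.Path.nil.cons (T.arrow a)).cons (S.arrow b)))).cons (R.arrow c)) n
  refine Eq.trans (lsum_congr fun c _ => ?_) (e₃.trans ?_)
  · refine (congrArg _ (e₁ c)).trans ?_
    rw [smul_lsum]
    refine lsum_congr fun c' hc' => ?_
    rw [red_of_mem_cuts2 c.fst c' hc']
    rfl
  · rw [smul_lsum]
    refine lsum_congr fun c _ => Eq.trans ?_ (congrArg _ (congrArg _ (e₂ c)).symm)
    rw [smul_lsum, smul_lsum]
    refine lsum_congr fun c' _ => ?_
    rw [hcat_assoc]
    simp only [smul_smul, ← Int.negOnePow_add]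
    refine congrArg₂ (· • ·) (negOnePow_congr ?_) rfl
    simp only [arrow]
    subst h₃
    refine ⟨0, ?_⟩
    ring

end Assoc

end Cochain

/-! ### The differential of the composition product -/

namespace Cochain

section Unit

variable {Q : GrQuiver k} {B : AInfCat k} {f g h : Q.Ob → B.hcat.Ob}
  {d e : ℤ}

theorem hcat_val_hUnit_right {X Y : B.hcat.Ob} (a : X ⟶ Y) :
    B.hcat.μ.val ((Quiver.Path.nil.cons (⟨0, B.hUnit X⟩ : X ⟶ X)).cons a) a.1 = a.2 := by
  obtain ⟨η, hη⟩ := (B.isCohUnit_hUnit X).right_unit a.2 rfl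
  have h : prodOf B.cohμ a.2 (B.hUnit X) a.1 = a.2 := sub_eq_zero.1 (hη.symm.trans rfl)
  refine Eq.trans ?_ h
  exact (one_smul _ _).symm.trans (by rw [prodOf, Int.negOnePow_zero]; rfl)

theorem hcat_val_hUnit_left {X Y : B.hcat.Ob} (a : X ⟶ Y) :
    B.hcat.μ.val ((Quiver.Path.nil.cons a).cons (⟨0, B.hUnit Y⟩ : Y ⟶ Y)) a.1
      = a.1.negOnePow • a.2 := by
  obtain ⟨η, hη⟩ := (B.isCohUnit_hUnit Y).left_unit a.2 rfl
  have h : prodOf B.cohμ (B.hUnit Y) a.2 a.1 = a.2 := sub_eq_zero.1 (hη.symm.trans rfl)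
  refine Eq.trans ?_ (congrArg (fun y => a.1.negOnePow • y) h)
  rw [prodOf, smul_smul, ← Int.negOnePow_add, Int.negOnePow_even _ ⟨a.1, rfl⟩, one_smul]
  rfl

theorem hcat_μ_val_of_length {X Y : B.hcat.Ob} (p : Path X Y) (n : ℤ) (h : p.length ≠ 2) :
    B.hcat.μ.val p n = 0 := B.cohVal_of_length p n h

/-- The identity transformation of a functor with values in a cohomological category. -/
noncomputable def unitC (f : Q.Ob → B.hcat.Ob) : Cochain Q Bʰ f f 0 :=
  ofNil fun X => B.hUnit (f X)

theorem unitC_arrow_nil (f : Q.Ob → B.hcat.Ob) (X : Q.Ob) :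
    (unitC (B := B) f).arrow (.nil : Path X X) = (⟨0, B.hUnit (f X)⟩ : f X ⟶ f X) := by
  rw [arrow_eq (N := 0) _ _ (by simp [red]), unitC, ofNil_val_nil]

theorem starC_unit_right (T : Cochain Q Bʰ f g d) (hr : d = 0 + d) :
    starC T (unitC f) d hr = T := by
  refine ext fun p n => ?_
  by_cases hn : n = red p + d
  · subst hn
    rw [starC_val, lsum_cuts2_eq_fst_nil]
    · rw [unitC_arrow_nil]
      simp only [red, mul_zero, Int.negOnePow_zero, one_smul]
      exact hcat_val_hUnit_right (T.arrow p)
    · intro c _ hc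
      rw [arrow, unitC, ofNil_val _ _ _ hc]
      exact (congrArg _ (B.hcat.μ.val_zero .nil _ (Quiver.Path.nil.cons (T.arrow c.snd)) _)).trans
        (smul_zero _)
  · rw [val_eq_zero _ _ _ hn, val_eq_zero _ _ _ hn]

theorem starC_unit_left (T : Cochain Q Bʰ f g d) (hr : d = d + 0) :
    starC (unitC g) T d hr = d.negOnePow • T := by
  refine ext fun {X Y} p n => ?_
  by_cases hn : n = red p + d
  · subst hn
    rw [starC_val, lsum_cuts2_eq_snd_nil]
    · simp only
      rw [unitC_arrow_nil, units_smul_val]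
      refine (congrArg _ (hcat_val_hUnit_left (T.arrow p))).trans ?_
      refine (smul_smul _ _ (T.val p (red p + d))).trans ?_
      rw [← Int.negOnePow_add]
      refine congrArg₂ (· • ·) (negOnePow_congr ⟨0, ?_⟩) rfl
      simp only [arrow]
      ring
    · intro c _ hc
      rw [(unitC g).arrow_eq c.snd rfl, unitC, ofNil_val _ _ _ hc]
      exact (congrArg _ (B.hcat.μ.val_zero (Quiver.Path.nil.cons (T.arrow c.fst)) _ .nil _)).trans
        (smul_zero _)
  · rw [val_eq_zero _ _ _ hn, val_eq_zero _ _ _ hn]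

/-- With values in a graded category, the target part of the differential is a commutator with `F`
and `G` for the product `⋆`. -/
theorem ins_hcat_μ (F : Cochain Q Bʰ f f 1) (G : Cochain Q Bʰ g g 1)
    (hF : ∀ (X : Q.Ob) (n : ℤ), F.val (.nil : Path X X) n = 0)
    (hG : ∀ (X : Q.Ob) (n : ℤ), G.val (.nil : Path X X) n = 0)
    (T : Cochain Q Bʰ f g d) :
    insC F G T B.hcat.μ (d + 1) = starC T F (d + 1) + starC G T (d + 1) := by
  refine ext fun {X Y} p n => ?_
  rw [insC_val, add_val, starC_val, starC_val, ins]
  have key : ∀ (c : Cut3 X Y) (r : Path (f X) (f c.Z)) (t : Path (g c.W) (g Y)),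
      B.hcat.μ.val ((r.cons (T.arrow c.mid)).comp t) n
        = (if t.length = 0 then B.hcat.μ.val ((r.cons (T.arrow c.mid)).comp t) n else 0)
          + (if r.length = 0 then B.hcat.μ.val ((r.cons (T.arrow c.mid)).comp t) n else 0) := by
    intro c r t
    by_cases hr : r.length = 0 <;> by_cases ht : t.length = 0
    · rw [hcat_μ_val_of_length _ _ (by simp [hr, ht]), ite_self, ite_self, add_zero]
    · rw [if_neg ht, if_pos hr, zero_add]
    · rw [if_neg hr, if_pos ht, add_zero]
    · rw [if_neg hr, if_neg ht, hcat_μ_val_of_length _ _ (by simp; omega), zero_add]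
  simp only [fun (c : Cut3 X Y) r t => congrArg
    (fun y => ((d - 1) * red c.fst).negOnePow • y) (key c r t), smul_add, lsum_add]
  congr 1
  · refine (cuts3_eq_cuts2_fst p fun {Z W} a b c => lsum (F.blocks a) fun (r : Path (f X) (f Z)) => lsum (G.blocks c)
      fun t => ((d - 1) * red a).negOnePow •
        if t.length = 0 then B.hcat.μ.val ((r.cons (T.arrow b)).comp t) n else 0).trans ?_
    rw [lsum_cuts2_eq_snd_nil]
    · refine lsum_congr fun c _ => ?_
      have : ∀ r : Path (f X) (f c.Z), lsum (G.blocks (.nil : Path Y Y)) (fun t =>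
          ((d - 1) * red c.fst).negOnePow • if t.length = 0 then
            B.hcat.μ.val ((r.cons (T.arrow c.snd)).comp t) n else 0)
          = ((d - 1) * red c.fst).negOnePow • B.hcat.μ.val (r.cons (T.arrow c.snd)) n := by
        intro r
        refine (lsum_blocks_nil G _).trans ?_
        exact congrArg _ (if_pos rfl)
      refine (lsum_congr fun r _ => this r).trans ?_
      rw [← smul_lsum]
      refine congrArg _ ?_
      exact lsum_blocks_of_length_ne_one F ((B.hcat.μ.isML n).cons (T.arrow c.snd))
        (fun q hq => hcat_μ_val_of_length _ _ (by simpa using hq)) c.fst hF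
    · intro c _ hc
      refine lsum_eq_zero fun _ _ => lsum_eq_zero fun _ _ => lsum_eq_zero fun t ht => ?_
      rw [if_neg (length_of_mem_blocks G _ t ht hc), smul_zero]
  · refine (lsum_cuts3 p _).trans ?_
    rw [lsum_cuts2_eq_fst_nil]
    · refine lsum_congr fun c _ => ?_
      refine (lsum_blocks_nil F _).trans ?_
      simp only [Quiver.Path.length_nil, if_true, red]
      rw [← smul_lsum, mul_zero, sub_self, zero_mul]
      refine congrArg _ ?_
      exact lsum_blocks_of_length_ne_one G
        ((B.hcat.μ.isML n).comp_left (Quiver.Path.nil.cons (T.arrow c.fst)))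
        (fun q hq => hcat_μ_val_of_length _ _ (by simp; omega)) c.snd hG
    · intro c _ hc
      refine lsum_eq_zero fun _ _ => lsum_eq_zero fun r hr => lsum_eq_zero fun _ _ => ?_
      rw [if_neg (length_of_mem_blocks F _ r hr hc), smul_zero]

end Unit

section BarDifferential

variable {A : AInfCat k} {B : AInfCat k} {f g h : A.Ob → B.hcat.Ob}
  {d e : ℤ}

/-- The part of the differential of a cochain that involves the structure of the source. -/
noncomputable abbrev barD {B : GrQuiver k} {f g : A.Ob → B.Ob} 
    (T : Cochain Aᵍ B f g d) : Cochain Aᵍ B f g (d + 1) :=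
  insC (idC Aᵍ) (idC Aᵍ) A.μ T (d + 1)

/-- The source part of the differential is a derivation of `⋆`. -/
theorem barD_starC (S : Cochain Aᵍ Bʰ g h e)
    (T : Cochain Aᵍ Bʰ f g d) (r : ℤ) (hr : r = d + e) :
    barD (starC S T r hr) = starC (barD S) T (r + 1)
      + (e - 1).negOnePow • starC S (barD T) (r + 1) := by
  refine ext fun {X Y} p n => ?_
  rw [insC_val, add_val, units_smul_val, starC_val, starC_val]
  refine (ins_cuts2 (idC Aᵍ) (idC Aᵍ) A.μ (fun c : Cut2 X Y =>
    ((e - 1) * red c.fst).negOnePow • B.hcat.μ.val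
      ((Quiver.Path.nil.cons (T.arrow c.fst)).cons (S.arrow c.snd)) n) p).trans ?_
  rw [add_comm, smul_lsum]
  have hL' : ∀ {Z : A.Ob} (s : Path X Z) (t : Path Z Y),
      ins (idC Aᵍ) (idC Aᵍ) A.μ (fun q : Path X Z =>
        ((e - 1) * red q).negOnePow •
          B.hcat.μ.val ((Quiver.Path.nil.cons (T.arrow q)).cons (S.arrow t)) n) s
      = ((e - 1) * (red s + 1)).negOnePow •
        B.hcat.μ.val ((Quiver.Path.nil.cons ((barD T).arrow s)).cons (S.arrow t)) n := by
    intro Z s t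
    refine Eq.trans ?_ (congrArg _ (insert_insC (idC Aᵍ) (idC Aᵍ) A.μ
      (B.hcat.μ.isML n) T (d + 1) (by ring) s .nil (Quiver.Path.nil.cons (S.arrow t))).symm)
    rw [← ins_units_smul]
    refine ins_congr_red _ _ _ s fun q hq => ?_
    rw [hq]
    rfl
  have hR' : ∀ {Z : A.Ob} (s : Path X Z) (t : Path Z Y),
      ins (idC Aᵍ) (idC Aᵍ) A.μ (fun q : Path Z Y =>
        ((e - 1) * red s).negOnePow •
          B.hcat.μ.val ((Quiver.Path.nil.cons (T.arrow s)).cons (S.arrow q)) n) t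
      = ((e - 1) * red s).negOnePow •
        B.hcat.μ.val ((Quiver.Path.nil.cons (T.arrow s)).cons ((barD S).arrow t)) n := by
    intro Z s t
    rw [ins_units_smul]
    exact congrArg _ (insert_insC (idC Aᵍ) (idC Aᵍ) A.μ (B.hcat.μ.isML n) S
      (e + 1) (by ring) t (Quiver.Path.nil.cons (T.arrow s)) .nil).symm
  congr 1 <;> refine lsum_congr fun c _ => ?_
  · refine (congrArg _ (lsum_congr (ψ := fun r => ((e - 1) * red c.fst).negOnePow •
      B.hcat.μ.val ((Quiver.Path.nil.cons (T.arrow r)).cons ((barD S).arrow c.snd)) n)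
      fun r hr => (hR' r c.snd).trans
      (congrArg₂ (· • ·) (congrArg (fun i => ((e - 1) * i).negOnePow)
        ((idC Aᵍ).red_of_mem_blocks c.fst r hr)) rfl))).trans ?_
    refine (congrArg _ (lsum_blocks_idC ((isML_arrow T ((B.hcat.μ.isML n).cons _) .nil
      .nil).units_smul _) c.fst)).trans ?_
    rw [smul_smul, ← Int.negOnePow_add]
    exact congrArg₂ (· • ·) (negOnePow_congr ⟨0, by ring⟩) rfl
  · refine (lsum_congr fun t _ => hL' c.fst t).trans ?_
    refine (lsum_blocks_idC ((isML_arrow S ((B.hcat.μ.isML n).comp_left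
      (Quiver.Path.nil.cons ((barD T).arrow c.fst))) .nil .nil).units_smul _) c.snd).trans ?_
    rw [smul_smul, ← Int.negOnePow_add]
    exact congrArg₂ (· • ·) (negOnePow_congr ⟨0, by ring⟩) rfl

end BarDifferential

end Cochain

/-! ### Inverting natural transformations -/

namespace AInfFunctor

section Leibniz

variable {A : AInfCat k} {B : AInfCat k} {f g h : A.Ob → B.hcat.Ob}
  {d e : ℤ}

/-- With values in a graded category, the differential is `T ↦ ± T ⋆ F + G ⋆ T ± T ∘ μ_A`. -/
theorem homDC_eq_starC (F : AInfFunctor A B.hcat f) (G : AInfFunctor A B.hcat g)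
    (T : Cochain Aᵍ Bʰ f g d) :
    homDC F G T = starC T F.toCochain (d + 1) + starC G.toCochain T (d + 1)
      + d.negOnePow • barD T := by
  rw [homDC, ins_hcat_μ F.toCochain G.toCochain F.val_nil G.val_nil, sub_eq_add_neg,
    ← Units.neg_smul, ← Int.negOnePow_succ, sub_add_cancel]

/-- The Leibniz rule for the composition of transformations. -/
theorem homDC_starC (F : AInfFunctor A B.hcat f) (G : AInfFunctor A B.hcat g)
    (H : AInfFunctor A B.hcat h) (S : Cochain Aᵍ Bʰ g h e)
    (T : Cochain Aᵍ Bʰ f g d) (r : ℤ) (hr : r = d + e) :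
    homDC F H (starC S T r hr) = d.negOnePow • starC (homDC G H S) T (r + 1)
      - starC S (homDC F G T) (r + 1) := by
  have hd : d.negOnePow * d.negOnePow = 1 := by
    rw [← Int.negOnePow_add, Int.negOnePow_even _ ⟨d, rfl⟩]
  have h₁ := starC_starC S T F.toCochain (d + 1) r (r + 1) (by ring) (by omega) hr (by omega)
  have h₂ := starC_starC H.toCochain S T r (e + 1) (r + 1) hr (by omega) (by omega) (by omega)
  have h₃ := starC_starC S G.toCochain T (d + 1) (e + 1) (r + 1) (by omega) (by omega) (by omega)
    (by omega)
  rw [homDC_eq_starC, homDC_eq_starC, homDC_eq_starC, barD_starC S T r hr]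
  rw [starC_add_left, starC_add_left, starC_units_smul_left, starC_add_right, starC_add_right,
    starC_units_smul_right, h₁, h₂, h₃]
  simp only [smul_add]
  subst hr
  simp only [smul_smul, ← Int.negOnePow_add, Int.negOnePow_one, Units.neg_smul, one_smul, hd]
  have e₁ : (d + e + (e - 1)).negOnePow = -d.negOnePow := by
    rw [← Int.negOnePow_succ]
    exact negOnePow_congr ⟨e - 1, by ring⟩
  rw [e₁, Units.neg_smul]
  abel

theorem homDC_unitC (F : AInfFunctor A B.hcat f) : homDC F F (unitC (B := B) f) = 0 := by
  have h₁ : starC (unitC f) F.toCochain (0 + 1) = (1 : ℤ).negOnePow • F.toCochain :=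
    starC_unit_left F.toCochain _
  have h₂ : starC F.toCochain (unitC f) (0 + 1) = F.toCochain := starC_unit_right F.toCochain _
  rw [homDC_eq_starC, h₁, h₂]
  have : barD (A := A) (unitC (Q := Aᵍ) (B := B) f) = 0 :=
    ext fun p n => ins_ofNil (fun X => B.hUnit (f X)) A.μ p n
  rw [this, smul_zero, add_zero, Int.negOnePow_one, Units.neg_smul, one_smul]
  exact neg_add_cancel F.toCochain

end Leibniz

end AInfFunctor

namespace Cochain

section Division

variable {Q : GrQuiver k} {B : AInfCat k} {f g h : Q.Ob → B.hcat.Ob}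
  {d e : ℤ}

theorem VanishesBelow.starC {S : Cochain Q Bʰ g h e}
    {T : Cochain Q Bʰ f g d} {m n : ℕ} (hS : S.VanishesBelow m)
    (hT : T.VanishesBelow n) (r : ℤ) (hr : r = d + e) : (starC S T r hr).VanishesBelow (m + n) := by
  refine ⟨fun p i hp => lsum_eq_zero fun c hc => ?_⟩
  have hl := AInfCat.length_of_mem_cuts2 p c hc
  by_cases h : c.snd.length < m
  · rw [hS.arrow c.snd h]
    exact (congrArg _ (B.hcat.μ.val_zero (Quiver.Path.nil.cons (T.arrow c.fst)) _ .nil _)).trans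
      (smul_zero _)
  · rw [hT.arrow c.fst (by omega)]
    exact (congrArg _ (B.hcat.μ.val_zero .nil _ (Quiver.Path.nil.cons (S.arrow c.snd)) _)).trans
      (smul_zero _)

/-- A cochain of degree zero whose order zero part is invertible is invertible for `⋆`. -/
theorem exists_starC_inverse (t : Cochain Q Bʰ f g 0)
    (u : Cochain Q Bʰ g f 0)
    (h₁ : (starC u t 0 - unitC f).VanishesBelow 1) (h₂ : (starC t u 0 - unitC g).VanishesBelow 1) :
    ∃ s : Cochain Q Bʰ g f 0, starC s t 0 = unitC f ∧ starC t s 0 = unitC g := by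
  have key : ∀ (h : Q.Ob → B.hcat.Ob) (X : Cochain Q Bʰ g h 0),
      starC X t 0 = 0 → X = 0 := by
    intro h X hX
    have e₁ : starC X (starC t u 0) 0 = 0 := by
      rw [starC_starC X t u 0 0 0 rfl rfl rfl rfl, hX, starC_zero_left, smul_zero]
    have e₂ : X = -starC X (starC t u 0 - unitC g) 0 := by
      rw [sub_eq_add_neg, starC_add_right, e₁, starC_neg_right, starC_unit_right, zero_add, neg_neg]
    refine eq_zero_of_vanishesBelow fun m => ?_
    induction m with
    | zero => exact vanishesBelow_zero X
    | succ m ih =>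
      rw [e₂]
      exact (VanishesBelow.starC ih h₂ 0 rfl).neg
  obtain ⟨s, hP, hR⟩ := exists_seq_of_step
    (fun m (s : Cochain Q Bʰ g f 0) => (unitC f - starC s t 0).VanishesBelow m)
    (fun m s s' => (s' - s).VanishesBelow m) ⟨0, vanishesBelow_zero _⟩ (fun m s hs => by
    refine ⟨s + starC (unitC f - starC s t 0) u 0, ?_, ?_⟩
    · have : unitC f - starC (s + starC (unitC f - starC s t 0) u 0) t 0
          = -starC (unitC f - starC s t 0) (starC u t 0 - unitC f) 0 := by
        have e₁ := starC_starC (unitC f - starC s t 0) u t 0 0 0 rfl rfl rfl rfl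
        rw [Int.negOnePow_zero, one_smul] at e₁
        rw [starC_add_left, ← e₁, sub_eq_add_neg (starC u t 0), starC_add_right, starC_neg_right,
          starC_unit_right]
        abel
      rw [this]
      exact (VanishesBelow.starC hs h₁ 0 rfl).neg
    · rw [add_sub_cancel_left]
      exact VanishesBelow.starC hs (vanishesBelow_zero u) 0 rfl)
  obtain ⟨L, hL⟩ := exists_limit s hR
  have hs : starC L t 0 = unitC f := by
    refine (sub_eq_zero.1 (eq_zero_of_vanishesBelow fun m => ?_)).symm
    have : unitC f - starC L t 0 = (unitC f - starC (s m) t 0) - starC (L - s m) t 0 := by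
      rw [starC_sub_left]
      abel
    rw [this]
    exact (hP m).sub (VanishesBelow.starC (hL m) (vanishesBelow_zero t) 0 rfl)
  refine ⟨L, hs, sub_eq_zero.1 (key g _ ?_)⟩
  have e₁ := starC_starC t L t 0 0 0 rfl rfl rfl rfl
  rw [Int.negOnePow_zero, one_smul, hs, starC_unit_right] at e₁
  rw [starC_sub_left, ← e₁, starC_unit_left, Int.negOnePow_zero, one_smul, sub_self]

end Division

end Cochain

namespace AInfFunctor

section NatEquiv

variable {A : AInfCat k} {B : AInfCat k} {f g h : A.Ob → B.hcat.Ob}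
  {d e : ℤ}

/-- With values in a graded category, the composition `homMul` of transformations is `⋆`. -/
theorem homMul_eq_starC (F : AInfFunctor A B.hcat f) (G : AInfFunctor A B.hcat g)
    (H : AInfFunctor A B.hcat h) (S : Cochain Aᵍ Bʰ g h e)
    (T : Cochain Aᵍ Bʰ f g d) (r : ℤ) (hr : r = d + e) {X Y : A.Ob}
    (p : Path X Y) (n : ℤ) : homMul F G H S T p n = (starC S T r hr).val p n := by
  rw [homMul, starC_val]
  refine (lsum_cuts3 p _).trans ?_
  rw [lsum_cuts2_eq_fst_nil]
  · refine lsum_congr fun c _ => ?_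
    rw [lsum_cuts3_eq_mid]
    · refine (lsum_blocks_nil F.toCochain _).trans ((lsum_blocks_nil G.toCochain _).trans
        ((lsum_blocks_nil H.toCochain _).trans ?_))
      simp only [red]
      refine congrArg₂ (· • ·) (congrArg _ (by ring)) rfl
    · intro b _ hb
      refine lsum_eq_zero fun r _ => lsum_eq_zero fun s hs => lsum_eq_zero fun t ht => ?_
      refine (congrArg _ (hcat_μ_val_of_length _ _ ?_)).trans (smul_zero _)
      simp only [Quiver.Path.length_comp, Quiver.Path.length_cons]
      have h₁ := length_of_mem_blocks G.toCochain _ s hs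
      have h₂ := length_of_mem_blocks H.toCochain _ t ht
      omega
  · intro c _ hc
    refine lsum_eq_zero fun _ _ => lsum_eq_zero fun b _ => lsum_eq_zero fun r hr =>
      lsum_eq_zero fun s _ => lsum_eq_zero fun t _ => ?_
    refine (congrArg _ (hcat_μ_val_of_length _ _ ?_)).trans (smul_zero _)
    simp only [Quiver.Path.length_comp, Quiver.Path.length_cons]
    have h₁ := length_of_mem_blocks F.toCochain _ r hr hc
    omega

theorem idVal_eq_unitC (f : A.Ob → B.hcat.Ob) {X Y : A.Ob} (p : Path X Y) (n : ℤ) :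
    idVal (B := B) f p n = (unitC (Q := Aᵍ) (B := B) f).val p n := by
  cases p <;> rfl

theorem sub_congr {M : Type*} [AddCommGroup M] {a b c d : M} (h : a = b) (h' : c = d) :
    a - c = b - d := by rw [h, h']

/-- Equivalence of functors, with the equations stated for cochains. -/
theorem natEquiv_iff (F : AInfFunctor A B.hcat f) (G : AInfFunctor A B.hcat g) :
    NatEquiv (B := B) F G ↔ ∃ (T : Cochain Aᵍ Bʰ f g 0)
      (S : Cochain Aᵍ Bʰ g f 0)
      (U : Cochain Aᵍ Bʰ f f (-1))
      (V : Cochain Aᵍ Bʰ g g (-1)),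
      homDC F G T = 0 ∧ homDC G F S = 0 ∧ 
        (∀ {X Y : A.Ob} (p : Path X Y) (n : ℤ),
          (homDC F F U).val p n = (starC S T 0 - unitC f).val p n) ∧
        ∀ {X Y : A.Ob} (p : Path X Y) (n : ℤ),
          (homDC G G V).val p n = (starC T S 0 - unitC g).val p n := by
  constructor
  · intro h'
    obtain ⟨T, S, U, V, h⟩ : ∃ (T : Cochain Aᵍ Bʰ f g 0)
      (S : Cochain Aᵍ Bʰ g f 0)
      (U : Cochain Aᵍ Bʰ f f (-1))
      (V : Cochain Aᵍ Bʰ g g (-1)),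
      ∀ {X Y : A.Ob} (p : Path X Y) (n : ℤ),
        homD F G T p n = 0 ∧ homD G F S p n = 0 ∧
        homMul F G F S T p n - (show B.hcat.Hom (f X) (f Y) n from idVal (B := B) f p n) = homD F F U p n ∧
        homMul G F G T S p n - (show B.hcat.Hom (g X) (g Y) n from idVal (B := B) g p n) = homD G G V p n := h'
    refine ⟨T, S, U, V, ext fun p n => ?_, ext fun p n => ?_, fun p n => ?_, fun p n => ?_⟩
    · exact (homDC_val F G T p n).trans (h p n).1
    · exact (homDC_val G F S p n).trans (h p n).2.1
    · refine (homDC_val F F U p n).trans ((h p n).2.2.1.symm.trans ?_)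
      exact (sub_congr (homMul_eq_starC F G F S T 0 rfl p n) (idVal_eq_unitC f p n)).trans
        (sub_val _ _ p n).symm
    · refine (homDC_val G G V p n).trans ((h p n).2.2.2.symm.trans ?_)
      exact (sub_congr (homMul_eq_starC G F G T S 0 rfl p n) (idVal_eq_unitC g p n)).trans
        (sub_val _ _ p n).symm
  · rintro ⟨T, S, U, V, h₁, h₂, h₃, h₄⟩
    refine ⟨T, S, U, V, fun p n => ⟨?_, ?_, ?_, ?_⟩⟩
    · exact (homDC_val F G T p n).symm.trans (congrArg (fun T => T.val p n) h₁)
    · exact (homDC_val G F S p n).symm.trans (congrArg (fun T => T.val p n) h₂)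
    · refine Eq.trans ?_ ((h₃ p n).symm.trans (homDC_val F F U p n))
      exact (sub_congr (homMul_eq_starC F G F S T 0 rfl p n) (idVal_eq_unitC f p n)).trans
        (sub_val _ _ p n).symm
    · refine Eq.trans ?_ ((h₄ p n).symm.trans (homDC_val G G V p n))
      exact (sub_congr (homMul_eq_starC G F G T S 0 rfl p n) (idVal_eq_unitC g p n)).trans
        (sub_val _ _ p n).symm

/-- A closed natural transformation of degree zero whose order zero part is invertible is an
isomorphism. -/
theorem natEquiv_of_invertible (F : AInfFunctor A B.hcat f) (G : AInfFunctor A B.hcat g)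
    (t : Cochain Aᵍ Bʰ f g 0)
    (u : Cochain Aᵍ Bʰ g f 0) (ht : homDC F G t = 0)
    (h₁ : (starC u t 0 - unitC f).VanishesBelow 1) (h₂ : (starC t u 0 - unitC g).VanishesBelow 1) :
    NatEquiv (B := B) F G := by
  obtain ⟨s, hs, hs'⟩ := exists_starC_inverse t u h₁ h₂
  refine (natEquiv_iff F G).2 ⟨t, s, 0, 0, ht, ?_, fun p n => ?_, fun p n => ?_⟩
  · have e₁ := homDC_starC F G F s t 0 rfl
    rw [hs, homDC_unitC, ht, starC_zero_right, sub_zero, Int.negOnePow_zero, one_smul] at e₁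
    have e₂ : starC (starC (homDC G F s) t 1) s 1 = homDC G F s := by
      have := starC_starC (homDC G F s) t s 0 1 1 rfl rfl rfl rfl
      rw [hs', Int.negOnePow_zero, one_smul] at this
      rw [← this]
      exact starC_unit_right _ _
    rw [← e₂]
    exact (congrArg (fun T => starC T s 1) e₁.symm).trans (starC_zero_left _ _ _)
  · rw [homDC_zero, hs, sub_self]
  · rw [homDC_zero, hs', sub_self]

theorem natEquiv_refl (F : AInfFunctor A B.hcat f) : NatEquiv (B := B) F F := by
  have h : starC (unitC (Q := Aᵍ) (B := B) f) (unitC f) 0 = unitC f :=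
    starC_unit_right _ _
  refine natEquiv_of_invertible F F (unitC f) (unitC f) (homDC_unitC F) ?_ ?_ <;>
  · rw [h, sub_self]
    exact ⟨fun _ _ _ => rfl⟩

end NatEquiv

end AInfFunctor

/-- Every pure structure induces an equivalence with the cohomological category. -/
theorem PureStructure.nonempty_formalityEquiv [CharZero k] {A : AInfCat k}
    (s : PureStructure A) : Nonempty (FormalityEquiv A s) := by
  obtain ⟨K⟩ := Contraction.nonempty A
  obtain ⟨ψ, hψ, hT⟩ := s.exists_ψ K
  obtain ⟨θ, hθ⟩ := exists_inverse K hψ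
  refine ⟨⟨ψ, fun {X Y n} a => ?_, (AInfFunctor.relates_iff ψ (eulerC Aʰ) s.b).2 hT,
    θ, ?_⟩⟩
  · have e : ψ.lin n n (A.cls a) = K.i X Y n (A.cls a) := hψ n (A.cls a)
    exact (congrArg (fun y => A.Homologous y a.1) e).mpr
      ((A.homologous_iff_cls ⟨_, K.d_i (A.cls a) _⟩ a).2 (cls_i K _))
  · have : AInfFunctor.NatEquiv (θ.comp ψ) (AInfFunctor.id A.hcat) := by
      rw [hθ]
      exact AInfFunctor.natEquiv_refl _
    exact this

/-! ### Functors that relate vector fields together with their equivariant structures -/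

/-- The Euler vector field is a pure structure on the cohomological category. -/
noncomputable def eulerPure (A : AInfCat k) : PureStructure A.hcat where
  b := eulerC Aʰ
  closed {X Y} p n := by
    refine (AInfFunctor.homDC_id_val (A := A.hcat) (eulerC Aʰ) p n).symm.trans ?_
    rw [homDC_euler]
    rfl
  c _ := 0
  d_c X := (map_zero (A.hcat.d 0 1)).trans (neg_zero (G := A.HHom X X 1)).symm
  pure {X Y} i a _ := by
    refine ⟨0, (map_zero (A.hcat.d (i - 1) i)).trans ?_⟩
    have h₁ : A.hcat.prod (0 : A.hcat.Hom Y Y 0) a i = 0 := A.hcat.zero_prod a i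
    have h₂ : A.hcat.prod a (0 : A.hcat.Hom X X 0) i = 0 := A.hcat.prod_zero a i
    have h₃ : (eulerC Aʰ).lin i i a = (i : k) • a :=
      ofLin_lin (A := Aʰ) (fun _ _ n => (n : k) • LinearMap.id) i a
    rw [h₁, h₂, h₃, sub_zero, add_zero, Int.cast_smul_eq_zsmul, sub_self]

namespace AInfFunctor

variable {A : AInfCat k} {B : AInfCat k} {C : AInfCat k}
variable {f g : A.Ob → B.Ob} {c : B.Ob → C.Ob} 

theorem ext_toCochain {F G : AInfFunctor A B f} (h : F.toCochain = G.toCochain) : F = G := by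
  rcases F with ⟨_, _, _, _⟩
  rcases G with ⟨_, _, _, _⟩
  obtain rfl := h
  rfl

/-- The functor `F` relates the pure structures: the vector fields agree under `F` by means of a
pre-natural transformation `T` whose order zero part agrees up to coboundaries with the
difference of the equivariant structures. -/
def IsRelated (F : AInfFunctor A B f) (sA : PureStructure A) (sB : PureStructure B) : Prop :=
  ∃ T : Cochain Aᵍ Bᵍ f f 0,
    homDC F F T = F.postVF sA.b - sB.b.pre F.toCochain ∧
    ∀ X : A.Ob, T.val (.nil : Path X X) 0
      - (sB.c (f X) - F.lin 0 0 (sA.c X)) ∈ B.exact (f X) (f X) 0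

theorem lin_mem_exact (F : AInfFunctor A B f) {X Y : A.Ob} {n : ℤ} {a : A.Hom X Y n}
    (h : a ∈ A.exact X Y n) : F.lin n n a ∈ B.exact (f X) (f Y) n := by
  obtain ⟨η, rfl⟩ := h
  exact ⟨F.lin (n - 1) (n - 1) η, F.d_lin (n - 1) n η⟩

theorem _root_.AInf.Cochain.insC_nil {A : GrQuiver k} {B : GrQuiver k}
    {C : GrQuiver k} {f g : A.Ob → B.Ob} {c c' : B.Ob → C.Ob} {d e : ℤ}
    (F : Cochain A B f f 1) (G : Cochain A B g g 1)
    (T : Cochain A B f g d) (S : Cochain B C c c' e) (r : ℤ) (hr : r = d + e - 1) (X : A.Ob) (n : ℤ) :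
    (insC F G T S r hr).val (.nil : Path X X) n = S.lin d n (T.val .nil d) := by
  rw [insC_val]
  refine (ins_eq_leading F G (S.isML n) _ (vanishesBelow_zero T)).trans ?_
  rw [T.arrow_eq (N := d) _ (by simp [red])]
  rfl

theorem insC_postVF (F : AInfFunctor A B f) (G : AInfFunctor B C c)
    (a : Cochain Aᵍ Aᵍ (fun X => X) (fun X => X) 1) :
    insC F.toCochain F.toCochain (F.postVF a) G.toCochain 1 = (G.comp F).postVF a :=
  ext fun p n => (ins_idC_blocks F.toCochain a (G.isML n) p).symm

theorem insC_pre_VF (F : AInfFunctor A B f) (G : AInfFunctor B C c)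
    (b : Cochain Bᵍ Bᵍ (fun X => X) (fun X => X) 1) :
    insC F.toCochain F.toCochain (b.pre F.toCochain) G.toCochain 1
      = (G.postVF b).pre F.toCochain :=
  ext fun p n => (blocks_ins_idC F.val_nil b (G.isML n) p).symm

theorem IsRelated.comp {F : AInfFunctor A B f} {G : AInfFunctor B C c} {sA : PureStructure A}
    {sB : PureStructure B} {sC : PureStructure C} (hF : F.IsRelated sA sB)
    (hG : G.IsRelated sB sC) : (G.comp F).IsRelated sA sC := by
  obtain ⟨T, hT, hT₀⟩ := hF
  obtain ⟨S, hS, hS₀⟩ := hG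
  refine ⟨insC F.toCochain F.toCochain T G.toCochain 0 + S.pre F.toCochain, ?_, fun X => ?_⟩
  · have h₁ := homDC_insC F F T G
    have h₂ := homDC_pre G G S F
    rw [hT] at h₁
    rw [hS, sub_pre, Contraction.pre_pre] at h₂
    have h₃ : insC F.toCochain F.toCochain (F.postVF sA.b - sB.b.pre F.toCochain) G.toCochain 1
        = (G.comp F).postVF sA.b - (G.postVF sB.b).pre F.toCochain := by
      rw [insC_sub_left, insC_postVF, insC_pre_VF]
    refine (homDC_add _ _ _ _).trans ?_
    refine (congrArg₂ (· + ·) (h₁.trans h₃) h₂).trans ?_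
    exact sub_add_sub_cancel _ _ _
  · have h₁ := G.lin_mem_exact (hT₀ X)
    have h₂ := add_mem h₁ (hS₀ (f X))
    have h₃ : (G.comp F).lin 0 0 (sA.c X)
        = G.lin 0 0 (F.lin 0 0 (sA.c X)) := by
      refine (lsum_blocks_str₁ F.toCochain _ _).trans ?_
      rw [F.arrow_eq (str₁ (sA.c X)) (N := 0) (by simp [red])]
      rfl
    have h₄ : (S.pre F.toCochain).val (.nil : Path X X) 0 = S.val .nil 0 :=
      lsum_blocks_nil F.toCochain _
    rw [add_val, insC_nil, h₃, h₄]
    rw [map_sub, map_sub] at h₂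
    convert h₂ using 1
    abel

end AInfFunctor

/-! ### Invariance under equivalence of functors -/

namespace Cochain

theorem val_eq_zero_of_length {Q : GrQuiver k} {R : GrQuiver k}
    {f g : Q.Ob → R.Ob} {d : ℤ} {T : Cochain Q R f g d} {X Y : Q.Ob} {p : Path X Y} {n : ℤ}
    (hp : p.length = 0) (hT : ∀ (X : Q.Ob) (n : ℤ), T.val (.nil : Path X X) n = 0) :
    T.val p n = 0 := by
  cases p with
  | nil => exact hT _ _
  | cons p a => simp at hp

/-- The part of order `r` of a cochain of degree `d`, multiplied by `r - d`. On cochains of a graded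
category this is the bracket with the Euler fields. -/
def degC {Q : GrQuiver k} {R : GrQuiver k} {f g : Q.Ob → R.Ob} {d : ℤ}
    (T : Cochain Q R f g d) : Cochain Q R f g d where
  val p n := ((p.length - d : ℤ) : k) • T.val p n
  val_eq_zero p n h := by rw [T.val_eq_zero p n h, smul_zero]
  val_add p i a b q n := by
    simp only [Quiver.Path.length_comp, Quiver.Path.length_cons]
    rw [T.val_add, smul_add]
  val_smul p i r a q n := by
    simp only [Quiver.Path.length_comp, Quiver.Path.length_cons]
    rw [T.val_smul, smul_comm]

theorem degC_val {Q : GrQuiver k} {R : GrQuiver k} {f g : Q.Ob → R.Ob} {d : ℤ}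
    (T : Cochain Q R f g d) {X Y : Q.Ob} (p : Path X Y) (n : ℤ) :
    T.degC.val p n = ((p.length - d : ℤ) : k) • T.val p n := rfl

section Deg

variable {A : AInfCat k} {B : AInfCat k} {f g h : A.hcat.Ob → B.hcat.Ob}
  {d e : ℤ}

theorem degC_add (S T : Cochain Aʰ Bʰ f g d) :
    (S + T).degC = S.degC + T.degC := 
  ext fun p n => by rw [degC_val, add_val, smul_add]; rfl

theorem degC_units_smul (s : ℤˣ) (T : Cochain Aʰ Bʰ f g d) :
    (s • T).degC = s • T.degC := 
  ext fun p n => by rw [degC_val, units_smul_val, units_smul_val, degC_val, smul_comm]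

/-- The operator `degC` is a derivation of `⋆`. -/
theorem degC_starC (S : Cochain Aʰ Bʰ g h e)
    (T : Cochain Aʰ Bʰ f g d) (r : ℤ) (hr : r = d + e) :
    (starC S T r hr).degC = starC S.degC T r hr + starC S T.degC r hr := by
  refine ext fun {X Y} p n => ?_
  rw [degC_val, add_val, starC_val, starC_val, starC_val, smul_lsum, ← lsum_add]
  refine lsum_congr fun c hc => ?_
  have hl := AInfCat.length_of_mem_cuts2 p c hc
  have e₁ : B.hcat.μ.val ((Quiver.Path.nil.cons (T.degC.arrow c.fst)).cons (S.arrow c.snd)) n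
      = ((c.fst.length - d : ℤ) : k) •
        B.hcat.μ.val ((Quiver.Path.nil.cons (T.arrow c.fst)).cons (S.arrow c.snd)) n :=
    (B.hcat.μ.isML n).smul .nil _ _ _ (Quiver.Path.nil.cons (S.arrow c.snd))
  have e₂ : B.hcat.μ.val ((Quiver.Path.nil.cons (T.arrow c.fst)).cons (S.degC.arrow c.snd)) n
      = ((c.snd.length - e : ℤ) : k) •
        B.hcat.μ.val ((Quiver.Path.nil.cons (T.arrow c.fst)).cons (S.arrow c.snd)) n :=
    (B.hcat.μ.isML n).smul (Quiver.Path.nil.cons (T.arrow c.fst)) _ _ _ .nil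
  rw [e₁, e₂, ← smul_add, ← add_smul, smul_comm]
  congr 2
  rw [← Int.cast_add, ← hl, hr]
  congr 1
  push_cast
  ring

theorem starC_congr_right {Q : GrQuiver k} {C : AInfCat k}
    {f g h : Q.Ob → C.Ob} {d d' e : ℤ} (S : Cochain Q Cᵍ g h e)
    {T : Cochain Q Cᵍ f g d} {T' : Cochain Q Cᵍ f g d'} (hd : d = d')
    (hT : ∀ {X Y : Q.Ob} (p : Path X Y) (n : ℤ), T.val p n = T'.val p n) (r : ℤ)
    (hr : r = d + e) (hr' : r = d' + e) : starC S T r hr = starC S T' r hr' := by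
  subst hd
  rw [ext (T := T) (S := T') hT]

theorem barD_degC (T : Cochain Aʰ Bʰ f g d) :
    barD (A := A.hcat) T.degC = (barD (A := A.hcat) T).degC := by
  refine ext fun {X Y} p n => ?_
  rw [degC_val, insC_val, insC_val]
  refine (ins_idC (A := Aʰ) A.hcat.μ (T.degC.isML n) p).trans (Eq.trans ?_
    (congrArg _ (ins_idC (A := Aʰ) A.hcat.μ (T.isML n) p)).symm)
  rw [smul_lsum]
  refine lsum_congr fun c hc => ?_
  rw [smul_comm]
  refine congrArg _ ?_
  have hl := AInfCat.length_of_mem_cuts3 p c hc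
  by_cases h : c.mid.length = 2
  · rw [degC_val]
    refine congrArg (fun i : ℤ => (i : k) • _) ?_
    simp only [Quiver.Path.length_comp, Quiver.Path.length_cons]
    push_cast [← hl, h]
    ring
  · have : A.hcat.μ.arrow c.mid = (⟨red c.mid + 2, 0⟩ : c.Z ⟶ c.W) := by
      rw [arrow, hcat_μ_val_of_length _ _ h]
    rw [this]
    exact (T.degC.val_zero c.fst _ c.last n).trans ((congrArg _ (T.val_zero c.fst _ c.last n)).trans
      (smul_zero _)).symm

end Deg

end Cochain

namespace AInfFunctor

section Conjugation

variable {A : AInfCat k} {B : AInfCat k} {f g : A.hcat.Ob → B.hcat.Ob}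

/-- A functor of graded categories fails to preserve the Euler fields by `(r - 1) F^r` at order `r`.
-/
theorem postVF_euler_sub (F : AInfFunctor A.hcat B.hcat f) :
    F.postVF (eulerC Aʰ) - (eulerC Bʰ).pre F.toCochain
      = F.degC := by
  refine ext fun p n => ?_
  by_cases hn : n = red p + 1
  · subst hn
    have h₁ : (F.postVF (eulerC Aʰ)).val p (red p + 1) = _ :=
      ins_eulerC (A := Aʰ) (F.isML (red p + 1)) p
    have h₂ : ((eulerC Bʰ).pre F.toCochain).val p (red p + 1)
        = ((red p + 1 : ℤ) : k) • F.val p (red p + 1) := by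
      have hE : (eulerC Bʰ).IsLinear := isLinear_ofLin _
      rw [hE.pre F.toCochain F.val_nil, thenC_val]
      exact ofLin_lin (A := Bʰ) (fun _ _ n => (n : k) • LinearMap.id) (red p + 1) _
    rw [sub_val, h₁, h₂, degC_val, ← sub_smul, ← Int.cast_sub]
    refine congrArg (fun i : ℤ => (i : k) • _) ?_
    ring
  · rw [val_eq_zero _ _ _ hn, val_eq_zero _ _ _ hn]

/-- A functor between cohomological categories that is equivalent to a linear functor is related to
the Euler fields. -/
theorem isRelated_of_natEquiv {F : AInfFunctor A.hcat B.hcat f} {G : AInfFunctor A.hcat B.hcat g}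
    (hF : F.toCochain.IsLinear) (h : NatEquiv (B := B) F G) :
    G.IsRelated (eulerPure A) (eulerPure B) := by
  obtain ⟨t, s, U, V, ht, hs, -, hV⟩ := (natEquiv_iff F G).1 h
  have hF₀ : F.degC = 0 := by
    refine ext fun p n => ?_
    by_cases hp : p.length = 1
    · rw [degC_val, hp, Nat.cast_one, sub_self, Int.cast_zero, zero_smul, zero_val]
    · rw [degC_val, hF.eq_zero p n hp, smul_zero, zero_val]
  have hc : homDC G G G.degC = 0 := by
    rw [← postVF_euler_sub, homDC_sub, homDC_postVF G (homDC_euler A),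
      homDC_pre_VF G (homDC_euler B), sub_zero]
  have hEt : homDC F G t.degC = -starC G.degC t 1 := by
    have := congrArg degC ht
    rw [homDC_eq_starC, degC_add, degC_add, degC_starC, degC_starC, degC_units_smul, ← barD_degC,
      hF₀, starC_zero_right, add_zero] at this
    rw [homDC_eq_starC, eq_neg_iff_add_eq_zero]
    refine Eq.trans ?_ (this.trans (ext fun p n => smul_zero _))
    abel
  have h₁ : homDC G G (starC G.degC V 0)
      = G.degC - starC G.degC (starC t s 0) 1 := by
    have e₁ := homDC_starC G G G G.degC V 0 rfl
    have e₂ : starC G.degC (homDC G G V) (0 + 1)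
        = starC G.degC (starC t s 0 - unitC g) 1 :=
      starC_congr_right _ (by ring) hV _ _ _
    rw [e₁, hc, starC_zero_left, smul_zero, zero_sub, e₂, sub_eq_add_neg, starC_add_right,
      starC_neg_right, starC_unit_right]
    abel
  have h₂ : homDC G G (starC t.degC s 0) = -starC G.degC (starC t s 0) 1 := by
    have e₁ := homDC_starC G F G t.degC s 0 rfl
    have e₂ := starC_starC G.degC t s 0 1 1 rfl rfl rfl rfl
    rw [e₁, hEt, hs, starC_zero_right, sub_zero, starC_neg_left]
    rw [Int.negOnePow_zero, one_smul] at e₂ ⊢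
    rw [e₂]
    rfl
  refine ⟨starC G.degC V 0 - starC t.degC s 0, ?_, fun X => ?_⟩
  · rw [homDC_sub, h₁, h₂]
    refine Eq.trans ?_ (postVF_euler_sub G).symm
    abel
  · have hG : G.degC.VanishesBelow 1 := ⟨fun p n hp => by
      rw [degC_val, val_eq_zero_of_length (by omega) G.val_nil, smul_zero]⟩
    have hE : t.degC.VanishesBelow 1 := ⟨fun p n hp => by
      rw [degC_val, Nat.lt_one_iff.1 hp, Nat.cast_zero, sub_zero, Int.cast_zero, zero_smul]⟩
    have h₃ := (VanishesBelow.starC hG (vanishesBelow_zero V) 0 rfl).sub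
      (VanishesBelow.starC hE (vanishesBelow_zero s) 0 rfl)
    rw [h₃.eq_zero (.nil : Path X X) 0 (by simp)]
    refine Eq.subst (motive := fun x => x ∈ B.hcat.exact (g X) (g X) 0) ?_ (zero_mem _)
    refine (sub_eq_zero.2 ?_).symm
    refine ((sub_eq_zero.2 ?_).symm)
    exact (map_zero (G.lin 0 0)).symm

end Conjugation

end AInfFunctor

/-! ### Cancelling the formality equivalence on the source -/

namespace AInfFunctor

section Cancel

theorem homDC_sub_insC {A : AInfCat k} {B : AInfCat k}
    {C : AInfCat k} {f : A.Ob → B.Ob} {c : B.Ob → C.Ob}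
    (F : AInfFunctor A B f) (G : AInfFunctor B C c)
    {xA : Cochain Aᵍ Aᵍ (fun X => X) (fun X => X) 1}
    {xB : Cochain Bᵍ Bᵍ (fun X => X) (fun X => X) 1}
    {xC : Cochain Cᵍ Cᵍ (fun X => X) (fun X => X) 1}
    {S : Cochain Aᵍ Bᵍ f f 0}
    {T : Cochain Aᵍ Cᵍ (fun X => c (f X)) (fun X => c (f X)) 0}
    (hS : homDC F F S = F.postVF xA - xB.pre F.toCochain)
    (hT : homDC (G.comp F) (G.comp F) T = (G.comp F).postVF xA - xC.pre (G.comp F).toCochain) :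
    homDC (G.comp F) (G.comp F) (T - insC F.toCochain F.toCochain S G.toCochain 0)
      = (G.postVF xB - xC.pre G.toCochain).pre F.toCochain := by
  have h₁ := homDC_insC F F S G
  have h₃ : insC F.toCochain F.toCochain (F.postVF xA - xB.pre F.toCochain)
      G.toCochain 1 = (G.comp F).postVF xA - (G.postVF xB).pre F.toCochain := by
    rw [insC_sub_left, insC_postVF, insC_pre_VF]
  have h₄ : (xC.pre G.toCochain).pre F.toCochain = xC.pre (G.comp F).toCochain :=
    Contraction.pre_pre xC G.toCochain F.toCochain
  rw [hS] at h₁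
  rw [sub_pre, h₄]
  refine (homDC_sub _ _ _ _).trans ((congrArg₂ (· - ·) hT (h₁.trans h₃)).trans ?_)
  exact sub_sub_sub_cancel_left _ _ _

theorem homDC_sub_pre {A : AInfCat k} {B : AInfCat k}
    {C : AInfCat k} {f : A.Ob → B.Ob} {c : B.Ob → C.Ob}
    (F : AInfFunctor A B f) (G : AInfFunctor B C c)
    {xA : Cochain Aᵍ Aᵍ (fun X => X) (fun X => X) 1}
    {xB : Cochain Bᵍ Bᵍ (fun X => X) (fun X => X) 1}
    {xC : Cochain Cᵍ Cᵍ (fun X => X) (fun X => X) 1}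
    {S : Cochain Bᵍ Cᵍ c c 0}
    {T : Cochain Aᵍ Cᵍ (fun X => c (f X)) (fun X => c (f X)) 0}
    (hS : homDC G G S = G.postVF xB - xC.pre G.toCochain)
    (hT : homDC (G.comp F) (G.comp F) T = (G.comp F).postVF xA - xC.pre (G.comp F).toCochain) :
    homDC (G.comp F) (G.comp F) (T - S.pre F.toCochain)
      = insC F.toCochain F.toCochain (F.postVF xA - xB.pre F.toCochain) G.toCochain 1 := by
  have h₁ := homDC_pre G G S F
  have h₃ : insC F.toCochain F.toCochain (F.postVF xA - xB.pre F.toCochain)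
      G.toCochain 1 = (G.comp F).postVF xA - (G.postVF xB).pre F.toCochain := by
    rw [insC_sub_left, insC_postVF, insC_pre_VF]
  have h₄ : (xC.pre G.toCochain).pre F.toCochain = xC.pre (G.comp F).toCochain :=
    Contraction.pre_pre xC G.toCochain F.toCochain
  rw [hS, sub_pre, h₄] at h₁
  rw [h₃]
  refine (homDC_sub _ _ _ _).trans ((congrArg₂ (· - ·) hT h₁).trans ?_)
  exact sub_sub_sub_cancel_right _ _ _

variable {A : AInfCat k} {C : AInfCat k} {c : A.Ob → C.Ob}

/-- Composition with a minimal model can be cancelled on the right, by lifting the homotopy between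
the vector fields with `exists_lift_of_pre`. -/
theorem IsRelated.of_comp_right (K : Contraction A) {ψ : AInfFunctor A.hcat A (fun X => X)}
    (hψ : ∀ {X Y : A.Ob} (n : ℤ) (a : A.HHom X Y n), ψ.lin n n a = K.i X Y n a)
    {sA : PureStructure A} {sC : PureStructure C} (h : ψ.IsRelated (eulerPure A) sA)
    {G : AInfFunctor A C c} (hG : (G.comp ψ).IsRelated (eulerPure A) sC) : G.IsRelated sA sC := by
  obtain ⟨S, hS, hS₀⟩ := h
  obtain ⟨T, hT, hT₀⟩ := hG
  have hc : homDC G G (G.postVF sA.b - sC.b.pre G.toCochain) = 0 := by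
    rw [homDC_sub, homDC_postVF G sA.homDC_b, homDC_pre_VF G sC.homDC_b, sub_zero]
  obtain ⟨R, hR, hR'⟩ := exists_lift_of_pre (d := 0) K hψ G G (G.postVF sA.b - sC.b.pre G.toCochain) hc
    (T - insC ψ.toCochain ψ.toCochain S G.toCochain 0) (homDC_sub_insC ψ G hS hT)
  refine ⟨R, hR, fun X => ?_⟩
  have h₂ : (R.pre ψ.toCochain).val (.nil : Quiver.Path (V := A.hcat.Ob) X X) 0
      = R.val (.nil : Quiver.Path (V := A.Ob) X X) 0 := lsum_blocks_nil ψ.toCochain _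
  rw [hR', sub_val, insC_nil] at h₂
  have e₁ : ψ.lin 0 0 ((eulerPure A).c X) = 0 := map_zero (ψ.lin 0 0)
  have e₂ : (G.comp ψ).lin 0 0 ((eulerPure A).c X) = 0 :=
    map_zero ((G.comp ψ).lin 0 0)
  have h₄ := hS₀ X
  have h₅ := hT₀ X
  rw [e₁, sub_zero] at h₄
  rw [e₂, sub_zero] at h₅
  have h₆ := sub_mem h₅ (G.lin_mem_exact h₄)
  rw [map_sub] at h₆
  rw [← h₂]
  refine Eq.subst (motive := fun y => y ∈ C.exact (c X) (c X) 0) ?_ h₆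
  abel

end Cancel

end AInfFunctor

namespace AInfFunctor

section Naturality

variable {A : AInfCat k} {B : AInfCat k} {f g : A.Ob → B.Ob}

/-- The order-one part of the differential of a transformation of order zero is the failure of
naturality. -/
theorem homDC_ofNil_str (F : AInfFunctor A B f) (G : AInfFunctor A B g)
    (c : ∀ X, B.Hom (f X) (g X) 0) {X Y : A.Ob} {n : ℤ} (a : A.Hom X Y n) :
    (homDC F G (ofNil (A := Aᵍ) c)).val (str₁ a) n
      = B.prod (G.lin n n a) (c X) n - B.prod (c Y) (F.lin n n a) n := by
  rw [homDC_val', ins_ofNil, smul_zero, sub_zero]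
  have hF : F.arrow (str₁ a) = (⟨n, F.lin n n a⟩ : f X ⟶ f Y) :=
    arrow_eq (N := n) _ _ (by simp [red])
  have hG : G.arrow (str₁ a) = (⟨n, G.lin n n a⟩ : g X ⟶ g Y) :=
    arrow_eq (N := n) _ _ (by simp [red])
  have hT : ∀ X : A.Ob, (ofNil (A := Aᵍ) c).arrow (.nil : Path X X)
      = (⟨0, c X⟩ : f X ⟶ g X) := fun X =>
    (arrow_eq (N := 0) _ _ (by simp [red])).trans (congrArg (Sigma.mk _) (ofNil_val_nil c X))
  have hT₁ : (ofNil (A := Aᵍ) c).arrow (str₁ a)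
      = (⟨red (str₁ a) + 0, 0⟩ : f X ⟶ g Y) :=
    congrArg (Sigma.mk _) (ofNil_val c _ _ (by simp [str₁]))
  have hc : cuts3 (str₁ a) = [⟨X, X, .nil, .nil, str₁ a⟩, ⟨X, Y, .nil, str₁ a, .nil⟩,
      ⟨Y, Y, str₁ a, .nil, .nil⟩] := rfl
  rw [ins, hc, lsum_cons, lsum_cons, lsum_cons, lsum_nil, add_zero]
  simp only [lsum_blocks_nil, lsum_blocks_str₁, hF, hG, hT, hT₁]
  have h₀ : B.μ.val ((Quiver.Path.nil.cons (⟨red (str₁ a) + 0, 0⟩ : f X ⟶ g Y)).comp .nil) n = 0 :=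
    B.μ.val_zero _ _ _ _
  rw [h₀, smul_zero, zero_add]
  refine (congrArg₂ (· + ·) ?_ ?_).trans (sub_eq_add_neg _ _).symm
  · exact congrArg₂ (· • ·) (negOnePow_congr ⟨0, by simp [red]⟩) rfl
  · refine (congrArg (· • _) (?_ : _ = -n.negOnePow)).trans (Units.neg_smul _ _)
    rw [← Int.negOnePow_succ]
    exact negOnePow_congr ⟨-n, by simp only [red, str₁]; ring⟩

end Naturality

end AInfFunctor

section Central

variable {A : AInfCat k}

theorem AInfCat.cls_prod_comm {X Y : A.Ob} {n : ℤ} (a : A.cocycles X Y n) (u : A.cocycles Y Y 0)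
    (u' : A.cocycles X X 0) (h : A.prod u.1 a.1 n - A.prod a.1 u'.1 n ∈ A.exact X Y n) :
    A.hcat.prod (A.cls u : A.hcat.Hom Y Y 0) (A.cls a : A.hcat.Hom X Y n) n
      = A.hcat.prod (A.cls a : A.hcat.Hom X Y n) (A.cls u' : A.hcat.Hom X X 0) n := by
  refine (A.cohμ_prod u a n).trans (Eq.trans ?_ (A.cohμ_prod a u' n).symm)
  rw [← sub_eq_zero, ← map_sub, A.cls_eq_zero]
  obtain ⟨η, hη⟩ := h
  refine ⟨η, hη.trans ?_⟩
  rw [Units.smul_def, Units.smul_def, Submodule.coe_sub, Submodule.coe_smul_of_tower,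
    Submodule.coe_smul_of_tower, ← Units.smul_def, ← Units.smul_def]
  rfl

theorem weightOp_sub_weightOp (b : Cochain Aᵍ Aᵍ (fun X => X) (fun X => X) 1)
    {X Y : A.Ob} (cX cX' : A.Hom X X 0) (cY cY' : A.Hom Y Y 0) {n : ℤ} (x : A.Hom X Y n) :
    weightOp b cX cY x - weightOp b cX' cY' x
      = A.prod x (cX - cX') n - A.prod (cY - cY') x n := by
  have h₁ : A.prod x (cX - cX') n = A.prod x cX n - A.prod x cX' n := by
    rw [AInfCat.prod, AInfCat.prod, AInfCat.prod, prodOf, prodOf, prodOf, ← smul_sub]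
    exact congrArg _ (LinearMap.map_sub₂ (A.μ.bilin 0 n n) cX cX' x)
  have h₂ : A.prod (cY - cY') x n = A.prod cY x n - A.prod cY' x n := by
    rw [AInfCat.prod, AInfCat.prod, AInfCat.prod, prodOf, prodOf, prodOf, ← smul_sub]
    exact congrArg _ (map_sub (A.μ.bilin n 0 n x) cY cY')
  rw [h₁, h₂, weightOp, weightOp]
  abel

/-- A central family of elements of degree zero of a graded category is a natural transformation of
the identity functor. -/
theorem AInfFunctor.homDC_ofNil_of_central {c : ∀ X : A.Ob, A.hcat.Hom X X 0}
    (hc : ∀ {X Y : A.Ob} (n : ℤ) (a : A.hcat.Hom X Y n),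
      A.hcat.prod (c Y) a n = A.hcat.prod a (c X) n) :
    homDC (AInfFunctor.id A.hcat) (AInfFunctor.id A.hcat)
      (ofNil (A := Aʰ) (B := Aʰ) (f := fun X => X) c) = 0 := by
  refine ext fun {X Y} p n => ?_
  by_cases hp : p.length = 1
  · cases p with
    | nil => simp at hp
    | cons p a =>
      cases p with
      | cons p a' => simp at hp
      | nil =>
        obtain ⟨m, x⟩ := a
        by_cases hn : n = m
        · subst hn
          have e : (AInfFunctor.id A.hcat).lin n n x = x :=
            ofLin_lin (A := Aʰ) (fun _ _ _ => LinearMap.id) n x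
          refine (homDC_ofNil_str (A := A.hcat) (AInfFunctor.id A.hcat) (AInfFunctor.id A.hcat)
            c x).trans ?_
          rw [e, hc]
          exact sub_self _
        · exact val_eq_zero _ _ _ (by simp only [red]; omega)
  · rw [homDC_val', ins_ofNil, smul_zero, sub_zero]
    refine (ins_idC (A := Aʰ) _ (A.hcat.μ.isML n) p).trans (lsum_eq_zero fun d hd => ?_)
    by_cases hd₀ : d.mid.length = 0
    · have := AInfCat.length_of_mem_cuts3 p d hd
      rw [Cochain.hcat_μ_val_of_length _ _ (by simp; omega), smul_zero]
    · have e : (ofNil (A := Aʰ) (B := Aʰ) (f := fun X => X)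
          (g := fun X => X) c).arrow d.mid = (⟨red d.mid + 0, 0⟩ : d.Z ⟶ d.W) := by
        rw [arrow, ofNil_val _ _ _ hd₀]
      rw [e, A.hcat.μ.val_zero, smul_zero]

/-- A minimal model under which the vector fields agree is related to the Euler field also with
regard to the equivariant structures. The order-zero part of the homotopy and the equivariant
structures give operators which both induce the Euler field, so that they differ by a central family
of cohomology classes; the homotopy is corrected by the natural transformation which this family
defines. -/
theorem AInfFunctor.isRelated_of_homDC_eq (K : Contraction A)
    {ψ : AInfFunctor A.hcat A (fun X => X)}
    (hψ : ∀ {X Y : A.Ob} (n : ℤ) (a : A.HHom X Y n), ψ.lin n n a = K.i X Y n a)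
    (s : PureStructure A) (T : Cochain Aʰ Aᵍ (fun X => X) (fun X => X) 0)
    (hT : homDC ψ ψ T = ψ.postVF (eulerC Aʰ) - s.b.pre ψ.toCochain) :
    ψ.IsRelated (eulerPure A) s := by
  have hW : fieldDefect (A := A.hcat) A (eulerC _) s.b ψ.toCochain T = 0 := by
    refine ext fun {X Y} p n => ?_
    have h := congrArg (fun T => T.val p n) hT
    simp only [homDC_val', sub_val, show ((0 : ℤ) - 1) = -1 by norm_num, Int.negOnePow_neg,
      Int.negOnePow_one, Units.neg_smul, one_smul, sub_neg_eq_add] at h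
    rw [fieldDefect_val, zero_val]
    have h' := sub_eq_zero.2 h
    rw [← h']
    abel
  obtain ⟨t, ht⟩ : ∃ t : ∀ X : A.Ob, A.Hom X X 0, t = fun X =>
    T.val (.nil : Quiver.Path (V := A.hcat.Ob) X X) 0 := ⟨_, rfl⟩
  obtain ⟨N, hN⟩ : ∃ N : Cochain Aʰ Aᵍ (fun X => X) (fun X => X) 0,
    N = ofNil (A := Aʰ) t := ⟨_, rfl⟩
  have hN₀ : ∀ X, N.val (.nil : Quiver.Path (V := A.hcat.Ob) X X) 0 = t X := fun X => by
    rw [hN, ofNil_val_nil]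
  have hd : ∀ {X Y : A.hcat.Ob} (p : Path X Y) (n : ℤ), p.length ≤ 1 →
      (fieldDefect (A := A.hcat) A (eulerC _) s.b ψ.toCochain N).val p n
        + A.d (red p + 0) n ((T - N).val p (red p + 0)) = 0 := by
    intro X Y p n hp
    have hU : (T - N).VanishesBelow 1 := vanishesBelow_of_val fun {X Y} p hp => by
      cases p with
      | cons p a => simp at hp
      | nil =>
        rw [sub_val, sub_eq_zero]
        exact ((hN₀ X).trans (congrFun ht X)).symm
    have := fieldDefect_add_right ψ.toCochain N s.b hU p n hp
    rw [← this, add_sub_cancel, hW]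
    rfl
  have hψ₁ : ψ.toCochain.VanishesBelow 1 :=
    ⟨fun p n hp => val_eq_zero_of_length (by omega) ψ.val_nil⟩
  have hu : ∀ X : A.Ob, A.d 0 1 (t X - s.c X) = 0 := by
    intro X
    have h := congrArg (fun T => T.val (.nil : Quiver.Path (V := A.hcat.Ob) X X) 1) hW
    simp only [fieldDefect_val, zero_val] at h
    rw [ins_eq_leading _ _ (A.μ.isML _) _ (vanishesBelow_zero _),
      A.hcat_ins_μ_eq_zero (T.isML _) _ fun q hq => by simp at hq,
      ins_eulerC (ψ.isML _), ψ.val_nil, lsum_blocks_nil, smul_zero,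
      add_zero, sub_zero] at h
    have h₁ := s.d_c X
    rw [map_sub, h₁, sub_neg_eq_add, ht]
    exact h
  have hcomm : ∀ {X Y : A.Ob} {n : ℤ} (a : A.HHom X Y n),
      A.prod (t Y - s.c Y) (K.i X Y n a) n
        - A.prod (K.i X Y n a) (t X - s.c X) n
        ∈ A.exact X Y n := by
    intro X Y n a
    have h₁ := fieldDefect_add_left (0 : Cochain Aʰ Aᵍ _ _ 1)
      N s.b one_pos hψ₁ (str₁ (A := Aʰ) a) le_rfl
    have h₂ := hd (str₁ (A := Aʰ) a) (red (str₁ (A := Aʰ) a) + 1) le_rfl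
    have h₀ := fieldDefect_zero_ofNil s.b
      t (str₁ (A := Aʰ) a) rfl
    rw [← hN] at h₀
    rw [zero_add, h₀, zero_add, hN₀, hN₀] at h₁
    rw [h₁] at h₂
    have e : red (str₁ (A := Aʰ) a) + 1 = n := by simp [red]
    rw [e] at h₂
    have e₁ : ψ.val (str₁ (A := Aʰ) a) n = K.i X Y n a := hψ n a
    have h₃ := s.weightOp_sub_mem_exact (K.i X Y n a) (K.d_i a _)
    have e₂ : red (str₁ (A := Aʰ) a) + ((1 : ℕ) : ℤ) = n := by
      rw [Nat.cast_one, e]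
    have h₄ : weightOp s.b (t X) (t Y) (K.i X Y n a) - (n : k) • K.i X Y n a ∈ A.exact X Y n := by
      rw [e₁] at h₂
      have h₅ : ((red (str₁ (A := Aʰ) a)
          + ((str₁ (A := Aʰ) a).length : ℕ) : ℤ) : k) = (n : k) := congrArg _ e₂
      rw [h₅] at h₂
      rw [eq_neg_of_add_eq_zero_left h₂]
      exact neg_mem (A.d_mem_exact _)
    have h₅ := neg_mem (sub_mem h₄ h₃)
    rw [sub_sub_sub_cancel_right, weightOp_sub_weightOp, neg_sub] at h₅
    exact h₅
  obtain ⟨τ, hτ⟩ : ∃ τ : ∀ X : A.Ob, A.hcat.Hom X X 0, τ = fun X => A.cls ⟨_, hu X⟩ := ⟨_, rfl⟩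
  have hcent := AInfFunctor.homDC_ofNil_of_central (A := A) (c := τ) (fun {X Y} n a => by
    have := AInfCat.cls_prod_comm ⟨K.i X Y n a, K.d_i a _⟩ ⟨_, hu Y⟩ ⟨_, hu X⟩ (hcomm a)
    rw [cls_i K a] at this
    rw [hτ]
    exact this)
  refine ⟨T - insC (idC _) (idC _) (ofNil (A := Aʰ) (B := Aʰ)
    (f := fun X => X) (g := fun X => X) τ) ψ.toCochain 0, ?_, fun X => ?_⟩
  · have h₁ := homDC_insC (AInfFunctor.id A.hcat) (AInfFunctor.id A.hcat)
      (ofNil (A := Aʰ) (B := Aʰ) (f := fun X => X) τ) ψ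
    have e : ψ.comp (AInfFunctor.id A.hcat) = ψ := ext_toCochain (comp_idC ψ.toCochain)
    rw [hcent, insC_zero_left, e] at h₁
    refine (homDC_sub _ _ _ _).trans ((congrArg₂ (· - ·) hT h₁).trans (sub_zero _))
  · rw [sub_val, insC_nil, ofNil_val_nil]
    have e₀ : ψ.lin 0 0 ((eulerPure A).c X) = 0 := map_zero (ψ.lin 0 0)
    have e₁ : ψ.lin 0 0 (τ X) = K.i X X 0 (A.cls ⟨_, hu X⟩) := by
      rw [hτ]
      exact hψ 0 _
    rw [e₀, sub_zero, e₁]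
    have h₁ : T.val (.nil : Quiver.Path (V := A.hcat.Ob) X X) 0 = t X := (congrFun ht X).symm
    obtain ⟨η, hη⟩ := (A.homologous_iff_cls ⟨_, hu X⟩
      ⟨_, K.d_i (A.cls ⟨_, hu X⟩) _⟩).2 (cls_i K _).symm
    refine ⟨η, hη.trans ?_⟩
    rw [h₁]
    exact sub_right_comm _ _ _

end Central

/-! ### Natural transformations in order zero -/

namespace AInfCat

variable {B : AInfCat k}

theorem hcat_prod_assoc {X Y Z W : B.hcat.Ob} {p q r : ℤ} (c : B.hcat.Hom Z W r)
    (b : B.hcat.Hom Y Z q) (a : B.hcat.Hom X Y p) {m₁ m₂ m : ℤ} (h₁ : m₁ = p + q)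
    (h₂ : m₂ = q + r) :
    B.hcat.prod c (B.hcat.prod b a m₁) m = B.hcat.prod (B.hcat.prod c b m₂) a m := by
  subst h₁ h₂
  have h := hcat_assoc (B := B) (⟨p, a⟩ : X ⟶ Y) (⟨q, b⟩ : Y ⟶ Z) (⟨r, c⟩ : Z ⟶ W) m
  rw [B.hcat.μ.arrow_eq (N := p + q) _ (by simp only [red]; ring),
    B.hcat.μ.arrow_eq (N := q + r) _ (by simp only [red]; ring)] at h
  have e₁ : B.hcat.prod c (B.hcat.prod b a (p + q)) m = (p + q).negOnePow • p.negOnePow •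
      B.hcat.μ.val ((Quiver.Path.nil.cons (⟨p + q, B.hcat.μ.val (str₂ (A := Bʰ) b a) (p + q)⟩ : X ⟶ Z)).cons
        (⟨r, c⟩ : Z ⟶ W)) m :=
    congrArg (fun y => (p + q).negOnePow • y)
      (((B.hcat.μ.isML m).cons (⟨r, c⟩ : Z ⟶ W)).insert_units_smul .nil (p + q) _ _ .nil)
  have e₂ : B.hcat.prod (B.hcat.prod c b (q + r)) a m = p.negOnePow • q.negOnePow •
      B.hcat.μ.val ((Quiver.Path.nil.cons (⟨p, a⟩ : X ⟶ Y)).cons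
        (⟨q + r, B.hcat.μ.val (str₂ (A := Bʰ) c b) (q + r)⟩ : Y ⟶ W)) m :=
    congrArg (fun y => p.negOnePow • y)
      ((B.hcat.μ.isML m).insert_units_smul (Quiver.Path.nil.cons (⟨p, a⟩ : X ⟶ Y)) (q + r) _ _ .nil)
  rw [e₁, e₂]
  refine (congrArg (fun y => (p + q).negOnePow • p.negOnePow • y) h).trans ?_
  rw [smul_smul, smul_smul, smul_smul, ← Int.negOnePow_add, ← Int.negOnePow_add, ← Int.negOnePow_add]
  refine congrArg₂ (· • ·) (negOnePow_congr ⟨p, by ring⟩) rfl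

theorem hcat_prod_unit {X Y : B.hcat.Ob} {n : ℤ} (a : B.hcat.Hom X Y n) :
    B.hcat.prod a (B.hUnit X) n = a := by
  obtain ⟨η, hη⟩ := (B.isCohUnit_hUnit X).right_unit a rfl
  exact sub_eq_zero.1 (hη.symm.trans rfl)

theorem hcat_unit_prod {X Y : B.hcat.Ob} {n : ℤ} (a : B.hcat.Hom X Y n) :
    B.hcat.prod (B.hUnit Y) a n = a := by
  obtain ⟨η, hη⟩ := (B.isCohUnit_hUnit Y).left_unit a rfl
  exact sub_eq_zero.1 (hη.symm.trans rfl)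

end AInfCat

theorem AInfCat.eq_hUnit {B : AInfCat k} {X : B.hcat.Ob} {e : B.hcat.Hom X X 0}
    (he : B.hcat.IsCohUnit e) : e = B.hUnit X := by
  obtain ⟨η, hη⟩ := he.left_unit (B.hUnit X)
    (hcat_μ_val_of_length (B := B) (str₁ (A := Bʰ) (B.hUnit X)) _ (by simp [str₁]))
  have h : B.hcat.prod e (B.hUnit X) 0 - B.hUnit X = 0 :=
    hη.symm.trans (hcat_μ_val_of_length (B := B) (str₁ (A := Bʰ) η) _
      (by simp [str₁]))
  rw [AInfCat.hcat_prod_unit] at h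
  exact sub_eq_zero.mp h

namespace AInfFunctor

section Naturality

variable {A : AInfCat k} {B : AInfCat k} {f g h : A.hcat.Ob → B.hcat.Ob}

theorem NatEquiv.symm {A : AInfCat k} {f g : A.Ob → B.hcat.Ob}
    {F : AInfFunctor A B.hcat f} {G : AInfFunctor A B.hcat g} (h : NatEquiv (B := B) F G) :
    NatEquiv (B := B) G F := by
  obtain ⟨T, S, U, V, h₁, h₂, h₃, h₄⟩ := (natEquiv_iff F G).1 h
  exact (natEquiv_iff G F).2 ⟨S, T, V, U, h₂, h₁, h₄, h₃⟩

theorem starC_val_nil {Q : GrQuiver k} {f g h : Q.Ob → B.hcat.Ob}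
    (S : Cochain Q Bʰ g h 0) (T : Cochain Q Bʰ f g 0) (X : Q.Ob) :
    (starC S T 0).val (.nil : Path X X) 0
      = B.hcat.prod (S.val (.nil : Path X X) 0) (T.val (.nil : Path X X) 0) 0 := by
  have hT : T.arrow (.nil : Path X X)
      = (⟨0, T.val (.nil : Path X X) 0⟩ : f X ⟶ g X) := arrow_eq (N := 0) _ _ (by simp [red])
  have hS : S.arrow (.nil : Path X X)
      = (⟨0, S.val (.nil : Path X X) 0⟩ : g X ⟶ h X) := arrow_eq (N := 0) _ _ (by simp [red])
  rw [starC_val]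
  simp only [cuts2, lsum, List.map_cons, List.map_nil, List.sum_cons, List.sum_nil, add_zero]
  rw [hT, hS]
  exact congrArg₂ (· • ·) (negOnePow_congr ⟨0, by simp [red]⟩) rfl

theorem hcat_linD {d : ℤ} (T : Cochain Aʰ Bʰ f g d) :
    linD (A := A.hcat) (B := B.hcat) T = 0 := by
  rw [linD, hcat_thenC_μ, AInfCat.hcat_d₁, insC_zero_left, smul_zero, sub_zero]

/-- The order-one part of the differential of a transformation between functors of graded
categories measures the failure of its order-zero part to be natural. -/
theorem hcat_homDC_str (F : AInfFunctor A.hcat B.hcat f) (G : AInfFunctor A.hcat B.hcat g)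
    (T : Cochain Aʰ Bʰ f g 0) {X Y : A.hcat.Ob} {n : ℤ}
    (a : A.hcat.Hom X Y n) :
    (homDC F G T).val (str₁ (A := Aʰ) a) n
      = B.hcat.prod (G.lin n n a) (T.val (.nil : Path X X) 0) n
        - B.hcat.prod (T.val (.nil : Path Y Y) 0) (F.lin n n a) n := by
  have hR : (T - ofNil (A := Aʰ) fun X => T.val (.nil : Path X X) 0).VanishesBelow 1 :=
    vanishesBelow_of_val fun {X Y} p hp => by
      cases p with
      | cons p a => simp at hp
      | nil =>
        refine (?_ : ∀ i : ℤ, i = 0 → (T - ofNil (A := Aʰ) fun X =>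
          T.val (.nil : Path X X) 0).val (.nil : Path X X) i = 0) _ (by simp [red])
        rintro i rfl
        rw [sub_val, ofNil_val_nil, sub_self]
  have h := homDC_leading F G (str₁ (A := Aʰ) a) n hR
  rw [hcat_linD, homDC_sub, sub_val, zero_val, sub_eq_zero] at h
  exact h.trans (homDC_ofNil_str (A := A.hcat) F G _ a)

theorem NatEquiv.exists_inverse {F : AInfFunctor A.hcat B.hcat f} {G : AInfFunctor A.hcat B.hcat g}
    (h : NatEquiv (B := B) F G) :
    ∃ (T : Cochain Aʰ Bʰ f g 0)
      (S : Cochain Aʰ Bʰ g f 0),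
      homDC F G T = 0 ∧ homDC G F S = 0 ∧
      (∀ X : A.hcat.Ob, B.hcat.prod (S.val (.nil : Path X X) 0)
        (T.val (.nil : Path X X) 0) 0 = B.hUnit (f X)) ∧
      ∀ X : A.hcat.Ob, B.hcat.prod (T.val (.nil : Path X X) 0)
        (S.val (.nil : Path X X) 0) 0 = B.hUnit (g X) := by
  obtain ⟨T, S, U, V, h₁, h₂, h₃, h₄⟩ := (natEquiv_iff F G).1 h
  refine ⟨T, S, h₁, h₂, fun X => ?_, fun X => ?_⟩
  · have h := h₃ (.nil : Path X X) 0
    rw [homDC_leading F F (d := -1) _ _ (vanishesBelow_zero _), sub_val, starC_val_nil, unitC,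
      ofNil_val_nil, hcat_linD] at h
    exact sub_eq_zero.1 h.symm
  · have h := h₄ (.nil : Path X X) 0
    rw [homDC_leading G G (d := -1) _ _ (vanishesBelow_zero _), sub_val, starC_val_nil, unitC,
      ofNil_val_nil, hcat_linD] at h
    exact sub_eq_zero.1 h.symm

/-- A natural transformation whose order-zero part has an inverse is an equivalence. -/
theorem natEquiv_of_nil {F : AInfFunctor A.hcat B.hcat f} {G : AInfFunctor A.hcat B.hcat g}
    {T : Cochain Aʰ Bʰ f g 0} (hT : homDC F G T = 0)
    (s : ∀ X, B.hcat.Hom (g X) (f X) 0)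
    (h₁ : ∀ X : A.hcat.Ob, B.hcat.prod (s X) (T.val (.nil : Path X X) 0) 0 = B.hUnit (f X))
    (h₂ : ∀ X : A.hcat.Ob, B.hcat.prod (T.val (.nil : Path X X) 0) (s X) 0 = B.hUnit (g X)) :
    NatEquiv (B := B) F G := by
  have key : ∀ {g : A.hcat.Ob → B.hcat.Ob} (R : Cochain Aʰ Bʰ g g 0),
      (∀ X : A.hcat.Ob, R.val (.nil : Path X X) 0 = B.hUnit (g X)) →
      (R - unitC g).VanishesBelow 1 := fun {g'} R hR => by
    refine vanishesBelow_of_val fun {X Y} p hp => ?_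
    cases p with
    | cons p a => simp at hp
    | nil =>
      refine (?_ : ∀ i : ℤ, i = 0 → (R - unitC (B := B) g').val (.nil : Path X X) i = 0) _
        (by simp [red])
      rintro i rfl
      rw [sub_val, hR, unitC, ofNil_val_nil, sub_self]
  refine natEquiv_of_invertible F G T (ofNil (A := Aʰ) s) hT (key _ fun X => ?_)
    (key _ fun X => ?_)
  · rw [starC_val_nil, ofNil_val_nil, h₁]
  · rw [starC_val_nil, ofNil_val_nil, h₂]

theorem NatEquiv.trans {F : AInfFunctor A.hcat B.hcat f} {G : AInfFunctor A.hcat B.hcat g}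
    {H : AInfFunctor A.hcat B.hcat h} (hFG : NatEquiv (B := B) F G)
    (hGH : NatEquiv (B := B) G H) : NatEquiv (B := B) F H := by
  obtain ⟨T, S, hT, -, hST, hTS⟩ := hFG.exists_inverse
  obtain ⟨T', S', hT', -, hST', hTS'⟩ := hGH.exists_inverse
  refine natEquiv_of_nil (T := starC T' T 0)
    (by rw [homDC_starC F G H T' T 0 rfl, hT, hT', starC_zero_left, starC_zero_right, smul_zero,
      sub_zero])
    (fun X => B.hcat.prod (S.val (.nil : Path X X) 0)
      (S'.val (.nil : Path X X) 0) 0) (fun X => ?_) (fun X => ?_)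
  · rw [starC_val_nil, B.hcat_prod_assoc (m₂ := 0) _ _ _ (by ring) (by ring),
      ← B.hcat_prod_assoc (m₁ := 0) (S.val _ 0) _ _ (by ring) (by ring), hST', B.hcat_prod_unit, hST]
  · rw [starC_val_nil, B.hcat_prod_assoc (m₂ := 0) _ _ _ (by ring) (by ring),
      ← B.hcat_prod_assoc (m₁ := 0) (T'.val _ 0) _ _ (by ring) (by ring), hTS, B.hcat_prod_unit, hTS']

theorem NatEquiv.comp_right {C : AInfCat k} {c : C.hcat.Ob → A.hcat.Ob}
    {F : AInfFunctor A.hcat B.hcat f} {G : AInfFunctor A.hcat B.hcat g}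
    (hFG : NatEquiv (B := B) F G) (K : AInfFunctor C.hcat A.hcat c) :
    NatEquiv (B := B) (F.comp K) (G.comp K) := by
  obtain ⟨T, S, hT, -, hST, hTS⟩ := hFG.exists_inverse
  have e : ∀ X : C.hcat.Ob, (T.pre K.toCochain).val (.nil : Path X X) 0
      = T.val (.nil : Quiver.Path (V := A.hcat.Ob) (c X) (c X)) 0 := fun X =>
    lsum_blocks_nil K.toCochain fun r => T.val r 0
  refine natEquiv_of_nil (T := T.pre K.toCochain) (by rw [homDC_pre, hT, zero_pre])
    (fun X => S.val (.nil : Quiver.Path (V := A.hcat.Ob) (c X) (c X)) 0) (fun X => ?_)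
    (fun X => ?_)
  · rw [e]
    exact hST (c X)
  · rw [e]
    exact hTS (c X)

/-- A functor to a graded category turns a natural transformation whose order-zero part represents
the units into an equivalence. -/
theorem natEquiv_comp_of_unit {f : A.hcat.Ob → B.Ob} {G₀ G₁ : AInfFunctor A.hcat B f}
    {T : Cochain Aʰ Bᵍ f f 0} (hT : homDC G₀ G₁ T = 0)
    (hT₀ : ∀ X : A.hcat.Ob, T.val (.nil : Path X X) 0 = B.unit (f X))
    (θ : AInfFunctor B B.hcat (fun X => X)) :
    NatEquiv (B := B) (θ.comp G₀) (θ.comp G₁) := by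
  have e : ∀ X : A.hcat.Ob, (insC G₀.toCochain G₁.toCochain T θ.toCochain 0).val
      (.nil : Path X X) 0 = B.hUnit (f X) := fun X => by
    rw [insC_nil]
    exact (congrArg (θ.lin 0 0) (hT₀ X)).trans
      (AInfCat.eq_hUnit (θ.unital _ (B.isCohUnit_unit (f X))))
  refine natEquiv_of_nil (T := insC G₀.toCochain G₁.toCochain T θ.toCochain 0)
    (by rw [homDC_insC, hT, insC_zero_left]) (fun X => B.hUnit (f X)) (fun X => ?_) (fun X => ?_)
  · rw [e]
    exact B.hcat_unit_prod _
  · rw [e]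
    exact B.hcat_unit_prod _

/-- A functor which is equivalent to the identity induces isomorphisms on morphism spaces. -/
theorem NatEquiv.bijective_lin {F : AInfFunctor A.hcat A.hcat (fun X => X)}
    (h : NatEquiv (B := A) F (AInfFunctor.id A.hcat)) (X Y : A.hcat.Ob) (n : ℤ) :
    Function.Bijective (F.lin (X := X) (Y := Y) n n) := by
  obtain ⟨T, S, hT, -, hst, hts⟩ := h.exists_inverse
  set t := fun X : A.hcat.Ob => T.val (.nil : Path X X) 0
  set s := fun X : A.hcat.Ob => S.val (.nil : Path X X) 0
  have hid : ∀ {X Y : A.hcat.Ob} (a : A.hcat.Hom X Y n),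
      (AInfFunctor.id A.hcat).lin n n a = a := fun {X Y} a =>
    ofLin_lin (A := Aʰ) (fun _ _ _ => LinearMap.id) n a
  have hn' : ∀ {X Y : A.hcat.Ob} (a : A.hcat.Hom X Y n),
      A.hcat.prod a (t X) n = A.hcat.prod (t Y) (F.lin n n a) n := fun {X Y} a => by
    have h := hcat_homDC_str F (AInfFunctor.id A.hcat) T a
    rw [hT, hid] at h
    exact sub_eq_zero.1 h.symm
  constructor
  · rw [injective_iff_map_eq_zero]
    intro a ha
    have h₁ := hn' a
    rw [ha, A.hcat.prod_zero] at h₁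
    rw [← A.hcat_prod_unit a, ← hts X, A.hcat_prod_assoc (m₂ := n) a (t X) (s X) (by ring) (by ring), h₁,
      A.hcat.zero_prod]
  · intro b
    refine ⟨A.hcat.prod (A.hcat.prod (t Y) b n) (s X) n, ?_⟩
    have h₁ := hn' (A.hcat.prod (A.hcat.prod (t Y) b n) (s X) n)
    rw [← A.hcat_prod_assoc (m₁ := 0) _ (s X) (t X) (by ring) (by ring), hst, A.hcat_prod_unit] at h₁
    have h₂ := congrArg (fun y => A.hcat.prod (s Y) y n) h₁
    simp only at h₂
    rw [A.hcat_prod_assoc (m₂ := 0) _ _ _ (by ring) (by ring), hst, A.hcat_unit_prod,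
      A.hcat_prod_assoc (m₂ := 0) _ _ _ (by ring) (by ring), hst, A.hcat_unit_prod] at h₂
    exact h₂.symm

end Naturality

end AInfFunctor

/-! ### Cancelling the formality equivalence on the target -/

namespace AInfFunctor

section Cancel

variable {A : AInfCat k} {B : AInfCat k} {f g : A.hcat.Ob → B.Ob}

theorem linD_hcat_val {d : ℤ} (T : Cochain Aʰ Bᵍ f g d)
    {X Y : A.hcat.Ob} (p : Path X Y) (n : ℤ) :
    (linD (A := A.hcat) T).val p n = B.d (red p + d) n (T.val p (red p + d)) := by
  rw [linD_val, AInfCat.hcat_d₁, ins_zero_left _ _ (T.isML n), smul_zero, sub_zero]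

theorem insC_leading {Q : GrQuiver k} {R : GrQuiver k}
    {S₀ : GrQuiver k} {f g : Q.Ob → R.Ob} {h h' : R.Ob → S₀.Ob} {d e : ℤ}
    (F : Cochain Q R f f 1) (G : Cochain Q R g g 1)
    {T : Cochain Q R f g d} (S : Cochain R S₀ h h' e) (r : ℤ) (hr : r = d + e - 1) {X Y : Q.Ob}
    (p : Path X Y) (n : ℤ) (hT : T.VanishesBelow p.length) :
    (insC F G T S r hr).val p n = S.lin (red p + d) n (T.val p (red p + d)) :=
  ins_eq_leading F G (S.isML n) p hT

theorem _root_.AInf.Cochain.VanishesBelow.insC {Q : GrQuiver k}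
    {R : GrQuiver k}
    {S₀ : GrQuiver k} {f g : Q.Ob → R.Ob} {h h' : R.Ob → S₀.Ob} {d e : ℤ}
    {T : Cochain Q R f g d} {m : ℕ} (hT : T.VanishesBelow m)
    (F : Cochain Q R f f 1) (G : Cochain Q R g g 1)
    (S : Cochain R S₀ h h' e) (r : ℤ) (hr : r = d + e - 1) :
    (Cochain.insC F G T S r hr).VanishesBelow m :=
  ⟨fun p n hp => ins_eq_zero F G (S.isML n) p hT hp⟩

variable {θ : AInfFunctor B B.hcat (fun X => X)}

/-- One order of the construction in `exists_lift_of_insC`: the term `U₁` is a primitive of the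
error in the equation for the differential, which exists because `θ` detects coboundaries, and the
term `U₂` consists of cocycles that represent the remaining error after composition with `θ`. -/
theorem exists_lift_of_insC_step
    (hθ : ∀ {X Y : B.Ob} {n : ℤ} (x : B.Hom X Y n), B.d n (n + 1) x = 0 →
      θ.lin n n x = 0 → x ∈ B.exact X Y n)
    (σ : ∀ (X Y : B.Ob) (n : ℤ), B.HHom X Y n →ₗ[k] B.Hom X Y n)
    (hσ : ∀ (X Y : B.Ob) (n m : ℤ) (y : B.HHom X Y n), B.d n m (σ X Y n y) = 0)
    (hθσ : ∀ (X Y : B.Ob) (n : ℤ) (y : B.HHom X Y n), θ.lin n n (σ X Y n y) = y)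
    (G : AInfFunctor A.hcat B f) (c : Cochain Aʰ Bᵍ f f (0 + 1))
    (hc : homDC G G c = 0) (T : Cochain Aʰ Bʰ f f 0)
    (hT : homDC (θ.comp G) (θ.comp G) T = insC G.toCochain G.toCochain c θ.toCochain 1)
    {m : ℕ} {X : Cochain Aʰ Bᵍ f f 0}
    (hZ : (c - homDC G G X).VanishesBelow m)
    (hY : (T - insC G.toCochain G.toCochain X θ.toCochain 0).VanishesBelow m) :
    ∃ X', (X' - X).VanishesBelow m ∧ (c - homDC G G X').VanishesBelow (m + 1) ∧
      (T - insC G.toCochain G.toCochain X' θ.toCochain 0).VanishesBelow (m + 1) := by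
  obtain ⟨Z, hZ'⟩ : ∃ Z, Z = c - homDC G G X := ⟨_, rfl⟩
  obtain ⟨Y, hY'⟩ : ∃ Y : Cochain Aʰ Bʰ f f 0,
    Y = T - insC G.toCochain G.toCochain X θ.toCochain 0 := ⟨_, rfl⟩
  rw [← hZ'] at hZ
  rw [← hY'] at hY
  have hZc : homDC G G Z = 0 := by
    rw [hZ', homDC_sub, hc, sub_eq_zero]
    exact (homDC_homDC G G X).symm
  have hdZ : ∀ {U V : A.hcat.Ob} (p : Path U V) (n : ℤ), p.length = m →
      B.d (red p + (0 + 1)) n (Z.val p (red p + (0 + 1))) = 0 := by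
    intro U V p n hp
    rw [← linD_hcat_val, ← homDC_leading G G p n (hp ▸ hZ), hZc]
    rfl
  have hδY : homDC (θ.comp G) (θ.comp G) Y
      = insC G.toCochain G.toCochain Z θ.toCochain 1 := by
    have h₁ := homDC_insC G G X θ
    rw [hY', hZ', insC_sub_left]
    refine (homDC_sub _ _ _ _).trans (congrArg₂ (· - ·) hT h₁)
  have hE : ∀ {U V : A.hcat.Ob} (p : Path U V), p.length = m →
      Z.val p (red p + (0 + 1)) ∈ B.exact (f U) (f V) (red p + (0 + 1)) := by
    intro U V p hp
    refine hθ _ (hdZ p _ hp) ?_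
    rw [← insC_leading G.toCochain G.toCochain θ.toCochain 1 rfl p _ (hp ▸ hZ), ← hδY]
    refine (homDC_leading (θ.comp G) (θ.comp G) p _ (hp ▸ hY)).trans ?_
    rw [hcat_linD]
    rfl
  obtain ⟨U₁, hU₁⟩ : ∃ U₁ : Cochain Aʰ Bᵍ f f 0,
    U₁ = Z.thenC B.primC 0 := ⟨_, rfl⟩
  have hU₁m : U₁.VanishesBelow m := hU₁ ▸ hZ.thenC_primC 0 (by norm_num)
  have hU₁d : ∀ {U V : A.hcat.Ob} (p : Path U V), p.length = m →
      B.d (red p + 0) (red p + (0 + 1)) (U₁.val p (red p + 0)) = Z.val p (red p + (0 + 1)) := by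
    intro U V p hp
    rw [hU₁]
    exact d_thenC_primC Z p 0 (by norm_num) (hE p hp)
  obtain ⟨Y₁, hY₁⟩ : ∃ Y₁ : Cochain Aʰ Bʰ f f 0,
    Y₁ = Y - insC G.toCochain G.toCochain U₁ θ.toCochain 0 := ⟨_, rfl⟩
  have hY₁m : Y₁.VanishesBelow m := hY₁ ▸ hY.sub (hU₁m.insC _ _ _ _ _)
  obtain ⟨U₂, hU₂⟩ : ∃ U₂ : Cochain Aʰ Bᵍ f f 0,
    U₂ = Y₁.thenC (Cochain.ofLin (A := Bʰ) σ) 0 := ⟨_, rfl⟩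
  have hU₂v : ∀ {U V : A.hcat.Ob} (p : Path U V),
      U₂.val p (red p + 0) = σ _ _ _ (Y₁.val p (red p + 0)) := by
    intro U V p
    rw [hU₂, thenC_val]
    exact ofLin_lin (A := Bʰ) σ _ _
  have hU₂m : U₂.VanishesBelow m := vanishesBelow_of_val fun p hp => by
    rw [hU₂v, hY₁m.eq_zero p _ hp]
    exact map_zero (σ _ _ _)
  have e₁ : c - homDC G G (X + U₁ + U₂) = Z - homDC G G U₁ - homDC G G U₂ := by
    rw [homDC_add, homDC_add, hZ']
    abel
  have e₂ : T - insC G.toCochain G.toCochain (X + U₁ + U₂) θ.toCochain 0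
      = Y₁ - insC G.toCochain G.toCochain U₂ θ.toCochain 0 := by
    rw [insC_add_left, insC_add_left, hY₁, hY']
    abel
  refine ⟨X + U₁ + U₂, ?_, ?_, ?_⟩
  · rw [add_assoc, add_sub_cancel_left]
    exact hU₁m.add hU₂m
  · rw [e₁]
    refine ((hZ.sub (vanishesBelow_homDC G G hU₁m)).sub (vanishesBelow_homDC G G hU₂m)).succ ?_
    intro U V p n hp
    by_cases hn : n = red p + (0 + 1)
    · subst hn
      rw [sub_val, sub_val, homDC_leading G G p _ (hp ▸ hU₁m), homDC_leading G G p _ (hp ▸ hU₂m),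
        linD_hcat_val, linD_hcat_val, hU₁d p hp, hU₂v, hσ, sub_self, sub_zero]
    · exact val_eq_zero _ _ _ (by omega)
  · rw [e₂]
    refine (hY₁m.sub (hU₂m.insC _ _ _ _ _)).succ ?_
    intro U V p n hp
    by_cases hn : n = red p + 0
    · subst hn
      rw [sub_val, insC_leading _ _ _ _ _ _ _ (hp ▸ hU₂m), hU₂v, hθσ, sub_self]
    · exact val_eq_zero _ _ _ hn

/-- Composition with a functor `θ : B → H B` which is a quasi-isomorphism on morphisms is
injective on the cohomology of the complexes of pre-natural transformations. -/
theorem exists_lift_of_insC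
    (hθ : ∀ {X Y : B.Ob} {n : ℤ} (x : B.Hom X Y n), B.d n (n + 1) x = 0 →
      θ.lin n n x = 0 → x ∈ B.exact X Y n)
    (σ : ∀ (X Y : B.Ob) (n : ℤ), B.HHom X Y n →ₗ[k] B.Hom X Y n)
    (hσ : ∀ (X Y : B.Ob) (n m : ℤ) (y : B.HHom X Y n), B.d n m (σ X Y n y) = 0)
    (hθσ : ∀ (X Y : B.Ob) (n : ℤ) (y : B.HHom X Y n), θ.lin n n (σ X Y n y) = y)
    (G : AInfFunctor A.hcat B f) (c : Cochain Aʰ Bᵍ f f (0 + 1))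
    (hc : homDC G G c = 0) (T : Cochain Aʰ Bʰ f f 0)
    (hT : homDC (θ.comp G) (θ.comp G) T = insC G.toCochain G.toCochain c θ.toCochain 1)
    (x₀ : ∀ U : A.hcat.Ob, B.Hom (f U) (f U) 0)
    (hx : ∀ U : A.hcat.Ob, B.d 0 1 (x₀ U) = c.val (.nil : Path U U) 1)
    (hx' : ∀ U : A.hcat.Ob, θ.lin 0 0 (x₀ U) = T.val (.nil : Path U U) 0) :
    ∃ X, homDC G G X = c ∧ ∀ U : A.hcat.Ob, X.val (.nil : Path U U) 0 = x₀ U := by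
  have h₀ : (c - homDC G G (ofNil x₀)).VanishesBelow 1 := by
    refine vanishesBelow_of_val fun {U V} p hp => ?_
    cases p with
    | cons p a => simp at hp
    | nil =>
      rw [sub_val, homDC_leading G G _ _ (vanishesBelow_zero _), linD_hcat_val]
      refine sub_eq_zero.2 ((hx U).symm.trans ?_)
      exact congrArg (B.d 0 1) (ofNil_val_nil x₀ U).symm
  have h₁ : (T - insC G.toCochain G.toCochain (ofNil x₀) θ.toCochain 0).VanishesBelow 1 := by
    refine vanishesBelow_of_val fun {U V} p hp => ?_
    cases p with
    | cons p a => simp at hp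
    | nil =>
      rw [sub_val, insC_nil, ofNil_val_nil]
      exact sub_eq_zero.2 (hx' U).symm
  obtain ⟨s, hs, hs'⟩ := exists_seq_of_step
    (fun m X => (X - ofNil x₀).VanishesBelow 1 ∧ (c - homDC G G X).VanishesBelow (m + 1) ∧
      (T - insC G.toCochain G.toCochain X θ.toCochain 0).VanishesBelow (m + 1))
    (fun m X X' => (X' - X).VanishesBelow m)
    ⟨ofNil x₀, by rw [sub_self]; exact ⟨fun _ _ _ => rfl⟩, h₀, h₁⟩
    (fun m X hX => by
      obtain ⟨X', h, h', h''⟩ := exists_lift_of_insC_step hθ σ hσ hθσ G c hc T hT hX.2.1 hX.2.2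
      refine ⟨X', ⟨?_, h', h''⟩, h.mono (Nat.le_succ m)⟩
      rw [← sub_add_sub_cancel X' X]
      exact (h.mono (by omega)).add hX.1)
  obtain ⟨L, hL⟩ := exists_limit s hs'
  refine ⟨L, ?_, fun U => ?_⟩
  · refine (sub_eq_zero.1 (eq_zero_of_vanishesBelow fun m => ?_)).symm
    have e : c - homDC G G L = (c - homDC G G (s m)) - homDC G G (L - s m) := by
      rw [homDC_sub]
      abel
    rw [e]
    exact ((hs m).2.1.mono (Nat.le_succ m)).sub (vanishesBelow_homDC G G (hL m))
  · have h := ((hL 1).add (hs 1).1).eq_zero (.nil : Path U U) 0 (by simp)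
    rw [sub_add_sub_cancel, sub_val, ofNil_val_nil] at h
    exact sub_eq_zero.1 h

end Cancel

section Post

variable {A : AInfCat k} {B : AInfCat k} {f : A.hcat.Ob → B.Ob}

/-- Composition with a functor `B → H B` that inverts a minimal model can be cancelled on the left.
The order-zero part of the homotopy is prescribed to be the equivariant structure of `B`. -/
theorem IsRelated.of_comp_left (K : Contraction B) {θ : AInfFunctor B B.hcat (fun X => X)}
    (hL : ∀ (X Y : B.Ob) (n : ℤ), Function.Bijective
      ((θ.lin n n).comp (K.i X Y n) : B.HHom X Y n →ₗ[k] B.hcat.Hom X Y n))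
    {sB : PureStructure B} (h : θ.IsRelated sB (eulerPure B))
    {G : AInfFunctor A.hcat B f} (hG : (θ.comp G).IsRelated (eulerPure A) (eulerPure B)) :
    G.IsRelated (eulerPure A) sB := by
  obtain ⟨S, hS, hS₀⟩ := h
  obtain ⟨T, hT, hT₀⟩ := hG
  have hex : ∀ {X Y : B.Ob} {n : ℤ} {y : B.hcat.Hom X Y n}, y ∈ B.hcat.exact X Y n → y = 0 := by
    rintro X Y n _ ⟨η, rfl⟩
    rfl
  have hc : homDC G G (G.postVF (eulerPure A).b - sB.b.pre G.toCochain) = 0 := by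
    rw [homDC_sub, homDC_postVF G (eulerPure A).homDC_b, homDC_pre_VF G sB.homDC_b, sub_zero]
  have h₁ : ∀ {X Y : B.Ob} {n : ℤ} (x : B.Hom X Y n), B.d n (n + 1) x = 0 →
      θ.lin n n x = 0 → x ∈ B.exact X Y n := by
    intro X Y n x hx hx₀
    have h₁ : B.Homologous (K.i X Y n (B.cls ⟨x, hx⟩)) x :=
      (B.homologous_iff_cls ⟨_, K.d_i (B.cls ⟨x, hx⟩) _⟩ ⟨x, hx⟩).2 (cls_i K _)
    obtain ⟨η, hη⟩ := h₁
    have h₂ : θ.lin n n (K.i X Y n (B.cls ⟨x, hx⟩)) = 0 := by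
      have := hex (θ.lin_mem_exact ⟨η, hη⟩)
      rw [map_sub, hx₀] at this
      exact (sub_zero _).symm.trans this
    have h₃ : B.cls ⟨x, hx⟩ = 0 := (hL X Y n).1 (h₂.trans (map_zero _).symm)
    obtain ⟨ζ, hζ⟩ := (B.cls_eq_zero _).1 h₃
    exact ⟨ζ, hζ⟩
  have h₂ : ∀ U : A.hcat.Ob, B.d 0 1 (sB.c (f U))
      = (G.postVF (eulerPure A).b - sB.b.pre G.toCochain).val (.nil : Path U U) 1 := by
    intro U
    have e₁ : (eulerPure A).b.val (.nil : Path U U) 1 = 0 := rfl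
    have e₂ : (sB.b.pre G.toCochain).val (.nil : Path U U) 1
        = sB.b.val (.nil : Path (f U) (f U)) 1 := lsum_blocks_nil G.toCochain _
    rw [sB.d_c, sub_val, insC_nil, e₁, e₂, map_zero, zero_sub]
  have h₃ : ∀ U : A.hcat.Ob, θ.lin 0 0 (sB.c (f U))
      = (T - S.pre G.toCochain).val (.nil : Path U U) 0 := by
    intro U
    have e₀ : (S.pre G.toCochain).val (.nil : Path U U) 0
        = S.val (.nil : Path (f U) (f U)) 0 := lsum_blocks_nil G.toCochain _
    have e₁ : (θ.comp G).lin 0 0 ((eulerPure A).c U) = 0 :=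
      map_zero ((θ.comp G).lin 0 0)
    have e₂ : (eulerPure B).c (f U) = 0 := rfl
    have h₁ := hex (hT₀ U)
    have h₂ := hex (hS₀ (f U))
    rw [e₁, e₂, sub_zero, sub_zero] at h₁
    rw [e₂, zero_sub, sub_neg_eq_add] at h₂
    rw [sub_val, e₀, h₁, zero_sub]
    exact eq_neg_of_add_eq_zero_right h₂
  obtain ⟨X, hX, hX₀⟩ := exists_lift_of_insC (θ := θ) h₁
    (fun X Y n => (K.i X Y n).comp (LinearEquiv.ofBijective _ (hL X Y n)).symm.toLinearMap)
    (fun X Y n m y => K.d_i _ _)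
    (fun X Y n y => (LinearEquiv.ofBijective _ (hL X Y n)).apply_symm_apply y)
    G (G.postVF (eulerPure A).b - sB.b.pre G.toCochain) hc (T - S.pre G.toCochain)
    (homDC_sub_pre G θ hS hT) (fun U => sB.c (f U)) h₂ h₃
  refine ⟨X, hX, fun U => ?_⟩
  have e : G.lin 0 0 ((eulerPure A).c U) = 0 := map_zero (G.lin 0 0)
  rw [hX₀, e, sub_zero, sub_self]
  exact zero_mem _

end Post

end AInfFunctor

/-! ### Formal functors relate the vector fields -/

theorem comp_lin {A : GrQuiver k} {B : GrQuiver k}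
    {C : GrQuiver k} {f : A.Ob → B.Ob} {g : B.Ob → C.Ob} (G : Cochain B C g g 1)
    (F : Cochain A B f f 1) {X Y : A.Ob} {n : ℤ} (a : A.Hom X Y n) :
    (G.comp F).lin n n a = G.lin n n (F.lin n n a) := by
  have hF : F.arrow (str₁ a) = (⟨n, F.lin n n a⟩ : f X ⟶ f Y) :=
    arrow_eq (N := n) _ _ (by simp [red])
  refine (List.sum_singleton (x := G.val (Quiver.Path.nil.cons (F.arrow (str₁ a))) n)).trans ?_
  rw [hF]
  rfl

section Formal

variable {A : AInfCat k} {B : AInfCat k} {f : A.Ob → B.Ob}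

theorem AInfFunctor.isRelated_of_natEquiv_id (K : Contraction A)
    {ψ : AInfFunctor A.hcat A (fun X => X)}
    (hψ : ∀ {X Y : A.Ob} (n : ℤ) (a : A.HHom X Y n), ψ.lin n n a = K.i X Y n a)
    {s : PureStructure A} (h : ψ.IsRelated (eulerPure A) s)
    {θ : AInfFunctor A A.hcat (fun X => X)}
    (hθ : NatEquiv (B := A) (θ.comp ψ) (AInfFunctor.id A.hcat)) :
    θ.IsRelated s (eulerPure A) :=
  IsRelated.of_comp_right K hψ h
    (isRelated_of_natEquiv (F := AInfFunctor.id A.hcat) (isLinear_ofLin (A := Aʰ) _)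
      hθ.symm)

/-- The linear part of `ψ` is a choice of cocycle representatives. -/
theorem FormalityEquiv.exists_contraction {s : PureStructure A} (E : FormalityEquiv A s) :
    ∃ K : Contraction A, ∀ {X Y : A.Ob} (n : ℤ) (a : A.HHom X Y n),
      E.ψ.lin n n a = K.i X Y n a := by
  have hd : ∀ (X Y : A.Ob) (n m : ℤ) (a : A.HHom X Y n),
      A.d n m (E.ψ.lin n n a) = 0 := by
    intro X Y n m a
    exact ((show AInfFunctor A.hcat A (fun X => X) from E.ψ).d_lin n m a).trans
      (map_zero ((show AInfFunctor A.hcat A (fun X => X) from E.ψ).lin m m))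
  obtain ⟨K, hK⟩ := Contraction.exists_of_section (A := A)
    (fun X Y n => E.ψ.lin n n) (fun X Y n a => hd X Y n _ a) (fun X Y n a => by
      obtain ⟨a, rfl⟩ := A.cls_surjective a
      exact (A.homologous_iff_cls ⟨_, hd X Y n _ _⟩ a).1 (E.coh_ψ a))
  exact ⟨K, fun {X Y} n a => congrArg (fun i => i X Y n a) hK.symm⟩

/-- Both functors of an equivalence induced by a pure structure relate the pure structures. -/
theorem FormalityEquiv.exists_related {s : PureStructure A} (E : FormalityEquiv A s) :
    ∃ (K : Contraction A) (ψ : AInfFunctor A.hcat A (fun X => X))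
      (θ : AInfFunctor A A.hcat (fun X => X)), ψ = E.ψ ∧ θ = E.θ ∧
      (∀ {X Y : A.Ob} (n : ℤ) (a : A.HHom X Y n), ψ.lin n n a = K.i X Y n a) ∧
      ψ.IsRelated (eulerPure A) s ∧ θ.IsRelated s (eulerPure A) ∧
      AInfFunctor.NatEquiv (B := A) (θ.comp ψ) (AInfFunctor.id A.hcat) := by
  obtain ⟨K, hK⟩ := E.exists_contraction
  obtain ⟨T, hT⟩ := (AInfFunctor.relates_iff (A := A.hcat) (show AInfFunctor A.hcat A (fun X => X) from E.ψ)
    (eulerC Aʰ) s.b).1 E.euler_ψ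
  have hψ := AInfFunctor.isRelated_of_homDC_eq K (ψ := E.ψ) hK s T hT
  exact ⟨K, E.ψ, E.θ, rfl, rfl, hK, hψ,
    AInfFunctor.isRelated_of_natEquiv_id K (ψ := E.ψ) (θ := E.θ) hK hψ E.θ_ψ, E.θ_ψ⟩

/-- A formal functor relates the pure structures: the linear functor `H F` preserves the Euler
fields, hence so does the composition `H A → A → B → H B`, and both equivalences can be cancelled.
-/
theorem AInfFunctor.IsFormalWith.isRelated {F : AInfFunctor A B f} {sA : PureStructure A}
    {sB : PureStructure B} {EA : FormalityEquiv A sA} {EB : FormalityEquiv B sB}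
    (h : F.IsFormalWith EA EB) : F.IsRelated sA sB := by
  obtain ⟨KA, ψA, θA, eψA, eθA, hψA, hψA', hθA, hA⟩ := EA.exists_related
  obtain ⟨KB, ψB, θB, eψB, eθB, hψB, hψB', hθB, hB⟩ := EB.exists_related
  have h₁ : NatEquiv (B := B) (show AInfFunctor A.hcat B.hcat f from F.coh)
    (θB.comp (F.comp ψA)) := by
    rw [eψA, eθB]
    exact h
  have h₂ := AInfFunctor.isRelated_of_natEquiv (F := (show AInfFunctor A.hcat B.hcat f from F.coh))
    (isLinear_ofLin (A := Aʰ) _) h₁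
  have hL := hB.bijective_lin
  refine IsRelated.of_comp_right KA hψA hψA' (IsRelated.of_comp_left KB ?_ hθB h₂)
  intro X Y n
  refine Eq.subst (motive := fun φ => Function.Bijective φ) (funext fun a => ?_) (hL X Y n)
  exact (comp_lin θB.toCochain ψB.toCochain a).trans (congrArg (θB.lin n n) (hψB n a))

end Formal

/-! ### The diagonal bimodule is pure -/

namespace AInfBimodule

section Diagonal

variable (B : AInfCat k)

/-- A cochain of `B` acts on the diagonal bimodule by `(x, m, y) ↦ ± b(x, m, y)`. -/
def diagC {d e : ℤ} (he : e = d - 1)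
    (b : Cochain Bᵍ Bᵍ (fun X => X) (fun X => X) d) :
    BiCochain (A := Bᵍ) (B := Bᵍ)
      ⟨fun Y X n => B.Hom Y X n⟩ ⟨fun Y X n => B.Hom Y X n⟩ e where
  val {X X' Y Y'} p n m q n' := (red q).negOnePow • b.val ((q.cons (⟨n, m⟩ : Y ⟶ X)).comp p) n'
  val_eq_zero {X X' Y Y'} p n m q n' h := by
    rw [b.val_eq_zero, smul_zero]
    rw [red_marked]
    intro h'
    exact h (h'.trans (by simp only; omega))
  val_add {X X' Y Y'} p n m m' q n' := by rw [b.val_add, smul_add]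
  val_smul {X X' Y Y'} p n r m q n' := by rw [b.val_smul, smul_comm]
  left_isML {X X' Y Y' n} m q n' :=
    ((b.isML n').comp_left (q.cons (⟨n, m⟩ : Y ⟶ X))).units_smul _
  right_isML {X X' Y Y'} p n m n' :=
    { add := fun p' i a b' q => by
        have := b.val_add p' i a b' ((q.cons (⟨n, m⟩ : Y ⟶ X)).comp p) n'
        simp only [red_marked, Quiver.Path.comp_assoc, ← Quiver.Path.comp_cons] at this ⊢
        rw [this, smul_add]
      smul := fun p' i r a q => by
        have := b.val_smul p' i r a ((q.cons (⟨n, m⟩ : Y ⟶ X)).comp p) n'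
        simp only [red_marked, Quiver.Path.comp_assoc, ← Quiver.Path.comp_cons] at this ⊢
        rw [this, smul_comm] }

theorem diagμ_lin {X Y : B.Ob} (i j : ℤ) (m : B.Hom Y X i) : (diagμ B).lin i j m = -B.d i j m := by
  have h1 : (diagμ B).lin i j m = (0 + 1 : ℤ).negOnePow • B.d i j m := rfl
  rw [h1]
  simp

theorem diagμ_leftAct {X X' Y : B.Ob} {n : ℤ} (c : B.Hom X X' 0) (m : B.Hom Y X n) :
    (diagμ B).leftAct c m = B.prod c m n := by
  have h1 : (diagμ B).leftAct c m = -(n.negOnePow • ((0 + 1 : ℤ).negOnePow •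
    B.μ.val (str₂ c m) n)) := rfl
  rw [h1]
  simp [prodOf]

theorem diagμ_rightAct {X Y Y' : B.Ob} {n : ℤ} (m : B.Hom Y X n) (c : B.Hom Y' Y 0) :
    (diagμ B).rightAct m c = B.prod m c n := by
  have h1 : (diagμ B).rightAct m c = (red (str₁ c) + 1 : ℤ).negOnePow •
    B.μ.val (str₂ m c) n := rfl
  rw [h1]
  simp [prodOf, red]

/-- The Hochschild cocycle condition for `b`, evaluated on the strings `(x, m, y)`, is the equation
for `b` as a pre-endomorphism of the diagonal bimodule. -/
theorem diagC_rel (s : PureStructure B) {X X' Y Y' : B.Ob} (p : Path X X') {n : ℤ}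
    (m : B.Hom Y X n) (q : Path Y' Y) (n' : ℤ) :
    lsum (cuts2 p) (fun a => lsum (cuts2 q) (fun b => (0 * red b.fst).negOnePow •
        (diagμ B).val a.snd ((diagC B (d := 1) (e := 0) rfl s.b).val a.fst m b.snd
          (red a.fst + n + red b.snd + 0)) b.fst n'))
      - Int.negOnePow 0 • (lsum (cuts3 p) (fun r => (red q + n + red r.fst).negOnePow •
          (diagC B (d := 1) (e := 0) rfl s.b).val ((r.fst.cons (B.μ.arrow r.mid)).comp r.last) m q n')
        + lsum (cuts2 p) (fun a => lsum (cuts2 q) (fun b => (red b.fst).negOnePow •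
          (diagC B (d := 1) (e := 0) rfl s.b).val a.snd ((diagμ B).val a.fst m b.snd
            (red a.fst + n + red b.snd + 1)) b.fst n'))
        + lsum (cuts3 q) (fun r => (red r.fst).negOnePow •
          (diagC B (d := 1) (e := 0) rfl s.b).val p m ((r.fst.cons (B.μ.arrow r.mid)).comp r.last) n'))
      = -lsum (cuts3 p) (fun r => (diagμ B).val ((r.fst.cons (s.b.arrow r.mid)).comp r.last) m q n')
        - lsum (cuts3 q) (fun r => (diagμ B).val p m ((r.fst.cons (s.b.arrow r.mid)).comp r.last) n') := by
  have key := congrArg (fun y => (red q).negOnePow • y)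
    (s.closed ((q.cons (⟨n, m⟩ : Y ⟶ X)).comp p) n')
  simp only [AInfCat.hochschildD, smul_zero, sub_self, zero_mul, Int.negOnePow_zero, one_smul] at key
  rw [lsum_cuts3_marked, lsum_cuts3_marked] at key
  simp only [smul_add, smul_lsum, smul_smul, ← Int.negOnePow_add] at key
  have m₁ : lsum (cuts2 p) (fun a => lsum (cuts2 q) (fun b => (0 * red b.fst).negOnePow •
      (diagμ B).val a.snd ((diagC B (d := 1) (e := 0) rfl s.b).val a.fst m b.snd
        (red a.fst + n + red b.snd + 0)) b.fst n'))
      = -lsum (cuts2 q) (fun b => lsum (cuts2 p) (fun a => (red q).negOnePow •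
        B.μ.val ((b.fst.cons (s.b.arrow ((b.snd.cons (⟨n, m⟩ : Y ⟶ X)).comp a.fst))).comp a.snd)
          n')) := by
    rw [lsum_comm, ← lsum_neg]
    refine lsum_congr fun b hb => ?_
    rw [← lsum_neg]
    refine lsum_congr fun a ha => ?_
    have := red_of_mem_cuts2 q b hb
    rw [s.b.arrow_eq (N := red a.fst + n + red b.snd + 0) _ (by rw [red_marked]; simp only; ring)]
    simp only [diagμ, diagC]
    rw [(B.μ.isML n').insert_units_smul, smul_smul, smul_smul, ← Units.neg_smul,
      ← Int.negOnePow_add, ← Int.negOnePow_add, ← Int.negOnePow_succ]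
    exact congrArg₂ (· • ·) (negOnePow_congr ⟨0, by linarith⟩) rfl
  have p₁ : lsum (cuts3 p) (fun r => (diagμ B).val ((r.fst.cons (s.b.arrow r.mid)).comp r.last) m q n')
      = -lsum (cuts3 p) (fun c => (red q).negOnePow •
      B.μ.val ((((q.cons (⟨n, m⟩ : Y ⟶ X)).comp c.fst).cons (s.b.arrow c.mid)).comp c.last) n') := by
    rw [← lsum_neg]
    refine lsum_congr fun c _ => ?_
    simp only [diagμ]
    rw [← Units.neg_smul, ← Int.negOnePow_succ, ← Quiver.Path.comp_cons, ← Quiver.Path.comp_assoc]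
  have q₁ : lsum (cuts3 q) (fun r => (diagμ B).val p m ((r.fst.cons (s.b.arrow r.mid)).comp r.last) n')
      = -lsum (cuts3 q) (fun c => (red q).negOnePow •
      B.μ.val ((c.fst.cons (s.b.arrow c.mid)).comp
        ((c.last.cons (⟨n, m⟩ : Y ⟶ X)).comp p)) n') := by
    rw [← lsum_neg]
    refine lsum_congr fun c hc => ?_
    have := red_of_mem_cuts3 q c hc
    simp only [diagμ]
    rw [red_marked, ← Units.neg_smul, ← Int.negOnePow_succ, ← Quiver.Path.comp_assoc,
      Quiver.Path.comp_cons]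
    refine congrArg₂ (· • ·) (negOnePow_congr ⟨0, ?_⟩) rfl
    simp only [arrow]
    linarith
  have p₂ : lsum (cuts3 p) (fun r => (red q + n + red r.fst).negOnePow •
        (diagC B (d := 1) (e := 0) rfl s.b).val ((r.fst.cons (B.μ.arrow r.mid)).comp r.last) m q n')
      = lsum (cuts3 p) (fun c =>
        (red q + (1 + red ((q.cons (⟨n, m⟩ : Y ⟶ X)).comp c.fst))).negOnePow •
        s.b.val ((((q.cons (⟨n, m⟩ : Y ⟶ X)).comp c.fst).cons (B.μ.arrow c.mid)).comp c.last)
          n') := by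
    refine lsum_congr fun c _ => ?_
    simp only [diagC]
    rw [smul_smul, ← Int.negOnePow_add, ← Quiver.Path.comp_cons, ← Quiver.Path.comp_assoc, red_marked]
    exact congrArg₂ (· • ·) (negOnePow_congr ⟨0, by simp only; ring⟩) rfl
  have m₂ : lsum (cuts2 p) (fun a => lsum (cuts2 q) (fun b => (red b.fst).negOnePow •
        (diagC B (d := 1) (e := 0) rfl s.b).val a.snd ((diagμ B).val a.fst m b.snd
          (red a.fst + n + red b.snd + 1)) b.fst n'))
      = lsum (cuts2 q) (fun b => lsum (cuts2 p) (fun a =>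
        (red q + (1 + red b.fst)).negOnePow •
        s.b.val ((b.fst.cons (B.μ.arrow ((b.snd.cons (⟨n, m⟩ : Y ⟶ X)).comp a.fst))).comp a.snd)
          n')) := by
    rw [lsum_comm]
    refine lsum_congr fun b hb => lsum_congr fun a ha => ?_
    have := red_of_mem_cuts2 q b hb
    rw [B.μ.arrow_eq (N := red a.fst + n + red b.snd + 1) _ (by rw [red_marked]; simp only; ring)]
    simp only [diagμ, diagC]
    rw [(s.b.isML n').insert_units_smul, smul_smul, smul_smul,
      ← Int.negOnePow_add, ← Int.negOnePow_add]
    exact congrArg₂ (· • ·) (negOnePow_congr ⟨0, by linarith⟩) rfl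
  have q₂ : lsum (cuts3 q) (fun r => (red r.fst).negOnePow •
        (diagC B (d := 1) (e := 0) rfl s.b).val p m ((r.fst.cons (B.μ.arrow r.mid)).comp r.last) n')
      = lsum (cuts3 q) (fun c =>
        (red q + (1 + red c.fst)).negOnePow • s.b.val ((c.fst.cons (B.μ.arrow c.mid)).comp
          ((c.last.cons (⟨n, m⟩ : Y ⟶ X)).comp p)) n') := by
    refine lsum_congr fun c hc => ?_
    have := red_of_mem_cuts3 q c hc
    simp only [diagC]
    rw [red_marked, smul_smul, ← Int.negOnePow_add, ← Quiver.Path.comp_assoc,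
      Quiver.Path.comp_cons]
    refine congrArg₂ (· • ·) (negOnePow_congr ⟨0, ?_⟩) rfl
    simp only [arrow]
    linarith
  have aux : ∀ {M : Type _} [AddCommGroup M] {a b c d e f : M}, a + b + c + (d + e + f) = 0 →
      -b - (f + e + d) = -(-c) - -a := fun h => by
    rw [← sub_eq_zero, ← neg_eq_zero, ← h]
    abel
  rw [m₁, p₁, q₁, p₂, m₂, q₂, Int.negOnePow_zero, one_smul]
  exact aux key

/-- The diagonal bimodule is pure: the vector field itself is a pure equivariant structure. -/
theorem diag_isPure (s : PureStructure B) : (diag B).IsPure s s := by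
  refine ⟨diagC B (d := 1) (e := 0) rfl s.b, fun {X X' Y Y'} p n m q n' => diagC_rel B s p m q n',
    fun {X Y} i φ hφ => ?_⟩
  have hφ' : B.d i (i + 1) φ = 0 := neg_eq_zero.1 ((diagμ_lin B i (i + 1) φ).symm.trans hφ)
  obtain ⟨η, hη⟩ := s.pure i φ hφ'
  refine ⟨-η, (diagμ_lin B _ _ _).trans ?_⟩
  have e : (diagC B (d := 1) (e := 0) rfl s.b).lin i i φ = s.b.lin i i φ :=
    (congrArg (· • _) Int.negOnePow_zero).trans (one_smul _ _)
  refine ((congrArg Neg.neg (map_neg (B.d (i - 1) i) η)).trans (neg_neg _)).trans (hη.trans ?_)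
  exact congrArg₂ (· - ·) (congrArg₂ (· + ·) (congrArg₂ (· - ·) e.symm (diagμ_leftAct B _ φ).symm)
    (diagμ_rightAct B φ _).symm) rfl

end Diagonal

end AInfBimodule

/-! ### Pre-endomorphisms of bimodules and their pullbacks -/

theorem IsML.red_smul {A : GrQuiver k} {M : Type*} [AddCommGroup M] [Module k M]
    {X Y : A.Ob} {Φ : Path X Y → M} (h : IsML Φ) (s : ℤ → ℤˣ) :
    IsML (fun p => s (red p) • Φ p) where
  add p i a b q := by
    simp only [red_marked]
    rw [h.add, smul_add]
  smul p i r a q := by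
    simp only [red_marked]
    rw [h.smul, smul_comm]

theorem IsML.ins {Q : GrQuiver k} {A : GrQuiver k}
    {B : GrQuiver k} {M : Type*} [AddCommGroup M] [Module k M] {f g : A.Ob → B.Ob}
    {d : ℤ} (F : Cochain A B f f 1) (G : Cochain A B g g 1) (T : Cochain A B f g d) {X Y : A.Ob}
    {X' Y' : Q.Ob} {Ψ : Path X' Y' → Path (f X) (g Y) → M}
    (h : ∀ r, IsML (fun q => Ψ q r)) (p : Path X Y) :
    IsML (fun q => Cochain.ins F G T (Ψ q) p) :=
  IsML.lsum (fun _ => IsML.lsum (fun _ => IsML.lsum (fun _ => (h _).units_smul _) _) _) _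

theorem Cochain.ins_k_smul {A : GrQuiver k}
    {B : GrQuiver k} {M : Type*} [AddCommGroup M] [Module k M] {f g : A.Ob → B.Ob}
    {d : ℤ} (F : Cochain A B f f 1) (G : Cochain A B g g 1) (T : Cochain A B f g d) {X Y : A.Ob}
    (r : k) (Φ : Path (f X) (g Y) → M) (p : Path X Y) :
    ins F G T (fun q => r • Φ q) p = r • ins F G T Φ p :=
  (ins_map F G T (DistribSMul.toAddMonoidHom M r) Φ p).symm

namespace BiCochain

variable {A : GrQuiver k} {B : GrQuiver k}
variable {P : GrBimod.{u, v, w, v', w', z} A B} {Q : GrBimod.{u, v, w, v', w', z'} A B} {d : ℤ}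

instance : Add (BiCochain P Q d) where
  add S T :=
    { val := fun p _ m q n' => S.val p m q n' + T.val p m q n'
      val_eq_zero := fun p _ m q n' h => by
        rw [S.val_eq_zero p m q n' h, T.val_eq_zero p m q n' h, add_zero]
      val_add := fun p _ m m' q n' => by
        rw [S.val_add, T.val_add]
        exact add_add_add_comm _ _ _ _
      val_smul := fun p _ r m q n' => by rw [S.val_smul, T.val_smul, smul_add]
      left_isML := fun m q n' => (S.left_isML m q n').add' (T.left_isML m q n')
      right_isML := fun p _ m n' => (S.right_isML p m n').add' (T.right_isML p m n') }

theorem add_val (S T : BiCochain P Q d) {X X' : A.Ob} {Y Y' : B.Ob} (p : Path X X') {n : ℤ}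
    (m : P.Mod Y X n) (q : Path Y' Y) (n' : ℤ) :
    (S + T).val p m q n' = S.val p m q n' + T.val p m q n' := rfl

theorem val_zero_mid (T : BiCochain P Q d) {X X' : A.Ob} {Y Y' : B.Ob} (p : Path X X')
    {n : ℤ} (q : Path Y' Y) (n' : ℤ) : T.val p (0 : P.Mod Y X n) q n' = 0 := by
  have := T.val_smul p (0 : k) (0 : P.Mod Y X n) q n'
  rwa [zero_smul, zero_smul] at this

/-- Evaluation as an additive map of the module element. -/
def valHom (T : BiCochain P Q d) {X X' : A.Ob} {Y Y' : B.Ob} (p : Path X X') (n : ℤ)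
    (q : Path Y' Y) (n' : ℤ) : P.Mod Y X n →+ Q.Mod Y' X' n' :=
  AddMonoidHom.mk' (fun m => T.val p m q n') fun m m' => T.val_add p m m' q n'

end BiCochain

namespace AInfBimodule

section General

variable {A : AInfCat k} {B : AInfCat k}
variable (P : AInfBimodule.{u, v, w, v', w', z} A B)
variable {X X' : A.Ob} {Y Y' : B.Ob}

theorem endD_eq (c : BiCochain P.toGrBimod P.toGrBimod 0) (p : Path X X') {n : ℤ}
    (m : P.toGrBimod.Mod Y X n) (q : Path Y' Y) (n' : ℤ) :
    P.endD c p m q n' = lsum (cuts2 p) (fun a => lsum (cuts2 q) (fun b =>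
        P.μ.val a.snd (c.val a.fst m b.snd (red a.fst + n + red b.snd + 0)) b.fst n'))
      - ((red q + n).negOnePow • ins (idC Aᵍ) (idC Aᵍ) A.μ
            (fun p => c.val p m q n') p
        + lsum (cuts2 p) (fun a => lsum (cuts2 q) (fun b => (red b.fst).negOnePow •
          c.val a.snd (P.μ.val a.fst m b.snd (red a.fst + n + red b.snd + 1)) b.fst n'))
        + ins (idC Bᵍ) (idC Bᵍ) B.μ (fun q => c.val p m q n') q) := by
  rw [endD, ins_idC _ (c.left_isML m q n'), ins_idC _ (c.right_isML p m n')]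
  simp only [zero_mul, Int.negOnePow_zero, one_smul, smul_lsum, smul_smul, ← Int.negOnePow_add,
    show ((2 : ℤ) - 1) = 1 by norm_num, one_mul]

theorem endD_add (c c' : BiCochain P.toGrBimod P.toGrBimod 0) (p : Path X X') {n : ℤ}
    (m : P.toGrBimod.Mod Y X n) (q : Path Y' Y) (n' : ℤ) :
    P.endD (c + c') p m q n' = P.endD c p m q n' + P.endD c' p m q n' := by
  simp only [endD, BiCochain.add_val, P.μ.val_add, smul_add, lsum_add]
  abel

theorem nuLeft_eq (b : Cochain Aᵍ Aᵍ (fun X => X) (fun X => X) 1)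
    (p : Path X X') {n : ℤ} (m : P.toGrBimod.Mod Y X n) (q : Path Y' Y) (n' : ℤ) :
    P.nuLeft b p m q n' = -ins (idC Aᵍ) (idC Aᵍ) b
      (fun p => P.μ.val p m q n') p := by
  rw [nuLeft, ins_idC _ (P.μ.left_isML m q n')]
  simp only [sub_self, zero_mul, Int.negOnePow_zero, one_smul]

theorem nuRight_eq (b : Cochain Bᵍ Bᵍ (fun X => X) (fun X => X) 1)
    (p : Path X X') {n : ℤ} (m : P.toGrBimod.Mod Y X n) (q : Path Y' Y) (n' : ℤ) :
    P.nuRight b p m q n' = ins (idC Bᵍ) (idC Bᵍ) b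
      (fun q => P.μ.val p m q n') q := by
  rw [nuRight, ins_idC _ (P.μ.right_isML p m n')]
  simp only [sub_self, zero_mul, Int.negOnePow_zero, one_smul]

theorem rel_eq (p : Path X X') {n : ℤ}
    (m : P.toGrBimod.Mod Y X n) (q : Path Y' Y) (n' : ℤ) :
    (red q + n).negOnePow • ins (idC Aᵍ) (idC Aᵍ) A.μ
          (fun p => P.μ.val p m q n') p
      + lsum (cuts2 p) (fun a => lsum (cuts2 q) (fun b => (red b.fst).negOnePow •
        P.μ.val a.snd (P.μ.val a.fst m b.snd (red a.fst + n + red b.snd + 1)) b.fst n'))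
      + ins (idC Bᵍ) (idC Bᵍ) B.μ (fun q => P.μ.val p m q n') q = 0 := by
  rw [← P.rel p m q n', ins_idC _ (P.μ.left_isML m q n'), ins_idC _ (P.μ.right_isML p m n')]
  simp only [smul_lsum, smul_smul, ← Int.negOnePow_add, show ((2 : ℤ) - 1) = 1 by norm_num, one_mul]

end General

section PullLeft

variable {A : AInfCat k} {C : AInfCat k} {D : AInfCat k}
variable {f : A.Ob → C.Ob} (P : AInfBimodule.{u, v'', w'', x, x', z} C D) (F : AInfFunctor A C f)

/-- The pullback under a functor `F`, acting on the left, of a pre-endomorphism. -/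
def leftC {d : ℤ} (c : BiCochain P.toGrBimod P.toGrBimod d) :
    BiCochain (A := Aᵍ) (B := Dᵍ)
      ⟨fun Y X n => P.toGrBimod.Mod Y (f X) n⟩ ⟨fun Y X n => P.toGrBimod.Mod Y (f X) n⟩ d where
  val p _ m q n' := lsum (F.blocks p) fun r => c.val r m q n'
  val_eq_zero p n m q n' h := lsum_eq_zero fun r hr => c.val_eq_zero r m q n' (by
    rwa [Cochain.red_of_mem_blocks _ _ r hr])
  val_add p n m m' q n' := by simp only [c.val_add, lsum_add]
  val_smul p n r m q n' := by simp only [c.val_smul, smul_lsum]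
  left_isML m q n' := F.isML_blocks (c.left_isML m q n')
  right_isML p n m n' := IsML.lsum (fun r => c.right_isML r m n') (F.blocks p)

/-- The pre-endomorphism of a left pullback which lets a pre-natural transformation of the
functor act. -/
def insLeft (T : Cochain Aᵍ Cᵍ f f 0) :
    BiCochain (A := Aᵍ) (B := Dᵍ)
      ⟨fun Y X n => P.toGrBimod.Mod Y (f X) n⟩ ⟨fun Y X n => P.toGrBimod.Mod Y (f X) n⟩ 0 where
  val p n m q n' := (red q + n).negOnePow • ins F.toCochain F.toCochain T
    (fun r => P.μ.val r m q n') p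
  val_eq_zero p n m q n' h := by
    rw [ins_congr_red F.toCochain F.toCochain T p (Ψ := fun _ => 0), ins_zero_fun, smul_zero]
    intro r hr
    exact P.μ.val_eq_zero r m q n' (by omega)
  val_add p n m m' q n' := by
    simp only [P.μ.val_add]
    rw [ins_add, smul_add]
  val_smul p n r m q n' := by
    simp only [P.μ.val_smul]
    rw [ins_k_smul, smul_comm]
  left_isML m q n' := (isML_ins _ _ _ (P.μ.left_isML m q n')).units_smul _
  right_isML p n m n' := (IsML.ins _ _ _ (fun r => P.μ.right_isML r m n') p).red_smul
    fun i => (i + n).negOnePow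

end PullLeft

section PullRight

variable {B : AInfCat k} {C : AInfCat k} {D : AInfCat k}
variable {g : B.Ob → D.Ob} (P : AInfBimodule.{u, v'', w'', x, x', z} C D) (G : AInfFunctor B D g)

/-- The pullback under a functor `G`, acting on the right, of a pre-endomorphism. -/
def rightC {d : ℤ} (c : BiCochain P.toGrBimod P.toGrBimod d) :
    BiCochain (A := Cᵍ) (B := Bᵍ)
      ⟨fun Y X n => P.toGrBimod.Mod (g Y) X n⟩ ⟨fun Y X n => P.toGrBimod.Mod (g Y) X n⟩ d where
  val p _ m q n' := lsum (G.blocks q) fun t => c.val p m t n'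
  val_eq_zero p n m q n' h := lsum_eq_zero fun t ht => c.val_eq_zero p m t n' (by
    rwa [Cochain.red_of_mem_blocks _ _ t ht])
  val_add p n m m' q n' := by simp only [c.val_add, lsum_add]
  val_smul p n r m q n' := by simp only [c.val_smul, smul_lsum]
  left_isML m q n' := IsML.lsum (fun t => c.left_isML m t n') (G.blocks q)
  right_isML p n m n' := G.isML_blocks (c.right_isML p m n')

/-- The pre-endomorphism of a right pullback which lets a pre-natural transformation of the
functor act. -/
def insRight (T : Cochain Bᵍ Dᵍ g g 0) :
    BiCochain (A := Cᵍ) (B := Bᵍ)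
      ⟨fun Y X n => P.toGrBimod.Mod (g Y) X n⟩ ⟨fun Y X n => P.toGrBimod.Mod (g Y) X n⟩ 0 where
  val p n m q n' := ins G.toCochain G.toCochain T (fun t => P.μ.val p m t n') q
  val_eq_zero p n m q n' h := by
    rw [ins_congr_red G.toCochain G.toCochain T q (Ψ := fun _ => 0), ins_zero_fun]
    intro t ht
    exact P.μ.val_eq_zero p m t n' (by omega)
  val_add p n m m' q n' := by
    simp only [P.μ.val_add]
    rw [ins_add]
  val_smul p n r m q n' := by
    simp only [P.μ.val_smul]
    rw [ins_k_smul]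
  left_isML m q n' := IsML.ins _ _ _ (fun t => P.μ.left_isML m t n') q
  right_isML p n m n' := isML_ins _ _ _ (P.μ.right_isML p m n')

end PullRight

end AInfBimodule

/-! ### The differential of pulled back pre-endomorphisms -/

theorem Cochain.ins_comm {Q : GrQuiver k} {R : GrQuiver k}
    {A : GrQuiver k} {B : GrQuiver k} {M : Type*} [AddCommGroup M]
    {f g : A.Ob → B.Ob} {f' g' : Q.Ob → R.Ob} {d e : ℤ} (F : Cochain A B f f 1)
    (G : Cochain A B g g 1) (T : Cochain A B f g d) (F' : Cochain Q R f' f' 1)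
    (G' : Cochain Q R g' g' 1) (S : Cochain Q R f' g' e) {X Y : A.Ob} {X' Y' : Q.Ob}
    (Θ : Path (f X) (g Y) → Path (f' X') (g' Y') → M) (p : Path X Y)
    (q : Path X' Y') :
    ins F G T (fun r => ins F' G' S (Θ r) q) p
      = ins F' G' S (fun t => ins F G T (fun r => Θ r t) p) q := by
  let L : (Path (f' X') (g' Y') → M) →+ M := AddMonoidHom.mk' (fun Ψ => ins F' G' S Ψ q)
    fun Ψ Ψ' => ins_add F' G' S Ψ Ψ' q
  have h : L (ins F G T Θ p) = ins F G T (fun r => L (Θ r)) p := ins_map F G T L Θ p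
  refine h.symm.trans (ins_congr _ _ _ (fun t => ?_) q)
  exact ins_map F G T (Pi.evalAddMonoidHom (fun _ => M) t) Θ p

namespace AInfBimodule

section PullLeft

variable {A : AInfCat k} {C : AInfCat k} {D : AInfCat k}
variable {f : A.Ob → C.Ob} (P : AInfBimodule.{u, v'', w'', x, x', z} C D) (F : AInfFunctor A C f)
variable {X X' : A.Ob} {Y Y' : D.Ob}

theorem lsum_cuts2_leftC {d e : ℤ} (S : BiCochain P.toGrBimod P.toGrBimod d)
    (T : BiCochain P.toGrBimod P.toGrBimod e) (j : ℤ) (s : ℤ → ℤˣ) (p : Path X X') {n : ℤ}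
    (m : P.toGrBimod.Mod Y (f X) n) (q : Path Y' Y) (n' : ℤ) :
    lsum (cuts2 p) (fun a => lsum (cuts2 q) fun b => s (red b.fst) • (P.leftC F S).val a.snd
        ((P.leftC F T).val a.fst m b.snd (red a.fst + n + red b.snd + j)) b.fst n')
      = lsum (F.blocks p) fun r => lsum (cuts2 r) fun a => lsum (cuts2 q) fun b =>
        s (red b.fst) • S.val a.snd (T.val a.fst m b.snd (red a.fst + n + red b.snd + j))
          b.fst n' := by
  rw [Cochain.lsum_blocks_cuts2]
  refine lsum_congr fun a _ => ?_
  have h : ∀ r ∈ F.blocks a.fst, lsum (F.blocks a.snd) (fun r' =>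
      lsum (cuts2 q) fun b => s (red b.fst) • S.val r' (T.val r m b.snd
        (red r + n + red b.snd + j)) b.fst n')
      = lsum (cuts2 q) fun b => lsum (F.blocks a.snd) fun r' => s (red b.fst) •
        S.val r' (T.val r m b.snd (red a.fst + n + red b.snd + j)) b.fst n' := fun r hr => by
    rw [lsum_comm, Cochain.red_of_mem_blocks _ _ r hr]
  rw [lsum_congr h, lsum_comm]
  refine lsum_congr fun b _ => ?_
  simp only [leftC, BiCochain.val_lsum, smul_lsum]

/-- The differential of `insLeft F T` involves the differential of `T` only, by the bimodule
relations. -/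
theorem insLeft_rel (T : Cochain Aᵍ Cᵍ f f 0) (p : Path X X') {n : ℤ}
    (m : P.toGrBimod.Mod Y (f X) n) (q : Path Y' Y) (n' : ℤ) :
    lsum (cuts2 p) (fun a => lsum (cuts2 q) fun b => (P.leftC F P.μ).val a.snd
        ((P.insLeft F T).val a.fst m b.snd (red a.fst + n + red b.snd + 0)) b.fst n')
      - ((red q + n).negOnePow • ins (idC Aᵍ) (idC Aᵍ) A.μ
            (fun p => (P.insLeft F T).val p m q n') p
        + lsum (cuts2 p) (fun a => lsum (cuts2 q) (fun b => (red b.fst).negOnePow •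
          (P.insLeft F T).val a.snd ((P.leftC F P.μ).val a.fst m b.snd
            (red a.fst + n + red b.snd + 1)) b.fst n'))
        + ins (idC Dᵍ) (idC Dᵍ) D.μ
          (fun q => (P.insLeft F T).val p m q n') q)
      = -ins F.toCochain F.toCochain (AInfFunctor.homDC F F T) (fun r => P.μ.val r m q n') p := by
  have h₀ := ins_congr F.toCochain F.toCochain T (fun r => P.rel_eq r m q n') p
  rw [ins_zero_fun, ins_add, ins_add, ins_units_smul, ins_cuts2] at h₀
  have h₁ := AInfFunctor.ins_homDC F F T (P.μ.left_isML m q n') p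
  -- the part where the transformation is inserted before the inner operation
  have h₂ : lsum (cuts2 p) (fun a => lsum (F.blocks a.snd) fun t =>
        ins F.toCochain F.toCochain T (fun s => lsum (cuts2 q) fun b => (red b.fst).negOnePow •
          P.μ.val t (P.μ.val s m b.snd (red s + n + red b.snd + 1)) b.fst n') a.fst)
      = (red q + n).negOnePow • lsum (cuts2 p) (fun a => lsum (cuts2 q) fun b =>
        (P.leftC F P.μ).val a.snd
        ((P.insLeft F T).val a.fst m b.snd (red a.fst + n + red b.snd + 0)) b.fst n') := by
    rw [smul_lsum]
    refine lsum_congr fun a _ => ?_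
    simp only [ins_lsum]
    rw [lsum_comm, smul_lsum]
    refine lsum_congr fun b hb => ?_
    simp only [leftC, insLeft, BiCochain.val_units_smul]
    rw [smul_lsum, smul_lsum]
    refine lsum_congr fun t _ => ?_
    rw [ins_units_smul, smul_smul, ← Int.negOnePow_add]
    refine congrArg₂ (· • ·) (negOnePow_congr ⟨-red b.snd - n, by
      have := red_of_mem_cuts2 q b hb; linarith⟩) ?_
    refine Eq.trans ?_ (ins_map F.toCochain F.toCochain T (P.μ.valHom t _ b.fst n') _ a.fst).symm
    refine ins_congr_red _ _ _ _ fun s hs => ?_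
    rw [hs, show red a.fst + (0 - 1) + n + red b.snd + 1 = red a.fst + n + red b.snd + 0 by ring]
    rfl
  have h₃ : lsum (cuts2 p) (fun a => ((0 - 1) * red a.fst).negOnePow •
        lsum (F.blocks a.fst) fun r =>
        ins F.toCochain F.toCochain T (fun s => lsum (cuts2 q) fun b => (red b.fst).negOnePow •
          P.μ.val s (P.μ.val r m b.snd (red r + n + red b.snd + 1)) b.fst n') a.snd)
      = -((red q + n).negOnePow • lsum (cuts2 p) (fun a => lsum (cuts2 q) fun b =>
        (red b.fst).negOnePow • (P.insLeft F T).val a.snd ((P.leftC F P.μ).val a.fst m b.snd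
            (red a.fst + n + red b.snd + 1)) b.fst n')) := by
    rw [smul_lsum, ← lsum_neg]
    refine lsum_congr fun a _ => ?_
    simp only [ins_lsum]
    rw [lsum_comm, smul_lsum, smul_lsum, ← lsum_neg]
    refine lsum_congr fun b hb => ?_
    simp only [leftC, insLeft, BiCochain.val_lsum, ins_lsum, smul_lsum]
    rw [← lsum_neg]
    refine lsum_congr fun r hr => ?_
    rw [ins_units_smul, smul_smul, smul_smul, smul_smul, ← Int.negOnePow_add, ← Int.negOnePow_add,
      ← Int.negOnePow_add, Cochain.red_of_mem_blocks _ _ r hr, ← Units.neg_smul,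
      ← Int.negOnePow_succ]
    exact congrArg₂ (· • ·) (negOnePow_congr ⟨-red a.fst - n - red q - 1, by
      have := red_of_mem_cuts2 q b hb; linarith⟩) rfl
  have h₄ : ins (idC Dᵍ) (idC Dᵍ) D.μ
      (fun q => (P.insLeft F T).val p m q n') q = -((red q + n).negOnePow •
        ins F.toCochain F.toCochain T (fun r => ins (idC Dᵍ) (idC Dᵍ) D.μ
          (fun q => P.μ.val r m q n') q) p) := by
    rw [ins_comm, ← Units.neg_smul, ← Int.negOnePow_succ, ← ins_units_smul]
    refine ins_congr_red _ _ _ _ fun t ht => ?_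
    exact congrArg₂ (· • ·) (negOnePow_congr ⟨0, by rw [ht]; ring⟩) rfl
  have h₅ : (red q + n).negOnePow • ins (idC Aᵍ) (idC Aᵍ) A.μ
      (fun p => (P.insLeft F T).val p m q n') p = ins (idC Aᵍ) (idC Aᵍ) A.μ
      (fun p => ins F.toCochain F.toCochain T (fun r => P.μ.val r m q n') p) p := by
    rw [← ins_units_smul]
    refine ins_congr _ _ _ (fun p => ?_) p
    exact (smul_smul _ _ _).trans (by rw [Int.units_mul_self, one_smul])
  rw [h₂, h₃] at h₀
  rw [h₁, h₄, h₅]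
  have h₆ := congrArg (fun y => (red q + n).negOnePow • y) h₀
  simp only [smul_add, smul_neg, smul_smul, Int.units_mul_self, one_smul, smul_zero] at h₆
  simp only [zero_sub, Int.negOnePow_neg, Int.negOnePow_one, Units.neg_smul, one_smul]
  rw [← sub_eq_zero, ← h₆]
  abel

end PullLeft

section PullRight

variable {B : AInfCat k} {C : AInfCat k} {D : AInfCat k}
variable {g : B.Ob → D.Ob} (P : AInfBimodule.{u, v'', w'', x, x', z} C D) (G : AInfFunctor B D g)
variable {X X' : C.Ob} {Y Y' : B.Ob}

theorem lsum_cuts2_rightC {d e : ℤ} (S : BiCochain P.toGrBimod P.toGrBimod d)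
    (T : BiCochain P.toGrBimod P.toGrBimod e) (j : ℤ) (s : ℤ → ℤˣ) (p : Path X X') {n : ℤ}
    (m : P.toGrBimod.Mod (g Y) X n) (q : Path Y' Y) (n' : ℤ) :
    lsum (cuts2 p) (fun a => lsum (cuts2 q) fun b => s (red b.fst) • (P.rightC G S).val a.snd
        ((P.rightC G T).val a.fst m b.snd (red a.fst + n + red b.snd + j)) b.fst n')
      = lsum (G.blocks q) fun t => lsum (cuts2 p) fun a => lsum (cuts2 t) fun b =>
        s (red b.fst) • S.val a.snd (T.val a.fst m b.snd (red a.fst + n + red b.snd + j))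
          b.fst n' := by
  rw [lsum_comm (G.blocks q)]
  refine lsum_congr fun a _ => ?_
  rw [Cochain.lsum_blocks_cuts2]
  refine lsum_congr fun b _ => ?_
  simp only [rightC, BiCochain.val_lsum, smul_lsum]
  rw [lsum_comm]
  refine lsum_congr fun t ht => ?_
  refine lsum_congr fun t' ht' => ?_
  rw [Cochain.red_of_mem_blocks _ _ t ht, Cochain.red_of_mem_blocks _ _ t' ht']

/-- The differential of `insRight G T` involves the differential of `T` only, by the bimodule
relations. -/
theorem insRight_rel (T : Cochain Bᵍ Dᵍ g g 0) (p : Path X X') {n : ℤ}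
    (m : P.toGrBimod.Mod (g Y) X n) (q : Path Y' Y) (n' : ℤ) :
    lsum (cuts2 p) (fun a => lsum (cuts2 q) fun b => (P.rightC G P.μ).val a.snd
        ((P.insRight G T).val a.fst m b.snd (red a.fst + n + red b.snd + 0)) b.fst n')
      - ((red q + n).negOnePow • ins (idC Cᵍ) (idC Cᵍ) C.μ
            (fun p => (P.insRight G T).val p m q n') p
        + lsum (cuts2 p) (fun a => lsum (cuts2 q) (fun b => (red b.fst).negOnePow •
          (P.insRight G T).val a.snd ((P.rightC G P.μ).val a.fst m b.snd
            (red a.fst + n + red b.snd + 1)) b.fst n'))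
        + ins (idC Bᵍ) (idC Bᵍ) B.μ
          (fun q => (P.insRight G T).val p m q n') q)
      = -ins G.toCochain G.toCochain (AInfFunctor.homDC G G T) (fun t => P.μ.val p m t n') q := by
  have h₀ := ins_congr G.toCochain G.toCochain T (fun t => P.rel_eq p m t n') q
  rw [ins_zero_fun, ins_add, ins_add] at h₀
  simp only [lsum_comm (cuts2 p)] at h₀
  rw [ins_cuts2] at h₀
  have h₁ := AInfFunctor.ins_homDC G G T (P.μ.right_isML p m n') q
  -- the part where the transformation is inserted after the inner operation
  have h₂ : lsum (cuts2 q) (fun b => lsum (G.blocks b.snd) fun t =>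
        ins G.toCochain G.toCochain T (fun s => lsum (cuts2 p) fun a => (red s).negOnePow •
          P.μ.val a.snd (P.μ.val a.fst m t (red a.fst + n + red t + 1)) s n') b.fst)
      = -lsum (cuts2 p) (fun a => lsum (cuts2 q) fun b => (red b.fst).negOnePow •
          (P.insRight G T).val a.snd ((P.rightC G P.μ).val a.fst m b.snd
            (red a.fst + n + red b.snd + 1)) b.fst n') := by
    rw [lsum_comm (cuts2 p), ← lsum_neg]
    refine lsum_congr fun b _ => ?_
    simp only [ins_lsum]
    rw [lsum_comm, ← lsum_neg]
    refine lsum_congr fun a _ => ?_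
    simp only [rightC, insRight, BiCochain.val_lsum, ins_lsum, smul_lsum]
    rw [← lsum_neg]
    refine lsum_congr fun t ht => ?_
    rw [← Units.neg_smul, ← Int.negOnePow_succ, ← ins_units_smul,
      Cochain.red_of_mem_blocks _ _ t ht]
    refine ins_congr_red _ _ _ _ fun s hs => ?_
    exact congrArg₂ (· • ·) (negOnePow_congr ⟨-1, by rw [hs]; ring⟩) rfl
  have h₃ : lsum (cuts2 q) (fun b => ((0 - 1) * red b.fst).negOnePow •
        lsum (G.blocks b.fst) fun t =>
        ins G.toCochain G.toCochain T (fun s => lsum (cuts2 p) fun a => (red t).negOnePow •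
          P.μ.val a.snd (P.μ.val a.fst m s (red a.fst + n + red s + 1)) t n') b.snd)
      = lsum (cuts2 p) (fun a => lsum (cuts2 q) fun b => (P.rightC G P.μ).val a.snd
        ((P.insRight G T).val a.fst m b.snd (red a.fst + n + red b.snd + 0)) b.fst n') := by
    rw [lsum_comm (cuts2 p)]
    refine lsum_congr fun b _ => ?_
    simp only [ins_lsum]
    rw [lsum_comm, smul_lsum]
    refine lsum_congr fun a _ => ?_
    simp only [rightC, insRight, smul_lsum]
    refine lsum_congr fun t ht => ?_
    rw [ins_units_smul, smul_smul, ← Int.negOnePow_add, Cochain.red_of_mem_blocks _ _ t ht,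
      show (0 - 1) * red b.fst + red b.fst = 0 by ring, Int.negOnePow_zero, one_smul]
    refine Eq.trans ?_ (ins_map G.toCochain G.toCochain T (P.μ.valHom a.snd _ t n') _ b.snd).symm
    refine ins_congr_red _ _ _ _ fun s hs => ?_
    rw [hs, show red a.fst + n + (red b.snd + (0 - 1)) + 1 = red a.fst + n + red b.snd + 0 by ring]
    rfl
  have h₄ : ins G.toCochain G.toCochain T (fun t => (red t + n).negOnePow •
        ins (idC Cᵍ) (idC Cᵍ) C.μ (fun p => P.μ.val p m t n') p) q
      = -((red q + n).negOnePow • ins (idC Cᵍ) (idC Cᵍ) C.μ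
            (fun p => (P.insRight G T).val p m q n') p) := by
    simp only [insRight]
    rw [← ins_comm, ← Units.neg_smul, ← Int.negOnePow_succ, ← ins_units_smul]
    refine ins_congr_red _ _ _ _ fun t ht => ?_
    exact congrArg₂ (· • ·) (negOnePow_congr ⟨-1, by rw [ht]; ring⟩) rfl
  rw [h₂, h₃, h₄] at h₀
  rw [h₁, ← sub_eq_zero, ← h₀]
  simp only [zero_sub, Int.negOnePow_neg, Int.negOnePow_one, Units.neg_smul, one_smul, insRight]
  abel

end PullRight

end AInfBimodule

/-! ### Pullbacks of pure bimodules -/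

theorem BiCochain.ext {A : GrQuiver k} {B : GrQuiver k}
    {P : GrBimod.{u, v, w, v', w', z} A B} {Q : GrBimod.{u, v, w, v', w', z'} A B} {d : ℤ}
    {S T : BiCochain P Q d} (h : ∀ {X X' : A.Ob} {Y Y' : B.Ob} (p : Path X X') (n : ℤ)
      (m : P.Mod Y X n) (q : Path Y' Y) (n' : ℤ), S.val p m q n' = T.val p m q n') :
    S = T := by
  rcases S with ⟨s, _, _, _, _, _⟩
  rcases T with ⟨t, _, _, _, _, _⟩
  have : @s = @t := by
    funext X X' Y Y' p n m q n'
    exact h p n m q n'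
  subst this
  rfl

theorem AInfCat.vanishesBelow_μ (A : AInfCat k) : A.μ.VanishesBelow 1 :=
  ⟨fun {X Y} p n hp => by
    cases p with
    | nil => exact A.μ_nil X n
    | cons p a => simp at hp⟩

namespace AInfBimodule

section General

variable {A : AInfCat k} {B : AInfCat k}
variable (P : AInfBimodule.{u, v, w, v', w', z} A B)

theorem leftAct_sub {X X' : A.Ob} {Y : B.Ob} (a b : A.Hom X X' 0) {i : ℤ}
    (φ : P.toGrBimod.Mod Y X i) :
    P.μ.leftAct (a - b) φ = P.μ.leftAct a φ - P.μ.leftAct b φ := by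
  have h := ((P.μ.left_isML (X := X) (X' := X') φ (.nil : Path Y Y) i).insertHom .nil 0
    .nil).map_sub a b
  refine (congrArg (fun y => -(i.negOnePow • y)) h).trans ?_
  rw [smul_sub, neg_sub]
  exact (neg_sub_neg _ _).symm

theorem rightAct_sub {X : A.Ob} {Y Y' : B.Ob} (a b : B.Hom Y' Y 0) {i : ℤ}
    (φ : P.toGrBimod.Mod Y X i) :
    P.μ.rightAct φ (a - b) = P.μ.rightAct φ a - P.μ.rightAct φ b :=
  ((P.μ.right_isML (Y := Y) (Y' := Y') (.nil : Path X X) φ i).insertHom .nil 0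
    .nil).map_sub a b

/-- A coboundary acts on cocycles of a bimodule by coboundaries. -/
theorem leftAct_exact {X X' : A.Ob} {Y : B.Ob} {a : A.Hom X X' 0} (ha : a ∈ A.exact X X' 0) {i : ℤ}
    (φ : P.toGrBimod.Mod Y X i) (hφ : P.μ.lin i (i + 1) φ = 0) :
    ∃ η, P.μ.lin (i - 1) i η = P.μ.leftAct a φ := by
  obtain ⟨b, rfl⟩ := ha
  have h := P.rel_eq (str₁ b) φ (.nil : Path Y Y) i
  have z₁ := ins_eq_zero (idC Bᵍ) (idC Bᵍ)
    (P.μ.right_isML (str₁ b) φ i) (.nil : Path Y Y) B.vanishesBelow_μ Nat.zero_lt_one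
  have z₂ := ins_eq_leading (idC Aᵍ) (idC Aᵍ)
    (P.μ.left_isML φ (.nil : Path Y Y) i) (str₁ b) A.vanishesBelow_μ
  rw [z₁, z₂, A.μ.arrow_eq (N := 0) _ (by simp [red])] at h
  simp only [str₁, cuts2, List.map_cons, List.map_nil, List.singleton_append, lsum_cons, lsum_nil,
    red, add_zero, zero_add] at h
  have hφ₀ : P.μ.val .nil φ .nil (0 + i + 0 + 1) = 0 := by
    rw [show (0 + i + 0 + 1 : ℤ) = i + 1 by ring]
    exact hφ
  rw [hφ₀, BiCochain.val_zero_mid, smul_zero, zero_add, Int.negOnePow_zero, one_smul,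
    show (0 + (0 - 1 - 1) + i + 0 + 1 : ℤ) = i - 1 by ring] at h
  exact ⟨_, eq_neg_of_add_eq_zero_right h⟩

theorem rightAct_exact {X : A.Ob} {Y Y' : B.Ob} {a : B.Hom Y' Y 0} (ha : a ∈ B.exact Y' Y 0) {i : ℤ}
    (φ : P.toGrBimod.Mod Y X i) (hφ : P.μ.lin i (i + 1) φ = 0) :
    ∃ η, P.μ.lin (i - 1) i η = P.μ.rightAct φ a := by
  obtain ⟨b, rfl⟩ := ha
  have h := P.rel_eq (.nil : Path X X) φ (str₁ b) i
  have z₁ := ins_eq_zero (idC Aᵍ) (idC Aᵍ)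
    (P.μ.left_isML φ (str₁ b) i) (.nil : Path X X) A.vanishesBelow_μ Nat.zero_lt_one
  have z₂ := ins_eq_leading (idC Bᵍ) (idC Bᵍ)
    (P.μ.right_isML (.nil : Path X X) φ i) (str₁ b) B.vanishesBelow_μ
  rw [z₁, z₂, B.μ.arrow_eq (N := 0) _ (by simp [red]), smul_zero, zero_add] at h
  simp only [str₁, cuts2, List.map_cons, List.map_nil, List.singleton_append, lsum_cons, lsum_nil,
    red, add_zero, zero_add] at h
  have hφ₀ : P.μ.val .nil φ .nil (0 + i + 0 + 1) = 0 := by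
    rw [show (0 + i + 0 + 1 : ℤ) = i + 1 by ring]
    exact hφ
  rw [hφ₀, BiCochain.val_zero_mid, smul_zero, add_zero, Int.negOnePow_zero, one_smul,
    show (0 + i + (0 + (0 - 1 - 1)) + 1 : ℤ) = i - 1 by ring] at h
  exact ⟨-_, ((P.μ.lin _ _).map_neg _).trans (neg_eq_of_add_eq_zero_right h)⟩

end General

section PullLeft

variable {A : AInfCat k} {C : AInfCat k} {D : AInfCat k}
variable {f : A.Ob → C.Ob} (P : AInfBimodule.{u, v'', w'', x, x', z} C D) (F : AInfFunctor A C f)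

theorem pull_id_right : ∃ h₁ h₂ h₃, P.pull F (AInfFunctor.id D) =
    ⟨⟨fun Y X n => P.toGrBimod.Mod Y (f X) n⟩, P.leftC F P.μ, h₁, h₂, h₃⟩ := by
  have h : P.pullμ F (AInfFunctor.id D) = P.leftC F P.μ :=
    BiCochain.ext fun p n m q n' => lsum_congr fun r _ =>
      lsum_blocks_idC (P.μ.right_isML r m n') q
  rw [← h]
  exact ⟨_, _, _, rfl⟩

/-- The pullback of `c_P` is corrected by the action of the homotopy `T` between `F ∘ b_A` and
`b_C ∘ F`, whose order-zero part accounts for the change of the equivariant structures. -/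
theorem IsPure.pull_left {sA : PureStructure A} {sC : PureStructure C} {sD : PureStructure D}
    (hP : P.IsPure sC sD) (hF : F.IsRelated sA sC) :
    (P.pull F (AInfFunctor.id D)).IsPure sA sD := by
  obtain ⟨h₁, h₂, h₃, e⟩ := P.pull_id_right F
  rw [e]
  obtain ⟨c, hc, hw⟩ := hP
  obtain ⟨T, hT, hT₀⟩ := hF
  refine ⟨P.leftC F c + P.insLeft F T, fun {X X' Y Y'} p n m q n' => ?_, fun {X Y} i φ hφ => ?_⟩
  · rw [endD_add, nuLeft_eq, nuRight_eq, endD_eq, endD_eq]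
    have e₁ := P.insLeft_rel F T p m q n'
    have e₂ := lsum_congr fun r (_ : r ∈ F.blocks p) =>
      (P.endD_eq c r m q n').symm.trans ((hc r m q n').trans
        (by rw [nuLeft_eq, nuRight_eq]))
    rw [lsum_sub, lsum_sub, lsum_add, lsum_add, lsum_neg,
      blocks_ins_idC F.val_nil _ (P.μ.left_isML m q n'), ← smul_lsum,
      ← AInfFunctor.ins_μ_blocks F (c.left_isML m q n'), ← ins_lsum, ← ins_lsum,
      ← P.lsum_cuts2_leftC F c P.μ 1 (fun i => i.negOnePow)] at e₂
    have e₃ := P.lsum_cuts2_leftC F P.μ c 0 (fun _ => 1) p m q n'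
    simp only [one_smul] at e₃
    rw [← e₃] at e₂
    rw [hT, ins_sub_left _ _ _ _ (P.μ.left_isML m q n')] at e₁
    refine (congrArg₂ (· + ·) e₂ e₁).trans ?_
    refine Eq.trans ?_ (congrArg (fun y => -y - _)
      (ins_idC_blocks F.toCochain sA.b (P.μ.left_isML m q n') p).symm)
    exact (add_comm _ _).trans (by rw [neg_sub, sub_eq_add_neg, sub_eq_add_neg]; abel)
  · have l₁ : ∀ {d : ℤ} (S : BiCochain P.toGrBimod P.toGrBimod d) (a b : ℤ)
        (m : P.toGrBimod.Mod Y (f X) a), (P.leftC F S).lin a b m = S.lin a b m :=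
      fun S a b m => Cochain.lsum_blocks_nil F.toCochain (fun r => S.val r m .nil b)
    have l₂ : (P.insLeft F T).lin i i φ = -P.μ.leftAct (T.val (.nil : Path X X) 0) φ := by
      have := ins_eq_leading F.toCochain F.toCochain (P.μ.left_isML φ (.nil : Path Y Y) i)
        (.nil : Path X X) (vanishesBelow_zero T)
      rw [T.arrow_eq (N := 0) _ (by simp [red])] at this
      exact (congrArg (fun y => (0 + i).negOnePow • y) this).trans
        (by rw [zero_add, BiCochain.leftAct, neg_neg])
    have l₃ : (P.leftC F P.μ).leftAct (sA.c X) φ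
        = P.μ.leftAct (F.lin 0 0 (sA.c X)) φ := by
      have h : (P.leftC F P.μ).val (str₁ (sA.c X)) φ .nil i = P.μ.val (.cons .nil
          (F.arrow (str₁ (sA.c X)))) φ .nil i :=
        lsum_singleton _ (fun r => P.μ.val r φ .nil i)
      refine congrArg (fun y => -(i.negOnePow • y)) (h.trans ?_)
      rw [F.arrow_eq (N := 0) _ (by simp [red])]
      rfl
    have l₄ : (P.leftC F P.μ).rightAct φ (sD.c Y) = P.μ.rightAct φ (sD.c Y) :=
      Cochain.lsum_blocks_nil F.toCochain (fun r => P.μ.val r φ (str₁ (sD.c Y)) i)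
    have hφ' := (l₁ P.μ _ _ φ).symm.trans hφ
    obtain ⟨η, hη⟩ := hw i φ hφ'
    obtain ⟨ζ, hζ⟩ := P.leftAct_exact (hT₀ X) φ hφ'
    refine ⟨η - ζ, (l₁ P.μ _ _ _).trans (((P.μ.lin _ _).map_sub _ _).trans ?_)⟩
    refine (congrArg₂ (· - ·) hη hζ).trans ?_
    refine Eq.trans ?_ (congrArg₂ (· - ·) (congrArg₂ (· + ·) (congrArg₂ (· - ·)
      (congrArg₂ (· + ·) (l₁ c _ _ φ) l₂) l₃) l₄) rfl).symm
    rw [leftAct_sub, leftAct_sub]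
    abel

end PullLeft

section PullRight

variable {B : AInfCat k} {C : AInfCat k} {D : AInfCat k}
variable {g : B.Ob → D.Ob} (P : AInfBimodule.{u, v'', w'', x, x', z} C D) (G : AInfFunctor B D g)

theorem pull_id_left : ∃ h₁ h₂ h₃, P.pull (AInfFunctor.id C) G =
    ⟨⟨fun Y X n => P.toGrBimod.Mod (g Y) X n⟩, P.rightC G P.μ, h₁, h₂, h₃⟩ := by
  have h : P.pullμ (AInfFunctor.id C) G = P.rightC G P.μ :=
    BiCochain.ext fun p n m q n' => lsum_blocks_idC
      (IsML.lsum (fun t => P.μ.left_isML m t n') (G.blocks q)) p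
  rw [← h]
  exact ⟨_, _, _, rfl⟩

/-- The mirror image of `IsPure.pull_left`. -/
theorem IsPure.pull_right {sB : PureStructure B} {sC : PureStructure C} {sD : PureStructure D}
    (hP : P.IsPure sC sD) (hG : G.IsRelated sB sD) :
    (P.pull (AInfFunctor.id C) G).IsPure sC sB := by
  obtain ⟨h₁, h₂, h₃, e⟩ := P.pull_id_left G
  rw [e]
  obtain ⟨c, hc, hw⟩ := hP
  obtain ⟨T, hT, hT₀⟩ := hG
  refine ⟨P.rightC G c + P.insRight G T, fun {X X' Y Y'} p n m q n' => ?_, fun {X Y} i φ hφ => ?_⟩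
  · rw [endD_add, nuLeft_eq, nuRight_eq, endD_eq, endD_eq]
    have e₁ := P.insRight_rel G T p m q n'
    have e₂ := lsum_congr fun t (ht : t ∈ G.blocks q) =>
      (P.endD_eq c p m t n').symm.trans ((hc p m t n').trans
        (by rw [nuLeft_eq, nuRight_eq]))
    have e₀ := lsum_congr fun t (ht : t ∈ G.blocks q) =>
      congrArg (fun i : ℤ => (i + n).negOnePow • ins (idC Cᵍ) (idC Cᵍ) C.μ
        (fun p => c.val p m t n') p) (Cochain.red_of_mem_blocks _ _ t ht)
    rw [lsum_sub, lsum_sub, lsum_add, lsum_add, lsum_neg,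
      blocks_ins_idC G.val_nil _ (P.μ.right_isML p m n'), e₀, ← smul_lsum,
      ← AInfFunctor.ins_μ_blocks G (c.right_isML p m n'), ← ins_lsum, ← ins_lsum,
      ← P.lsum_cuts2_rightC G c P.μ 1 (fun i => i.negOnePow)] at e₂
    have e₃ := P.lsum_cuts2_rightC G P.μ c 0 (fun _ => 1) p m q n'
    simp only [one_smul] at e₃
    rw [← e₃] at e₂
    rw [hT, ins_sub_left _ _ _ _ (P.μ.right_isML p m n')] at e₁
    refine (congrArg₂ (· + ·) e₂ e₁).trans ?_
    refine Eq.trans ?_ (congrArg (fun y => _ - y)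
      (ins_idC_blocks G.toCochain sB.b (P.μ.right_isML p m n') q).symm)
    rw [neg_sub, sub_add_sub_cancel]
    rfl
  · have l₁ : ∀ {d : ℤ} (S : BiCochain P.toGrBimod P.toGrBimod d) (a b : ℤ)
        (m : P.toGrBimod.Mod (g Y) X a), (P.rightC G S).lin a b m = S.lin a b m :=
      fun S a b m => Cochain.lsum_blocks_nil G.toCochain (fun r => S.val .nil m r b)
    have l₂ : (P.insRight G T).lin i i φ = P.μ.rightAct φ (T.val (.nil : Path Y Y) 0) := by
      have := ins_eq_leading G.toCochain G.toCochain (P.μ.right_isML (.nil : Path X X) φ i)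
        (.nil : Path Y Y) (vanishesBelow_zero T)
      rw [T.arrow_eq (N := 0) _ (by simp [red])] at this
      exact this
    have l₃ : (P.rightC G P.μ).rightAct φ (sB.c Y)
        = P.μ.rightAct φ (G.lin 0 0 (sB.c Y)) := by
      have h : (P.rightC G P.μ).val .nil φ (str₁ (sB.c Y)) i = P.μ.val .nil φ (.cons .nil
          (G.arrow (str₁ (sB.c Y)))) i :=
        lsum_singleton _ (fun r => P.μ.val .nil φ r i)
      refine h.trans ?_
      rw [G.arrow_eq (N := 0) _ (by simp [red])]
      rfl
    have l₄ : (P.rightC G P.μ).leftAct (sC.c X) φ = P.μ.leftAct (sC.c X) φ :=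
      congrArg (fun y => -(i.negOnePow • y))
        (Cochain.lsum_blocks_nil G.toCochain (fun r => P.μ.val (str₁ (sC.c X)) φ r i))
    have hφ' := (l₁ P.μ _ _ φ).symm.trans hφ
    obtain ⟨η, hη⟩ := hw i φ hφ'
    obtain ⟨ζ, hζ⟩ := P.rightAct_exact (hT₀ Y) φ hφ'
    refine ⟨η + ζ, (l₁ P.μ _ _ _).trans (((P.μ.lin _ _).map_add _ _).trans ?_)⟩
    refine (congrArg₂ (· + ·) hη hζ).trans ?_
    refine Eq.trans ?_ (congrArg₂ (· - ·) (congrArg₂ (· + ·) (congrArg₂ (· - ·)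
      (congrArg₂ (· + ·) (l₁ c _ _ φ) l₂) l₄) l₃) rfl).symm
    rw [rightAct_sub, rightAct_sub]
    abel

end PullRight

section Pull

variable {A : AInfCat k} {B : AInfCat k}
variable {C : AInfCat k} {D : AInfCat k}
variable {f : A.Ob → C.Ob} {g : B.Ob → D.Ob}

/-- Purity of bimodules is preserved by pullback under functors which relate the pure
structures. -/
theorem IsPure.pull {P : AInfBimodule.{u, v'', w'', x, x', z} C D} {F : AInfFunctor A C f}
    {G : AInfFunctor B D g} {sA : PureStructure A} {sB : PureStructure B} {sC : PureStructure C}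
    {sD : PureStructure D} (hP : P.IsPure sC sD) (hF : F.IsRelated sA sC) (hG : G.IsRelated sB sD) :
    (P.pull F G).IsPure sA sB := by
  have h := IsPure.pull_right (P.pull F (AInfFunctor.id D)) G (IsPure.pull_left P F hP hF) hG
  have e : (P.pull F (AInfFunctor.id D)).pullμ (AInfFunctor.id A) G = P.pullμ F G := by
    refine BiCochain.ext fun p n m q n' => (lsum_blocks_idC (IsML.lsum (fun t =>
      (P.pullμ F (AInfFunctor.id D)).left_isML m t n') (G.blocks q)) p).trans ?_
    refine Eq.trans (lsum_congr fun t _ => lsum_congr fun r _ =>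
      lsum_blocks_idC (P.μ.right_isML r m n') t) ?_
    exact lsum_comm _ _ _
  have : ∃ h₁ h₂ h₃, (P.pull F (AInfFunctor.id D)).pull (AInfFunctor.id A) G =
      ⟨⟨fun Y X n => P.toGrBimod.Mod (g Y) (f X) n⟩, P.pullμ F G, h₁, h₂, h₃⟩ := by
    rw [← e]
    exact ⟨_, _, _, rfl⟩
  obtain ⟨_, _, _, e'⟩ := this
  rw [e'] at h
  exact h

end Pull

end AInfBimodule

/-! ### Pre-endomorphisms acting on cochains with values in a bimodule -/

theorem AInfFunctor.isRelated_id {A : AInfCat k} (s : PureStructure A) :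
    (AInfFunctor.id A).IsRelated s s := by
  refine ⟨0, ?_, fun X => ?_⟩
  · rw [AInfFunctor.homDC_zero]
    refine (sub_eq_zero.2 ?_).symm
    exact (idC_insC (idC Aᵍ) (idC Aᵍ) s.b (by omega)).trans (pre_idC s.b).symm
  · have h : (AInfFunctor.id A).lin 0 0 (s.c X) = s.c X :=
      ofLin_lin (fun _ _ _ => LinearMap.id) 0 (s.c X)
    rw [h, sub_self, sub_zero, Cochain.zero_val]
    exact zero_mem _

/-- All graph bimodules of a functor which relates the pure structures are pure. -/
theorem AInfFunctor.IsRelated.graphs_isPure {A : AInfCat k} {B : AInfCat k}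
    {f : A.Ob → B.Ob} {F : AInfFunctor A B f} {sA : PureStructure A} {sB : PureStructure B}
    (h : F.IsRelated sA sB) :
    F.leftGraph.IsPure sA sB ∧ F.rightGraph.IsPure sB sA ∧ F.twoSidedGraph.IsPure sA sA :=
  have hB := AInfBimodule.diag_isPure B sB
  have hid := AInfFunctor.isRelated_id sB
  ⟨hB.pull h hid, hB.pull hid h, hB.pull h h⟩

theorem Cochain.ins_cuts2_idC {A : GrQuiver k} {M : Type*} [AddCommGroup M] [Module k M]
    {d : ℤ} (T : Cochain A A (fun X => X) (fun X => X) d) {X Y : A.Ob}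
    {Ψ : ∀ Z : A.Ob, Path X Z → Path Z Y → M}
    (h₁ : ∀ Z q, IsML (fun p => Ψ Z p q)) (h₂ : ∀ Z p, IsML (fun q => Ψ Z p q))
    (p : Path X Y) :
    ins (idC A) (idC A) T (fun q => lsum (cuts2 q) fun b => Ψ b.Z b.fst b.snd) p
      = lsum (cuts2 p) (fun a => ins (idC A) (idC A) T (fun s => Ψ a.Z s a.snd) a.fst)
        + lsum (cuts2 p) (fun a => ((d - 1) * red a.fst).negOnePow •
          ins (idC A) (idC A) T (fun s => Ψ a.Z a.fst s) a.snd) := by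
  refine (ins_cuts2 (idC A) (idC A) T (fun b => Ψ b.Z b.fst b.snd) p).trans
    (congrArg₂ (· + ·) (lsum_congr fun a _ => ?_) (lsum_congr fun a _ => ?_))
  · have h : IsML (fun t => ins (idC A) (idC A) T (fun s => Ψ a.Z s t) a.fst) :=
      IsML.ins (idC A) (idC A) T (Ψ := fun t s => Ψ a.Z s t) (h₂ a.Z) a.fst
    exact lsum_blocks_idC h a.snd
  · have h : IsML (fun t => ins (idC A) (idC A) T (fun s => Ψ a.Z t s) a.snd) :=
      IsML.ins (idC A) (idC A) T (Ψ := fun t s => Ψ a.Z t s) (h₁ a.Z) a.snd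
    exact congrArg (((d - 1) * red a.fst).negOnePow • ·) (lsum_blocks_idC h a.fst)

section Evaluation

variable {H : GrQuiver k} {R : GrQuiver k} {g₀ g₁ : H.Ob → R.Ob} {d e : ℤ}

/-- The morphism spaces `R(g₀ Y, g₁ X)`, as a graded bimodule. -/
abbrev homBimod (R : GrQuiver k) (g₀ g₁ : H.Ob → R.Ob) :
    GrBimod.{u, v, w, v, w, w'} H H :=
  ⟨fun Y X n => R.Hom (g₀ Y) (g₁ X) n⟩

theorem BiCochain.isML_mid (c : BiCochain (homBimod R g₀ g₁) (homBimod R g₀ g₁) e)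
    (T : Cochain H R g₀ g₁ d) {X X' Y Y' : H.Ob} (p : Path X X') (q : Path Y' Y)
    (n : ℤ) : IsML (fun r : Path Y X => c.val p (T.val r (red r + d)) q n) where
  add r i a b t := by
    rw [red_marked, red_marked, red_marked]
    exact (congrArg (fun y => c.val p y q n) (T.val_add r i a b t _)).trans (c.val_add _ _ _ _ _)
  smul r i s a t := by
    rw [red_marked, red_marked]
    exact (congrArg (fun y => c.val p y q n) (T.val_smul r i s a t _)).trans (c.val_smul _ _ _ _ _)

theorem BiCochain.isML_cuts2_mid (c : BiCochain (homBimod R g₀ g₁) (homBimod R g₀ g₁) e)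
    (T : Cochain H R g₀ g₁ d) {X Z Y : H.Ob} (q : Path X Z) (n : ℤ) (s : ℤ → ℤˣ) :
    IsML (fun p : Path Z Y => lsum (cuts2 p) fun a => s (red a.fst) •
      c.val a.snd (T.val a.fst (red a.fst + d)) q n) :=
  IsML.cuts2 (Φ := fun _ r r' => c.val r' (T.val r (red r + d)) q n)
    (fun _ r' => c.isML_mid T r' q n) (fun _ r => c.left_isML _ q n) fun i _ => s i

/-- The action of a pre-endomorphism of a bimodule on the cochains with values in it. -/
def evC (c : BiCochain (homBimod R g₀ g₁) (homBimod R g₀ g₁) e) (T : Cochain H R g₀ g₁ d) (r : ℤ)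
    (hr : r = d + e := by omega) : Cochain H R g₀ g₁ r := 
  have hML : ∀ {X Y : H.Ob} (n : ℤ), IsML (fun p : Path X Y => lsum (cuts3 p) fun x =>
      (d * red x.fst).negOnePow • c.val x.last (T.val x.mid (red x.mid + d)) x.fst n) := fun {X Y} n => by
    have h := IsML.cuts2 (X := X) (Y := Y) (Φ := fun _ q q' => lsum (cuts2 q') fun a => (1 : ℤˣ) •
        c.val a.snd (T.val a.fst (red a.fst + d)) q n)
      (fun _ q' => IsML.lsum (fun a => (c.right_isML _ _ n).units_smul _) _)
      (fun _ q => c.isML_cuts2_mid T q n fun _ => 1) fun i _ => (d * i).negOnePow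
    simpa only [lsum_cuts3, one_smul, smul_lsum] using h
  { val := fun p n => lsum (cuts3 p) fun x =>
      (d * red x.fst).negOnePow • c.val x.last (T.val x.mid (red x.mid + d)) x.fst n
    val_eq_zero := fun p n hn => lsum_eq_zero fun x hx => by
      have := red_of_mem_cuts3 p x hx
      rw [c.val_eq_zero _ _ _ _ (by omega), smul_zero]
    val_add := fun p i a b q n => (hML n).add p i a b q
    val_smul := fun p i s a q n => (hML n).smul p i s a q }

theorem evC_val (c : BiCochain (homBimod R g₀ g₁) (homBimod R g₀ g₁) e) (T : Cochain H R g₀ g₁ d)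
    (r : ℤ) (hr : r = d + e) {X Y : H.Ob} (p : Path X Y) (n : ℤ) :
    (evC c T r hr).val p n = lsum (cuts3 p) fun x => (d * red x.fst).negOnePow •
      c.val x.last (T.val x.mid (red x.mid + d)) x.fst n := rfl

theorem evC_add (c : BiCochain (homBimod R g₀ g₁) (homBimod R g₀ g₁) e)
    (S T : Cochain H R g₀ g₁ d) (r : ℤ) (hr : r = d + e) :
    evC c (S + T) r hr = evC c S r hr + evC c T r hr := Cochain.ext fun p n => by
  simp only [evC_val, add_val, c.val_add, smul_add, lsum_add]

theorem evC_units_smul (c : BiCochain (homBimod R g₀ g₁) (homBimod R g₀ g₁) e) (s : ℤˣ)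
    (T : Cochain H R g₀ g₁ d) (r : ℤ) (hr : r = d + e) :
    evC c (s • T) r hr = s • evC c T r hr := Cochain.ext fun p n => by
  simp only [evC_val, units_smul_val, c.val_units_smul, smul_lsum]
  exact lsum_congr fun x _ => smul_comm _ _ _

theorem evC_neg (c : BiCochain (homBimod R g₀ g₁) (homBimod R g₀ g₁) e)
    (T : Cochain H R g₀ g₁ d) (r : ℤ) (hr : r = d + e) :
    evC c (-T) r hr = -evC c T r hr := by
  have h := evC_units_smul c (-1) T r hr
  simpa only [Units.neg_smul, one_smul] using h

theorem evC_sub (c : BiCochain (homBimod R g₀ g₁) (homBimod R g₀ g₁) e)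
    (S T : Cochain H R g₀ g₁ d) (r : ℤ) (hr : r = d + e) :
    evC c (S - T) r hr = evC c S r hr - evC c T r hr := by
  rw [sub_eq_add_neg, evC_add, evC_neg, ← sub_eq_add_neg]

theorem evC_eq_leading (c : BiCochain (homBimod R g₀ g₁) (homBimod R g₀ g₁) e)
    {T : Cochain H R g₀ g₁ d} (r : ℤ) (hr : r = d + e) {X Y : H.Ob} (p : Path X Y) (n : ℤ)
    (hT : T.VanishesBelow p.length) :
    (evC c T r hr).val p n = c.lin (red p + d) n (T.val p (red p + d)) := by
  rw [evC_val, lsum_cuts3_eq_mid p]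
  · simp [red]
    rfl
  · intro x hx h
    have := AInfCat.length_of_mem_cuts3 p x hx
    rw [hT.eq_zero _ _ (by omega), BiCochain.val_zero_mid, smul_zero]

theorem VanishesBelow.evC (c : BiCochain (homBimod R g₀ g₁) (homBimod R g₀ g₁) e)
    {T : Cochain H R g₀ g₁ d} (r : ℤ) (hr : r = d + e) {m : ℕ} (hT : T.VanishesBelow m) :
    (evC c T r hr).VanishesBelow m := ⟨fun p n hp => lsum_eq_zero fun x hx => by
  have := AInfCat.length_of_mem_cuts3 p x hx
  rw [hT.eq_zero _ _ (by omega), BiCochain.val_zero_mid, smul_zero]⟩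

theorem lsum_cuts3_mid_coassoc {M : Type*} [AddCommGroup M] {X Y : H.Ob} (p : Path X Y)
    (φ : ∀ {Z₁ Z₂ Z₃ Z₄ : H.Ob}, Path X Z₁ → Path Z₁ Z₂ → Path Z₂ Z₃ →
      Path Z₃ Z₄ → Path Z₄ Y → M) :
    lsum (cuts3 p) (fun o => lsum (cuts3 o.mid) fun i => φ o.fst i.fst i.mid i.last o.last)
      = lsum (cuts3 p) fun x => lsum (cuts2 x.last) fun a => lsum (cuts2 x.fst) fun b =>
        φ b.fst b.snd x.mid a.fst a.snd := by
  have h₁ : ∀ x : Cut3 X Y, lsum (cuts2 x.last) (fun a => lsum (cuts2 x.fst) fun b =>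
      φ b.fst b.snd x.mid a.fst a.snd) = lsum (cuts2 x.fst) fun b => lsum (cuts2 x.last) fun a =>
        φ b.fst b.snd x.mid a.fst a.snd := fun x => lsum_comm _ _ _
  rw [lsum_congr fun x _ => h₁ x, cuts3_fst_coassoc p (fun b₁ b₂ m l => lsum (cuts2 l) fun a =>
    φ b₁ b₂ m a.fst a.snd), lsum_cuts3]
  refine lsum_congr fun a _ => ?_
  exact (cuts3_last_coassoc a.snd (fun b₂ m a₁ a₂ => φ a.fst b₂ m a₁ a₂)).symm

end Evaluation

/-! ### The Euler operator commutes with the differential -/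

section EvaluationD

variable {H : AInfCat k} {R : GrQuiver k} {g₀ g₁ : H.Ob → R.Ob} {d : ℤ}
variable (c : BiCochain (homBimod (H := Hᵍ) R g₀ g₁)
  (homBimod (H := Hᵍ) R g₀ g₁) 0)
variable (m : BiCochain (homBimod (H := Hᵍ) R g₀ g₁)
  (homBimod (H := Hᵍ) R g₀ g₁) 1)
variable (T : Cochain Hᵍ R g₀ g₁ d)

/-- The operation of the source, inserted in a string on which `c` acts by way of `T`, meets either
the inputs of `T` or the bimodule inputs of `c` on one of the two sides. -/
theorem ins_μ_evC {X Y : H.Ob} (p : Path X Y) (n : ℤ) :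
    ins (idC Hᵍ) (idC Hᵍ) H.μ (fun q => (evC c T d).val q n) p
      = d.negOnePow • (lsum (cuts3 p) fun x => (d * red x.fst).negOnePow •
          ins (idC Hᵍ) (idC Hᵍ) H.μ
            (fun q => c.val x.last (T.val x.mid (red x.mid + d)) q n) x.fst)
        + ((evC c (insC (idC Hᵍ) (idC Hᵍ) H.μ T (d + 1)) (d + 1)).val p n
        + d.negOnePow • lsum (cuts3 p) fun x => (d * red x.fst).negOnePow •
          (red x.fst + (red x.mid + d)).negOnePow •
          ins (idC Hᵍ) (idC Hᵍ) H.μ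
            (fun q => c.val q (T.val x.mid (red x.mid + d)) x.fst n) x.last) := by
  have e₁ := ins_cuts2_idC H.μ (Ψ := fun Z (q : Path X Z) (q' : Path Z Y) =>
      (d * red q).negOnePow • lsum (cuts2 q') fun a => c.val a.snd (T.val a.fst (red a.fst + d)) q n)
    (fun Z q' => (IsML.lsum (fun a : Cut2 Z Y => c.right_isML a.snd
      (T.val a.fst (red a.fst + d)) n) (cuts2 q')).red_smul fun i => (d * i).negOnePow)
    (fun Z q => by
      have := (c.isML_cuts2_mid T (X := X) (Y := Y) q n fun _ => 1).units_smul (d * red q).negOnePow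
      simpa only [one_smul] using this) p
  refine (ins_congr _ _ _ (fun q => ?_) p).trans (e₁.trans (congrArg₂ (· + ·) ?_ ?_))
  · rw [evC_val, lsum_cuts3]
    refine lsum_congr fun a _ => ?_
    dsimp only
    rw [smul_lsum]
  · rw [lsum_cuts3, smul_lsum]
    refine lsum_congr fun a _ => ?_
    refine (ins_congr_red (idC Hᵍ) (idC Hᵍ) H.μ (Ψ := fun s =>
      (d + d * red a.fst).negOnePow • lsum (cuts2 a.snd) fun b =>
        c.val b.snd (T.val b.fst (red b.fst + d)) s n) a.fst (fun s hs => ?_)).trans ?_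
    · rw [hs]
      exact congrArg₂ (· • ·) (congrArg _ (by ring)) rfl
    · rw [ins_units_smul, ins_lsum, smul_lsum, smul_lsum]
      refine lsum_congr fun b _ => ?_
      rw [smul_smul, ← Int.negOnePow_add]
  · have e₂ : ∀ a : Cut2 X Y, ((2 - 1) * red a.fst).negOnePow •
        ins (idC Hᵍ) (idC Hᵍ) H.μ (fun s => (d * red a.fst).negOnePow •
          lsum (cuts2 s) fun b => c.val b.snd (T.val b.fst (red b.fst + d)) a.fst n) a.snd
        = (lsum (cuts2 a.snd) fun b => ((d + 1) * red a.fst).negOnePow • c.val b.snd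
            ((insC (idC Hᵍ) (idC Hᵍ) H.μ T (d + 1)).val b.fst
              (red b.fst + (d + 1))) a.fst n)
          + lsum (cuts2 a.snd) fun b => d.negOnePow • (d * red a.fst).negOnePow •
            (red a.fst + (red b.fst + d)).negOnePow •
            ins (idC Hᵍ) (idC Hᵍ) H.μ
              (fun q => c.val q (T.val b.fst (red b.fst + d)) a.fst n) b.snd := fun a => by
      have e₃ := ins_cuts2_idC H.μ (Ψ := fun Z (q : Path a.Z Z) (q' : Path Z Y) =>
        c.val q' (T.val q (red q + d)) a.fst n) (fun Z q' => c.isML_mid T q' a.fst n)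
        (fun Z q => c.left_isML _ a.fst n) a.snd
      rw [ins_units_smul, e₃, smul_add, smul_add]
      refine congrArg₂ (· + ·) ?_ ?_
      · rw [smul_smul, smul_lsum, ← Int.negOnePow_add]
        refine lsum_congr fun b _ => congrArg₂ (· • ·) (congrArg _ (by ring)) ?_
        rw [insC_val]
        refine Eq.trans ?_ (ins_map (idC Hᵍ) (idC Hᵍ) H.μ
          (c.valHom b.snd _ a.fst n) _ b.fst).symm
        refine ins_congr_red _ _ _ _ fun s hs => ?_
        rw [show red s + d = red b.fst + (d + 1) by rw [hs]; ring]
        rfl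
      · rw [smul_smul, smul_lsum, ← Int.negOnePow_add]
        refine lsum_congr fun b _ => ?_
        rw [smul_smul, smul_smul, smul_smul, ← Int.negOnePow_add, ← Int.negOnePow_add,
          ← Int.negOnePow_add]
        exact congrArg₂ (· • ·) (negOnePow_congr ⟨-d, by ring⟩) rfl
    rw [lsum_congr fun a _ => e₂ a, lsum_add, evC_val, lsum_cuts3, lsum_cuts3, smul_lsum]
    refine congrArg₂ (· + ·) rfl (lsum_congr fun a _ => ?_)
    rw [smul_lsum]

/-- The composition of the actions of two pre-endomorphisms is the action of their composition. -/
theorem evC_evC {d' : ℤ} {X Y : H.Ob} {e e' : ℤ}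
    (c : BiCochain (homBimod (H := Hᵍ) R g₀ g₁) (homBimod (H := Hᵍ) R g₀ g₁) e)
    (c' : BiCochain (homBimod (H := Hᵍ) R g₀ g₁) (homBimod (H := Hᵍ) R g₀ g₁) e')
    (hd : d' = d + e) (r : ℤ) (hr : r = d' + e') (p : Path X Y) (n : ℤ) :
    (evC c' (evC c T d') r).val p n = lsum (cuts3 p) fun x => (d * red x.fst).negOnePow •
      lsum (cuts2 x.last) fun a => lsum (cuts2 x.fst) fun b => (e * red b.fst).negOnePow •
        c'.val a.snd (c.val a.fst (T.val x.mid (red x.mid + d)) b.snd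
          (red a.fst + (red x.mid + d) + red b.snd + e)) b.fst n := by
  have key := lsum_cuts3_mid_coassoc p (fun {Z₁ Z₂ Z₃ Z₄} (b₁ : Path X Z₁)
    (b₂ : Path Z₁ Z₂) (m : Path Z₂ Z₃) (a₁ : Path Z₃ Z₄)
    (a₂ : Path Z₄ Y) => (d' * red b₁).negOnePow • (d * red b₂).negOnePow •
      c'.val a₂ (c.val a₁ (T.val m (red m + d)) b₂ (red a₁ + (red m + d) + red b₂ + e)) b₁ n)
  refine Eq.trans (lsum_congr fun o _ => ?_) (key.trans (lsum_congr fun x _ => ?_))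
  · rw [evC_val, BiCochain.val_lsum, smul_lsum]
    refine lsum_congr fun i hi => ?_
    have := red_of_mem_cuts3 o.mid i hi
    rw [BiCochain.val_units_smul, show red o.mid + d' = red i.last + (red i.mid + d) + red i.fst + e
      by omega]
  · rw [smul_lsum]
    refine lsum_congr fun a _ => ?_
    rw [smul_lsum]
    refine lsum_congr fun b hb => ?_
    have := red_of_mem_cuts2 x.fst b hb
    rw [smul_smul, smul_smul, ← Int.negOnePow_add, ← Int.negOnePow_add, hd, ← this]
    exact congrArg₂ (· • ·) (congrArg _ (by ring)) rfl

end EvaluationD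

section Derivation

variable {A : AInfCat k} {R : GrQuiver k} {g₀ g₁ : A.hcat.Ob → R.Ob} {d : ℤ}

theorem units_combination {V : Type*} [AddCommGroup V] [Module k V] (s : ℤˣ) (q : k)
    {a b e f g j x y : V} (h : a - (y + f + x) = b - q • e) :
    -(a - b) - (-s) • (s • x + (g + s • y) - q • j) = -f - (-s) • g - q • (-e - (-s) • j) := by
  have h' : a = b - q • e + (y + f + x) := sub_eq_iff_eq_add.mp h
  subst h'
  rcases Int.units_eq_one_or s with rfl | rfl <;>
  simp only [Units.neg_smul, one_smul, smul_neg, neg_neg, smul_sub, smul_add] <;> abel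

/-- The differential on cochains with values in a bimodule with structure maps `m`. -/
noncomputable def evD (m : BiCochain (homBimod (H := Aʰ) R g₀ g₁)
    (homBimod (H := Aʰ) R g₀ g₁) 1) (T : Cochain Aʰ R g₀ g₁ d) :
    Cochain Aʰ R g₀ g₁ (d + 1) :=
  -evC m T (d + 1) - (d - 1).negOnePow •
    insC (idC Aʰ) (idC Aʰ) A.hcat.μ T (d + 1)

/-- The Euler operator on cochains with values in a bimodule: the action of a pre-endomorphism,
minus composition with the Euler vector field of the source. -/
noncomputable def evEuler (c : BiCochain (homBimod (H := Aʰ) R g₀ g₁)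
    (homBimod (H := Aʰ) R g₀ g₁) 0) (T : Cochain Aʰ R g₀ g₁ d) :
    Cochain Aʰ R g₀ g₁ d :=
  evC c T d - insC (idC Aʰ) (idC Aʰ) (eulerC Aʰ) T d

variable {c : BiCochain (homBimod (H := Aʰ) R g₀ g₁)
  (homBimod (H := Aʰ) R g₀ g₁) 0}
variable {m : BiCochain (homBimod (H := Aʰ) R g₀ g₁)
  (homBimod (H := Aʰ) R g₀ g₁) 1}

theorem evEuler_val (T : Cochain Aʰ R g₀ g₁ d) {X Y : A.hcat.Ob}
    (p : Path X Y) (n : ℤ) : (evEuler c T).val p n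
      = (evC c T d).val p n - ((red p + p.length : ℤ) : k) • T.val p n := by
  rw [evEuler, sub_val, insC_val, ins_eulerC (A := Aʰ) (T.isML n)]

theorem evD_val (T : Cochain Aʰ R g₀ g₁ d) {X Y : A.hcat.Ob}
    (p : Path X Y) (n : ℤ) : (evD m T).val p n = -(evC m T (d + 1)).val p n
      - (d - 1).negOnePow • ins (idC Aʰ) (idC Aʰ) A.hcat.μ
        (fun q => T.val q n) p := by
  rw [evD, sub_val, neg_val, units_smul_val, insC_val]

/-- The equation `d c = ν(e) - ν(e)` for the Euler fields says exactly that the operator `evEuler c`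
commutes with the differential, as the operations of a graded category have weight zero. -/
theorem evD_evEuler (hc : ∀ {X X' Y Y' : A.hcat.Ob} (p : Path X X') {n : ℤ}
      (y : R.Hom (g₀ Y) (g₁ X) n) (q : Path Y' Y) (n' : ℤ),
      lsum (cuts2 p) (fun a => lsum (cuts2 q) fun b =>
          m.val a.snd (c.val a.fst y b.snd (red a.fst + n + red b.snd + 0)) b.fst n')
        - ((red q + n).negOnePow • ins (idC Aʰ) (idC Aʰ) A.hcat.μ
              (fun p => c.val p y q n') p
          + lsum (cuts2 p) (fun a => lsum (cuts2 q) (fun b => (red b.fst).negOnePow •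
            c.val a.snd (m.val a.fst y b.snd (red a.fst + n + red b.snd + 1)) b.fst n'))
          + ins (idC Aʰ) (idC Aʰ) A.hcat.μ
              (fun q => c.val p y q n') q)
        = -(((red p + p.length : ℤ) : k) • m.val p y q n'
          + ((red q + q.length : ℤ) : k) • m.val p y q n'))
    (T : Cochain Aʰ R g₀ g₁ d) : evD m (evEuler c T) = evEuler c (evD m T) := by
  refine Cochain.ext fun {X Y} p n => ?_
  set W := insC (idC Aʰ) (idC Aʰ) (eulerC Aʰ) T d
    with hW
  set N := insC (idC Aʰ) (idC Aʰ) A.hcat.μ T (d + 1) with hN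
  -- the failure of `c` to be closed, applied to the values of `T`
  have h₁ := lsum_congr fun (x : Cut3 X Y) (_ : x ∈ cuts3 p) =>
    congrArg (fun y => (d * red x.fst).negOnePow • y)
      (hc x.last (T.val x.mid (red x.mid + d)) x.fst n)
  simp only [smul_sub, smul_add, lsum_sub, lsum_add] at h₁
  have e₁ := evC_evC (H := A.hcat) T c m (d' := d) (by omega) (d + 1) (by omega) p n
  have e₂ := evC_evC (H := A.hcat) T m c (d' := d + 1) (by omega) (d + 1) (by omega) p n
  have e₃ := ins_μ_evC (H := A.hcat) c T p n
  simp only [zero_mul, Int.negOnePow_zero, one_smul, one_mul] at e₁ e₂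
  rw [← e₁, ← e₂] at h₁
  -- the weights add up
  have h₂ : lsum (cuts3 p) (fun x => (d * red x.fst).negOnePow •
      -(((red x.last + x.last.length : ℤ) : k) • m.val x.last (T.val x.mid (red x.mid + d)) x.fst n
        + ((red x.fst + x.fst.length : ℤ) : k) • m.val x.last (T.val x.mid (red x.mid + d)) x.fst n))
      = (evC m W (d + 1)).val p n - ((red p + p.length : ℤ) : k) • (evC m T (d + 1)).val p n := by
    rw [evC_val, evC_val, smul_lsum, ← lsum_sub]
    refine lsum_congr fun x hx => ?_
    have r₁ := red_of_mem_cuts3 p x hx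
    have r₂ := AInfCat.length_of_mem_cuts3 p x hx
    rw [hW, insC_val, ins_eulerC (A := Aʰ) (T.isML _), m.val_smul,
      smul_comm _ ((d * red x.fst).negOnePow), ← smul_sub, ← sub_smul, ← add_smul, ← neg_smul,
      ← r₁, ← r₂]
    push_cast
    congr 2
    ring
  have h₃ : ins (idC Aʰ) (idC Aʰ) A.hcat.μ (fun q => W.val q n) p
      = ((red p + p.length : ℤ) : k) • N.val p n := by
    have := ins_comm_of_closed (A := A.hcat) (eulerC Aʰ) (homDC_euler A)
      (T.isML n) p
    rw [ins_eulerC (A := Aʰ)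
      (isML_ins _ _ _ (T.isML n) : IsML fun q : Path X Y => ins _ _ A.hcat.μ _ q)] at this
    exact this
  have h₄ : (evC c (evD m T) (d + 1)).val p n = -(evC c (evC m T (d + 1)) (d + 1)).val p n
      - (d - 1).negOnePow • (evC c N (d + 1)).val p n := by
    rw [evD, evC_sub, evC_neg, evC_units_smul, sub_val, units_smul_val, neg_val]
  have h₅ : (evC m (evEuler c T) (d + 1)).val p n
      = (evC m (evC c T d) (d + 1)).val p n - (evC m W (d + 1)).val p n := by
    rw [evEuler, evC_sub, sub_val]
  have h₆ : ins (idC Aʰ) (idC Aʰ) A.hcat.μ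
        (fun q => (evEuler c T).val q n) p
      = ins (idC Aʰ) (idC Aʰ) A.hcat.μ
        (fun q => (evC c T d).val q n) p - ((red p + p.length : ℤ) : k) • N.val p n := by
    rw [← h₃, ← ins_sub]
    exact ins_congr _ _ _ (fun q => sub_val _ _ q n) p
  have hs : (d - 1).negOnePow = -d.negOnePow := Int.negOnePow_sub _ _ |>.trans (by simp)
  have hN' : ins (idC Aʰ) (idC Aʰ) A.hcat.μ
      (fun q => T.val q n) p = N.val p n := by rw [hN, insC_val]
  rw [evD_val, evEuler_val, h₄, h₅, h₆, evD_val, e₃, hs, hN']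
  rw [h₂] at h₁
  exact units_combination _ _ h₁

end Derivation

/-! ### Extending transformations which are natural up to homotopy -/

namespace AInfFunctor

section Straighten

variable {A : AInfCat k} {B : AInfCat k} {g₀ g₁ : A.hcat.Ob → B.Ob} {d : ℤ}

/-- If the lowest order of `u` consists of coboundaries, it can be removed by subtracting the
differential of a cochain. -/
theorem exists_homDC_sub {G₀ : AInfFunctor A.hcat B g₀} {G₁ : AInfFunctor A.hcat B g₁}
    {u : Cochain Aʰ Bᵍ g₀ g₁ (d + 1)} {m : ℕ} (hu : u.VanishesBelow m)
    (he : ∀ {X Y : A.hcat.Ob} (p : Path X Y), p.length = m →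
      u.val p (red p + (d + 1)) ∈ B.exact (g₀ X) (g₁ Y) (red p + (d + 1))) :
    ∃ x : Cochain Aʰ Bᵍ g₀ g₁ d, x.VanishesBelow m ∧
      (u - homDC G₀ G₁ x).VanishesBelow (m + 1) := by
  refine ⟨u.thenC B.primC d (by ring), hu.thenC_primC d (by ring), ?_⟩
  refine vanishesBelow_of_val fun {X Y} p hp => ?_
  have hx := hu.thenC_primC (B := B) d (by ring)
  rcases Nat.lt_succ_iff_lt_or_eq.mp hp with h | h
  · rw [sub_val, hu.eq_zero p _ h, (vanishesBelow_homDC G₀ G₁ hx).eq_zero p _ h, sub_zero]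
  · rw [sub_val, homDC_leading _ _ p _ (hx.mono h.le), linD_hcat_val,
      d_thenC_primC u p d (by ring) (he p h), sub_self]

variable (c : BiCochain (homBimod (H := Aʰ) Bᵍ g₀ g₁)
  (homBimod (H := Aʰ) Bᵍ g₀ g₁) 0)

theorem evEuler_sub (S T : Cochain Aʰ Bᵍ g₀ g₁ d) :
    evEuler c (S - T) = evEuler c S - evEuler c T := by
  refine Cochain.ext fun p n => ?_
  rw [sub_val, evEuler_val, evEuler_val, evEuler_val, evC_sub, sub_val, sub_val, smul_sub]
  abel

theorem evEuler_add_smul (r : k) (S T : Cochain Aʰ Bᵍ g₀ g₁ d) :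
    evEuler c (S + r • T) = evEuler c S + r • evEuler c T := by
  refine Cochain.ext fun p n => ?_
  have e : (evC c (r • T) d).val p n = r • (evC c T d).val p n := by
    rw [evC_val, evC_val, smul_lsum]
    refine lsum_congr fun x _ => ?_
    rw [smul_val, c.val_smul, smul_comm]
  rw [add_val, smul_val, evEuler_val, evEuler_val, evEuler_val, evC_add, add_val, add_val,
    smul_val, e, smul_add, smul_sub, smul_comm r]
  abel

theorem _root_.AInf.Cochain.VanishesBelow.evEuler
    {T : Cochain Aʰ Bᵍ g₀ g₁ d} {m : ℕ} (hT : T.VanishesBelow m) :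
    (evEuler c T).VanishesBelow m := ⟨fun p n hp => by
  rw [evEuler_val, (VanishesBelow.evC c d (by omega) hT).eq_zero p n hp, hT.eq_zero p n hp,
    smul_zero, sub_zero]⟩

variable {c}
/-- On closed terms of order `m`, the Euler operator acts on cochains of degree `d` with weight `d -
m`. -/
theorem evEuler_leading (hw : ∀ {X Y : A.hcat.Ob} (i : ℤ) (φ : B.Hom (g₀ X) (g₁ Y) i),
      B.d i (i + 1) φ = 0 → c.lin i i φ - (i : k) • φ ∈ B.exact (g₀ X) (g₁ Y) i)
    {T : Cochain Aʰ Bᵍ g₀ g₁ d} {X Y : A.hcat.Ob}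
    (p : Path X Y) (hT : T.VanishesBelow p.length)
    (hd : B.d (red p + d) (red p + (d + 1)) (T.val p (red p + d)) = 0) :
    (evEuler c T).val p (red p + d) - ((d - p.length : ℤ) : k) • T.val p (red p + d)
      ∈ B.exact (g₀ X) (g₁ Y) (red p + d) := by
  have h := hw (red p + d) (T.val p (red p + d)) (by rw [add_assoc]; exact hd)
  rw [evEuler_val, evC_eq_leading c d (by omega) p _ hT]
  have e : ∀ a b : B.Hom (g₀ X) (g₁ Y) (red p + d), a - ((red p + p.length : ℤ) : k) • b
      - ((d - p.length : ℤ) : k) • b = a - ((red p + d : ℤ) : k) • b := fun a b => by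
    rw [sub_sub, ← add_smul]
    push_cast
    congr 2
    ring
  exact (e _ _).symm ▸ h

/-- The data of the inductive construction of a natural transformation: a cochain `t` which is
closed up to strings of length `m`, and whose image under the Euler operator is up to length
`m - 1` the coboundary of `s`. -/
structure PartialTransformation (G₀ : AInfFunctor A.hcat B g₀) (G₁ : AInfFunctor A.hcat B g₁)
    (c : BiCochain (homBimod (H := Aʰ) Bᵍ g₀ g₁)
      (homBimod (H := Aʰ) Bᵍ g₀ g₁) 0) (m : ℕ)
    (t : Cochain Aʰ Bᵍ g₀ g₁ (d + 1))
    (s : Cochain Aʰ Bᵍ g₀ g₁ d) : Prop where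
  closed : (homDC G₀ G₁ t).VanishesBelow (m + 1)
  euler : (evEuler c t - homDC G₀ G₁ s).VanishesBelow m

variable {G₀ : AInfFunctor A.hcat B g₀} {G₁ : AInfFunctor A.hcat B g₁}

theorem homDC_smul (r : k) (T : Cochain Aʰ Bᵍ g₀ g₁ d) :
    homDC G₀ G₁ (r • T) = r • homDC G₀ G₁ T := by
  refine Cochain.ext fun p n => ?_
  rw [smul_val, homDC_val', homDC_val', ins_k_smul_left _ _ _ _ (B.μ.isML n), smul_sub,
    smul_comm r]
  exact congrArg (fun y => _ - _ • y) (ins_k_smul _ _ _ r _ p)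

/-- The error in the equation for `s`, at order `m`, and the obstruction to closedness, at order `m
+ 1`, both have the nonzero weight `-m`. The first is absorbed in `t` and `s`; then the second is
both a multiple of a coboundary and an eigenvector, hence a coboundary. -/
theorem PartialTransformation.exists_succ [CharZero k]
    (hw : ∀ {X Y : A.hcat.Ob} (i : ℤ) (φ : B.Hom (g₀ X) (g₁ Y) i),
      B.d i (i + 1) φ = 0 → c.lin i i φ - (i : k) • φ ∈ B.exact (g₀ X) (g₁ Y) i)
    (hcomm : ∀ {d : ℤ} (T : Cochain Aʰ Bᵍ g₀ g₁ d),
      homDC G₀ G₁ (evEuler c T) = evEuler c (homDC G₀ G₁ T)) (hd : d + 1 = 0) {m : ℕ} (hm : 1 ≤ m)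
    {t : Cochain Aʰ Bᵍ g₀ g₁ (d + 1)}
    {s : Cochain Aʰ Bᵍ g₀ g₁ d}
    (h : PartialTransformation G₀ G₁ c m t s) :
    ∃ t' s', PartialTransformation G₀ G₁ c (m + 1) t' s' ∧ (t' - t).VanishesBelow m := by
  have hm₀ : (m : k) ≠ 0 := Nat.cast_ne_zero.mpr (by omega)
  set v := evEuler c t - homDC G₀ G₁ s with hv
  have hδv : homDC G₀ G₁ v = evEuler c (homDC G₀ G₁ t) := by
    rw [hv, homDC_sub, homDC_homDC, sub_zero, hcomm]
  have hv₁ : (homDC G₀ G₁ v).VanishesBelow (m + 1) := hδv ▸ h.closed.evEuler c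
  -- the Euler operator multiplies the leading term of `v` by `-m`, up to coboundaries
  set v₁ := v + (m : k)⁻¹ • evEuler c v with hv₁'
  have hv₂ : v₁.VanishesBelow m :=
    h.euler.add ⟨fun p n hp => by rw [smul_val, (h.euler.evEuler c).eq_zero p n hp, smul_zero]⟩
  obtain ⟨z, hz, hz'⟩ := exists_homDC_sub (G₀ := G₀) (G₁ := G₁) hv₂ fun {X Y} p hp => by
    have hdv : B.d (red p + (d + 1)) (red p + (d + 1 + 1)) (v.val p (red p + (d + 1))) = 0 := by
      rw [← linD_hcat_val, ← homDC_leading G₀ G₁ p _ (h.euler.mono hp.le)]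
      exact hv₁.eq_zero p _ (by omega)
    have := Submodule.smul_mem _ (m : k)⁻¹ (evEuler_leading hw p (h.euler.mono hp.le) hdv)
    have e : ((d + 1 - p.length : ℤ) : k) = -m := by rw [hd, hp]; simp
    rw [e, smul_sub, smul_smul, mul_neg, inv_mul_cancel₀ hm₀, neg_one_smul, sub_neg_eq_add] at this
    rw [hv₁', add_val, smul_val, add_comm (v.val p _)]
    exact this
  set t₁ := t + (m : k)⁻¹ • v with ht₁
  have hD : evEuler c t₁ - homDC G₀ G₁ (s + z) = v₁ - homDC G₀ G₁ z := by
    refine Cochain.ext fun p n => ?_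
    rw [ht₁, evEuler_add_smul, homDC_add, hv₁', hv]
    simp only [sub_val, add_val]
    abel
  have hu : (homDC G₀ G₁ t₁).VanishesBelow (m + 1) := by
    rw [ht₁, homDC_add, homDC_smul]
    exact h.closed.add ⟨fun p n hp => by rw [smul_val, hv₁.eq_zero p n hp, smul_zero]⟩
  -- the Euler operator multiplies the leading term of the coboundary of `t₁`, which is closed,
  -- by `-m` up to coboundaries, and sends it to a coboundary
  obtain ⟨x, hx, hx'⟩ := exists_homDC_sub (G₀ := G₀) (G₁ := G₁) hu fun {X Y} p hp => by
    have hdu : B.d (red p + (d + 1 + 1)) (red p + (d + 1 + 1 + 1))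
        ((homDC G₀ G₁ t₁).val p (red p + (d + 1 + 1))) = 0 := by
      rw [← linD_hcat_val, ← homDC_leading G₀ G₁ p _ (hu.mono hp.le), homDC_homDC]
      rfl
    have h₁ := evEuler_leading hw p (hu.mono hp.le) hdu
    have h₂ : (evEuler c (homDC G₀ G₁ t₁)).val p (red p + (d + 1 + 1))
        ∈ B.exact (g₀ X) (g₁ Y) (red p + (d + 1 + 1)) := by
      have e : evEuler c (homDC G₀ G₁ t₁) = homDC G₀ G₁ (v₁ - homDC G₀ G₁ z) := by
        rw [← hD, homDC_sub, homDC_homDC, sub_zero, hcomm]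
      rw [e, homDC_leading G₀ G₁ p _ (hz'.mono hp.le), linD_hcat_val]
      exact B.d_mem_exact _
    have e : ((d + 1 + 1 - p.length : ℤ) : k) = -m := by rw [hd, hp]; push_cast; ring
    rw [e, neg_smul, sub_neg_eq_add] at h₁
    have h₃ := (Submodule.add_mem_iff_right _ h₂).mp h₁
    exact (Submodule.smul_mem_iff _ hm₀).mp h₃
  refine ⟨t₁ - x, s + z, ⟨?_, ?_⟩, ?_⟩
  · rw [homDC_sub]
    exact hx'
  · have e : evEuler c (t₁ - x) - homDC G₀ G₁ (s + z) = v₁ - homDC G₀ G₁ z - evEuler c x := by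
      rw [← hD, evEuler_sub]
      exact sub_right_comm _ _ _
    rw [e]
    exact hz'.sub (hx.evEuler c)
  · have e : t₁ - x - t = (m : k)⁻¹ • v - x := by
      rw [ht₁]
      refine Cochain.ext fun p n => ?_
      simp only [sub_val, add_val]
      abel
    rw [e]
    exact VanishesBelow.sub
      ⟨fun p n hp => by rw [smul_val, h.euler.eq_zero p n hp, smul_zero]⟩ (hx.mono (by omega))

/-- A cochain of degree zero that is closed up to order one agrees in order zero with a closed one.
-/
theorem exists_natural_of_vanishesBelow [CharZero k] {G₀ : AInfFunctor A.hcat B g₀}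
    {G₁ : AInfFunctor A.hcat B g₁}
    (hw : ∀ {X Y : A.hcat.Ob} (i : ℤ) (φ : B.Hom (g₀ X) (g₁ Y) i),
      B.d i (i + 1) φ = 0 → c.lin i i φ - (i : k) • φ ∈ B.exact (g₀ X) (g₁ Y) i)
    (hcomm : ∀ {d : ℤ} (T : Cochain Aʰ Bᵍ g₀ g₁ d),
      homDC G₀ G₁ (evEuler c T) = evEuler c (homDC G₀ G₁ T)) {e : ℤ} (he : e = 0)
    (t : Cochain Aʰ Bᵍ g₀ g₁ e) (ht : (homDC G₀ G₁ t).VanishesBelow 2) :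
    ∃ L : Cochain Aʰ Bᵍ g₀ g₁ e, homDC G₀ G₁ L = 0 ∧
      (L - t).VanishesBelow 1 := by
  obtain ⟨d, rfl⟩ : ∃ d, e = d + 1 := ⟨e - 1, by ring⟩
  obtain ⟨s, -, hs⟩ := exists_homDC_sub (G₀ := G₀) (G₁ := G₁) (vanishesBelow_zero (evEuler c t))
    fun {X Y} p hp => by
      cases p with
      | cons p a => simp at hp
      | nil =>
        have h := evEuler_leading hw (T := t) (.nil : Path X X) (vanishesBelow_zero t) (by
          rw [← linD_hcat_val, ← homDC_leading G₀ G₁ _ _ (vanishesBelow_zero t)]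
          exact ht.eq_zero _ _ (by simp))
        have e : ((d + 1 - (.nil : Path X X).length : ℤ) : k) = 0 := by simp [he]
        rwa [e, zero_smul, sub_zero] at h
  obtain ⟨σ, hσ, hσ'⟩ := exists_seq_of_step
    (α := Cochain Aʰ Bᵍ g₀ g₁ (d + 1) ×
      Cochain Aʰ Bᵍ g₀ g₁ d)
    (fun n a => PartialTransformation G₀ G₁ c (n + 1) a.1 a.2 ∧ (a.1 - t).VanishesBelow 1)
    (fun n a b => (b.1 - a.1).VanishesBelow (n + 1))
    ⟨(t, s), ⟨ht, hs⟩, ⟨fun p n _ => by rw [sub_self]; rfl⟩⟩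
    fun n a ha => by
      obtain ⟨t', s', h, h'⟩ := ha.1.exists_succ hw hcomm he (by omega)
      refine ⟨(t', s'), ⟨h, ?_⟩, h'⟩
      have := (h'.mono (by omega : 1 ≤ n + 1)).add ha.2
      rwa [sub_add_sub_cancel] at this
  obtain ⟨L, hL⟩ := exists_limit (fun n => (σ n).1) fun n => (hσ' n).mono (by omega)
  refine ⟨L, eq_zero_of_vanishesBelow fun m => ?_, ?_⟩
  · have h₁ := vanishesBelow_homDC G₀ G₁ (hL m)
    rw [homDC_sub] at h₁
    have := h₁.add ((hσ m).1.closed.mono (by omega : m ≤ m + 1 + 1))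
    rwa [sub_add_cancel] at this
  · have := (hL 1).add (hσ 1).2
    rwa [sub_add_sub_cancel] at this

/-- A cochain of degree zero which is natural up to homotopy extends to a natural transformation,
if the differential commutes with an operator which induces the Euler vector field: the obstructions
live in the eigenspaces with nonzero eigenvalues. -/
theorem exists_natural [CharZero k] {G₀ : AInfFunctor A.hcat B g₀} {G₁ : AInfFunctor A.hcat B g₁}
    (hw : ∀ {X Y : A.hcat.Ob} (i : ℤ) (φ : B.Hom (g₀ X) (g₁ Y) i),
      B.d i (i + 1) φ = 0 → c.lin i i φ - (i : k) • φ ∈ B.exact (g₀ X) (g₁ Y) i)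
    (hcomm : ∀ {d : ℤ} (T : Cochain Aʰ Bᵍ g₀ g₁ d),
      homDC G₀ G₁ (evEuler c T) = evEuler c (homDC G₀ G₁ T))
    (t₀ : ∀ X, B.Hom (g₀ X) (g₁ X) 0) (hd : ∀ X, B.d 0 1 (t₀ X) = 0)
    (hn : ∀ {X Y : A.hcat.Ob} (n : ℤ) (a : A.hcat.Hom X Y n),
      B.prod (G₁.lin n n a) (t₀ X) n - B.prod (t₀ Y) (G₀.lin n n a) n
        ∈ B.exact (g₀ X) (g₁ Y) n) :
    ∃ T : Cochain Aʰ Bᵍ g₀ g₁ 0, homDC G₀ G₁ T = 0 ∧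
      ∀ X : A.hcat.Ob, T.val (.nil : Path X X) 0 = t₀ X := by
  set τ := ofNil (A := Aʰ) t₀ with hτ
  have h₀ : (homDC G₀ G₁ τ).VanishesBelow 1 := by
    refine vanishesBelow_of_val fun {X Y} p hp => ?_
    cases p with
    | cons p a => simp at hp
    | nil =>
      rw [homDC_leading _ _ _ _ (vanishesBelow_zero τ), linD_hcat_val]
      have e : ∀ i j : ℤ, i = 0 → j = 1 → B.d i j (τ.val (.nil : Path X X) i) = 0 := by
        rintro i j rfl rfl
        rw [hτ, ofNil_val_nil]
        exact hd X
      exact e _ _ (by simp [red]) (by simp [red])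
  obtain ⟨x, hx, hx'⟩ := exists_homDC_sub (G₀ := G₀) (G₁ := G₁) h₀ fun {X Y} p hp => by
    cases p with
    | nil => simp at hp
    | cons p a =>
      cases p with
      | cons p b => simp at hp
      | nil =>
        obtain ⟨n, a⟩ := a
        have h := hn n a
        rw [← homDC_ofNil_str (A := A.hcat)] at h
        refine (?_ : ∀ i : ℤ, i = n → (homDC G₀ G₁ τ).val (str₁ (A := Aʰ) a) i
          ∈ B.exact (g₀ X) (g₁ _) i) _ (by simp [red])
        rintro i rfl
        exact h
  set t := τ - x with ht
  have ht₀ : ∀ X : A.hcat.Ob, t.val (.nil : Path X X) 0 = t₀ X := fun X => by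
    rw [ht, sub_val, hx.eq_zero _ _ (by simp), sub_zero, hτ, ofNil_val_nil]
  have ht₁ : (homDC G₀ G₁ t).VanishesBelow 2 := by rw [ht, homDC_sub]; exact hx'
  obtain ⟨L, hL, hL'⟩ := exists_natural_of_vanishesBelow hw hcomm rfl t ht₁
  exact ⟨L, hL, fun X => (val_nil_congr hL' _ (by simp) _).trans (ht₀ X)⟩

end Straighten

end AInfFunctor

/-! ### Graph bimodules over the cohomological category -/

namespace AInfFunctor

section Graph

variable {A : AInfCat k} {B : AInfCat k} {g₀ g₁ : A.hcat.Ob → B.Ob}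

/-- The structure maps of the bimodule `(Y, X) ↦ B(G₀ Y, G₁ X)`. -/
def graphμ (G₀ : AInfFunctor A.hcat B g₀) (G₁ : AInfFunctor A.hcat B g₁) :
    BiCochain (homBimod (H := Aʰ) Bᵍ g₀ g₁)
      (homBimod (H := Aʰ) Bᵍ g₀ g₁) 1 :=
  (AInfBimodule.diag B).pullμ G₁ G₀

/-- A pre-natural transformation is a cochain with values in the bimodule `B(G₀, G₁)`, and its
differential is the one defined by the structure maps of the bimodule. -/
theorem homDC_eq_evD (G₀ : AInfFunctor A.hcat B g₀) (G₁ : AInfFunctor A.hcat B g₁) {d : ℤ}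
    (T : Cochain Aʰ Bᵍ g₀ g₁ d) :
    homDC G₀ G₁ T = evD (graphμ G₀ G₁) T := by
  refine Cochain.ext fun {X Y} p n => ?_
  rw [homDC_val', evD_val]
  refine congrArg (· - _) ?_
  rw [evC_val, ← lsum_neg]
  refine lsum_congr fun x _ => ?_
  have h₁ : (graphμ G₀ G₁).val x.last (T.val x.mid (red x.mid + d)) x.fst n
      = lsum (G₁.blocks x.last) fun r => lsum (G₀.blocks x.fst) fun t =>
        (red x.fst + 1).negOnePow • B.μ.val ((t.cons (T.arrow x.mid)).comp r) n :=
    lsum_congr fun r _ => lsum_congr fun t ht =>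
      congrArg (fun i : ℤ => (i + 1).negOnePow • B.μ.val ((t.cons (T.arrow x.mid)).comp r) n)
        (red_of_mem_blocks _ _ t ht)
  rw [h₁, lsum_comm, smul_lsum, ← lsum_neg]
  refine lsum_congr fun t _ => ?_
  rw [smul_lsum, ← lsum_neg]
  refine lsum_congr fun r _ => ?_
  rw [smul_smul, ← Int.negOnePow_add, ← Units.neg_smul, ← Int.negOnePow_succ]
  exact congrArg (· • _) (negOnePow_congr ⟨-red x.fst - 1, by ring⟩)

/-- A pure structure on the bimodule `(Y, X) ↦ B(G₀ Y, G₁ X)` over a cohomological category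
yields natural transformations from `G₀` to `G₁`. -/
theorem exists_natural_of_isPure [CharZero k] (G₀ : AInfFunctor A.hcat B g₀)
    (G₁ : AInfFunctor A.hcat B g₁) {h₁ h₂ h₃}
    (h : (⟨homBimod (H := Aʰ) Bᵍ g₀ g₁,
      graphμ G₀ G₁, h₁, h₂, h₃⟩ : AInfBimodule A.hcat A.hcat).IsPure
        (eulerPure A) (eulerPure A))
    (t₀ : ∀ X, B.Hom (g₀ X) (g₁ X) 0) (hd : ∀ X, B.d 0 1 (t₀ X) = 0)
    (hn : ∀ {X Y : A.hcat.Ob} (n : ℤ) (a : A.hcat.Hom X Y n),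
      B.prod (G₁.lin n n a) (t₀ X) n - B.prod (t₀ Y) (G₀.lin n n a) n
        ∈ B.exact (g₀ X) (g₁ Y) n) :
    ∃ T : Cochain Aʰ Bᵍ g₀ g₁ 0, homDC G₀ G₁ T = 0 ∧
      ∀ X : A.hcat.Ob, T.val (.nil : Path X X) 0 = t₀ X := by
  set P : AInfBimodule A.hcat A.hcat := ⟨homBimod (H := Aʰ) Bᵍ g₀ g₁,
    graphμ G₀ G₁, h₁, h₂, h₃⟩ with hP
  obtain ⟨c, hc, hw⟩ := h
  have hlin : ∀ {X Y : A.hcat.Ob} (i j : ℤ) (φ : B.Hom (g₀ X) (g₁ Y) i),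
      (graphμ G₀ G₁).lin i j φ = -B.d i j φ := fun {X Y} i j φ => by
    refine Eq.trans ?_ (AInfBimodule.diagμ_lin B i j φ)
    exact (lsum_blocks_nil G₁.toCochain fun r => lsum (G₀.blocks .nil) fun t =>
      (AInfBimodule.diagμ B).val r φ t j).trans
        (lsum_blocks_nil G₀.toCochain fun t => (AInfBimodule.diagμ B).val .nil φ t j)
  refine exists_natural (c := c) (fun {X Y} i φ hφ => ?_) (fun {d} T => ?_) t₀ hd hn
  · obtain ⟨η, hη⟩ := hw i φ ((hlin _ _ φ).trans (by rw [hφ, neg_zero]))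
    have l₁ : P.μ.leftAct ((0 : A.hcat.Hom Y Y 0)) φ = 0 := by
      have := P.leftAct_sub (0 : A.hcat.Hom Y Y 0) 0 φ
      rwa [sub_self, sub_self] at this
    have l₂ : P.μ.rightAct φ (0 : A.hcat.Hom X X 0) = 0 := by
      have := P.rightAct_sub (0 : A.hcat.Hom X X 0) 0 φ
      rwa [sub_self, sub_self] at this
    refine ⟨-η, ?_⟩
    have e := (hlin _ _ η).symm.trans hη
    rw [map_neg]
    refine e.trans ?_
    refine (congrArg₂ (fun a b => c.lin i i φ - a + b - i • φ) l₁ l₂).trans ?_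
    rw [sub_zero, add_zero, Int.cast_smul_eq_zsmul]
  · rw [homDC_eq_evD, homDC_eq_evD]
    refine evD_evEuler (fun p n y q n' => ?_) T
    refine ((P.endD_eq c p y q n').symm.trans ((hc p y q n').trans ?_))
    rw [P.nuLeft_eq, P.nuRight_eq]
    refine (congrArg₂ (fun a b => -a - b) (ins_eulerC (A := Aʰ)
      (P.μ.left_isML y q n') p) (ins_eulerC (A := Aʰ)
      (P.μ.right_isML p y n') q)).trans ?_
    rw [neg_add]
    exact sub_eq_add_neg _ _

end Graph

section Pullback

variable {A : AInfCat k} {B : AInfCat k} {f : A.Ob → B.Ob}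
variable {g : A.hcat.Ob → B.Ob}

/-- The pullback of `_F Δ^B` under `ψ` and `G` is the bimodule `B(G, F ψ)`. -/
theorem leftGraph_pull (F : AInfFunctor A B f) (ψ : AInfFunctor A.hcat A (fun X => X))
    (G : AInfFunctor A.hcat B g) : ∃ h₁ h₂ h₃, F.leftGraph.pull ψ G
      = ⟨homBimod (H := Aʰ) Bᵍ g f,
        graphμ G (F.comp ψ), h₁, h₂, h₃⟩ := by
  have h : F.leftGraph.pullμ ψ G = graphμ G (F.comp ψ) :=
    BiCochain.ext fun {X X' Y Y'} p n m q n' => by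
      refine Eq.trans ?_ (lsum_blocks_comp F.toCochain ψ.toCochain p
        (IsML.lsum (fun t => (AInfBimodule.diagμ B).left_isML m t n') (G.blocks q))).symm
      refine lsum_congr fun r _ => ?_
      rw [lsum_comm (F.blocks r)]
      refine lsum_congr fun t _ => lsum_congr fun s _ => ?_
      exact lsum_blocks_idC ((AInfBimodule.diagμ B).right_isML s m n') t
  rw [← h]
  exact ⟨_, _, _, rfl⟩

/-- The pullback of `Δ^B_F` under `G` and `ψ` is the bimodule `B(F ψ, G)`. -/
theorem rightGraph_pull (F : AInfFunctor A B f) (ψ : AInfFunctor A.hcat A (fun X => X))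
    (G : AInfFunctor A.hcat B g) : ∃ h₁ h₂ h₃, F.rightGraph.pull G ψ
      = ⟨homBimod (H := Aʰ) Bᵍ f g,
        graphμ (F.comp ψ) G, h₁, h₂, h₃⟩ := by
  have h : F.rightGraph.pullμ G ψ = graphμ (F.comp ψ) G :=
    BiCochain.ext fun {X X' Y Y'} p n m q n' => lsum_congr fun r _ => by
      refine Eq.trans ?_ (lsum_blocks_comp F.toCochain ψ.toCochain q
        ((AInfBimodule.diagμ B).right_isML r m n')).symm
      refine lsum_congr fun t _ => ?_
      exact lsum_blocks_idC (IsML.lsum (fun s => (AInfBimodule.diagμ B).left_isML m s n')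
        (F.blocks t)) r
  rw [← h]
  exact ⟨_, _, _, rfl⟩

end Pullback

end AInfFunctor

/-! ### Pure functors are formal -/

namespace AInfFunctor

section Equivalence

variable {A : AInfCat k} {B : AInfCat k} {f g : A.hcat.Ob → B.hcat.Ob}

theorem id_comp (F : AInfFunctor A.hcat B.hcat f) : (AInfFunctor.id B.hcat).comp F = F :=
  ext_toCochain (idC_comp F.toCochain F.val_nil)

theorem comp_assoc {A B C D : AInfCat k}  {f : A.Ob → B.Ob} {g : B.Ob → C.Ob} {h : C.Ob → D.Ob}
   (H : AInfFunctor C D h) (G : AInfFunctor B C g) (F : AInfFunctor A B f) :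
  (H.comp G).comp F = H.comp (G.comp F) :=
  ext_toCochain (Contraction.pre_pre H.toCochain G.toCochain F.toCochain)

end Equivalence

section Purity

variable {A : AInfCat k} {B : AInfCat k} {f : A.Ob → B.Ob}

/-- For a pure functor, the bimodule `B(ψ_B HF, F ψ_A)` or `B(F ψ_A, ψ_B HF)` over `H A` is pure for
the Euler fields. The units, which are natural up to homotopy, therefore extend to a natural
transformation between the two functors, and composing it with `θ_B` gives the equivalence. -/
theorem IsPure.isFormalWith [CharZero k] {F : AInfFunctor A B f} {sA : PureStructure A}
    {sB : PureStructure B} (h : F.IsPure sA sB) (EA : FormalityEquiv A sA)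
    (EB : FormalityEquiv B sB) : F.IsFormalWith EA EB := by
  obtain ⟨KA, ψA, θA, eψA, eθA, hψA, hψA', hθA, hA⟩ := EA.exists_related
  obtain ⟨KB, ψB, θB, eψB, eθB, hψB, hψB', hθB, hB⟩ := EB.exists_related
  obtain ⟨HF, eHF⟩ : ∃ HF : AInfFunctor A.hcat B.hcat f, HF = F.coh := ⟨F.coh, rfl⟩
  have goal : NatEquiv (B := B) HF (θB.comp (F.comp ψA)) → F.IsFormalWith EA EB := by
    rw [eψA, eθB, eHF]
    exact fun h => h
  apply goal
  have hHF : HF.IsRelated (eulerPure A) (eulerPure B) :=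
    isRelated_of_natEquiv (by rw [eHF]; exact isLinear_ofLin (A := Aʰ) _)
      (natEquiv_refl HF)
  -- the two functors agree on cohomology
  have hlin : ∀ {X Y : A.hcat.Ob} (n : ℤ) (a : A.hcat.Hom X Y n),
      B.d n (n + 1) ((F.comp ψA).lin n n a) = 0 ∧
      B.d n (n + 1) ((ψB.comp HF).lin n n a) = 0 ∧
      (F.comp ψA).lin n n a - (ψB.comp HF).lin n n a
        ∈ B.exact (f X) (f Y) n := fun {X Y} n a => by
    have e₁ : (F.comp ψA).lin n n a = F.lin n n (KA.i X Y n a) :=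
      (comp_lin F.toCochain ψA.toCochain a).trans (congrArg (F.lin n n) (hψA n a))
    have e₂ : (ψB.comp HF).lin n n a = KB.i _ _ n (HF.lin n n a) :=
      (comp_lin ψB.toCochain HF.toCochain a).trans (hψB n _)
    have e₃ : HF.lin n n a
        = B.cls (F.cocycleMap X Y n ⟨KA.i X Y n a, KA.d_i a _⟩) := by
      rw [eHF]
      refine (ofLin_lin (A := Aʰ) (B := Bʰ) _ n a).trans ?_
      conv_lhs => rw [← cls_i KA a]
      rfl
    rw [e₁, e₂]
    refine ⟨(F.cocycleMap X Y n ⟨KA.i X Y n a, KA.d_i a _⟩).2, KB.d_i _ _, ?_⟩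
    exact (AInfCat.homologous_iff_cls (F.cocycleMap X Y n ⟨KA.i X Y n a, KA.d_i a _⟩)
      ⟨KB.i _ _ n (HF.lin n n a), KB.d_i _ _⟩).2 (e₃.symm.trans (cls_i KB _).symm)
  have hHFB : NatEquiv (B := B) HF (θB.comp (ψB.comp HF)) := by
    have := (hB.comp_right HF).symm
    rwa [id_comp, comp_assoc] at this
  have hunit : ∀ X : A.hcat.Ob, B.d 0 1 (B.unit (f X)) = 0 := fun X =>
    (B.isCohUnit_unit (f X)).closed
  have hright : ∀ {X Y : A.hcat.Ob} {n : ℤ} (x : B.Hom (f X) (f Y) n), B.d n (n + 1) x = 0 →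
      B.prod x (B.unit (f X)) n - x ∈ B.exact (f X) (f Y) n := fun {X Y n} x hx =>
    (B.isCohUnit_unit (f X)).right_unit x hx
  have hleft : ∀ {X Y : A.hcat.Ob} {n : ℤ} (x : B.Hom (f X) (f Y) n), B.d n (n + 1) x = 0 →
      B.prod (B.unit (f Y)) x n - x ∈ B.exact (f X) (f Y) n := fun {X Y n} x hx =>
    (B.isCohUnit_unit (f Y)).left_unit x hx
  rcases h with h | h
  · have hP := AInfBimodule.IsPure.pull h hψA' (hHF.comp hψB')
    obtain ⟨h₁, h₂, h₃, e⟩ := F.leftGraph_pull ψA (ψB.comp HF)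
    rw [e] at hP
    obtain ⟨T, hT, hT₀⟩ := exists_natural_of_isPure _ _ hP (fun X => B.unit (f X)) hunit
      (fun {X Y} n a => by
        obtain ⟨h₁, h₂, h₃⟩ := hlin n a
        have := Submodule.sub_mem _ (Submodule.add_mem _ (hright _ h₁) h₃) (hleft _ h₂)
        rwa [sub_add_sub_cancel, sub_sub_sub_cancel_right] at this)
    exact hHFB.trans (natEquiv_comp_of_unit hT hT₀ θB)
  · have hP := AInfBimodule.IsPure.pull h (hHF.comp hψB') hψA'
    obtain ⟨h₁, h₂, h₃, e⟩ := F.rightGraph_pull ψA (ψB.comp HF)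
    rw [e] at hP
    obtain ⟨T, hT, hT₀⟩ := exists_natural_of_isPure _ _ hP (fun X => B.unit (f X)) hunit
      (fun {X Y} n a => by
        obtain ⟨h₁, h₂, h₃⟩ := hlin n a
        have := Submodule.sub_mem _ (Submodule.sub_mem _ (hright _ h₂) h₃) (hleft _ h₁)
        convert this using 1
        abel)
    exact hHFB.trans (natEquiv_comp_of_unit hT hT₀ θB).symm

end Purity

end AInfFunctor

end AInf

theorem mainTheorem8 {k : Type u} [Field k] [CharZero k]
    (A : AInf.AInfCat.{u, v, w} k) (B : AInf.AInfCat.{u, v', w'} k)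
    (sA : AInf.PureStructure A) (sB : AInf.PureStructure B)
    {f : A.Ob → B.Ob} (F : AInf.AInfFunctor A B f) :
    (F.IsPure sA sB ↔ F.IsFormal sA sB) ∧
    (∀ (EA : AInf.FormalityEquiv A sA) (EB : AInf.FormalityEquiv B sB),
      F.IsPure sA sB ↔ F.IsFormalWith EA EB) ∧
    (F.leftGraph.IsPure sA sB → F.rightGraph.IsPure sB sA ∧ F.twoSidedGraph.IsPure sA sA) ∧
    (F.rightGraph.IsPure sB sA → F.leftGraph.IsPure sA sB ∧ F.twoSidedGraph.IsPure sA sA) := by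
  obtain ⟨EA⟩ := sA.nonempty_formalityEquiv
  obtain ⟨EB⟩ := sB.nonempty_formalityEquiv
  have graphs (EA : AInf.FormalityEquiv A sA) (EB : AInf.FormalityEquiv B sB)
      (h : F.IsFormalWith EA EB) := h.isRelated.graphs_isPure
  refine ⟨⟨fun h => ⟨EA, EB, h.isFormalWith EA EB⟩, fun ⟨EA, EB, h⟩ => .inl (graphs EA EB h).1⟩,
    fun EA EB => ⟨fun h => h.isFormalWith EA EB, fun h => .inl (graphs EA EB h).1⟩,
    fun h => (graphs EA EB (AInf.AInfFunctor.IsPure.isFormalWith (.inl h) EA EB)).2, fun h => ?_⟩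
  have hg := graphs EA EB (AInf.AInfFunctor.IsPure.isFormalWith (.inr h) EA EB)
  exact ⟨hg.1, hg.2.2⟩
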